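/- Let $N\in\mathbb N$, $M,m\in\mathbb R$, let $B_1,\dots,B_N,C_1,\dots,C_N$ be constant hermitian $2\times2$ matrices, and let $\gamma^0=\begin{pmatrix}0&1\\1&0\end{pmatrix}$, $\gamma^1=\begin{pmatrix}0&-1\\1&0\end{pmatrix}$. For unknowns $\psi:\mathbb R^{1+1}\to\mathbb C^2$ and $V=(V_1,\dots,V_N):\mathbb R^{1+1}\to\mathbb R^N$ consider the Cauchy problem $$(-i\gamma^0\partial_t-i\gamma^1\partial_x+M)\psi=\sum_{j=1}^N V_j\gamma^0B_j\psi,\qquad (\partial_t^2-\partial_x^2+m^2)V_j=\psi^*C_j\psi\quad(1\le j\le N),$$ $$\psi(0,x)=\psi_0(x),\qquad V(0,x)=v(x),\qquad \partial_tV(0,x)=w(x),$$ where $\psi^*$ is the conjugate transpose. Let $Y(\mathbb R;\mathbb R^N)$ be the space of bounded absolutely continuous functions $f$ with $f'\in L^1$, with norm $\|f\|_{L^\infty}+\|f'\|_{L^1}$, and let $Y_{\mathrm{loc}}$ be the space of locally absolutely continuous functions, with the topology of locally uniform convergence of $f$ and $L^1_{\mathrm{loc}}$ convergence of $f'$. Put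 $$X_0=L^2(\mathbb R;\mathbb C^2)\times Y(\mathbb R;\mathbb R^N)\times L^1(\mathbb R;\mathbb R^N),\qquad X_{0,\mathrm{loc}}=L^2_{\mathrm{loc}}(\mathbb R;\mathbb C^2)\times Y_{\mathrm{loc}}(\mathbb R;\mathbb R^N)\times L^1_{\mathrm{loc}}(\mathbb R;\mathbb R^N).$$ **Theorem.** If $m=0$, the Cauchy problem is globally well posed for data in $X=X_0$. For arbitrary $m\in\mathbb R$ it is globally well posed for data in $X=X_{0,\mathrm{loc}}$. Here globally well posed in $X$ means that for every $T>0$: (a) for all data $(\psi_0,v,w)\in X$ there is a unique $(\psi,V)$ with $(\psi,V,\partial_tV)\in C([-T,T];X)$ that satisfies the equations in the sense of distributions on $(-T,T)\times\mathbb R$ and takes the given data at $t=0$; (b) the data-to-solution map $X\to C([-T,T];X)$ is continuous, and moreover $C^\infty$ (in the sense of Michal–Bastiani: directional derivatives of all orders exist and are jointly continuous; for the Banach space $X_0$ this is the usual notion); (c) higher regularity persists: for each $K\in\mathbb N$, if $\partial_x^j(\psi_0,v,w)\in X$ for $0\le j\le K$, then $\partial_t^j\partial_x^k(\psi,V,\partial_tV)\in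 C([-T,T];X)$ for all $j,k\ge0$ with $j+k\le K$; and if the data are $C^\infty$ functions on $\mathbb R$, then $(\psi,V,\partial_tV)$ is $C^\infty$ on $[-T,T]\times\mathbb R$; (d) every solution in (a) is a limit in $C([-T,T];X)$ of solutions that are $C^\infty$ on $[-T,T]\times\mathbb R$. -/

import Mathlib

open MeasureTheory Set Filter Topology
open scoped ContDiff ENNReal BoundedContinuousFunction

noncomputable section

namespace MDKG

/-! ### Spinors, fields and gamma matrices -/

/-- Spinors: `ℂ²` with its Euclidean norm. -/
abbrev Spinor : Type := EuclideanSpace ℂ (Fin 2)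

/-- Values of the potential `V = (V₁, …, V_N)`: `ℝ^N` with its Euclidean norm. -/
abbrev Pot (N : ℕ) : Type := EuclideanSpace ℝ (Fin N)

/-- Values of the triple `(ψ, V, ∂ₜV)`. -/
abbrev State (N : ℕ) : Type := Spinor × Pot N × Pot N

def gamma0 : Matrix (Fin 2) (Fin 2) ℂ := !![0, 1; 1, 0]

def gamma1 : Matrix (Fin 2) (Fin 2) ℂ := !![0, -1; 1, 0]

/-! ### The global data space `X₀ = L² × Y × L¹` -/

/-- The space `Y(ℝ; ℝ^N)` of bounded absolutely continuous functions `f` with derivative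
`g = f' ∈ L¹`, an element being recorded as the pair `(f, f')`. The norm is the inherited
`‖f‖_∞ + ‖f'‖_{L¹}`; the second entry is determined by the first. -/
def Y (N : ℕ) : Submodule ℝ (WithLp 1 ((ℝ →ᵇ Pot N) × Lp (Pot N) 1 (volume : Measure ℝ))) where
  carrier := {p | ∀ a b : ℝ, p.fst b - p.fst a = ∫ x in a..b, p.snd x}
  add_mem' := by
    intro p q hp hq a b
    have h : ∫ x in a..b, (p.snd + q.snd : Lp (Pot N) 1 (volume : Measure ℝ)) x
        = ∫ x in a..b, (p.snd x + q.snd x) := by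
      refine intervalIntegral.integral_congr_ae ?_
      filter_upwards [Lp.coeFn_add p.snd q.snd] with x hx _ using hx
    have hi (r : Lp (Pot N) 1 (volume : Measure ℝ)) : IntervalIntegrable r volume a b :=
      (L1.integrable_coeFn r).intervalIntegrable
    simp only [WithLp.add_fst, WithLp.add_snd, BoundedContinuousFunction.coe_add, Pi.add_apply]
    rw [h, intervalIntegral.integral_add (hi _) (hi _), ← hp a b, ← hq a b]
    abel
  zero_mem' := by
    intro a b
    have h : ∫ x in a..b, (0 : Lp (Pot N) 1 (volume : Measure ℝ)) x = ∫ x in a..b, (0 : Pot N) := by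
      refine intervalIntegral.integral_congr_ae ?_
      filter_upwards [Lp.coeFn_zero (Pot N) 1 (volume : Measure ℝ)] with x hx _ using hx
    simp only [WithLp.zero_fst, WithLp.zero_snd, BoundedContinuousFunction.coe_zero, Pi.zero_apply]
    rw [h]
    simp
  smul_mem' := by
    intro c p hp a b
    have h : ∫ x in a..b, (c • p.snd : Lp (Pot N) 1 (volume : Measure ℝ)) x
        = ∫ x in a..b, c • p.snd x := by
      refine intervalIntegral.integral_congr_ae ?_
      filter_upwards [Lp.coeFn_smul c p.snd] with x hx _ using hx
    simp only [WithLp.smul_fst, WithLp.smul_snd, BoundedContinuousFunction.coe_smul]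
    rw [h, intervalIntegral.integral_smul, ← hp a b, smul_sub]

/-- `X₀ = L²(ℝ; ℂ²) × Y(ℝ; ℝ^N) × L¹(ℝ; ℝ^N)`. -/
abbrev X0 (N : ℕ) : Type :=
  Lp Spinor 2 (volume : Measure ℝ) × Y N × Lp (Pot N) 1 (volume : Measure ℝ)

/-- The function `ℝ → State N` represented by an element of `X₀`. -/
def X0.rep {N : ℕ} (d : X0 N) (x : ℝ) : State N := (d.1 x, d.2.1.1.fst x, d.2.2 x)

/-! ### The local data space `X₀,loc = L²_loc × Y_loc × L¹_loc` -/

/-- Classes of functions on `ℝ` which are in `L^p` on every bounded interval. -/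
def lpLocSubmodule (E : Type) [NormedAddCommGroup E] [NormedSpace ℝ E] (p : ℝ≥0∞) :
    Submodule ℝ (ℝ →ₘ[(volume : Measure ℝ)] E) where
  carrier := {f | ∀ R : ℕ, MemLp f p ((volume : Measure ℝ).restrict (Icc (-(R : ℝ)) R))}
  add_mem' := fun {f g} hf hg R =>
    ((hf R).add (hg R)).ae_eq (EventuallyEq.symm (ae_restrict_of_ae (AEEqFun.coeFn_add f g)))
  zero_mem' := fun _ =>
    MemLp.zero.ae_eq
      (EventuallyEq.symm (ae_restrict_of_ae (AEEqFun.coeFn_zero (β := E) (μ := volume))))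
  smul_mem' := fun c f hf R =>
    ((hf R).const_smul c).ae_eq (EventuallyEq.symm (ae_restrict_of_ae (AEEqFun.coeFn_smul c f)))

/-- `L^p_loc(ℝ; E)`. -/
def LpLoc (E : Type) [NormedAddCommGroup E] [NormedSpace ℝ E] (p : ℝ≥0∞) : Type :=
  lpLocSubmodule E p

namespace LpLoc

variable {E : Type} [NormedAddCommGroup E] [NormedSpace ℝ E] {p : ℝ≥0∞}

instance : AddCommGroup (LpLoc E p) := inferInstanceAs (AddCommGroup (lpLocSubmodule E p))

instance : Module ℝ (LpLoc E p) := inferInstanceAs (Module ℝ (lpLocSubmodule E p))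

/-- A representative of the class. -/
def rep (f : LpLoc E p) : ℝ → E := f.1

theorem memLp_rep (f : LpLoc E p) (R : ℕ) :
    MemLp f.rep p ((volume : Measure ℝ).restrict (Icc (-(R : ℝ)) R)) := f.2 R

theorem rep_add (f g : LpLoc E p) : (f + g).rep =ᵐ[volume] f.rep + g.rep :=
  AEEqFun.coeFn_add f.1 g.1

theorem rep_zero : (0 : LpLoc E p).rep =ᵐ[volume] 0 := AEEqFun.coeFn_zero

theorem rep_smul (c : ℝ) (f : LpLoc E p) : (c • f).rep =ᵐ[volume] c • f.rep :=
  AEEqFun.coeFn_smul c f.1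

/-- Restriction to `[-R, R]`. -/
def restrict (R : ℕ) :
    LpLoc E p →ₗ[ℝ] Lp E p ((volume : Measure ℝ).restrict (Icc (-(R : ℝ)) R)) where
  toFun f := (f.memLp_rep R).toLp f.rep
  map_add' f g := by
    rw [← MemLp.toLp_add]
    exact MemLp.toLp_congr _ _ (ae_restrict_of_ae (rep_add f g))
  map_smul' c f := by
    rw [RingHom.id_apply, ← MemLp.toLp_const_smul]
    exact MemLp.toLp_congr _ _ (ae_restrict_of_ae (rep_smul c f))

/-- Convergence in `L^p_loc` is convergence in `L^p([-R, R])` for every `R`. -/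
instance [Fact (1 ≤ p)] : TopologicalSpace (LpLoc E p) :=
  ⨅ R : ℕ, TopologicalSpace.induced (restrict R) inferInstance

instance [Fact (1 ≤ p)] : IsTopologicalAddGroup (LpLoc E p) :=
  topologicalAddGroup_iInf fun R => topologicalAddGroup_induced (restrict R)

instance [Fact (1 ≤ p)] : ContinuousSMul ℝ (LpLoc E p) :=
  continuousSMul_iInf fun R => continuousSMul_induced (restrict R)

theorem intervalIntegrable_rep (f : LpLoc E 1) (a b : ℝ) :
    IntervalIntegrable f.rep volume a b := by
  obtain ⟨R, hR⟩ := exists_nat_ge (max |a| |b|)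
  have ha := abs_le.1 ((le_max_left _ _).trans hR)
  have hb := abs_le.1 ((le_max_right _ _).trans hR)
  have h : IntegrableOn f.rep (Icc (-(R : ℝ)) R) volume := memLp_one_iff_integrable.1 (f.memLp_rep R)
  rw [intervalIntegrable_iff]
  refine h.mono_set (uIoc_subset_uIcc.trans ?_)
  exact uIcc_subset_Icc ha hb

end LpLoc

/-- The space `Y_loc(ℝ; ℝ^N)` of locally absolutely continuous functions, an element being
recorded as the pair `(f, f')`. The topology is that of locally uniform convergence of `f` and
`L¹_loc` convergence of `f'`. -/
def YLoc (N : ℕ) : Submodule ℝ (C(ℝ, Pot N) × LpLoc (Pot N) 1) where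
  carrier := {p | ∀ a b : ℝ, p.1 b - p.1 a = ∫ x in a..b, p.2.rep x}
  add_mem' := by
    intro p q hp hq a b
    have h : ∫ x in a..b, (p.2 + q.2).rep x = ∫ x in a..b, (p.2.rep x + q.2.rep x) := by
      refine intervalIntegral.integral_congr_ae ?_
      filter_upwards [LpLoc.rep_add p.2 q.2] with x hx _ using hx
    simp only [Prod.fst_add, Prod.snd_add, ContinuousMap.coe_add, Pi.add_apply]
    rw [h, intervalIntegral.integral_add (LpLoc.intervalIntegrable_rep _ a b)
      (LpLoc.intervalIntegrable_rep _ a b), ← hp a b, ← hq a b]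
    abel
  zero_mem' := by
    intro a b
    have h : ∫ x in a..b, (0 : LpLoc (Pot N) 1).rep x = ∫ x in a..b, (0 : Pot N) := by
      refine intervalIntegral.integral_congr_ae ?_
      filter_upwards [LpLoc.rep_zero (E := Pot N) (p := 1)] with x hx _ using hx
    simp only [Prod.fst_zero, Prod.snd_zero, ContinuousMap.coe_zero, Pi.zero_apply]
    rw [h]
    simp
  smul_mem' := by
    intro c p hp a b
    have h : ∫ x in a..b, (c • p.2).rep x = ∫ x in a..b, c • p.2.rep x := by
      refine intervalIntegral.integral_congr_ae ?_
      filter_upwards [LpLoc.rep_smul c p.2] with x hx _ using hx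
    simp only [Prod.smul_fst, Prod.smul_snd, ContinuousMap.coe_smul, Pi.smul_apply]
    rw [h, intervalIntegral.integral_smul, ← hp a b, smul_sub]

/-- `X₀,loc = L²_loc(ℝ; ℂ²) × Y_loc(ℝ; ℝ^N) × L¹_loc(ℝ; ℝ^N)`. -/
abbrev X0Loc (N : ℕ) : Type := LpLoc Spinor 2 × YLoc N × LpLoc (Pot N) 1

/-- The function `ℝ → State N` represented by an element of `X₀,loc`. -/
def X0Loc.rep {N : ℕ} (d : X0Loc N) (x : ℝ) : State N := (d.1.rep x, d.2.1.1.1 x, d.2.2.rep x)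

/-! ### Weak derivatives and weak solutions

Below, `X` is a space of (classes of) functions `ℝ → State N`, `rep` picks representatives, and
`u : C([-T, T]; X)` is viewed as the function `(t, x) ↦ rep (u t) x`. Integrals over `(-T, T) × ℝ`
are written as iterated integrals, which do not depend on the representatives. -/

/-- Test functions on `(-T, T) × ℝ`. -/
def IsTest (T : ℝ) (φ : ℝ → ℝ → ℝ) : Prop :=
  ContDiff ℝ ∞ (Function.uncurry φ) ∧ HasCompactSupport (Function.uncurry φ) ∧
    tsupport (Function.uncurry φ) ⊆ Ioo (-T) T ×ˢ univ

/-- Lebesgue measure on `[-T, T]`. -/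
def timeMeasure (T : ℝ) : Measure (Icc (-T) T) := (volume : Measure ℝ).comap Subtype.val

/-- `∂ₜφ` at `(t, x)`. -/
def dt (φ : ℝ → ℝ → ℝ) (t x : ℝ) : ℝ := deriv (fun s => φ s x) t

/-- `∂ₓφ` at `(t, x)`. -/
def dx (φ : ℝ → ℝ → ℝ) (t x : ℝ) : ℝ := deriv (fun y => φ t y) x

/-- `g` is the derivative of `f` in the sense of distributions on `ℝ`. -/
def IsWeakDeriv {E : Type} [NormedAddCommGroup E] [NormedSpace ℝ E] (f g : ℝ → E) : Prop :=
  ∀ φ : ℝ → ℝ, ContDiff ℝ ∞ φ → HasCompactSupport φ →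
    ∫ x, deriv φ x • f x = -∫ x, φ x • g x

section Curves

variable {N : ℕ} {X : Type} [TopologicalSpace X] (rep : X → ℝ → State N) {T : ℝ}

/-- `v = ∂ₜu` in the sense of distributions on `(-T, T) × ℝ`. -/
def IsWeakDt (u v : C(Icc (-T) T, X)) : Prop :=
  ∀ φ : ℝ → ℝ → ℝ, IsTest T φ →
    ∫ t, (∫ x : ℝ, dt φ t x • rep (u t) x) ∂timeMeasure T =
      -∫ t, (∫ x : ℝ, φ t x • rep (v t) x) ∂timeMeasure T

/-- `v = ∂ₓu` in the sense of distributions on `(-T, T) × ℝ`. -/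
def IsWeakDx (u v : C(Icc (-T) T, X)) : Prop :=
  ∀ φ : ℝ → ℝ → ℝ, IsTest T φ →
    ∫ t, (∫ x : ℝ, dx φ t x • rep (u t) x) ∂timeMeasure T =
      -∫ t, (∫ x : ℝ, φ t x • rep (v t) x) ∂timeMeasure T

/-- `∂ₓ^j d ∈ X` for `j = 0, …, K`. -/
def HasRegularity (K : ℕ) (d : X) : Prop :=
  ∃ D : ℕ → X, D 0 = d ∧ ∀ j < K, IsWeakDeriv (rep (D j)) (rep (D (j + 1)))

/-- `∂ₜ^j ∂ₓ^k u ∈ C([-T, T]; X)` for `j + k ≤ K`. -/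
def CurveHasRegularity (K : ℕ) (u : C(Icc (-T) T, X)) : Prop :=
  ∃ D : ℕ → ℕ → C(Icc (-T) T, X), D 0 0 = u ∧
    ∀ j k, j + k < K → IsWeakDt rep (D j k) (D (j + 1) k) ∧ IsWeakDx rep (D j k) (D j (k + 1))

/-- The data `d` are (almost everywhere equal to) `C^∞` functions on `ℝ`. -/
def IsSmoothData (d : X) : Prop :=
  ∃ f : ℝ → State N, ContDiff ℝ ∞ f ∧ rep d =ᵐ[volume] f

/-- `u` is (almost everywhere, for each `t`) a `C^∞` function on `[-T, T] × ℝ`. -/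
def IsSmoothCurve (u : C(Icc (-T) T, X)) : Prop :=
  ∃ f : ℝ × ℝ → State N, ContDiffOn ℝ ∞ f (Icc (-T) T ×ˢ univ) ∧
    ∀ t : Icc (-T) T, rep (u t) =ᵐ[volume] fun x => f (t, x)

variable (M m : ℝ) (B C : Fin N → Matrix (Fin 2) (Fin 2) ℂ)

/-- `u = (ψ, V, W) ∈ C([-T, T]; X)` solves, in the sense of distributions on `(-T, T) × ℝ`,
`(-iγ^μ∂_μ + M)ψ = ∑ⱼ Vⱼ γ⁰ Bⱼ ψ`, `(∂ₜ² - ∂ₓ² + m²)Vⱼ = ψ^* Cⱼ ψ`, `W = ∂ₜV`,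
with data `u(0) = d`. -/
structure IsSolution (d : X) (u : C(Icc (-T) T, X)) : Prop where
  init : ∀ t : Icc (-T) T, (t : ℝ) = 0 → u t = d
  dirac : ∀ φ : ℝ → ℝ → ℝ, IsTest T φ →
    ∫ t, (∫ x : ℝ,
        ((Complex.I * (dt φ t x : ℂ)) • gamma0.mulVec (rep (u t) x).1.ofLp
          + (Complex.I * (dx φ t x : ℂ)) • gamma1.mulVec (rep (u t) x).1.ofLp
          + ((φ t x : ℂ) * (M : ℂ)) • (rep (u t) x).1.ofLp)) ∂timeMeasure T =
      ∫ t, (∫ x : ℝ,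
        (φ t x : ℂ) • ∑ j, ((rep (u t) x).2.1 j : ℂ) •
          (gamma0 * B j).mulVec (rep (u t) x).1.ofLp) ∂timeMeasure T
  kleinGordon : ∀ φ : ℝ → ℝ → ℝ, IsTest T φ → ∀ j : Fin N,
    ∫ t, (∫ x : ℝ,
        (((dt (dt φ) t x - dx (dx φ) t x + m ^ 2 * φ t x) * (rep (u t) x).2.1 j : ℝ) : ℂ)) ∂timeMeasure T =
      ∫ t, (∫ x : ℝ,
        (φ t x : ℂ) *
          (star (rep (u t) x).1.ofLp ⬝ᵥ (C j).mulVec (rep (u t) x).1.ofLp)) ∂timeMeasure T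
  velocity : ∀ φ : ℝ → ℝ → ℝ, IsTest T φ →
    ∫ t, (∫ x : ℝ, dt φ t x • (rep (u t) x).2.1) ∂timeMeasure T =
      -∫ t, (∫ x : ℝ, φ t x • (rep (u t) x).2.2) ∂timeMeasure T

end Curves

/-! ### Well-posedness -/

/-- `C^k` maps between topological vector spaces in the sense of Michal and Bastiani: all
directional derivatives up to order `k` exist and are jointly continuous. For `k = ∞` and Banach
spaces this is the same as being `C^∞` in the sense of Fréchet. -/
def IsBastianiC {F : Type} [AddCommGroup F] [Module ℝ F] [TopologicalSpace F] :
    ℕ → ∀ {E : Type} [AddCommGroup E] [Module ℝ E] [TopologicalSpace E], (E → F) → Prop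
  | 0, _, _, _, _, f => Continuous f
  | k + 1, E, _, _, _, f => Continuous f ∧ ∃ df : E × E → F,
      (∀ x v : E, Tendsto (fun h : ℝ => h⁻¹ • (f (x + h • v) - f x)) (𝓝[≠] 0) (𝓝 (df (x, v)))) ∧
        IsBastianiC k df

/-- Global well-posedness in `X`: for every `T > 0` and all data in `X` there is a unique solution
in `C([-T, T]; X)`; the data-to-solution map `S` is `C^∞` (in particular continuous); higher
regularity persists; smooth data give smooth solutions; and every solution is a limit in
`C([-T, T]; X)` of smooth solutions. -/
def GloballyWellPosed {N : ℕ} (M m : ℝ) (B C : Fin N → Matrix (Fin 2) (Fin 2) ℂ)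
    {X : Type} [AddCommGroup X] [Module ℝ X] [TopologicalSpace X] [IsTopologicalAddGroup X]
    [ContinuousSMul ℝ X] (rep : X → ℝ → State N) : Prop :=
  ∀ T : ℝ, 0 < T → ∃ S : X → C(Icc (-T) T, X),
    (∀ d : X, IsSolution rep M m B C d (S d)) ∧
    (∀ (d : X) (u : C(Icc (-T) T, X)), IsSolution rep M m B C d u → u = S d) ∧
    Continuous S ∧
    (∀ k : ℕ, IsBastianiC k S) ∧
    (∀ (K : ℕ) (d : X), HasRegularity rep K d → CurveHasRegularity rep K (S d)) ∧
    (∀ d : X, IsSmoothData rep d → IsSmoothCurve rep (S d)) ∧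
    (∀ d : X, ∃ e : ℕ → X, (∀ n, IsSmoothCurve rep (S (e n))) ∧
      Tendsto (fun n => S (e n)) atTop (𝓝 (S d)))

end MDKG

end

set_option linter.unusedSectionVars false

noncomputable section

namespace MDKG

/-! ### Curves in a Banach space -/

section Curves

variable {T : ℝ} [Fact (0 < T)]

/-! Multiplied by iγ⁰, the Dirac equation becomes a pair of transport equations, because γ⁰γ¹ =
diag(1, -1): the first spinor component moves right, the second left, and they are coupled through
the bounded terms -iMγ⁰ψ and i∑VⱼBⱼψ. The wave equation is treated likewise: V is the sum of a left
moving and a right moving element of Y, and ∂ₜV is the difference of their derivatives. A wave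
source F in L¹ enters the two movers as ½JF and -½JF, where J integrates from -∞. All products are
then bounded: L^∞ · L² lies in L², L² · L² lies in L¹, and J maps L¹ to Y. The term m²V is written
μV with an integrable density μ, a fourth, stationary unknown, so that it too is a bounded bilinear
term. For m = 0 take μ = 0; for other m, μ is a cutoff of m² and finite speed of propagation removes
the cutoff.

The result is an abstract problem on a Banach space (`TransportSystem`): a strongly continuous
bounded evolution built from translations, plus a translation invariant nonlinearity, linear plus
quadratic and bounded. Mild solutions are zeros of a smooth map on curves whose derivative is the
identity minus a Volterra operator, hence always invertible (`isUnit_one_sub_duhamel`). By the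
inverse function theorem the set of solvable data is open and the solution map is smooth; an a
priori bound makes the set closed (`solvable_of_bound`). The bound comes from conservation of ‖ψ‖ in
L² (`norm_liftSpinor_eq`), which uses that the Bⱼ are hermitian: with ‖ψ‖ and μ under control the
wave source grows at most linearly in V, and Gronwall closes the argument (`norm_le_of_isMild`).

Mild solutions are weak solutions by integration along characteristics. Conversely, uniqueness of
weak solutions is proved on cones |x| < r - |t| (`agree_of_x0Eqs`). The sources of a weak solution,
cut off to the cone, define a mild solution of the linear problem; it agrees with the weak solution
on the cone by uniqueness for transport equations, so it solves a closed integral equation with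
Lipschitz source, and such an equation has only one solution. This gives uniqueness and finite speed
of propagation together. Local data are cut off at level n + ⌈T⌉; the resulting solutions agree for
|x| < n + 1 and are glued. Cutting and gluing are continuous and linear, so the local solution map
inherits smoothness in the sense of Michal and Bastiani.

Regularity follows from translation invariance. Translates of a solution are the solutions for the
translated data, so the chain rule applied to the smooth solution map shows that the solution is
differentiable along translations when the data are; the equation then gives the time derivative. A
solution paired with its variation solves a system of the same abstract form, so induction gives all
orders (`contDiffOn_orbit`). Smooth pointwise representatives are recovered from smooth orbits by
continuous functionals, and density of smooth data together with continuity gives the approximation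
statement. -/

variable (T) in
/-- Projection of `ℝ` onto `[-T, T]`. -/
def clamp (t : ℝ) : Icc (-T) T :=
  projIcc (-T) T (by have := Fact.out (p := 0 < T); linarith) t

theorem continuous_clamp : Continuous (clamp T) := by
  unfold clamp
  exact continuous_projIcc

theorem clamp_coe (t : Icc (-T) T) : clamp T t = t := projIcc_val _ t

theorem clamp_of_mem {t : ℝ} (ht : t ∈ Icc (-T) T) : clamp T t = ⟨t, ht⟩ := projIcc_of_mem _ ht

variable (T) in
/-- Time zero. -/
def zeroTime : Icc (-T) T :=
  ⟨0, by have := Fact.out (p := 0 < T); constructor <;> linarith⟩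

theorem uIoc_zero_subset {t : ℝ} (ht : t ∈ Icc (-T) T) : uIoc 0 t ⊆ Icc (-T) T := by
  have h0 : (0 : ℝ) ∈ Icc (-T) T := (zeroTime T).2
  exact uIoc_subset_uIcc.trans (ordConnected_Icc.uIcc_subset h0 ht)

variable {X : Type} [NormedAddCommGroup X] [NormedSpace ℝ X]

theorem continuous_extend (f : C(Icc (-T) T, X)) : Continuous fun s => f (clamp T s) :=
  f.continuous.comp continuous_clamp

theorem intervalIntegrable_extend (f : C(Icc (-T) T, X)) (a b : ℝ) :
    IntervalIntegrable (fun s => f (clamp T s)) volume a b :=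
  (continuous_extend f).intervalIntegrable a b

/-- Absolute values in the weight and around the integral let one formula serve both time
directions. -/
theorem integral_exp_mul_abs {l : ℝ} (hl : 0 < l) (c t : ℝ) :
    |∫ s in (0 : ℝ)..t, c * Real.exp (l * |s|)| = |c| / l * (Real.exp (l * |t|) - 1) := by
  have key : ∀ t : ℝ, 0 ≤ t →
      ∫ s in (0 : ℝ)..t, c * Real.exp (l * |s|) = c / l * (Real.exp (l * t) - 1) := by
    intro t ht
    have h1 : ∫ s in (0 : ℝ)..t, c * Real.exp (l * |s|)
        = ∫ s in (0 : ℝ)..t, c * Real.exp (l * s) := by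
      refine intervalIntegral.integral_congr fun s hs => ?_
      rw [uIcc_of_le ht] at hs
      simp only [abs_of_nonneg hs.1]
    rw [h1, intervalIntegral.integral_const_mul, integral_comp_mul_left_exp hl.ne']
    field_simp
  have pos : ∀ t : ℝ, 0 ≤ t → |c / l * (Real.exp (l * t) - 1)|
      = |c| / l * (Real.exp (l * t) - 1) := by
    intro t ht
    have : 0 ≤ Real.exp (l * t) - 1 := by
      have := Real.one_le_exp (mul_nonneg hl.le ht); linarith
    rw [abs_mul, abs_div, abs_of_pos hl, abs_of_nonneg this]
  rcases le_total 0 t with ht | ht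
  · rw [key t ht, pos t ht, abs_of_nonneg ht]
  · have h2 : ∫ s in (0 : ℝ)..t, c * Real.exp (l * |s|)
        = -∫ s in (0 : ℝ)..(-t), c * Real.exp (l * |s|) := by
      rw [intervalIntegral.integral_symm]
      have := intervalIntegral.integral_comp_neg (a := t) (b := 0)
        (fun s => c * Real.exp (l * |s|))
      simp only [abs_neg, neg_zero] at this
      rw [this]
    have ht' : 0 ≤ -t := by linarith
    rw [h2, abs_neg, key _ ht', pos _ ht', abs_of_nonpos ht]
where
  integral_comp_mul_left_exp {l : ℝ} (hl : l ≠ 0) {t : ℝ} :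
      ∫ s in (0 : ℝ)..t, Real.exp (l * s) = (Real.exp (l * t) - 1) / l := by
    rw [intervalIntegral.integral_comp_mul_left _ hl, integral_exp]
    simp [div_eq_inv_mul]

/-- The primitive of a curve which vanishes at time zero. -/
def primitive : C(Icc (-T) T, X) →L[ℝ] C(Icc (-T) T, X) :=
  LinearMap.mkContinuous
    { toFun := fun f => ⟨fun t => ∫ s in (0 : ℝ)..t, f (clamp T s),
        (intervalIntegral.continuous_primitive (intervalIntegrable_extend f) 0).comp
          continuous_subtype_val⟩
      map_add' := fun f g => by
        ext t
        exact intervalIntegral.integral_add (intervalIntegrable_extend f 0 t)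
          (intervalIntegrable_extend g 0 t)
      map_smul' := fun c f => by
        ext t
        exact intervalIntegral.integral_smul c _ } T
    (fun f => by
      have hT : 0 ≤ T := (Fact.out (p := 0 < T)).le
      refine (ContinuousMap.norm_le _ (by positivity)).2 fun t => ?_
      refine (intervalIntegral.norm_integral_le_of_norm_le_const (C := ‖f‖)
        fun s _ => f.norm_coe_le_norm _).trans ?_
      rw [mul_comm, sub_zero]
      exact mul_le_mul_of_nonneg_right (abs_le.2 t.2) (norm_nonneg _))

theorem primitive_apply (f : C(Icc (-T) T, X)) (t : Icc (-T) T) :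
    primitive f t = ∫ s in (0 : ℝ)..t, f (clamp T s) := rfl

/-- Integrating the weight exp(l|s|) gains a factor 1/l. This gain is the source of smallness in all
Volterra estimates below, so no restriction on T is needed. -/
theorem norm_primitive_le_exp {f : C(Icc (-T) T, X)} {c l : ℝ} (hc : 0 ≤ c) (hl : 0 < l)
    (hf : ∀ s : Icc (-T) T, ‖f s‖ ≤ c * Real.exp (l * |(s : ℝ)|)) (t : Icc (-T) T) :
    ‖primitive f t‖ ≤ c / l * Real.exp (l * |(t : ℝ)|) := by
  have h : ‖∫ s in (0 : ℝ)..t, f (clamp T s)‖ ≤ |∫ s in (0 : ℝ)..t, c * Real.exp (l * |s|)| := by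
    refine intervalIntegral.norm_integral_le_abs_of_norm_le ?_ ?_
    · refine (ae_restrict_iff' measurableSet_uIoc).2 (Eventually.of_forall fun s hs => ?_)
      have hs' := uIoc_zero_subset t.2 hs
      simpa [clamp_of_mem hs'] using hf (clamp T s)
    · exact (by fun_prop : Continuous fun s : ℝ => c * Real.exp (l * |s|)).intervalIntegrable _ _
  rw [primitive_apply]
  refine h.trans ?_
  rw [integral_exp_mul_abs hl, abs_of_nonneg hc]
  have : 0 ≤ c / l := by positivity
  nlinarith

/-- Integral Gronwall inequality with a crude constant. -/
theorem le_exp_of_le_integral {g : C(Icc (-T) T, ℝ)} {a k : ℝ} (ha : 0 ≤ a) (hk : 0 < k)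
    (hg0 : ∀ t, 0 ≤ g t) (hg : ∀ t : Icc (-T) T, g t ≤ a + k * |primitive g t|)
    (t : Icc (-T) T) : g t ≤ 2 * a * Real.exp (2 * k * T) := by
  have hT : 0 ≤ T := (Fact.out (p := 0 < T)).le
  have : Nonempty (Icc (-T) T) := ⟨zeroTime T⟩
  -- At the maximum c of g(t)exp(-2k|t|), the rate 2k makes the integral term at most c/2. It is
  -- absorbed, giving c ≤ 2a.
  obtain ⟨t₀, -, ht₀⟩ := isCompact_univ.exists_isMaxOn univ_nonempty
    (by fun_prop : ContinuousOn (fun t : Icc (-T) T => g t * Real.exp (-(2 * k * |(t : ℝ)|))) univ)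
  set c := g t₀ * Real.exp (-(2 * k * |(t₀ : ℝ)|)) with hc
  have hc0 : 0 ≤ c := mul_nonneg (hg0 _) (Real.exp_pos _).le
  have hle : ∀ s : Icc (-T) T, g s ≤ c * Real.exp (2 * k * |(s : ℝ)|) := by
    intro s
    have h1 : g s * Real.exp (-(2 * k * |(s : ℝ)|)) ≤ c := ht₀ (mem_univ s)
    calc g s = g s * Real.exp (-(2 * k * |(s : ℝ)|)) * Real.exp (2 * k * |(s : ℝ)|) := by
          rw [mul_assoc, ← Real.exp_add]; simp
      _ ≤ _ := by gcongr
  have hp : ∀ s, |primitive g s| ≤ c / (2 * k) * Real.exp (2 * k * |(s : ℝ)|) := fun s =>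
    norm_primitive_le_exp (l := 2 * k) hc0 (by positivity)
      (fun s => by rw [Real.norm_of_nonneg (hg0 s)]; exact hle s) s
  have hc2 : c ≤ a + c / 2 := by
    have h1 := hg t₀
    have h2 := hp t₀
    have h3 : g t₀ ≤ a + c / 2 * Real.exp (2 * k * |(t₀ : ℝ)|) := by
      calc g t₀ ≤ a + k * (c / (2 * k) * Real.exp (2 * k * |(t₀ : ℝ)|)) := by
            refine h1.trans (by gcongr)
        _ = _ := by field_simp
    have h4 : Real.exp (-(2 * k * |(t₀ : ℝ)|)) ≤ 1 := by
      rw [Real.exp_le_one_iff]; simp; positivity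
    calc c ≤ (a + c / 2 * Real.exp (2 * k * |(t₀ : ℝ)|)) * Real.exp (-(2 * k * |(t₀ : ℝ)|)) := by
          rw [hc]; gcongr
      _ = a * Real.exp (-(2 * k * |(t₀ : ℝ)|)) + c / 2 := by
          rw [add_mul, mul_assoc (c / 2), ← Real.exp_add, add_neg_cancel, Real.exp_zero, mul_one]
      _ ≤ _ := by nlinarith
  calc g t ≤ c * Real.exp (2 * k * |(t : ℝ)|) := hle t
    _ ≤ 2 * a * Real.exp (2 * k * T) := by
      gcongr
      · linarith
      · exact abs_le.2 t.2

/-- Pointwise application of a strongly continuous family of operators to a curve. -/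
def applyFamily (S : ℝ → X →L[ℝ] X) (hS : Continuous fun p : ℝ × X => S p.1 p.2) (K : ℝ)
    (hK : ∀ t x, ‖S t x‖ ≤ K * ‖x‖) : C(Icc (-T) T, X) →L[ℝ] C(Icc (-T) T, X) :=
  LinearMap.mkContinuous
    { toFun := fun f => ⟨fun t => S t (f t),
        hS.comp (continuous_subtype_val.prodMk f.continuous)⟩
      map_add' := fun f g => by ext t; simp
      map_smul' := fun c f => by ext t; simp } |K|
    (fun f => by
      refine (ContinuousMap.norm_le _ (by positivity)).2 fun t => ?_
      refine (hK _ _).trans ?_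
      gcongr
      · exact le_abs_self K
      · exact f.norm_coe_le_norm t)

variable {F G : Type} [NormedAddCommGroup F] [NormedSpace ℝ F]
  [NormedAddCommGroup G] [NormedSpace ℝ G]

variable (T) in
/-- Pointwise application of a continuous linear map to a curve. -/
def mapCurve (L : X →L[ℝ] F) : C(Icc (-T) T, X) →L[ℝ] C(Icc (-T) T, F) :=
  L.compLeftContinuous ℝ (Icc (-T) T)

@[simp]
theorem mapCurve_apply (L : X →L[ℝ] F) (f : C(Icc (-T) T, X)) (t : Icc (-T) T) :
    mapCurve T L f t = L (f t) := rfl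

variable (T) in
/-- Pointwise application of a continuous bilinear map to two curves. -/
def mapCurve₂ (B : X →L[ℝ] F →L[ℝ] G) :
    C(Icc (-T) T, X) →L[ℝ] C(Icc (-T) T, F) →L[ℝ] C(Icc (-T) T, G) :=
  LinearMap.mkContinuous₂
    (LinearMap.mk₂ ℝ (fun f g => ⟨fun t => B (f t) (g t), by fun_prop⟩)
      (fun f f' g => by ext; simp) (fun c f g => by ext; simp)
      (fun f g g' => by ext; simp) (fun c f g => by ext; simp)) ‖B‖
    (fun f g => by
      refine (ContinuousMap.norm_le _ (by positivity)).2 fun t => ?_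
      refine (B.le_opNorm₂ _ _).trans ?_
      gcongr
      · exact f.norm_coe_le_norm t
      · exact g.norm_coe_le_norm t)

@[simp]
theorem mapCurve₂_apply (B : X →L[ℝ] F →L[ℝ] G) (f : C(Icc (-T) T, X)) (g : C(Icc (-T) T, F))
    (t : Icc (-T) T) : mapCurve₂ T B f g t = B (f t) (g t) := rfl

end Curves

/-! ### Semilinear transport systems -/

/-- A semilinear system `u_t = (E₊ - E₋) ∂u + L u + B(u, u)` in a normed space with a
translation group `τ` with generator `∂`; the part of `u` in the range of `1 - E₊ - E₋`
is not transported. -/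
structure TransportSystem (X : Type) [NormedAddCommGroup X] [NormedSpace ℝ X] where
  τ : ℝ → X →L[ℝ] X
  τ_zero : ∀ x, τ 0 x = x
  τ_add : ∀ s t x, τ (s + t) x = τ s (τ t x)
  τ_norm : ∀ t x, ‖τ t x‖ ≤ ‖x‖
  τ_cont : ∀ x, Continuous fun t => τ t x
  Ep : X →L[ℝ] X
  Em : X →L[ℝ] X
  Ep_Ep : ∀ x, Ep (Ep x) = Ep x
  Em_Em : ∀ x, Em (Em x) = Em x
  Ep_Em : ∀ x, Ep (Em x) = 0
  Em_Ep : ∀ x, Em (Ep x) = 0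
  Ep_τ : ∀ t x, Ep (τ t x) = τ t (Ep x)
  Em_τ : ∀ t x, Em (τ t x) = τ t (Em x)
  L : X →L[ℝ] X
  L_τ : ∀ t x, L (τ t x) = τ t (L x)
  B : X →L[ℝ] X →L[ℝ] X
  B_τ : ∀ t x y, B (τ t x) (τ t y) = τ t (B x y)

/-- Joint continuity of a strongly continuous bounded family of operators. -/
theorem continuous_family {X F : Type} [NormedAddCommGroup X] [NormedSpace ℝ X]
    [NormedAddCommGroup F] [NormedSpace ℝ F]
    (S : ℝ → X →L[ℝ] F) (K : ℝ) (hK : ∀ t x, ‖S t x‖ ≤ K * ‖x‖)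
    (hS : ∀ x, Continuous fun t => S t x) : Continuous fun p : ℝ × X => S p.1 p.2 := by
  rw [continuous_iff_continuousAt]
  rintro ⟨t, x⟩
  have h1 : Tendsto (fun p : ℝ × X => S p.1 x) (𝓝 (t, x)) (𝓝 (S t x)) :=
    ((hS x).tendsto t).comp (continuous_fst.tendsto (t, x))
  have h2 : Tendsto (fun p : ℝ × X => S p.1 (p.2 - x)) (𝓝 (t, x)) (𝓝 0) := by
    refine squeeze_zero_norm (a := fun p : ℝ × X => K * ‖p.2 - x‖) (fun p => hK _ _) ?_
    have : Tendsto (fun p : ℝ × X => K * ‖p.2 - x‖) (𝓝 (t, x)) (𝓝 (K * ‖x - x‖)) :=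
      (by fun_prop : Continuous fun p : ℝ × X => K * ‖p.2 - x‖).tendsto (t, x)
    simpa using this
  have := h1.add h2
  simp only [map_sub, add_zero, add_sub_cancel] at this
  exact this

namespace TransportSystem

variable {X : Type} [NormedAddCommGroup X] [NormedSpace ℝ X] (P : TransportSystem X)

theorem τ_joint : Continuous fun p : ℝ × X => P.τ p.1 p.2 :=
  continuous_family P.τ 1 (by simpa using P.τ_norm) P.τ_cont

/-- The projection onto the part which is not transported. -/
def Ez : X →L[ℝ] X := ContinuousLinearMap.id ℝ X - P.Ep - P.Em

theorem Ez_apply (x : X) : P.Ez x = x - P.Ep x - P.Em x := rfl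

/-- The free evolution. -/
def S (t : ℝ) : X →L[ℝ] X := P.Ep ∘L P.τ t + P.Em ∘L P.τ (-t) + P.Ez

theorem S_apply (t : ℝ) (x : X) : P.S t x = P.Ep (P.τ t x) + P.Em (P.τ (-t) x) + P.Ez x := rfl

theorem S_zero (x : X) : P.S 0 x = x := by
  simp [S_apply, P.τ_zero, Ez_apply]

theorem S_add (s t : ℝ) (x : X) : P.S (s + t) x = P.S s (P.S t x) := by
  simp only [S_apply, Ez_apply, map_add, map_sub, P.Ep_τ, P.Em_τ, P.Ep_Ep, P.Em_Em, P.Ep_Em,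
    P.Em_Ep, P.τ_add, map_zero, neg_add]
  abel

theorem S_S_neg (t : ℝ) (x : X) : P.S t (P.S (-t) x) = x := by
  rw [← S_add, add_neg_cancel, S_zero]

theorem S_τ (s t : ℝ) (x : X) : P.S s (P.τ t x) = P.τ t (P.S s x) := by
  have h : ∀ a b : ℝ, P.τ a (P.τ b x) = P.τ b (P.τ a x) := fun a b => by
    rw [← P.τ_add, ← P.τ_add, add_comm]
  simp only [S_apply, Ez_apply, map_add, map_sub, ← P.Ep_τ, ← P.Em_τ, h s t, h (-s) t]

/-- A bound for the free evolution. -/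
def K : ℝ := ‖P.Ep‖ + ‖P.Em‖ + ‖P.Ez‖

theorem K_nonneg : 0 ≤ P.K := by unfold K; positivity

theorem S_norm (t : ℝ) (x : X) : ‖P.S t x‖ ≤ P.K * ‖x‖ := by
  rw [S_apply, K, add_mul, add_mul]
  refine (norm_add₃_le).trans ?_
  gcongr
  · exact (P.Ep.le_opNorm _).trans (by gcongr; exact P.τ_norm _ _)
  · exact (P.Em.le_opNorm _).trans (by gcongr; exact P.τ_norm _ _)
  · exact P.Ez.le_opNorm _

theorem S_joint : Continuous fun p : ℝ × X => P.S p.1 p.2 := by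
  have h := P.τ_joint
  have h1 : Continuous fun p : ℝ × X => P.τ (-p.1) p.2 :=
    h.comp (continuous_fst.neg.prodMk continuous_snd)
  simp only [S_apply]
  fun_prop

/-- The nonlinearity. -/
def N (x : X) : X := P.L x + P.B x x

theorem N_τ (t : ℝ) (x : X) : P.N (P.τ t x) = P.τ t (P.N x) := by
  simp [N, P.L_τ, P.B_τ]

theorem contDiff_N : ContDiff ℝ ∞ P.N := by
  unfold N
  fun_prop

/-- The system satisfied by a solution together with a variation of it. -/
def tangent : TransportSystem (X × X) where
  τ t := (P.τ t).prodMap (P.τ t)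
  τ_zero x := by ext <;> simp [P.τ_zero]
  τ_add s t x := by ext <;> simp [P.τ_add]
  τ_norm t x := by
    exact max_le_max (P.τ_norm _ _) (P.τ_norm _ _)
  τ_cont x := (P.τ_cont x.1).prodMk (P.τ_cont x.2)
  Ep := P.Ep.prodMap P.Ep
  Em := P.Em.prodMap P.Em
  Ep_Ep x := by ext <;> simp [P.Ep_Ep]
  Em_Em x := by ext <;> simp [P.Em_Em]
  Ep_Em x := by ext <;> simp [P.Ep_Em]
  Em_Ep x := by ext <;> simp [P.Em_Ep]
  Ep_τ t x := by ext <;> simp [P.Ep_τ]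
  Em_τ t x := by ext <;> simp [P.Em_τ]
  L := P.L.prodMap P.L
  L_τ t x := by ext <;> simp [P.L_τ]
  B := (ContinuousLinearMap.compL ℝ (X × X) X (X × X) (ContinuousLinearMap.inl ℝ X X)) ∘L
        (P.B.bilinearComp (ContinuousLinearMap.fst ℝ X X) (ContinuousLinearMap.fst ℝ X X)) +
      (ContinuousLinearMap.compL ℝ (X × X) X (X × X) (ContinuousLinearMap.inr ℝ X X)) ∘L
        (P.B.bilinearComp (ContinuousLinearMap.fst ℝ X X) (ContinuousLinearMap.snd ℝ X X) +
          P.B.bilinearComp (ContinuousLinearMap.snd ℝ X X) (ContinuousLinearMap.fst ℝ X X))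
  B_τ t x y := by ext <;> simp [P.B_τ]

theorem tangent_S (t : ℝ) (x : X × X) : P.tangent.S t x = (P.S t x.1, P.S t x.2) := by
  ext <;> simp [S_apply, Ez_apply, tangent]

theorem tangent_N (x : X × X) :
    P.tangent.N x = (P.N x.1, P.L x.2 + P.B x.1 x.2 + P.B x.2 x.1) := by
  ext <;> simp [N, tangent, add_assoc]

/-! ### The Duhamel operator and linear Volterra equations -/

section Mild

variable {T : ℝ} [Fact (0 < T)]

theorem continuous_S_apply (d : X) : Continuous fun t : Icc (-T) T => P.S t d := by
  have h : Continuous fun t : Icc (-T) T => ((t : ℝ), d) := by fun_prop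
  have h2 := P.S_joint.comp h
  exact h2

theorem S_neg_joint : Continuous fun p : ℝ × X => P.S (-p.1) p.2 := by
  have h : Continuous fun p : ℝ × X => (-p.1, p.2) := by fun_prop
  have h2 := P.S_joint.comp h
  exact h2

/-- Free evolution of the data, as a curve. -/
def free : X →L[ℝ] C(Icc (-T) T, X) :=
  LinearMap.mkContinuous
    { toFun := fun d => ⟨fun t => P.S t d, P.continuous_S_apply d⟩
      map_add' := fun d e => ContinuousMap.ext fun t => map_add (P.S t) d e
      map_smul' := fun c d => ContinuousMap.ext fun t => map_smul (P.S t) c d } P.K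
    (fun d => (ContinuousMap.norm_le _ (by have := P.K_nonneg; positivity)).2 fun t =>
      P.S_norm t d)

theorem free_apply (d : X) (t : Icc (-T) T) : P.free d t = P.S t d := rfl

/-- `f(t) ↦ S(t) f(t)`. -/
def applyS : C(Icc (-T) T, X) →L[ℝ] C(Icc (-T) T, X) := applyFamily P.S P.S_joint P.K P.S_norm

/-- `f(t) ↦ S(-t) f(t)`. -/
def unapplyS : C(Icc (-T) T, X) →L[ℝ] C(Icc (-T) T, X) :=
  applyFamily (fun t => P.S (-t)) P.S_neg_joint
    P.K (fun t x => P.S_norm (-t) x)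

theorem unapplyS_apply (f : C(Icc (-T) T, X)) (t : Icc (-T) T) :
    P.unapplyS f t = P.S (-t) (f t) := rfl

/-- The Duhamel operator `f ↦ ∫₀ᵗ S(t - s) f(s) ds`. -/
def duhamel : C(Icc (-T) T, X) →L[ℝ] C(Icc (-T) T, X) := P.applyS ∘L primitive ∘L P.unapplyS

theorem duhamel_apply (f : C(Icc (-T) T, X)) (t : Icc (-T) T) :
    P.duhamel f t = P.S t (primitive (P.unapplyS f) t) := rfl

/-- The factor 1/l is the gain from integrating the weight; the square of `P.K` pays for S(t)
outside and S(-s) inside the integral. -/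
theorem norm_duhamel_le_exp {f : C(Icc (-T) T, X)} {c l : ℝ} (hc : 0 ≤ c) (hl : 0 < l)
    (hf : ∀ s : Icc (-T) T, ‖f s‖ ≤ c * Real.exp (l * |(s : ℝ)|)) (t : Icc (-T) T) :
    ‖P.duhamel f t‖ ≤ P.K ^ 2 * c / l * Real.exp (l * |(t : ℝ)|) := by
  have hK := P.K_nonneg
  have h1 := norm_primitive_le_exp (f := P.unapplyS f) (c := P.K * c) (by positivity) hl
    (fun s => (P.S_norm (-s) (f s)).trans (by
      rw [mul_assoc]; exact mul_le_mul_of_nonneg_left (hf s) hK)) t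
  rw [duhamel_apply]
  refine (P.S_norm t _).trans ((mul_le_mul_of_nonneg_left h1 hK).trans (le_of_eq ?_))
  ring

/-- A pointwise bound on the source gives a quantitative bound for the solution of the linear
integral equation. -/
theorem exists_bound_of_eq_add_duhamel (k : ℝ) (hk : 0 ≤ k) :
    ∃ c : ℝ, 0 ≤ c ∧ ∀ u r f : C(Icc (-T) T, X), u = r + P.duhamel f →
      (∀ t, ‖f t‖ ≤ k * ‖u t‖) → ‖u‖ ≤ c * ‖r‖ := by
  have hK := P.K_nonneg
  have hT : 0 ≤ T := (Fact.out (p := 0 < T)).le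
  -- With this rate the Duhamel term is at most half of the weighted maximum of u and can be
  -- absorbed; the + 1 keeps l positive when k or `P.K` vanishes.
  set l : ℝ := 2 * (P.K ^ 2 * k + 1) with hl
  have hl0 : 0 < l := by positivity
  refine ⟨2 * Real.exp (l * T), by positivity, fun u r f h hf => ?_⟩
  have : Nonempty (Icc (-T) T) := ⟨zeroTime T⟩
  obtain ⟨t₀, -, ht₀⟩ := isCompact_univ.exists_isMaxOn univ_nonempty
    (by fun_prop : ContinuousOn (fun t : Icc (-T) T => ‖u t‖ * Real.exp (-(l * |(t : ℝ)|))) univ)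
  set c := ‖u t₀‖ * Real.exp (-(l * |(t₀ : ℝ)|)) with hc
  have hc0 : 0 ≤ c := by positivity
  have hle : ∀ s : Icc (-T) T, ‖u s‖ ≤ c * Real.exp (l * |(s : ℝ)|) := by
    intro s
    have h1 : ‖u s‖ * Real.exp (-(l * |(s : ℝ)|)) ≤ c := ht₀ (mem_univ s)
    calc ‖u s‖ = ‖u s‖ * Real.exp (-(l * |(s : ℝ)|)) * Real.exp (l * |(s : ℝ)|) := by
          rw [mul_assoc, ← Real.exp_add]; simp
      _ ≤ _ := by gcongr
  have hd := P.norm_duhamel_le_exp (f := f) (c := k * c) (l := l) (by positivity) hl0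
    (fun s => (hf s).trans (by rw [mul_assoc]; exact mul_le_mul_of_nonneg_left (hle s) hk)) t₀
  have hhalf : P.K ^ 2 * (k * c) / l ≤ c / 2 := by
    rw [div_le_div_iff₀ hl0 two_pos, hl]
    nlinarith
  have hc2 : c ≤ ‖r‖ + c / 2 := by
    have h3 : ‖u t₀‖ ≤ ‖r‖ + c / 2 * Real.exp (l * |(t₀ : ℝ)|) := by
      calc ‖u t₀‖ = ‖r t₀ + P.duhamel f t₀‖ := by rw [h]; rfl
        _ ≤ ‖r t₀‖ + ‖P.duhamel f t₀‖ := norm_add_le _ _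
        _ ≤ ‖r‖ + c / 2 * Real.exp (l * |(t₀ : ℝ)|) :=
          add_le_add (r.norm_coe_le_norm t₀) (hd.trans (by gcongr))
    have h4 : Real.exp (-(l * |(t₀ : ℝ)|)) ≤ 1 := by
      rw [Real.exp_le_one_iff]; simp; positivity
    calc c ≤ (‖r‖ + c / 2 * Real.exp (l * |(t₀ : ℝ)|)) * Real.exp (-(l * |(t₀ : ℝ)|)) := by
          rw [hc]; gcongr
      _ = ‖r‖ * Real.exp (-(l * |(t₀ : ℝ)|)) + c / 2 := by
          rw [add_mul, mul_assoc (c / 2), ← Real.exp_add, add_neg_cancel, Real.exp_zero, mul_one]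
      _ ≤ _ := by nlinarith [norm_nonneg r]
  refine (ContinuousMap.norm_le _ (by positivity)).2 fun t => ?_
  calc ‖u t‖ ≤ c * Real.exp (l * |(t : ℝ)|) := hle t
    _ ≤ 2 * ‖r‖ * Real.exp (l * T) := by
      gcongr
      · linarith
      · exact abs_le.2 t.2
    _ = _ := by ring

/-- The operator V = duhamel ∘ A is of Volterra type: each application halves the size measured with
the weight exp(l|t|). On [-T, T] the weight costs at most exp(lT), so some power of V has operator
norm below 1 and 1 - V^n is invertible. Since 1 - V divides 1 - V^n with a commuting cofactor, the
geometric sum, it is invertible as well. -/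
theorem isUnit_one_sub_duhamel [CompleteSpace X]
    (A : C(Icc (-T) T, X) →L[ℝ] C(Icc (-T) T, X)) (k : ℝ) (hk : 0 ≤ k)
    (hA : ∀ w t, ‖A w t‖ ≤ k * ‖w t‖) :
    IsUnit (1 - P.duhamel ∘L A : C(Icc (-T) T, X) →L[ℝ] C(Icc (-T) T, X)) := by
  have hK := P.K_nonneg
  set l : ℝ := 2 * (P.K ^ 2 * k + 1) with hl
  have hl0 : 0 < l := by positivity
  set V : C(Icc (-T) T, X) →L[ℝ] C(Icc (-T) T, X) := P.duhamel ∘L A with hV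
  have hstep : ∀ (w : C(Icc (-T) T, X)) (c : ℝ), 0 ≤ c →
      (∀ s : Icc (-T) T, ‖w s‖ ≤ c * Real.exp (l * |(s : ℝ)|)) →
      ∀ s : Icc (-T) T, ‖V w s‖ ≤ c / 2 * Real.exp (l * |(s : ℝ)|) := by
    intro w c hc hw s
    have hd := P.norm_duhamel_le_exp (f := A w) (c := k * c) (l := l) (by positivity) hl0
      (fun s => (hA w s).trans (by rw [mul_assoc]; exact mul_le_mul_of_nonneg_left (hw s) hk)) s
    refine hd.trans ?_
    gcongr ?_ * _
    rw [div_le_div_iff₀ hl0 two_pos, hl]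
    nlinarith
  have hpow : ∀ (n : ℕ) (w : C(Icc (-T) T, X)) (s : Icc (-T) T),
      ‖(V ^ n) w s‖ ≤ ‖w‖ / 2 ^ n * Real.exp (l * |(s : ℝ)|) := by
    intro n w
    induction n with
    | zero =>
      intro s
      have : 1 ≤ Real.exp (l * |(s : ℝ)|) := Real.one_le_exp (by positivity)
      have h2 := w.norm_coe_le_norm s
      simp only [pow_zero, one_apply_eq_self, div_one]
      nlinarith [norm_nonneg w]
    | succ n ih =>
      intro s
      have := hstep ((V ^ n) w) _ (by positivity) ih s
      rw [pow_succ', mul_apply_eq_comp, pow_succ, ← div_div]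
      exact this
  obtain ⟨n, hn⟩ : ∃ n : ℕ, Real.exp (l * T) * (1 / 2 : ℝ) ^ n < 1 := by
    have h := (tendsto_pow_atTop_nhds_zero_of_lt_one (r := (1 / 2 : ℝ)) (by norm_num)
      (by norm_num)).const_mul (Real.exp (l * T))
    rw [mul_zero] at h
    exact (h.eventually (gt_mem_nhds zero_lt_one)).exists
  have hnorm : ‖V ^ n‖ < 1 := by
    refine lt_of_le_of_lt (ContinuousLinearMap.opNorm_le_bound _ (by positivity) fun w => ?_) hn
    refine (ContinuousMap.norm_le _ (by positivity)).2 fun t => (hpow n w t).trans ?_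
    have : Real.exp (l * |(t : ℝ)|) ≤ Real.exp (l * T) := by
      gcongr; exact abs_le.2 t.2
    calc ‖w‖ / 2 ^ n * Real.exp (l * |(t : ℝ)|) ≤ ‖w‖ / 2 ^ n * Real.exp (l * T) := by gcongr
      _ = _ := by rw [one_div, inv_pow]; ring
  have h1 : IsUnit (1 - V ^ n) := 
    isUnit_one_sub_of_norm_lt_one (R := C(Icc (-T) T, X) →L[ℝ] C(Icc (-T) T, X)) hnorm
  rw [← mul_neg_geom_sum] at h1
  have hcomm : Commute (1 - V) (∑ i ∈ Finset.range n, V ^ i) := by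
    rw [commute_iff_eq, mul_neg_geom_sum, geom_sum_mul_neg]
  exact ((Commute.isUnit_mul_iff hcomm).1 h1).1

end Mild

end TransportSystem

/-! ### Mild solutions: uniqueness, global solvability, smooth dependence on data, regularity -/

namespace TransportSystem

variable {X : Type} [NormedAddCommGroup X] [NormedSpace ℝ X] (P : TransportSystem X)
  {T : ℝ} [Fact (0 < T)]

/-- The nonlinearity acting pointwise on curves. -/
def curveN (u : C(Icc (-T) T, X)) : C(Icc (-T) T, X) := mapCurve T P.L u + mapCurve₂ T P.B u u

theorem curveN_apply (u : C(Icc (-T) T, X)) (t : Icc (-T) T) : P.curveN u t = P.N (u t) := rfl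

/-- The divided difference of the nonlinearity. -/
def lin (u v : C(Icc (-T) T, X)) : C(Icc (-T) T, X) →L[ℝ] C(Icc (-T) T, X) :=
  mapCurve T P.L + mapCurve₂ T P.B u + (mapCurve₂ T P.B).flip v

theorem lin_apply (u v w : C(Icc (-T) T, X)) (t : Icc (-T) T) :
    P.lin u v w t = P.L (w t) + P.B (u t) (w t) + P.B (w t) (v t) := rfl

/-- The splitting B(u, u) - B(v, v) = B(u, u - v) + B(u - v, v) requires no symmetry of B. -/
theorem curveN_sub (u v : C(Icc (-T) T, X)) : P.curveN u - P.curveN v = P.lin u v (u - v) := by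
  ext t
  simp only [ContinuousMap.sub_apply, curveN_apply, lin_apply, N, map_sub]
  abel

/-- The bound is pointwise in time on w, as the weighted Volterra estimates require. -/
theorem norm_lin_le (u v w : C(Icc (-T) T, X)) (t : Icc (-T) T) :
    ‖P.lin u v w t‖ ≤ (‖P.L‖ + ‖P.B‖ * (‖u‖ + ‖v‖)) * ‖w t‖ := by
  rw [lin_apply]
  have h1 := P.L.le_opNorm (w t)
  have h2 : ‖P.B (u t) (w t)‖ ≤ ‖P.B‖ * ‖u‖ * ‖w t‖ := (P.B.le_opNorm₂ _ _).trans (by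
    gcongr; exact u.norm_coe_le_norm t)
  have h3 : ‖P.B (w t) (v t)‖ ≤ ‖P.B‖ * ‖w t‖ * ‖v‖ := (P.B.le_opNorm₂ _ _).trans (by
    gcongr; exact v.norm_coe_le_norm t)
  refine norm_add₃_le.trans ?_
  nlinarith

theorem contDiff_curveN : ContDiff ℝ ∞ (P.curveN (T := T)) := by
  unfold curveN
  fun_prop

theorem hasFDerivAt_curveN (u : C(Icc (-T) T, X)) : HasFDerivAt P.curveN (P.lin u u) u := by
  have h := (mapCurve T P.L).hasFDerivAt (x := u)
  have h2 := (mapCurve₂ T P.B).hasFDerivAt_of_bilinear (hasFDerivAt_id u) (hasFDerivAt_id u)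
  refine (h.add h2).congr_fderiv ?_
  ext v t
  simp [lin_apply, add_assoc]

/-- `u` is the mild solution with data `d`. -/
def IsMild (d : X) (u : C(Icc (-T) T, X)) : Prop := u = P.free d + P.duhamel (P.curveN u)

variable {P} in
-- For a nonlinearity that is linear plus quadratic, the difference of two solutions solves an exact
-- linear Volterra equation. Uniqueness and Lipschitz dependence on the data both come from this.
theorem IsMild.sub_eq {d e : X} {u v : C(Icc (-T) T, X)} (hu : P.IsMild d u)
    (hv : P.IsMild e v) : u - v = P.free (d - e) + P.duhamel (P.lin u v (u - v)) := by
  rw [← curveN_sub, map_sub, map_sub]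
  nth_rewrite 1 [hu, hv]
  abel

variable {P} in
theorem IsMild.eq {d : X} {u v : C(Icc (-T) T, X)} (hu : P.IsMild d u) (hv : P.IsMild d v) :
    u = v := by
  obtain ⟨c, -, hc⟩ := P.exists_bound_of_eq_add_duhamel (T := T)
    (‖P.L‖ + ‖P.B‖ * (‖u‖ + ‖v‖)) (by positivity)
  have := hc _ _ _ (hu.sub_eq hv) (P.norm_lin_le u v _)
  rw [sub_self, map_zero, norm_zero, mul_zero] at this
  exact sub_eq_zero.1 (norm_le_zero_iff.1 this)

theorem IsMild.apply_zero {P : TransportSystem X} {d : X} {u : C(Icc (-T) T, X)}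
    (hu : P.IsMild d u) {t : Icc (-T) T} (ht : (t : ℝ) = 0) : u t = d := by
  rw [hu]
  simp [free_apply, duhamel_apply, primitive_apply, ht, S_zero]

variable (T) in
/-- All data have a mild solution on `[-T, T]`. -/
def Solvable : Prop := ∀ d : X, ∃ u : C(Icc (-T) T, X), P.IsMild d u

/-- The mild equation says that v - duhamel(N(v)) equals the free evolution of the data. The
derivative of the left side is the identity minus a Volterra operator, so the inverse function
theorem applies at every curve, large or small. -/
theorem hasStrictFDerivAt_sub_duhamel [CompleteSpace X] (u : C(Icc (-T) T, X)) :
    ∃ e : C(Icc (-T) T, X) ≃L[ℝ] C(Icc (-T) T, X),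
      (e : C(Icc (-T) T, X) →L[ℝ] C(Icc (-T) T, X)) = 1 - P.duhamel ∘L P.lin u u ∧
      HasStrictFDerivAt (fun v => v - P.duhamel (P.curveN v))
        (e : C(Icc (-T) T, X) →L[ℝ] C(Icc (-T) T, X)) u := by
  obtain ⟨e, he⟩ := P.isUnit_one_sub_duhamel (T := T) (P.lin u u)
    (‖P.L‖ + ‖P.B‖ * (‖u‖ + ‖u‖)) (by positivity) (fun w t => P.norm_lin_le u u w t)
  refine ⟨ContinuousLinearEquiv.unitsEquiv ℝ _ e, ?_, ?_⟩
  · rw [← he]; rfl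
  · have h1 : ContDiffAt ℝ ∞ (P.curveN (T := T)) u := P.contDiff_curveN.contDiffAt
    have h2 : HasStrictFDerivAt (P.curveN (T := T)) (P.lin u u) u :=
      h1.hasStrictFDerivAt' (P.hasFDerivAt_curveN u) (by simp)
    have h3 := (hasStrictFDerivAt_id u).sub (P.duhamel.hasStrictFDerivAt.comp u h2)
    refine h3.congr_fderiv ?_
    have : ((ContinuousLinearEquiv.unitsEquiv ℝ (C(Icc (-T) T, X)) e :
      C(Icc (-T) T, X) ≃L[ℝ] C(Icc (-T) T, X)) :
      C(Icc (-T) T, X) →L[ℝ] C(Icc (-T) T, X)) = 1 - P.duhamel ∘L P.lin u u := by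
      rw [← he]; rfl
    rw [this]; rfl

/-- Global solvability follows from an a priori bound, by a continuity argument in the data. -/
theorem solvable_of_bound [CompleteSpace X]
    (h : ∀ r : ℝ, ∃ M : ℝ, ∀ (d : X) (u : C(Icc (-T) T, X)), ‖d‖ ≤ r → P.IsMild d u → ‖u‖ ≤ M) :
    P.Solvable T := by
  -- Openness: by the inverse function theorem every curve close to the free evolution of d is
  -- attained, in particular the free evolution of nearby data.
  have hopen : IsOpen {d : X | ∃ u : C(Icc (-T) T, X), P.IsMild d u} := by
    rw [isOpen_iff_mem_nhds]
    rintro d ⟨u, hu⟩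
    obtain ⟨e, -, he⟩ := P.hasStrictFDerivAt_sub_duhamel u
    have hmap := he.map_nhds_eq_of_equiv
    have hud : u - P.duhamel (P.curveN u) = P.free d := by
      nth_rewrite 1 [hu]; abel
    have hr : range (fun v : C(Icc (-T) T, X) => v - P.duhamel (P.curveN v)) ∈ 𝓝 (P.free d) := by
      rw [← hud, ← hmap]
      exact range_mem_map
    filter_upwards [(P.free (T := T)).continuous.continuousAt hr]
    rintro d' ⟨v, hv⟩
    exact ⟨v, by unfold IsMild; rw [← hv]; simp⟩
  -- Closedness: along a convergent sequence of data the a priori bound makes the Lipschitz constant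
  -- of `exists_bound_of_eq_add_duhamel` uniform. The solutions are therefore Cauchy and their limit
  -- is mild.
  have hclosed : IsClosed {d : X | ∃ u : C(Icc (-T) T, X), P.IsMild d u} := by
    refine isClosed_of_closure_subset fun d hd => ?_
    obtain ⟨s, hs, hlim⟩ := mem_closure_iff_seq_limit.1 hd
    choose u hu using hs
    obtain ⟨r, hr⟩ := hlim.norm.bddAbove_range
    obtain ⟨M, hM⟩ := h r
    have huM : ∀ n, ‖u n‖ ≤ M := fun n => hM _ _ (hr ⟨n, rfl⟩) (hu n)
    have hM0 : 0 ≤ M := (norm_nonneg _).trans (huM 0)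
    obtain ⟨c, hc0, hc⟩ := P.exists_bound_of_eq_add_duhamel (T := T)
      (‖P.L‖ + ‖P.B‖ * (M + M)) (by positivity)
    have hcau : CauchySeq u := by
      have hsc := hlim.cauchySeq
      rw [Metric.cauchySeq_iff'] at hsc ⊢
      intro ε hε
      obtain ⟨n, hn⟩ := hsc (ε / (c * ‖P.free (T := T)‖ + 1)) (by positivity)
      refine ⟨n, fun m hm => ?_⟩
      have h1 := hc _ _ _ ((hu m).sub_eq (hu n)) (fun t => (P.norm_lin_le _ _ _ t).trans (by
        gcongr
        · exact huM m
        · exact huM n))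
      have h2 := (P.free (T := T)).le_opNorm (s m - s n)
      have h3 := hn m hm
      rw [dist_eq_norm, lt_div_iff₀ (by positivity)] at h3
      rw [dist_eq_norm]
      have h4 : c * ‖P.free (T := T) (s m - s n)‖ ≤ c * (‖P.free (T := T)‖ * ‖s m - s n‖) := by
        gcongr
      nlinarith [norm_nonneg (s m - s n)]
    obtain ⟨v, hv⟩ := cauchySeq_tendsto_of_complete hcau
    refine ⟨v, ?_⟩
    have h1 : Tendsto (fun n => P.free (s n) + P.duhamel (P.curveN (u n))) atTop
        (𝓝 (P.free d + P.duhamel (P.curveN v))) :=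
      (((P.free (T := T)).continuous.tendsto d).comp hlim).add
        ((P.duhamel.continuous.comp P.contDiff_curveN.continuous).tendsto v |>.comp hv)
    refine tendsto_nhds_unique hv (h1.congr fun n => (hu n).symm)
  -- Zero data have the zero solution, and a normed space is connected.
  have huniv := IsClopen.eq_univ ⟨hclosed, hopen⟩ ⟨0, 0, by
    unfold IsMild; ext t; simp [curveN]⟩
  exact fun d => by
    have : d ∈ {d : X | ∃ u : C(Icc (-T) T, X), P.IsMild d u} := huniv ▸ mem_univ d
    exact this

/-! ### The data-to-solution map and its derivative -/

section Sol

variable {P} (h : P.Solvable T)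

/-- The data-to-solution map. -/
def Solvable.sol (h : P.Solvable T) (d : X) : C(Icc (-T) T, X) := (h d).choose

theorem Solvable.isMild_sol (d : X) : P.IsMild d (h.sol d) := (h d).choose_spec

theorem Solvable.sol_sub (d : X) :
    h.sol d - P.duhamel (P.curveN (h.sol d)) = P.free d := by
  nth_rewrite 1 [h.isMild_sol d]; abel

/-- Near d the solution map is the smooth local inverse of v ↦ v - duhamel(N(v)) composed with the
linear map `free`. Uniqueness of mild solutions identifies the local inverse with `h.sol`. -/
theorem Solvable.contDiff_sol [CompleteSpace X] : ContDiff ℝ ∞ h.sol := by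
  rw [contDiff_iff_contDiffAt]
  intro d
  obtain ⟨e, -, he⟩ := P.hasStrictFDerivAt_sub_duhamel (h.sol d)
  have hΘ : ContDiffAt ℝ ∞ (fun v : C(Icc (-T) T, X) => v - P.duhamel (P.curveN v)) (h.sol d) :=
    (contDiff_id.sub (P.duhamel.contDiff.comp P.contDiff_curveN)).contDiffAt
  have hg := hΘ.to_localInverse he.hasFDerivAt (by simp)
  rw [h.sol_sub] at hg
  have hcomp := hg.comp d (P.free (T := T)).contDiff.contDiffAt
  refine hcomp.congr_of_eventuallyEq ?_
  have hs : HasStrictFDerivAt (fun v : C(Icc (-T) T, X) => v - P.duhamel (P.curveN v))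
      (e : C(Icc (-T) T, X) →L[ℝ] C(Icc (-T) T, X)) (h.sol d) := he
  have hri := (hΘ.hasStrictFDerivAt' he.hasFDerivAt (by simp)).eventually_right_inverse
  rw [h.sol_sub] at hri
  filter_upwards [(P.free (T := T)).continuous.continuousAt hri] with d' hd'
  refine IsMild.eq (h.isMild_sol d') ?_
  unfold IsMild
  have h1 : ContDiffAt.localInverse hΘ he.hasFDerivAt (by simp) (P.free d') -
      P.duhamel (P.curveN (ContDiffAt.localInverse hΘ he.hasFDerivAt (by simp) (P.free d'))) =
      P.free d' := hd'
  exact sub_eq_iff_eq_add.1 h1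

/-- The derivative of the solution map solves the linearized equation. -/
theorem Solvable.fderiv_sol [CompleteSpace X] (d e : X) :
    fderiv ℝ h.sol d e = P.free e + P.duhamel (P.lin (h.sol d) (h.sol d) (fderiv ℝ h.sol d e)) := by
  have hd : HasFDerivAt h.sol (fderiv ℝ h.sol d) d :=
    (h.contDiff_sol.differentiable (by simp)).differentiableAt.hasFDerivAt
  have h1 : HasFDerivAt (fun d => h.sol d - P.duhamel (P.curveN (h.sol d)))
      (fderiv ℝ h.sol d - P.duhamel ∘L (P.lin (h.sol d) (h.sol d) ∘L fderiv ℝ h.sol d)) d :=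
    hd.sub (P.duhamel.hasFDerivAt.comp d ((P.hasFDerivAt_curveN _).comp d hd))
  simp only [h.sol_sub] at h1
  have h2 := congrArg (fun L => L e) (h1.unique (P.free (T := T)).hasFDerivAt)
  simp only [sub_apply, ContinuousLinearMap.comp_apply] at h2
  exact sub_eq_iff_eq_add.1 h2

end Sol

/-- Operators intertwining the free evolutions intertwine the Duhamel operators. -/
theorem mapCurve_duhamel {X' : Type} [NormedAddCommGroup X'] [NormedSpace ℝ X']
    [CompleteSpace X] [CompleteSpace X'] {P : TransportSystem X} {P' : TransportSystem X'}
    (R : X →L[ℝ] X') (hR : ∀ t x, R (P.S t x) = P'.S t (R x)) (f : C(Icc (-T) T, X)) :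
    mapCurve T R (P.duhamel f) = P'.duhamel (mapCurve T R f) := by
  ext t
  rw [mapCurve_apply, duhamel_apply, duhamel_apply, hR, primitive_apply, primitive_apply,
    ← ContinuousLinearMap.intervalIntegral_comp_comm R (intervalIntegrable_extend _ 0 t)]
  simp only [unapplyS_apply, hR, mapCurve_apply]

variable {P}

/-- Free evolution and nonlinearity commute with translations, so the translated solution is mild
for the translated data; uniqueness does the rest. -/
theorem Solvable.sol_τ [CompleteSpace X] (h : P.Solvable T) (a : ℝ) (d : X) :
    h.sol (P.τ a d) = mapCurve T (P.τ a) (h.sol d) := by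
  refine (h.isMild_sol _).eq ?_
  have h1 := congrArg (mapCurve T (P.τ a)) (h.isMild_sol d)
  rw [map_add, mapCurve_duhamel (P' := P) (P.τ a) (fun t x => (P.S_τ t a x).symm)] at h1
  unfold IsMild
  convert h1 using 2
  · ext t; simp [free_apply, P.S_τ]
  · congr 1; ext t; simp [curveN_apply, P.N_τ]

/-- The solution paired with its variation. -/
theorem Solvable.isMild_tangent [CompleteSpace X] (h : P.Solvable T) (d e : X) :
    P.tangent.IsMild (d, e) ((h.sol d).prodMk (fderiv ℝ h.sol d e)) := by
  set u := h.sol d with hu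
  set w := fderiv ℝ h.sol d e with hw
  have h1 : mapCurve T (ContinuousLinearMap.fst ℝ X X)
      (P.tangent.duhamel (P.tangent.curveN (u.prodMk w))) = P.duhamel (P.curveN u) := by
    rw [mapCurve_duhamel (P' := P) _ (fun t x => by rw [tangent_S]; rfl)]
    congr 1
    ext t
    simp [curveN_apply, tangent_N]
  have h2 : mapCurve T (ContinuousLinearMap.snd ℝ X X)
      (P.tangent.duhamel (P.tangent.curveN (u.prodMk w))) = P.duhamel (P.lin u u w) := by
    rw [mapCurve_duhamel (P' := P) _ (fun t x => by rw [tangent_S]; rfl)]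
    congr 1
    ext t
    simp [curveN_apply, tangent_N, lin_apply]
  refine ContinuousMap.ext fun t => Prod.ext ?_ ?_
  · have h3 := congrArg (fun f => f t) (h.isMild_sol d)
    have h4 := congrArg (fun f => f t) h1
    simp only [mapCurve_apply, ContinuousLinearMap.coe_fst'] at h4
    simp only [ContinuousMap.add_apply, Prod.fst_add, free_apply, tangent_S, h4]
    exact h3
  · have h3 := congrArg (fun f => f t) (h.fderiv_sol d e)
    have h4 := congrArg (fun f => f t) h2
    simp only [mapCurve_apply, ContinuousLinearMap.coe_snd'] at h4
    simp only [ContinuousMap.add_apply, Prod.snd_add, free_apply, tangent_S, h4]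
    exact h3

/-- No new a priori bound is needed: the solutions of the tangent system are exhibited as the
solution paired with the derivative of the solution map. -/
theorem Solvable.tangent [CompleteSpace X] (h : P.Solvable T) : P.tangent.Solvable T :=
  fun d => ⟨_, h.isMild_tangent d.1 d.2⟩

theorem Solvable.tangent_sol [CompleteSpace X] (h : P.Solvable T) (d e : X) :
    h.tangent.sol (d, e) = (h.sol d).prodMk (fderiv ℝ h.sol d e) :=
  (h.tangent.isMild_sol _).eq (h.isMild_tangent d e)

/-! ### Regularity -/

theorem hasDerivAt_τ {d e : X} (hd : HasDerivAt (fun a => P.τ a d) e 0) (a : ℝ) :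
    HasDerivAt (fun a => P.τ a d) (P.τ a e) a := by
  have h1 : HasDerivAt (fun b => P.τ a (P.τ b d)) (P.τ a e) (a - a) := by
    rw [sub_self]
    exact (P.τ a).hasFDerivAt.comp_hasDerivAt 0 hd
  have h2 := HasDerivAt.comp_sub_const a a h1
  refine h2.congr_of_eventuallyEq (Eventually.of_forall fun b => ?_)
  simp only []
  rw [← P.τ_add, add_sub_cancel]

theorem hasDerivAt_S {d e : X} (hd : HasDerivAt (fun a => P.τ a d) e 0) :
    HasDerivAt (fun t => P.S t d) (P.Ep e - P.Em e) 0 := by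
  have h1 := P.Ep.hasFDerivAt.comp_hasDerivAt (0 : ℝ) hd
  have h0 : HasDerivAt (fun a => P.τ a d) e (-0) := by rwa [neg_zero]
  have h2 := P.Em.hasFDerivAt.comp_hasDerivAt (0 : ℝ) (h0.scomp 0 (hasDerivAt_neg (0 : ℝ)))
  have h3 := (h1.add h2).add_const (P.Ez d)
  refine h3.congr_deriv ?_
  simp [sub_eq_add_neg]

/-- Derivative of `t ↦ S(t) q(t)` at a zero of `q`, for a strongly continuous family `S`. -/
theorem hasDerivAt_family_of_zero {F : Type} [NormedAddCommGroup F] [NormedSpace ℝ F]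
    {S : ℝ → X →L[ℝ] F} (hS : Continuous fun p : ℝ × X => S p.1 p.2)
    {q : ℝ → X} {q' : X} {t : ℝ} (hq : HasDerivAt q q' t) (h0 : q t = 0) :
    HasDerivAt (fun s => S s (q s)) (S t q') t := by
  rw [hasDerivAt_iff_tendsto_slope] at hq ⊢
  have h1 : Tendsto (fun s => (s, slope q t s)) (𝓝[≠] t) (𝓝 (t, q')) :=
    (tendsto_id.mono_left nhdsWithin_le_nhds).prodMk_nhds hq
  refine ((hS.tendsto (t, q')).comp h1).congr fun s => ?_
  simp [slope, h0]

/-- Since translations commute with the solution map, a ↦ τₐu(t) is the solution map along the orbit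
of the data. The chain rule differentiates it without assuming regularity of u, and the linearized
solution appears as the space derivative. -/
theorem Solvable.hasDerivAt_τ_sol [CompleteSpace X] (h : P.Solvable T) {d e : X}
    (hd : HasDerivAt (fun a => P.τ a d) e 0) (t : Icc (-T) T) (a : ℝ) :
    HasDerivAt (fun a => P.τ a (h.sol d t)) (P.τ a (fderiv ℝ h.sol d e t)) a := by
  refine hasDerivAt_τ ?_ a
  have h1 : HasFDerivAt h.sol (fderiv ℝ h.sol d) (P.τ 0 d) := by
    rw [P.τ_zero]
    exact (h.contDiff_sol.differentiable (by simp)).differentiableAt.hasFDerivAt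
  have h2 := h1.comp_hasDerivAt (0 : ℝ) hd
  have h3 := (ContinuousMap.evalCLM ℝ t).hasFDerivAt.comp_hasDerivAt (0 : ℝ) h2
  refine h3.congr_of_eventuallyEq (Eventually.of_forall fun b => ?_)
  simp only [Function.comp, ContinuousMap.evalCLM_apply, h.sol_τ, mapCurve_apply]

/-- Near t write u(s) = S(s - t)u(t) + S(s)∫ₜˢ S(-r)N(u(r)) dr. The first term is differentiable
because u(t) is differentiable along translations, the second because its integral vanishes at s =
t. -/
theorem IsMild.hasDerivAt [CompleteSpace X] {d : X} {u : C(Icc (-T) T, X)} (hu : P.IsMild d u)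
    {t : ℝ} (ht : t ∈ Ioo (-T) T) {w : X}
    (hw : HasDerivAt (fun a => P.τ a (u (clamp T t))) w 0) :
    HasDerivAt (fun t => u (clamp T t)) (P.Ep w - P.Em w + P.N (u (clamp T t))) t := by
  set g : ℝ → X := fun s => P.unapplyS (P.curveN u) (clamp T s) with hg
  have hgc : Continuous g := continuous_extend _
  have hq : HasDerivAt (fun s => ∫ r in t..s, g r) (g t) t :=
    intervalIntegral.integral_hasDerivAt_right (hgc.intervalIntegrable _ _)
      (hgc.stronglyMeasurableAtFilter _ _) hgc.continuousAt
  have h1 := hasDerivAt_family_of_zero P.S_joint hq (by simp)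
  have h2 : HasDerivAt (fun s => P.S (s - t) (u (clamp T t))) (P.Ep w - P.Em w) t := by
    have h0 : HasDerivAt (fun s => P.S s (u (clamp T t))) (P.Ep w - P.Em w) (t - t) := by
      rw [sub_self]; exact hasDerivAt_S hw
    exact HasDerivAt.comp_sub_const t t h0
  have hgt : P.S t (g t) = P.N (u (clamp T t)) := by
    simp only [hg, unapplyS_apply, clamp_of_mem (Ioo_subset_Icc_self ht), curveN_apply]
    exact P.S_S_neg t _
  rw [hgt] at h1
  refine (h2.add h1).congr_of_eventuallyEq ?_
  have key : ∀ s ∈ Icc (-T) T, u (clamp T s) = P.S s (d + ∫ r in (0 : ℝ)..s, g r) := by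
    intro s hs
    rw [clamp_of_mem hs]
    conv_lhs => rw [hu]
    rw [map_add]
    rfl
  filter_upwards [isOpen_Ioo.mem_nhds ht] with s hs
  have e1 := key s (Ioo_subset_Icc_self hs)
  have e2 := key t (Ioo_subset_Icc_self ht)
  have e3 : ∫ r in (0 : ℝ)..s, g r = (∫ r in (0 : ℝ)..t, g r) + ∫ r in t..s, g r :=
    (intervalIntegral.integral_add_adjacent_intervals (hgc.intervalIntegrable _ _)
      (hgc.intervalIntegrable _ _)).symm
  simp only [Pi.add_apply]
  rw [e1, e2, e3, ← P.S_add, sub_add_cancel, ← map_add, add_assoc]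

end TransportSystem

/-- A function on an open subset of the plane with partial derivatives of class `C^n` is of
class `C^(n+1)`. -/
theorem contDiffOn_succ_of_partial {F : Type} [NormedAddCommGroup F] [NormedSpace ℝ F]
    {U : Set (ℝ × ℝ)} (hU : IsOpen U) {f f₁ f₂ : ℝ × ℝ → F} {n : ℕ}
    (h₁ : ∀ p ∈ U, HasDerivAt (fun t => f (t, p.2)) (f₁ p) p.1)
    (h₂ : ∀ p ∈ U, HasDerivAt (fun x => f (p.1, x)) (f₂ p) p.2)
    (hf₁ : ContDiffOn ℝ n f₁ U) (hf₂ : ContDiffOn ℝ n f₂ U) :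
    ContDiffOn ℝ (n + 1) f U ∧ ∀ p ∈ U, HasFDerivAt f
      ((ContinuousLinearMap.toSpanSingleton ℝ (f₁ p)).coprod
        (ContinuousLinearMap.toSpanSingleton ℝ (f₂ p))) p := by
  have hfd : ∀ p ∈ U, HasFDerivAt f
      ((ContinuousLinearMap.toSpanSingleton ℝ (f₁ p)).coprod
        (ContinuousLinearMap.toSpanSingleton ℝ (f₂ p))) p := by
    intro p hp
    have hev := hU.mem_nhds hp
    let f' : ℝ → ℝ → F := fun t x => f (t, x)
    let g₁ : ℝ → ℝ → ℝ →L[ℝ] F := fun t x => ContinuousLinearMap.toSpanSingleton ℝ (f₁ (t, x))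
    let g₂ : ℝ → ℝ → ℝ →L[ℝ] F := fun t x => ContinuousLinearMap.toSpanSingleton ℝ (f₂ (t, x))
    have hc : Continuous fun y : F => ContinuousLinearMap.toSpanSingleton ℝ y :=
      (ContinuousLinearMap.toSpanSingletonCLE (𝕜 := ℝ) (E := F)).continuous
    have c₁ : ContinuousAt (Function.uncurry g₁) p :=
      hc.continuousAt.comp (hf₁.continuousOn.continuousAt hev)
    have c₂ : ContinuousAt (Function.uncurry g₂) p :=
      hc.continuousAt.comp (hf₂.continuousOn.continuousAt hev)
    have := hasStrictFDerivAt_uncurry_coprod (𝕜 := ℝ) (u := p) (f := f') (f₁ := g₁) (f₂ := g₂)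
      (by filter_upwards [hev] with v hv using (h₁ v hv).hasFDerivAt)
      (by filter_upwards [hev] with v hv using (h₂ v hv).hasFDerivAt) c₁ c₂
    exact this.hasFDerivAt
  refine ⟨?_, hfd⟩
  rw [contDiffOn_succ_iff_fderiv_of_isOpen hU]
  refine ⟨fun p hp => (hfd p hp).differentiableAt.differentiableWithinAt, by simp, ?_⟩
  have hco : ContDiffOn ℝ n (fun p => (ContinuousLinearMap.toSpanSingleton ℝ (f₁ p)).coprod
        (ContinuousLinearMap.toSpanSingleton ℝ (f₂ p))) U := by
    have e : (fun p => (ContinuousLinearMap.toSpanSingleton ℝ (f₁ p)).coprod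
        (ContinuousLinearMap.toSpanSingleton ℝ (f₂ p))) =
        fun p => (ContinuousLinearMap.toSpanSingletonCLE (𝕜 := ℝ) (E := F) (f₁ p)) ∘L
            (ContinuousLinearMap.fst ℝ ℝ ℝ) +
          (ContinuousLinearMap.toSpanSingletonCLE (𝕜 := ℝ) (E := F) (f₂ p)) ∘L
            (ContinuousLinearMap.snd ℝ ℝ ℝ) := by
      funext p; ext <;> simp
    rw [e]
    have k₁ := (ContinuousLinearMap.toSpanSingletonCLE (𝕜 := ℝ) (E := F)).contDiff.comp_contDiffOn
      hf₁
    have k₂ := (ContinuousLinearMap.toSpanSingletonCLE (𝕜 := ℝ) (E := F)).contDiff.comp_contDiffOn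
      hf₂
    exact (k₁.clm_comp contDiffOn_const).add (k₂.clm_comp contDiffOn_const)
  exact hco.congr fun p hp => (hfd p hp).fderiv

namespace TransportSystem

/-- If the data have `K` derivatives along the translation group, then the translates of the
solution depend on time and translation parameter in a `C^K` manner. -/
theorem Solvable.contDiffOn_orbit {T : ℝ} [Fact (0 < T)] (K : ℕ) :
    ∀ {X : Type} [NormedAddCommGroup X] [NormedSpace ℝ X] [CompleteSpace X]
      {P : TransportSystem X} (h : P.Solvable T) (D : ℕ → X)
      (_ : ∀ j < K, HasDerivAt (fun a => P.τ a (D j)) (D (j + 1)) 0),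
      ContDiffOn ℝ K (fun p : ℝ × ℝ => P.τ p.2 (h.sol (D 0) (clamp T p.1)))
        (Ioo (-T) T ×ˢ univ) := by
  induction K with
  | zero =>
    intro X _ _ _ P h D _
    rw [Nat.cast_zero, contDiffOn_zero]
    have hc : Continuous fun p : ℝ × ℝ => (p.2, h.sol (D 0) (clamp T p.1)) :=
      continuous_snd.prodMk ((continuous_extend _).comp continuous_fst)
    have := P.τ_joint.comp hc
    exact this.continuousOn
  | succ K ih =>
    intro X _ _ _ P h D hD
    have h0 := hD 0 (Nat.succ_pos K)
    -- The induction runs over all systems at once. The tangent system with data (D j, D (j + 1))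
    -- has one derivative fewer, and its solution is u paired with the linearized solution w = ∂ₓu,
    -- so the orbits of both are of class C^K.
    have hT := ih h.tangent (fun j => (D j, D (j + 1))) (fun j hj =>
      (hD j (by omega)).prodMk (hD (j + 1) (by omega)))
    simp only [h.tangent_sol] at hT
    have hu : ContDiffOn ℝ K (fun p : ℝ × ℝ => P.τ p.2 (h.sol (D 0) (clamp T p.1)))
        (Ioo (-T) T ×ˢ univ) := contDiff_fst.comp_contDiffOn hT
    have hw : ContDiffOn ℝ K
        (fun p : ℝ × ℝ => P.τ p.2 (fderiv ℝ h.sol (D 0) (D 1) (clamp T p.1)))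
        (Ioo (-T) T ×ˢ univ) := contDiff_snd.comp_contDiffOn hT
    rw [Nat.cast_succ]
    -- Both partial derivatives are expressed through the orbits of u and w: the time derivative by
    -- the equation, the derivative in the translation parameter by w.
    refine (contDiffOn_succ_of_partial (isOpen_Ioo.prod isOpen_univ)
      (f₁ := fun p : ℝ × ℝ =>
        P.Ep (P.τ p.2 (fderiv ℝ h.sol (D 0) (D 1) (clamp T p.1))) -
          P.Em (P.τ p.2 (fderiv ℝ h.sol (D 0) (D 1) (clamp T p.1))) +
          P.N (P.τ p.2 (h.sol (D 0) (clamp T p.1))))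
      (f₂ := fun p : ℝ × ℝ => P.τ p.2 (fderiv ℝ h.sol (D 0) (D 1) (clamp T p.1)))
      ?_ ?_ ?_ hw).1
    · rintro ⟨t, a⟩ ⟨ht, -⟩
      have hx := h.hasDerivAt_τ_sol h0 (clamp T t) 0
      rw [P.τ_zero] at hx
      have := (P.τ a).hasFDerivAt.comp_hasDerivAt t ((h.isMild_sol (D 0)).hasDerivAt ht hx)
      refine this.congr_deriv ?_
      simp only [map_add, map_sub, P.N_τ, P.Ep_τ, P.Em_τ]
    · rintro ⟨t, a⟩ -
      exact h.hasDerivAt_τ_sol h0 (clamp T t) a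
    · exact ((P.Ep.contDiff.comp_contDiffOn hw).sub (P.Em.contDiff.comp_contDiffOn hw)).add
        ((P.contDiff_N.of_le (by exact_mod_cast le_top)).comp_contDiffOn hu)

end TransportSystem

/-- A bounded linear map given by a plain function. -/
def clmOfBound {E F : Type} [NormedAddCommGroup E] [NormedSpace ℝ E] [NormedAddCommGroup F]
    [NormedSpace ℝ F] (f : E → F) (hadd : ∀ x y, f (x + y) = f x + f y)
    (hsmul : ∀ (c : ℝ) x, f (c • x) = c • f x) (C : ℝ) (hb : ∀ x, ‖f x‖ ≤ C * ‖x‖) : E →L[ℝ] F :=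
  LinearMap.mkContinuous { toFun := f, map_add' := hadd, map_smul' := hsmul } C hb

/-! ### Translations and products on Lebesgue spaces -/

section Lebesgue

variable {E F G : Type} [NormedAddCommGroup E] [NormedSpace ℝ E]
  [NormedAddCommGroup F] [NormedSpace ℝ F] [NormedAddCommGroup G] [NormedSpace ℝ G]
  {p q r : ℝ≥0∞} [Fact (1 ≤ p)] [Fact (1 ≤ q)] [Fact (1 ≤ r)]

/-- `f ↦ f(· + t)` on `L^p(ℝ)`. -/
def lpShift (t : ℝ) : Lp E p (volume : Measure ℝ) →L[ℝ] Lp E p (volume : Measure ℝ) :=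
  (Lp.compMeasurePreservingₗᵢ ℝ (fun x => x + t)
    (measurePreserving_add_right volume t)).toContinuousLinearMap

theorem coeFn_lpShift (t : ℝ) (f : Lp E p (volume : Measure ℝ)) :
    lpShift t f =ᵐ[volume] fun x => f (x + t) :=
  Lp.coeFn_compMeasurePreserving f (measurePreserving_add_right volume t)

theorem ae_shift {s : ℝ → Prop} (h : ∀ᵐ x, s x) (t : ℝ) : ∀ᵐ x, s (x + t) :=
  (measurePreserving_add_right (volume : Measure ℝ) t).quasiMeasurePreserving.ae h

theorem norm_lpShift (t : ℝ) (f : Lp E p (volume : Measure ℝ)) : ‖lpShift t f‖ = ‖f‖ :=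
  Lp.norm_compMeasurePreserving f (measurePreserving_add_right volume t)

theorem lpShift_zero (f : Lp E p (volume : Measure ℝ)) : lpShift 0 f = f := by
  refine Lp.ext ?_
  filter_upwards [coeFn_lpShift 0 f] with x hx
  rw [hx, add_zero]

theorem lpShift_add (s t : ℝ) (f : Lp E p (volume : Measure ℝ)) :
    lpShift (s + t) f = lpShift s (lpShift t f) := by
  refine Lp.ext ?_
  filter_upwards [coeFn_lpShift (s + t) f, coeFn_lpShift s (lpShift t f),
    ae_shift (coeFn_lpShift t f) s] with x h1 h2 h3
  rw [h1, h2, h3, add_assoc]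

theorem continuous_lpShift (hp : p ≠ ⊤) (f : Lp E p (volume : Measure ℝ)) :
    Continuous fun t => lpShift t f := by
  have h : Continuous fun t : ℝ =>
      (⟨fun x : ℝ => x + t, by fun_prop⟩ : C(ℝ, ℝ)) := by
    refine ContinuousMap.continuous_of_continuous_uncurry _ ?_
    simp only [Function.uncurry_def, ContinuousMap.coe_mk]
    fun_prop
  exact (continuous_const (y := f)).compMeasurePreservingLp h
    (fun t => measurePreserving_add_right volume t) hp

theorem compLpL_lpShift (L : E →L[ℝ] F) (t : ℝ) (f : Lp E p (volume : Measure ℝ)) :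
    L.compLpL p volume (lpShift t f) = lpShift t (L.compLpL p volume f) := by
  refine Lp.ext ?_
  filter_upwards [L.coeFn_compLpL (lpShift t f), coeFn_lpShift t f,
    coeFn_lpShift t (L.compLpL p volume f), ae_shift (L.coeFn_compLpL f) t] with x h1 h2 h3 h4
  rw [h1, h2, h3, h4]

theorem holder_lpShift [ENNReal.HolderTriple p q r] (B : E →L[ℝ] F →L[ℝ] G) (t : ℝ)
    (f : Lp E p (volume : Measure ℝ)) (g : Lp F q (volume : Measure ℝ)) :
    B.holder r (lpShift t f) (lpShift t g) = lpShift t (B.holder r f g) := by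
  refine Lp.ext ?_
  filter_upwards [B.coeFn_holder (r := r) (lpShift t f) (lpShift t g), coeFn_lpShift t f,
    coeFn_lpShift t g, coeFn_lpShift t (B.holder r f g),
    ae_shift (B.coeFn_holder (r := r) f g) t] with x h1 h2 h3 h4 h5
  rw [h1, h2, h3, h4, h5]

theorem memLp_top_bcf (f : ℝ →ᵇ E) : MemLp f ⊤ (volume : Measure ℝ) :=
  memLp_top_of_bound f.continuous.aestronglyMeasurable ‖f‖
    (Eventually.of_forall f.norm_coe_le_norm)

/-- Bounded continuous functions as elements of `L^∞`. -/
def bcfTop : (ℝ →ᵇ E) →L[ℝ] Lp E ⊤ (volume : Measure ℝ) :=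
  clmOfBound (fun f => (memLp_top_bcf f).toLp f) (fun _ _ => rfl) (fun _ _ => rfl) 1
    (fun f => by
      rw [one_mul, Lp.norm_toLp]
      refine ENNReal.toReal_le_of_le_ofReal (norm_nonneg f) ?_
      rw [eLpNorm_exponent_top]
      exact eLpNormEssSup_le_of_ae_bound (Eventually.of_forall f.norm_coe_le_norm))

theorem coeFn_bcfTop (f : ℝ →ᵇ E) : bcfTop f =ᵐ[volume] f :=
  MemLp.coeFn_toLp (memLp_top_bcf f)

/-- A locally integrable function is determined almost everywhere by its integrals over
intervals. -/
theorem ae_eq_of_intervalIntegral_eq [CompleteSpace E] {f g : ℝ → E}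
    (hf : LocallyIntegrable f volume) (hg : LocallyIntegrable g volume)
    (h : ∀ x : ℝ, ∫ s in (0 : ℝ)..x, f s = ∫ s in (0 : ℝ)..x, g s) : f =ᵐ[volume] g := by
  filter_upwards [LocallyIntegrable.ae_hasDerivAt_integral hf,
    LocallyIntegrable.ae_hasDerivAt_integral hg] with x h1 h2
  have h1' := h1 0
  simp only [h] at h1'
  exact h1'.unique (h2 0)

end Lebesgue

/-! ### The space `Y` -/

section YSpace

variable {N : ℕ}

/-- The function underlying an element of `Y`. -/
def yFun : Y N →L[ℝ] (ℝ →ᵇ Pot N) := (WithLp.fstL 1 ℝ _ _) ∘L (Y N).subtypeL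

/-- The derivative of an element of `Y`. -/
def yDer : Y N →L[ℝ] Lp (Pot N) 1 (volume : Measure ℝ) := (WithLp.sndL 1 ℝ _ _) ∘L (Y N).subtypeL

theorem yFun_sub (p : Y N) (a b : ℝ) : yFun p b - yFun p a = ∫ x in a..b, yDer p x := p.2 a b

theorem Y.ext {p q : Y N} (h₁ : yFun p = yFun q) (h₂ : yDer p = yDer q) : p = q :=
  Subtype.ext (WithLp.ofLp_injective 1 (Prod.ext h₁ h₂))

theorem Y.norm_eq (p : Y N) : ‖p‖ = ‖yFun p‖ + ‖yDer p‖ := WithLp.prod_norm_eq_of_L1 p.1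

/-- Constructor for elements of `Y`. -/
def yMk (f : ℝ →ᵇ Pot N) (g : Lp (Pot N) 1 (volume : Measure ℝ))
    (h : ∀ a b : ℝ, f b - f a = ∫ x in a..b, g x) : Y N := ⟨WithLp.toLp 1 (f, g), h⟩

theorem integrable_lp_one {E : Type} [NormedAddCommGroup E] (g : Lp E 1 (volume : Measure ℝ)) :
    Integrable g volume := L1.integrable_coeFn g

theorem isClosed_Y :
    IsClosed (Y N : Set (WithLp 1 ((ℝ →ᵇ Pot N) × Lp (Pot N) 1 (volume : Measure ℝ)))) := by
  have : (Y N : Set (WithLp 1 ((ℝ →ᵇ Pot N) × Lp (Pot N) 1 (volume : Measure ℝ)))) =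
      ⋂ a : ℝ, ⋂ b : ℝ, {p | p.fst b - p.fst a = ∫ x in a..b, p.snd x} := by
    ext p; simp only [mem_iInter, mem_ofPred_eq]; rfl
  rw [this]
  refine isClosed_iInter fun a => isClosed_iInter fun b => isClosed_eq ?_ ?_
  · have h : ∀ c : ℝ, Continuous fun p : WithLp 1 ((ℝ →ᵇ Pot N) ×
        Lp (Pot N) 1 (volume : Measure ℝ)) => p.fst c := fun c =>
      (BoundedContinuousFunction.evalCLM ℝ c).continuous.comp
        (WithLp.continuous_fst 1 _ _)
    exact (h b).sub (h a)
  · simp only [intervalIntegral]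
    have hs := WithLp.continuous_snd 1 (ℝ →ᵇ Pot N) (Lp (Pot N) 1 (volume : Measure ℝ))
    have h1 := (continuous_setIntegral (Ioc a b)).comp hs
    have h2 := (continuous_setIntegral (Ioc b a)).comp hs
    exact h1.sub h2

instance : CompleteSpace (Y N) := isClosed_Y.completeSpace_coe

theorem norm_integral_Iic_le (g : Lp (Pot N) 1 (volume : Measure ℝ)) (x : ℝ) :
    ‖∫ s in Iic x, g s‖ ≤ ‖g‖ := by
  refine (norm_integral_le_integral_norm _).trans ?_
  rw [L1.norm_eq_integral_norm]
  exact setIntegral_le_integral (integrable_lp_one g).norm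
    (Eventually.of_forall fun _ => norm_nonneg _)

theorem integral_Iic_sub (g : Lp (Pot N) 1 (volume : Measure ℝ)) (a b : ℝ) :
    (∫ x in Iic b, g x) - ∫ x in Iic a, g x = ∫ x in a..b, g x :=
  intervalIntegral.integral_Iic_sub_Iic (integrable_lp_one g).integrableOn
    (integrable_lp_one g).integrableOn

theorem continuous_integral_Iic (g : Lp (Pot N) 1 (volume : Measure ℝ)) :
    Continuous fun x : ℝ => ∫ s in Iic x, g s := by
  have h1 := intervalIntegral.continuous_primitive
    (fun a b => (integrable_lp_one g).intervalIntegrable (a := a) (b := b)) 0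
  have h2 : (fun x : ℝ => ∫ s in Iic x, g s) =
      fun x => (∫ s in (0 : ℝ)..x, g s) + ∫ s in Iic (0 : ℝ), g s := by
    funext x; rw [← integral_Iic_sub g 0 x, sub_add_cancel]
  rw [h2]
  exact h1.add continuous_const

/-- `x ↦ ∫_{-∞}^x g` as a bounded continuous function. -/
def bcfJ (g : Lp (Pot N) 1 (volume : Measure ℝ)) : ℝ →ᵇ Pot N :=
  BoundedContinuousFunction.ofNormedAddCommGroup _ (continuous_integral_Iic g) ‖g‖
    (norm_integral_Iic_le g)

theorem bcfJ_apply (g : Lp (Pot N) 1 (volume : Measure ℝ)) (x : ℝ) :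
    bcfJ g x = ∫ s in Iic x, g s := rfl

theorem norm_bcfJ_le (g : Lp (Pot N) 1 (volume : Measure ℝ)) : ‖bcfJ g‖ ≤ ‖g‖ :=
  BoundedContinuousFunction.norm_ofNormedAddCommGroup_le _ (norm_nonneg g) (norm_integral_Iic_le g)

/-- `J g (x) = ∫_{-∞}^x g`. -/
def yJ : Lp (Pot N) 1 (volume : Measure ℝ) →L[ℝ] Y N :=
  clmOfBound (fun g => yMk (bcfJ g) g (integral_Iic_sub g))
    (fun f g => by
      refine Y.ext (BoundedContinuousFunction.ext fun x => ?_) rfl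
      change bcfJ (f + g) x = bcfJ f x + bcfJ g x
      simp only [bcfJ_apply]
      rw [← integral_add (integrable_lp_one f).integrableOn (integrable_lp_one g).integrableOn]
      exact integral_congr_ae (ae_restrict_of_ae (Lp.coeFn_add f g)))
    (fun c f => by
      refine Y.ext (BoundedContinuousFunction.ext fun x => ?_) rfl
      change bcfJ (c • f) x = c • bcfJ f x
      simp only [bcfJ_apply]
      rw [← integral_smul]
      exact integral_congr_ae (ae_restrict_of_ae (Lp.coeFn_smul c f))) 2
    (fun g => by
      rw [Y.norm_eq, two_mul]
      exact add_le_add (norm_bcfJ_le g) le_rfl)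

theorem yFun_yJ (g : Lp (Pot N) 1 (volume : Measure ℝ)) (x : ℝ) :
    yFun (yJ g) x = ∫ s in Iic x, g s := rfl

theorem yDer_yJ (g : Lp (Pot N) 1 (volume : Measure ℝ)) : yDer (yJ g) = g := rfl

/-- A constant function. -/
def yConstFun (c : Pot N) : Y N :=
  yMk (BoundedContinuousFunction.const ℝ c) 0 (fun a b => by
    have : ∫ x in a..b, (0 : Lp (Pot N) 1 (volume : Measure ℝ)) x = ∫ x in a..b, (0 : Pot N) :=
      intervalIntegral.integral_congr_ae (by
        filter_upwards [Lp.coeFn_zero (Pot N) 1 (volume : Measure ℝ)] with x hx _ using hx)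
    rw [this]
    simp)

theorem yFun_yConstFun (c : Pot N) : yFun (yConstFun c) = BoundedContinuousFunction.const ℝ c := rfl

theorem yDer_yConstFun (c : Pot N) : yDer (yConstFun c) = 0 := rfl

/-- Constant functions. -/
def yConst : Pot N →L[ℝ] Y N :=
  clmOfBound yConstFun
    (fun f g => Y.ext (BoundedContinuousFunction.ext fun x => rfl) (by
      simp only [map_add, yDer_yConstFun, add_zero]))
    (fun c f => Y.ext (BoundedContinuousFunction.ext fun x => rfl) (by
      simp only [map_smul, yDer_yConstFun, smul_zero])) 1
    (fun c => by
      rw [Y.norm_eq, one_mul, yFun_yConstFun, yDer_yConstFun, norm_zero, add_zero]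
      exact BoundedContinuousFunction.norm_const_le c)

theorem yFun_yConst (c : Pot N) (x : ℝ) : yFun (yConst c) x = c := rfl

theorem yDer_yConst (c : Pot N) : yDer (yConst c) = 0 := rfl

/-- Reduces statements about Y to constants and to the image of L¹ under J; the base point a is
arbitrary. -/
theorem Y.eq_const_add (p : Y N) (a : ℝ) :
    p = yConst (yFun p a - yFun (yJ (yDer p)) a) + yJ (yDer p) := by
  refine Y.ext ?_ ?_
  · ext1 x
    have h1 := yFun_sub p a x
    have h2 := yFun_sub (yJ (yDer p)) a x
    rw [yDer_yJ, ← h1] at h2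
    rw [map_add, BoundedContinuousFunction.add_apply, yFun_yConst]
    have : yFun (yJ (yDer p)) x = yFun p x - yFun p a + yFun (yJ (yDer p)) a :=
      sub_eq_iff_eq_add.1 h2
    rw [this]; abel
  · rw [map_add, yDer_yConst, yDer_yJ, zero_add]

/-- Translation of bounded continuous functions. -/
def bcfShift (t : ℝ) (f : ℝ →ᵇ Pot N) : ℝ →ᵇ Pot N :=
  f.compContinuous ⟨fun x => x + t, by fun_prop⟩

/-- Translation of elements of `Y`. -/
def yShiftFun (t : ℝ) (p : Y N) : Y N :=
  yMk (bcfShift t (yFun p)) (lpShift t (yDer p)) (fun a b => by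
    have h := intervalIntegral.integral_congr_ae (μ := volume) (a := a) (b := b)
      (f := lpShift t (yDer p)) (g := fun x => yDer p (x + t))
      ((coeFn_lpShift t (yDer p)).mono fun x hx _ => hx)
    rw [h, intervalIntegral.integral_comp_add_right (fun x => yDer p x) t, ← yFun_sub]
    rfl)

theorem yFun_yShiftFun (t : ℝ) (p : Y N) : yFun (yShiftFun t p) = bcfShift t (yFun p) := rfl

theorem yDer_yShiftFun (t : ℝ) (p : Y N) : yDer (yShiftFun t p) = lpShift t (yDer p) := rfl

theorem norm_yShiftFun_le (t : ℝ) (p : Y N) : ‖yShiftFun t p‖ ≤ 1 * ‖p‖ := by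
  rw [one_mul, Y.norm_eq, Y.norm_eq p, yFun_yShiftFun, yDer_yShiftFun, norm_lpShift]
  exact add_le_add (BoundedContinuousFunction.norm_compContinuous_le _ _) le_rfl

/-- `f ↦ f(· + t)` on `Y`. -/
def yShift (t : ℝ) : Y N →L[ℝ] Y N :=
  clmOfBound (yShiftFun t)
    (fun p q => Y.ext (BoundedContinuousFunction.ext fun x => rfl) (by
      simp only [map_add, yDer_yShiftFun]))
    (fun c p => Y.ext (BoundedContinuousFunction.ext fun x => rfl) (by
      simp only [map_smul, yDer_yShiftFun])) 1 (norm_yShiftFun_le t)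

theorem yFun_yShift (t : ℝ) (p : Y N) (x : ℝ) : yFun (yShift t p) x = yFun p (x + t) := rfl

theorem yDer_yShift (t : ℝ) (p : Y N) : yDer (yShift t p) = lpShift t (yDer p) := rfl

theorem norm_yShift_le (t : ℝ) (p : Y N) : ‖yShift t p‖ ≤ ‖p‖ :=
  (norm_yShiftFun_le t p).trans (one_mul _).le

theorem yShift_zero (p : Y N) : yShift 0 p = p :=
  Y.ext (by ext1 x; rw [yFun_yShift, add_zero]) (by rw [yDer_yShift, lpShift_zero])

theorem yShift_add (s t : ℝ) (p : Y N) : yShift (s + t) p = yShift s (yShift t p) :=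
  Y.ext (by ext1 x; simp only [yFun_yShift, add_assoc]) (by simp only [yDer_yShift, lpShift_add])

theorem yShift_yJ (t : ℝ) (g : Lp (Pot N) 1 (volume : Measure ℝ)) :
    yShift t (yJ g) = yJ (lpShift t g) := by
  refine Y.ext ?_ (by rw [yDer_yShift, yDer_yJ, yDer_yJ])
  ext1 x
  rw [yFun_yShift, yFun_yJ, yFun_yJ]
  have h1 : ∫ s in Iic x, lpShift t g s = ∫ s in Iic x, g (s + t) :=
    integral_congr_ae (ae_restrict_of_ae (coeFn_lpShift t g))
  have h2 := (measurePreserving_add_right (volume : Measure ℝ) t).setIntegral_preimage_emb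
    (MeasurableEquiv.addRight t).measurableEmbedding g (Iic (x + t))
  rw [h1, ← h2]
  simp

theorem yShift_yConst (t : ℝ) (c : Pot N) : yShift t (yConst c) = yConst c :=
  Y.ext (by ext1 x; rfl) (by rw [yDer_yShift, yDer_yConst, map_zero])

/-- Translations fix constants and commute with J, so strong continuity comes from L¹. For general
bounded continuous functions with the supremum norm it would fail. -/
theorem continuous_yShift (p : Y N) : Continuous fun t => yShift t p := by
  rw [Y.eq_const_add p 0]
  simp only [map_add, yShift_yConst, yShift_yJ]
  exact continuous_const.add (yJ.continuous.comp (continuous_lpShift (by simp) _))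

/-- Elements of `Y` as elements of `L^∞`. -/
def yTop : Y N →L[ℝ] Lp (Pot N) ⊤ (volume : Measure ℝ) := bcfTop ∘L yFun

theorem coeFn_yTop (p : Y N) : yTop p =ᵐ[volume] yFun p := coeFn_bcfTop _

theorem yTop_yShift (t : ℝ) (p : Y N) : yTop (yShift t p) = lpShift t (yTop p) := by
  refine Lp.ext ?_
  filter_upwards [coeFn_yTop (yShift t p), coeFn_lpShift t (yTop p),
    ae_shift (coeFn_yTop p) t] with x h1 h2 h3
  rw [h1, h2, h3, yFun_yShift]

end YSpace

attribute [irreducible] lpShift yShift yJ yTop yConst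

/-! ### The nonlinearities, pointwise -/

section Pointwise

variable {N : ℕ}

/-- A matrix acting on spinors, as a real linear map. -/
def spinorMap (A : Matrix (Fin 2) (Fin 2) ℂ) : Spinor →L[ℝ] Spinor :=
  (Matrix.toEuclideanCLM (n := Fin 2) (𝕜 := ℂ) A).restrictScalars ℝ

theorem spinorMap_ofLp (A : Matrix (Fin 2) (Fin 2) ℂ) (z : Spinor) :
    (spinorMap A z).ofLp = A.mulVec z.ofLp := by
  simp [spinorMap]

/-- `(V, z) ↦ i ∑ Vⱼ Bⱼ z`. -/
def diracMap (B : Fin N → Matrix (Fin 2) (Fin 2) ℂ) : Pot N →L[ℝ] Spinor →L[ℝ] Spinor :=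
  ∑ j, (EuclideanSpace.proj j : Pot N →L[ℝ] ℝ).smulRight (spinorMap (Complex.I • B j))

theorem diracMap_apply (B : Fin N → Matrix (Fin 2) (Fin 2) ℂ) (V : Pot N) (z : Spinor) :
    diracMap B V z = ∑ j, V j • spinorMap (Complex.I • B j) z := by
  simp [diracMap]

/-- `z ↦ -iM γ⁰ z`. -/
def massMap (M : ℝ) : Spinor →L[ℝ] Spinor := spinorMap (-(Complex.I * M) • gamma0)

/-- `(y, z) ↦ (Re y^* Cⱼ z)ⱼ`, as a linear map. -/
def currentLin (C : Fin N → Matrix (Fin 2) (Fin 2) ℂ) : Spinor →ₗ[ℝ] Spinor →ₗ[ℝ] Pot N :=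
  LinearMap.mk₂ ℝ
    (fun y z => WithLp.toLp 2 fun j => (star y.ofLp ⬝ᵥ (C j).mulVec z.ofLp).re)
    (fun y y' z => by ext j; simp [add_dotProduct])
    (fun c y z => by ext j; simp; ring)
    (fun y z z' => by ext j; simp [Matrix.mulVec_add]; ring)
    (fun c y z => by ext j; simp [Matrix.mulVec_smul]; ring)

/-- `(y, z) ↦ (Re y^* Cⱼ z)ⱼ`. -/
def currentMap (C : Fin N → Matrix (Fin 2) (Fin 2) ℂ) : Spinor →L[ℝ] Spinor →L[ℝ] Pot N :=
  LinearMap.toContinuousLinearMap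
    ((LinearMap.toContinuousLinearMap : (Spinor →ₗ[ℝ] Pot N) ≃ₗ[ℝ] (Spinor →L[ℝ] Pot N)).toLinearMap
      ∘ₗ currentLin C)

theorem currentMap_apply (C : Fin N → Matrix (Fin 2) (Fin 2) ℂ) (y z : Spinor) (j : Fin N) :
    currentMap C y z j = (star y.ofLp ⬝ᵥ (C j).mulVec z.ofLp).re := rfl

/-- `(a, V) ↦ -a V`. -/
def dampMap : ℝ →L[ℝ] Pot N →L[ℝ] Pot N := -ContinuousLinearMap.lsmul ℝ ℝ

theorem dampMap_apply (a : ℝ) (V : Pot N) : dampMap a V = -(a • V) := rfl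

/-- The projection on the first component of a spinor. -/
def spinFst : Spinor →L[ℝ] Spinor := spinorMap !![1, 0; 0, 0]

/-- The projection on the second component of a spinor. -/
def spinSnd : Spinor →L[ℝ] Spinor := spinorMap !![0, 0; 0, 1]

theorem spinFst_zero (z : Spinor) : spinFst z 0 = z 0 := by
  simp [spinFst, spinorMap_ofLp, Matrix.vecHead]

theorem spinFst_one (z : Spinor) : spinFst z 1 = 0 := by
  simp [spinFst, spinorMap_ofLp]

theorem spinSnd_zero (z : Spinor) : spinSnd z 0 = 0 := by
  simp [spinSnd, spinorMap_ofLp]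

theorem spinSnd_one (z : Spinor) : spinSnd z 1 = z 1 := by
  simp [spinSnd, spinorMap_ofLp, Matrix.vecHead, Matrix.vecTail]

theorem spinor_ext {y z : Spinor} (h0 : y 0 = z 0) (h1 : y 1 = z 1) : y = z := by
  ext i; fin_cases i <;> assumption

/-- For hermitian A the form z^*Az is real, so the factor i makes it imaginary. This is the algebra
behind conservation of charge, applied to the Bⱼ and to γ⁰. -/
theorem inner_spinorMap_of_isHermitian {A : Matrix (Fin 2) (Fin 2) ℂ} (hA : A.IsHermitian)
    (a : ℝ) (z : Spinor) : (inner ℂ z (spinorMap ((Complex.I * a) • A) z)).re = 0 := by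
  have h00 := hA.apply 0 0
  have h01 := hA.apply 0 1
  have h11 := hA.apply 1 1
  simp only [EuclideanSpace.inner_eq_star_dotProduct, spinorMap_ofLp, Matrix.smul_mulVec,
    smul_dotProduct]
  simp only [dotProduct, Matrix.mulVec, Fin.sum_univ_two, Pi.star_apply, RCLike.star_def,
    smul_eq_mul, Complex.ext_iff, Complex.conj_re, Complex.conj_im, Complex.mul_re, Complex.mul_im,
    Complex.add_re, Complex.add_im, Complex.I_re, Complex.I_im, Complex.ofReal_re,
    Complex.ofReal_im] at *
  have e1 : (A 0 0).im = 0 := by linarith [h00.2]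
  have e2 : (A 1 1).im = 0 := by linarith [h11.2]
  have e3 := h01.1
  have e4 := h01.2
  rw [e1, e2, ← e3, ← e4]
  ring

theorem isHermitian_gamma0 : gamma0.IsHermitian := by
  ext i j; fin_cases i <;> fin_cases j <;> simp [gamma0]

theorem inner_diracMap {B : Fin N → Matrix (Fin 2) (Fin 2) ℂ} (hB : ∀ j, (B j).IsHermitian)
    (V : Pot N) (z : Spinor) : (inner ℂ z (diracMap B V z)).re = 0 := by
  rw [diracMap_apply, inner_sum, Complex.re_sum]
  refine Finset.sum_eq_zero fun j _ => ?_
  have h := inner_spinorMap_of_isHermitian (hB j) (V j) z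
  have e : V j • spinorMap (Complex.I • B j) z = spinorMap ((Complex.I * (V j : ℂ)) • B j) z := by
    ext i
    simp [spinorMap_ofLp, Matrix.smul_mulVec]
    ring
  rw [e, h]

theorem inner_massMap (M : ℝ) (z : Spinor) : (inner ℂ z (massMap M z)).re = 0 := by
  have h := inner_spinorMap_of_isHermitian isHermitian_gamma0 (-M) z
  rwa [Complex.ofReal_neg, mul_neg] at h

end Pointwise

/-! ### The system on `L² × Y × Y × L¹` -/

section System

scoped instance (N : ℕ) : NormedAddCommGroup (Y N) := inferInstance
scoped instance (N : ℕ) : NormedSpace ℝ (Y N) := inferInstance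

scoped instance (N : ℕ) : SeminormedAddCommGroup (Y N) :=
  NormedAddCommGroup.toSeminormedAddCommGroup
scoped instance (N : ℕ) : TopologicalSpace (Y N) := UniformSpace.toTopologicalSpace
scoped instance (N : ℕ) : AddCommGroup (Y N) := SeminormedAddCommGroup.toAddCommGroup
scoped instance (N : ℕ) : AddCommMonoid (Y N) := AddCommGroup.toAddCommMonoid
scoped instance (N : ℕ) : Module ℝ (Y N) := NormedSpace.toModule
scoped instance (N : ℕ) : SMul ℝ (Y N) := SMulZeroClass.toSMul

section LpInstances

variable {E : Type} [NormedAddCommGroup E] [NormedSpace ℝ E] {p : ℝ≥0∞} [Fact (1 ≤ p)]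

scoped instance : SeminormedAddCommGroup (Lp E p (volume : Measure ℝ)) :=
  NormedAddCommGroup.toSeminormedAddCommGroup
scoped instance : TopologicalSpace (Lp E p (volume : Measure ℝ)) := UniformSpace.toTopologicalSpace
scoped instance : AddCommGroup (Lp E p (volume : Measure ℝ)) := SeminormedAddCommGroup.toAddCommGroup
scoped instance : AddCommMonoid (Lp E p (volume : Measure ℝ)) := AddCommGroup.toAddCommMonoid
scoped instance : Module ℝ (Lp E p (volume : Measure ℝ)) := NormedSpace.toModule
scoped instance : SMul ℝ (Lp E p (volume : Measure ℝ)) := SMulZeroClass.toSMul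

end LpInstances

variable (N : ℕ)

/-- Spinor field, right and left moving parts of the potential, and mass density. -/
def Lift : Type :=
  Lp Spinor 2 (volume : Measure ℝ) × Y N × Y N × Lp ℝ 1 (volume : Measure ℝ)

instance : NormedAddCommGroup (Lift N) := inferInstanceAs (NormedAddCommGroup
  (Lp Spinor 2 (volume : Measure ℝ) × Y N × Y N × Lp ℝ 1 (volume : Measure ℝ)))

instance : NormedSpace ℝ (Lift N) := inferInstanceAs (NormedSpace ℝ
  (Lp Spinor 2 (volume : Measure ℝ) × Y N × Y N × Lp ℝ 1 (volume : Measure ℝ)))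

instance : CompleteSpace (Lift N) := inferInstanceAs (CompleteSpace
  (Lp Spinor 2 (volume : Measure ℝ) × Y N × Y N × Lp ℝ 1 (volume : Measure ℝ)))

variable {N}

/-- Precomposition of a bilinear map with linear maps. -/
def bilinPull {X E F G : Type} [NormedAddCommGroup X] [NormedSpace ℝ X] [NormedAddCommGroup E]
    [NormedSpace ℝ E] [NormedAddCommGroup F] [NormedSpace ℝ F] [NormedAddCommGroup G]
    [NormedSpace ℝ G] (b : E →L[ℝ] F →L[ℝ] G) (f : X →L[ℝ] E) (g : X →L[ℝ] F) :
    X →L[ℝ] X →L[ℝ] G := b.bilinearComp f g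

/-- Postcomposition of a bilinear map with a linear map. -/
def bilinPush {X E F : Type} [NormedAddCommGroup X] [NormedSpace ℝ X] [NormedAddCommGroup E]
    [NormedSpace ℝ E] [NormedAddCommGroup F] [NormedSpace ℝ F]
    (f : E →L[ℝ] F) (b : X →L[ℝ] X →L[ℝ] E) :
    X →L[ℝ] X →L[ℝ] F := ContinuousLinearMap.compL ℝ X E F f ∘L b

/-- The spinor field. -/
def liftSpinor : Lift N →L[ℝ] Lp Spinor 2 (volume : Measure ℝ) :=
  (ContinuousLinearMap.fst ℝ (Lp Spinor 2 (volume : Measure ℝ))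
    (Y N × Y N × Lp ℝ 1 (volume : Measure ℝ)) :)

/-- The left moving part of the potential. -/
def liftLeft : Lift N →L[ℝ] Y N :=
  ((ContinuousLinearMap.fst ℝ (Y N) (Y N × Lp ℝ 1 (volume : Measure ℝ))).comp
    (ContinuousLinearMap.snd ℝ (Lp Spinor 2 (volume : Measure ℝ))
      (Y N × Y N × Lp ℝ 1 (volume : Measure ℝ))) :)

/-- The right moving part of the potential. -/
def liftRight : Lift N →L[ℝ] Y N :=
  (((ContinuousLinearMap.fst ℝ (Y N) (Lp ℝ 1 (volume : Measure ℝ))).comp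
    (ContinuousLinearMap.snd ℝ (Y N) (Y N × Lp ℝ 1 (volume : Measure ℝ)))).comp
    (ContinuousLinearMap.snd ℝ (Lp Spinor 2 (volume : Measure ℝ))
      (Y N × Y N × Lp ℝ 1 (volume : Measure ℝ))) :)

/-- The mass density. -/
def liftMass : Lift N →L[ℝ] Lp ℝ 1 (volume : Measure ℝ) :=
  (((ContinuousLinearMap.snd ℝ (Y N) (Lp ℝ 1 (volume : Measure ℝ))).comp
    (ContinuousLinearMap.snd ℝ (Y N) (Y N × Lp ℝ 1 (volume : Measure ℝ)))).comp
    (ContinuousLinearMap.snd ℝ (Lp Spinor 2 (volume : Measure ℝ))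
      (Y N × Y N × Lp ℝ 1 (volume : Measure ℝ))) :)

/-- The element of `L² × Y × Y × L¹` with components given by linear maps. -/
def liftProd {E : Type} [NormedAddCommGroup E] [NormedSpace ℝ E]
    (a : E →L[ℝ] Lp Spinor 2 (volume : Measure ℝ)) (b c : E →L[ℝ] Y N)
    (d : E →L[ℝ] Lp ℝ 1 (volume : Measure ℝ)) : E →L[ℝ] Lift N :=
  (a.prod (b.prod (c.prod d)) :)

section Prod

variable {E : Type} [NormedAddCommGroup E] [NormedSpace ℝ E]
    (a : E →L[ℝ] Lp Spinor 2 (volume : Measure ℝ)) (b c : E →L[ℝ] Y N)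
    (d : E →L[ℝ] Lp ℝ 1 (volume : Measure ℝ)) (x : E)

@[simp] theorem liftSpinor_liftProd : liftSpinor (liftProd a b c d x) = a x := rfl
@[simp] theorem liftLeft_liftProd : liftLeft (liftProd a b c d x) = b x := rfl
@[simp] theorem liftRight_liftProd : liftRight (liftProd a b c d x) = c x := rfl
@[simp] theorem liftMass_liftProd : liftMass (liftProd a b c d x) = d x := rfl

end Prod

theorem lift_ext {h k : Lift N} (h1 : liftSpinor h = liftSpinor k) (h2 : liftLeft h = liftLeft k)
    (h3 : liftRight h = liftRight k) (h4 : liftMass h = liftMass k) : h = k :=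
  Prod.ext h1 (Prod.ext h2 (Prod.ext h3 h4))

theorem norm_lift_eq (h : Lift N) :
    ‖h‖ = max ‖liftSpinor h‖ (max ‖liftLeft h‖ (max ‖liftRight h‖ ‖liftMass h‖)) := rfl

theorem continuous_lift {A : Type} [TopologicalSpace A] {f : A → Lift N}
    (h1 : Continuous fun a => liftSpinor (f a)) (h2 : Continuous fun a => liftLeft (f a))
    (h3 : Continuous fun a => liftRight (f a)) (h4 : Continuous fun a => liftMass (f a)) :
    Continuous f :=
  (h1.prodMk (h2.prodMk (h3.prodMk h4)) :)

attribute [irreducible] liftSpinor liftLeft liftRight liftMass liftProd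

/-- The potential. -/
def liftV : Lift N →L[ℝ] Y N := liftLeft + liftRight

theorem liftV_apply (h : Lift N) : liftV h = liftLeft h + liftRight h := rfl

variable (M : ℝ) (B C : Fin N → Matrix (Fin 2) (Fin 2) ℂ)

/-- The quadratic source term of the Dirac equation. -/
def diracSource : Lift N →L[ℝ] Lift N →L[ℝ] Lp Spinor 2 (volume : Measure ℝ) :=
  bilinPull (X := Lift N) ((diracMap B).holderL volume ⊤ 2 2) (yTop.comp liftV) liftSpinor

/-- The source term of the wave equation. -/
def waveSource : Lift N →L[ℝ] Lift N →L[ℝ] Lp (Pot N) 1 (volume : Measure ℝ) :=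
  bilinPull (X := Lift N) ((currentMap C).holderL volume 2 2 1) liftSpinor liftSpinor +
    bilinPull (X := Lift N) ((dampMap (N := N)).holderL volume 1 ⊤ 1) liftMass (yTop.comp liftV)

theorem compLpL_comp_eq {p : ℝ≥0∞} [Fact (1 ≤ p)] {E F G : Type} [NormedAddCommGroup E]
    [NormedSpace ℝ E] [NormedAddCommGroup F] [NormedSpace ℝ F] [NormedAddCommGroup G]
    [NormedSpace ℝ G] (L : F →L[ℝ] G) (K : E →L[ℝ] F) (R : E →L[ℝ] G) (h : ∀ x, L (K x) = R x)
    (f : Lp E p (volume : Measure ℝ)) :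
    L.compLpL p volume (K.compLpL p volume f) = R.compLpL p volume f := by
  refine Lp.ext ?_
  filter_upwards [L.coeFn_compLpL (K.compLpL p volume f), K.coeFn_compLpL f, R.coeFn_compLpL f]
    with x h1 h2 h3
  rw [h1, h2, h3, h]

theorem compLpL_zero {p : ℝ≥0∞} [Fact (1 ≤ p)] {E F : Type} [NormedAddCommGroup E]
    [NormedSpace ℝ E] [NormedAddCommGroup F] [NormedSpace ℝ F]
    (f : Lp E p (volume : Measure ℝ)) :
    (0 : E →L[ℝ] F).compLpL p volume f = 0 := by
  refine Lp.ext ?_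
  filter_upwards [(0 : E →L[ℝ] F).coeFn_compLpL f, Lp.coeFn_zero F p (volume : Measure ℝ)]
    with x h1 h2
  rw [h1, h2]; rfl

theorem compLpL_comp_zero {p : ℝ≥0∞} [Fact (1 ≤ p)] {E F G : Type} [NormedAddCommGroup E]
    [NormedSpace ℝ E] [NormedAddCommGroup F] [NormedSpace ℝ F] [NormedAddCommGroup G]
    [NormedSpace ℝ G] (L : F →L[ℝ] G) (K : E →L[ℝ] F) (h : ∀ x, L (K x) = 0)
    (f : Lp E p (volume : Measure ℝ)) :
    L.compLpL p volume (K.compLpL p volume f) = 0 := by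
  rw [compLpL_comp_eq L K 0 h, compLpL_zero]

theorem spinSnd_spinSnd (z : Spinor) : spinSnd (spinSnd z) = spinSnd z :=
  spinor_ext (by simp only [spinSnd_zero]) (by simp only [spinSnd_one])

theorem spinFst_spinFst (z : Spinor) : spinFst (spinFst z) = spinFst z :=
  spinor_ext (by simp only [spinFst_zero]) (by simp only [spinFst_one])

theorem spinSnd_spinFst (z : Spinor) : spinSnd (spinFst z) = 0 :=
  spinor_ext (by simp [spinSnd_zero]) (by simp [spinSnd_one, spinFst_one])

theorem spinFst_spinSnd (z : Spinor) : spinFst (spinSnd z) = 0 :=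
  spinor_ext (by simp [spinFst_zero, spinSnd_zero]) (by simp [spinFst_one])

/-- Insertion of a source of the wave equation. -/
def waveInsert : Lp (Pot N) 1 (volume : Measure ℝ) →L[ℝ] Lift N :=
  -- With these opposite halves the sum of the movers, V, receives no source, while the difference
  -- of their derivatives, ∂ₜV, receives the full source.
  liftProd 0 ((1 / 2 : ℝ) • yJ (N := N)) (-(1 / 2 : ℝ) • yJ (N := N)) 0

/-- The translation group on `L² × Y × Y × L¹`. -/
def liftShift (t : ℝ) : Lift N →L[ℝ] Lift N :=
  liftProd ((lpShift t).comp liftSpinor) ((yShift t).comp liftLeft) ((yShift t).comp liftRight)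
    ((lpShift t).comp liftMass)

section Shift

variable (t : ℝ) (h : Lift N)

@[simp] theorem liftSpinor_liftShift : liftSpinor (liftShift t h) = lpShift t (liftSpinor h) := by
  rw [liftShift, liftSpinor_liftProd]; rfl
@[simp] theorem liftLeft_liftShift : liftLeft (liftShift t h) = yShift t (liftLeft h) := by
  rw [liftShift, liftLeft_liftProd]; rfl
@[simp] theorem liftRight_liftShift : liftRight (liftShift t h) = yShift t (liftRight h) := by
  rw [liftShift, liftRight_liftProd]; rfl
@[simp] theorem liftMass_liftShift : liftMass (liftShift t h) = lpShift t (liftMass h) := by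
  rw [liftShift, liftMass_liftProd]; rfl

theorem liftV_liftShift : liftV (liftShift t h) = yShift t (liftV h) := by
  rw [liftV_apply, liftV_apply, liftLeft_liftShift, liftRight_liftShift, map_add]

end Shift

theorem diracSource_apply (h k : Lift N) :
    diracSource B h k = (diracMap B).holder 2 (yTop (liftV h)) (liftSpinor k) := rfl

theorem waveSource_apply (h k : Lift N) :
    waveSource C h k = (currentMap C).holder 1 (liftSpinor h) (liftSpinor k) +
      dampMap.holder 1 (liftMass h) (yTop (liftV k)) := rfl

attribute [irreducible] liftShift diracSource waveSource liftV

theorem diracSource_liftShift (t : ℝ) (h k : Lift N) :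
    diracSource B (liftShift t h) (liftShift t k) = lpShift t (diracSource B h k) := by
  rw [diracSource_apply, diracSource_apply, liftV_liftShift, yTop_yShift,
    liftSpinor_liftShift, holder_lpShift]

theorem waveSource_liftShift (t : ℝ) (h k : Lift N) :
    waveSource C (liftShift t h) (liftShift t k) = lpShift t (waveSource C h k) := by
  rw [waveSource_apply, waveSource_apply, liftV_liftShift, yTop_yShift, map_add,
    liftSpinor_liftShift, liftSpinor_liftShift, liftMass_liftShift,
    holder_lpShift, holder_lpShift]

/-- Projection on the left moving part. -/
def liftEp : Lift N →L[ℝ] Lift N :=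
  -- The second spinor component moves left. The mass density lies in neither range of the two
  -- projections, hence is not transported.
  liftProd ((spinSnd.compLpL 2 volume).comp liftSpinor) liftLeft 0 0

/-- Projection on the right moving part. -/
def liftEm : Lift N →L[ℝ] Lift N :=
  liftProd ((spinFst.compLpL 2 volume).comp liftSpinor) 0 liftRight 0

/-- The Dirac mass term. -/
def liftMassTerm : Lift N →L[ℝ] Lift N :=
  liftProd (((massMap M).compLpL 2 volume).comp liftSpinor) 0 0 0

/-- Insertion of a source of the Dirac equation. -/
def diracInsert : Lp Spinor 2 (volume : Measure ℝ) →L[ℝ] Lift N :=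
  liftProd (ContinuousLinearMap.id ℝ _) 0 0 0

/-- The quadratic terms. -/
def liftQuad : Lift N →L[ℝ] Lift N →L[ℝ] Lift N :=
  bilinPush diracInsert (diracSource B) + bilinPush waveInsert (waveSource C)

theorem liftQuad_apply (h k : Lift N) :
    liftQuad B C h k = diracInsert (diracSource B h k) + waveInsert (waveSource C h k) := rfl

section Components

variable (h : Lift N) (f : Lp Spinor 2 (volume : Measure ℝ)) (g : Lp (Pot N) 1 (volume : Measure ℝ))

@[simp] theorem liftSpinor_waveInsert : liftSpinor (waveInsert g) = 0 := by
  rw [waveInsert, liftSpinor_liftProd]; rfl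
@[simp] theorem liftLeft_waveInsert : liftLeft (waveInsert g) = (1 / 2 : ℝ) • yJ g := by
  rw [waveInsert, liftLeft_liftProd]; rfl
@[simp] theorem liftRight_waveInsert : liftRight (waveInsert g) = -(1 / 2 : ℝ) • yJ g := by
  rw [waveInsert, liftRight_liftProd]; rfl
@[simp] theorem liftMass_waveInsert : liftMass (waveInsert g) = 0 := by
  rw [waveInsert, liftMass_liftProd]; rfl

@[simp] theorem liftSpinor_diracInsert : liftSpinor (diracInsert (N := N) f) = f := by
  rw [diracInsert, liftSpinor_liftProd]; rfl
@[simp] theorem liftLeft_diracInsert : liftLeft (diracInsert (N := N) f) = 0 := by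
  rw [diracInsert, liftLeft_liftProd]; rfl
@[simp] theorem liftRight_diracInsert : liftRight (diracInsert (N := N) f) = 0 := by
  rw [diracInsert, liftRight_liftProd]; rfl
@[simp] theorem liftMass_diracInsert : liftMass (diracInsert (N := N) f) = 0 := by
  rw [diracInsert, liftMass_liftProd]; rfl

@[simp] theorem liftSpinor_liftEp :
    liftSpinor (liftEp h) = spinSnd.compLpL 2 volume (liftSpinor h) := by
  rw [liftEp, liftSpinor_liftProd]; rfl
@[simp] theorem liftLeft_liftEp : liftLeft (liftEp h) = liftLeft h := by
  rw [liftEp, liftLeft_liftProd]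
@[simp] theorem liftRight_liftEp : liftRight (liftEp h) = 0 := by
  rw [liftEp, liftRight_liftProd]; rfl
@[simp] theorem liftMass_liftEp : liftMass (liftEp h) = 0 := by
  rw [liftEp, liftMass_liftProd]; rfl

@[simp] theorem liftSpinor_liftEm :
    liftSpinor (liftEm h) = spinFst.compLpL 2 volume (liftSpinor h) := by
  rw [liftEm, liftSpinor_liftProd]; rfl
@[simp] theorem liftLeft_liftEm : liftLeft (liftEm h) = 0 := by
  rw [liftEm, liftLeft_liftProd]; rfl
@[simp] theorem liftRight_liftEm : liftRight (liftEm h) = liftRight h := by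
  rw [liftEm, liftRight_liftProd]
@[simp] theorem liftMass_liftEm : liftMass (liftEm h) = 0 := by
  rw [liftEm, liftMass_liftProd]; rfl

@[simp] theorem liftSpinor_liftMassTerm :
    liftSpinor (liftMassTerm M h) = (massMap M).compLpL 2 volume (liftSpinor h) := by
  rw [liftMassTerm, liftSpinor_liftProd]; rfl
@[simp] theorem liftLeft_liftMassTerm : liftLeft (liftMassTerm M h) = 0 := by
  rw [liftMassTerm, liftLeft_liftProd]; rfl
@[simp] theorem liftRight_liftMassTerm : liftRight (liftMassTerm M h) = 0 := by
  rw [liftMassTerm, liftRight_liftProd]; rfl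
@[simp] theorem liftMass_liftMassTerm : liftMass (liftMassTerm M h) = 0 := by
  rw [liftMassTerm, liftMass_liftProd]; rfl

end Components

attribute [irreducible] liftQuad liftEp liftEm liftMassTerm waveInsert diracInsert

theorem waveInsert_lpShift (t : ℝ) (g : Lp (Pot N) 1 (volume : Measure ℝ)) :
    waveInsert (lpShift t g) = liftShift t (waveInsert g) := by
  apply lift_ext <;> simp [yShift_yJ]

theorem diracInsert_lpShift (t : ℝ) (f : Lp Spinor 2 (volume : Measure ℝ)) :
    diracInsert (N := N) (lpShift t f) = liftShift t (diracInsert f) := by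
  apply lift_ext <;> simp

theorem liftShift_zero (h : Lift N) : liftShift 0 h = h := by
  apply lift_ext <;> simp [lpShift_zero, yShift_zero]

theorem liftShift_add (s t : ℝ) (h : Lift N) :
    liftShift (s + t) h = liftShift s (liftShift t h) := by
  apply lift_ext <;> simp [lpShift_add, yShift_add]

theorem norm_liftShift_le (t : ℝ) (h : Lift N) : ‖liftShift t h‖ ≤ ‖h‖ := by
  rw [norm_lift_eq, norm_lift_eq h, liftSpinor_liftShift, liftLeft_liftShift, liftRight_liftShift,
    liftMass_liftShift]
  exact max_le_max (norm_lpShift _ _).le (max_le_max (norm_yShift_le _ _)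
    (max_le_max (norm_yShift_le _ _) (norm_lpShift _ _).le))

theorem continuous_liftShift (h : Lift N) : Continuous fun t => liftShift t h := by
  apply continuous_lift <;> simp only [liftSpinor_liftShift, liftLeft_liftShift,
    liftRight_liftShift, liftMass_liftShift]
  · exact continuous_lpShift (by simp) _
  · exact continuous_yShift _
  · exact continuous_yShift _
  · exact continuous_lpShift (by simp) _

theorem liftEp_liftEp (h : Lift N) : liftEp (liftEp h) = liftEp h := by
  apply lift_ext <;> simp [compLpL_comp_eq spinSnd spinSnd spinSnd spinSnd_spinSnd]

theorem liftEm_liftEm (h : Lift N) : liftEm (liftEm h) = liftEm h := by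
  apply lift_ext <;> simp [compLpL_comp_eq spinFst spinFst spinFst spinFst_spinFst]

theorem liftEp_liftEm (h : Lift N) : liftEp (liftEm h) = 0 := by
  apply lift_ext <;> simp [compLpL_comp_zero spinSnd spinFst spinSnd_spinFst]

theorem liftEm_liftEp (h : Lift N) : liftEm (liftEp h) = 0 := by
  apply lift_ext <;> simp [compLpL_comp_zero spinFst spinSnd spinFst_spinSnd]

theorem liftEp_liftShift (t : ℝ) (h : Lift N) : liftEp (liftShift t h) = liftShift t (liftEp h) := by
  apply lift_ext <;> simp [compLpL_lpShift]

theorem liftEm_liftShift (t : ℝ) (h : Lift N) : liftEm (liftShift t h) = liftShift t (liftEm h) := by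
  apply lift_ext <;> simp [compLpL_lpShift]

theorem liftMassTerm_liftShift (t : ℝ) (h : Lift N) :
    liftMassTerm M (liftShift t h) = liftShift t (liftMassTerm M h) := by
  apply lift_ext <;> simp [compLpL_lpShift]

theorem liftQuad_liftShift (t : ℝ) (h k : Lift N) :
    liftQuad B C (liftShift t h) (liftShift t k) = liftShift t (liftQuad B C h k) := by
  rw [liftQuad_apply, liftQuad_apply, diracSource_liftShift, waveSource_liftShift,
    waveInsert_lpShift, diracInsert_lpShift, map_add]

/-- The Dirac–Klein–Gordon system. -/
def dkg : TransportSystem (Lift N) where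
  τ := liftShift
  τ_zero := liftShift_zero
  τ_add := liftShift_add
  τ_norm := norm_liftShift_le
  τ_cont := continuous_liftShift
  Ep := liftEp
  Em := liftEm
  Ep_Ep := liftEp_liftEp
  Em_Em := liftEm_liftEm
  Ep_Em := liftEp_liftEm
  Em_Ep := liftEm_liftEp
  Ep_τ := liftEp_liftShift
  Em_τ := liftEm_liftShift
  L := liftMassTerm M
  L_τ := liftMassTerm_liftShift M
  B := liftQuad B C
  B_τ := liftQuad_liftShift B C

end System

/-! ### Components of the evolution -/

section Components

variable {N : ℕ} (M : ℝ) (B C : Fin N → Matrix (Fin 2) (Fin 2) ℂ) (t : ℝ) (h : Lift N)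

theorem dkg_N : (dkg M B C).N h = liftMassTerm M h + liftQuad B C h h := rfl

theorem dkg_S : (dkg M B C).S t h =
    liftEp (liftShift t h) + liftEm (liftShift (-t) h) + (h - liftEp h - liftEm h) := rfl

theorem spinSnd_add_spinFst (z : Spinor) : spinSnd z + spinFst z = z :=
  spinor_ext (by simp [spinFst_zero, spinSnd_zero]) (by simp [spinFst_one, spinSnd_one])

theorem compLpL_spin_add (f : Lp Spinor 2 (volume : Measure ℝ)) :
    spinSnd.compLpL 2 volume f + spinFst.compLpL 2 volume f = f := by
  refine Lp.ext ?_
  filter_upwards [spinSnd.coeFn_compLpL f, spinFst.coeFn_compLpL f,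
    Lp.coeFn_add (spinSnd.compLpL 2 volume f) (spinFst.compLpL 2 volume f)] with x h1 h2 h3
  rw [h3, Pi.add_apply, h1, h2, spinSnd_add_spinFst]

/-- The free Dirac evolution. -/
def spinEvol (t : ℝ) :
    Lp Spinor 2 (volume : Measure ℝ) →L[ℝ] Lp Spinor 2 (volume : Measure ℝ) :=
  (spinSnd.compLpL 2 volume).comp (lpShift t) + (spinFst.compLpL 2 volume).comp (lpShift (-t))

theorem spinEvol_apply (f : Lp Spinor 2 (volume : Measure ℝ)) :
    spinEvol t f = spinSnd.compLpL 2 volume (lpShift t f) +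
      spinFst.compLpL 2 volume (lpShift (-t) f) := rfl

theorem liftSpinor_S : liftSpinor ((dkg M B C).S t h) = spinEvol t (liftSpinor h) := by
  have := compLpL_spin_add (liftSpinor h)
  rw [dkg_S, spinEvol_apply]
  simp only [map_add, map_sub, liftSpinor_liftEp, liftSpinor_liftEm, liftSpinor_liftShift]
  nth_rewrite 3 [← this]
  abel

theorem liftLeft_S : liftLeft ((dkg M B C).S t h) = yShift t (liftLeft h) := by
  rw [dkg_S]
  simp

theorem liftRight_S : liftRight ((dkg M B C).S t h) = yShift (-t) (liftRight h) := by
  rw [dkg_S]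
  simp

theorem liftMass_S : liftMass ((dkg M B C).S t h) = liftMass h := by
  rw [dkg_S]
  simp

theorem liftSpinor_N : liftSpinor ((dkg M B C).N h) =
    (massMap M).compLpL 2 volume (liftSpinor h) + diracSource B h h := by
  rw [dkg_N, liftQuad_apply]
  simp

theorem liftLeft_N : liftLeft ((dkg M B C).N h) = (1 / 2 : ℝ) • yJ (waveSource C h h) := by
  rw [dkg_N, liftQuad_apply]
  simp

theorem liftRight_N : liftRight ((dkg M B C).N h) = -(1 / 2 : ℝ) • yJ (waveSource C h h) := by
  rw [dkg_N, liftQuad_apply]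
  simp

theorem liftMass_N : liftMass ((dkg M B C).N h) = 0 := by
  rw [dkg_N, liftQuad_apply]
  simp

end Components

/-! ### Conservation of charge -/

section Charge

theorem inner_spinSnd_spinFst (f g : Lp Spinor 2 (volume : Measure ℝ)) :
    inner ℂ (spinSnd.compLpL 2 volume f) (spinFst.compLpL 2 volume g) = 0 := by
  rw [L2.inner_def]
  refine integral_eq_zero_of_ae ?_
  filter_upwards [spinSnd.coeFn_compLpL f, spinFst.coeFn_compLpL g] with x h1 h2
  rw [h1, h2, PiLp.inner_apply, Fin.sum_univ_two, spinSnd_zero, spinFst_one]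
  simp

theorem norm_add_sq_spin (f g : Lp Spinor 2 (volume : Measure ℝ)) :
    ‖spinSnd.compLpL 2 volume f + spinFst.compLpL 2 volume g‖ ^ 2 =
      ‖spinSnd.compLpL 2 volume f‖ ^ 2 + ‖spinFst.compLpL 2 volume g‖ ^ 2 := by
  rw [sq, sq, sq]
  exact norm_add_sq_eq_norm_sq_add_norm_sq_of_inner_eq_zero (𝕜 := ℂ) _ _
    (inner_spinSnd_spinFst f g)

/-- The two components are orthogonal and each is merely translated, so Pythagoras gives an
isometry. -/
theorem norm_spinEvol (t : ℝ) (f : Lp Spinor 2 (volume : Measure ℝ)) : ‖spinEvol t f‖ = ‖f‖ := by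
  have h1 := norm_add_sq_spin (lpShift t f) (lpShift (-t) f)
  have h2 := norm_add_sq_spin f f
  rw [compLpL_lpShift, compLpL_lpShift, norm_lpShift, norm_lpShift, ← h2, compLpL_spin_add,
    ← compLpL_lpShift, ← compLpL_lpShift, ← spinEvol_apply] at h1
  exact (sq_eq_sq₀ (norm_nonneg _) (norm_nonneg _)).1 h1

theorem re_inner_spinEvol (t : ℝ) (f g : Lp Spinor 2 (volume : Measure ℝ)) :
    (inner ℂ (spinEvol t f) (spinEvol t g)).re = (inner ℂ f g).re := by
  have h1 := re_inner_eq_norm_add_mul_self_sub_norm_sub_mul_self_div_four (𝕜 := ℂ) f g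
  have h2 := re_inner_eq_norm_add_mul_self_sub_norm_sub_mul_self_div_four (𝕜 := ℂ)
    (spinEvol t f) (spinEvol t g)
  rw [← map_add, ← map_sub, norm_spinEvol, norm_spinEvol, ← h1] at h2
  exact h2

theorem re_inner_eq_zero_of_ae {f g : Lp Spinor 2 (volume : Measure ℝ)}
    (h : ∀ᵐ x, (inner ℂ (f x) (g x)).re = 0) : (inner ℂ f g).re = 0 := by
  rw [L2.inner_def]
  have := integral_re (L2.integrable_inner (𝕜 := ℂ) f g)
  refine this.symm.trans (integral_eq_zero_of_ae ?_)
  filter_upwards [h] with x hx using hx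

variable {N : ℕ} (M : ℝ) {B C : Fin N → Matrix (Fin 2) (Fin 2) ℂ}

theorem re_inner_liftSpinor_N (hB : ∀ j, (B j).IsHermitian) (h : Lift N) :
    (inner ℂ (liftSpinor h) (liftSpinor ((dkg M B C).N h))).re = 0 := by
  refine re_inner_eq_zero_of_ae ?_
  rw [liftSpinor_N, diracSource_apply]
  filter_upwards [Lp.coeFn_add ((massMap M).compLpL 2 volume (liftSpinor h))
      ((diracMap B).holder 2 (yTop (liftV h)) (liftSpinor h)),
    (massMap M).coeFn_compLpL (liftSpinor h),
    (diracMap B).coeFn_holder (r := 2) (yTop (liftV h)) (liftSpinor h)] with x h1 h2 h3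
  rw [h1, Pi.add_apply, h2, h3, inner_add_right, Complex.add_re, inner_massMap,
    inner_diracMap hB, add_zero]

variable {T : ℝ} [Fact (0 < T)]

theorem hasDerivAt_primitive {X : Type} [NormedAddCommGroup X] [NormedSpace ℝ X] [CompleteSpace X]
    (f : C(Icc (-T) T, X)) (t : ℝ) :
    HasDerivAt (fun t => ∫ s in (0 : ℝ)..t, f (clamp T s)) (f (clamp T t)) t :=
  intervalIntegral.integral_hasDerivAt_right (intervalIntegrable_extend f 0 t)
    (continuous_extend f).stronglyMeasurable.stronglyMeasurableAtFilter
    (continuous_extend f).continuousAt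

/-- A mild solution in the interaction picture. -/
theorem TransportSystem.IsMild.eq_S {X : Type} [NormedAddCommGroup X] [NormedSpace ℝ X]
    {P : TransportSystem X} {d : X} {u : C(Icc (-T) T, X)} (hu : P.IsMild d u) (t : Icc (-T) T) :
    u t = P.S t (d + ∫ s in (0 : ℝ)..t, P.unapplyS (P.curveN u) (clamp T s)) := by
  conv_lhs => rw [hu]
  rw [ContinuousMap.add_apply, P.free_apply, P.duhamel_apply, map_add, primitive_apply]

/-- Conservation of charge. A mild solution need not be differentiable in time, but S(-t)u(t) is, so
‖ψ‖² can be differentiated in this interaction picture. The free evolution is an isometry, which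
moves the resulting inner product back to ψ and its lower order terms, where its real part vanishes.
-/
theorem norm_liftSpinor_eq (hB : ∀ j, (B j).IsHermitian) {d : Lift N} {u : C(Icc (-T) T, Lift N)}
    (hu : (dkg M B C).IsMild d u) (t : Icc (-T) T) : ‖liftSpinor (u t)‖ = ‖liftSpinor d‖ := by
  set P := dkg M B C with hP
  set w := P.unapplyS (P.curveN u) with hw
  set a : ℝ → Lift N := fun t => d + ∫ s in (0 : ℝ)..t, w (clamp T s) with ha
  have hua (t : Icc (-T) T) : u t = P.S t (a t) := hu.eq_S t
  have hda (t : ℝ) : HasDerivAt a (w (clamp T t)) t := (hasDerivAt_primitive w t).const_add d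
  set b : ℝ → Lp Spinor 2 (volume : Measure ℝ) := fun t => liftSpinor (a t) with hb
  have hdb (t : ℝ) : HasDerivAt b (liftSpinor (w (clamp T t))) t :=
    liftSpinor.hasFDerivAt.comp_hasDerivAt t (hda t)
  have hde (t : ℝ) := (hdb t).inner ℂ (hdb t)
  have hre (t : ℝ) : HasDerivAt (fun t => (inner ℂ (b t) (b t)).re)
      (2 * (inner ℂ (b t) (liftSpinor (w (clamp T t)))).re) t := by
    have h1 := (Complex.reCLM.hasFDerivAt (x := inner ℂ (b t) (b t))).comp_hasDerivAt t (hde t)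
    refine h1.congr_deriv ?_
    rw [Complex.reCLM_apply, Complex.add_re, ← inner_conj_symm (liftSpinor (w (clamp T t))) (b t),
      Complex.conj_re]
    ring
  have hzero (t : Icc (-T) T) : (inner ℂ (b t) (liftSpinor (w (clamp T t)))).re = 0 := by
    rw [clamp_coe, ← re_inner_spinEvol t]
    have h1 : spinEvol t (b t) = liftSpinor (u t) := by
      rw [hua, liftSpinor_S]
    have h2 : spinEvol t (liftSpinor (w t)) = liftSpinor (P.N (u t)) := by
      rw [← liftSpinor_S M B C, hw, P.unapplyS_apply, P.S_S_neg, P.curveN_apply]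
    rw [h1, h2, re_inner_liftSpinor_N M hB]
  have hconst : ∀ t ∈ Icc (-T) T, (inner ℂ (b t) (b t)).re = (inner ℂ (b (-T)) (b (-T))).re := by
    refine constant_of_has_deriv_right_zero
      (fun t _ => (hre t).continuousAt.continuousWithinAt) fun t ht => ?_
    have h1 := hzero ⟨t, Ico_subset_Icc_self ht⟩
    have h2 := hre t
    rw [show (inner ℂ (b t) (liftSpinor (w (clamp T t)))).re = 0 from h1, mul_zero] at h2
    exact h2.hasDerivWithinAt
  have h0 := (hconst t t.2).trans (hconst 0 (zeroTime T).2).symm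
  have h1 (t : ℝ) : (inner ℂ (b t) (b t)).re = ‖b t‖ ^ 2 := inner_self_eq_norm_sq (𝕜 := ℂ) (b t)
  rw [h1, h1] at h0
  have h2 := (sq_eq_sq₀ (norm_nonneg _) (norm_nonneg _)).1 h0
  rw [hua, liftSpinor_S, norm_spinEvol]
  refine h2.trans ?_
  simp [hb, ha]

end Charge

/-! ### A priori bound -/

section Bound

variable {N : ℕ} (M : ℝ) {B C : Fin N → Matrix (Fin 2) (Fin 2) ℂ} {T : ℝ} [Fact (0 < T)]

/-- The mass density is neither transported nor forced: it is a parameter carried along as an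
unknown. -/
theorem liftMass_eq {d : Lift N} {u : C(Icc (-T) T, Lift N)}
    (hu : (dkg M B C).IsMild d u) (t : Icc (-T) T) : liftMass (u t) = liftMass d := by
  rw [hu.eq_S t, liftMass_S, map_add, ← ContinuousLinearMap.intervalIntegral_comp_comm _
    (intervalIntegrable_extend _ _ _)]
  have : ∀ s, liftMass ((dkg M B C).unapplyS ((dkg M B C).curveN u) (clamp T s)) = 0 := fun s => by
    rw [TransportSystem.unapplyS_apply, liftMass_S, TransportSystem.curveN_apply, liftMass_N]
  simp [this]

theorem norm_current_le (f : Lp Spinor 2 (volume : Measure ℝ)) :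
    ‖(currentMap C).holder 1 f f‖ ≤
      ‖(currentMap C).holderL (volume : Measure ℝ) 2 2 1‖ * ‖f‖ * ‖f‖ :=
  ((currentMap C).holderL (volume : Measure ℝ) 2 2 1).le_opNorm₂ f f

theorem norm_damp_le (f : Lp ℝ 1 (volume : Measure ℝ)) (V : Y N) :
    ‖(dampMap (N := N)).holder 1 f (yTop V)‖ ≤
      ‖(dampMap (N := N)).holderL (volume : Measure ℝ) 1 ⊤ 1‖ * ‖f‖ * (‖yTop (N := N)‖ * ‖V‖) :=
  (((dampMap (N := N)).holderL (volume : Measure ℝ) 1 ⊤ 1).le_opNorm₂ f (yTop V)).trans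
    (mul_le_mul_of_nonneg_left (yTop.le_opNorm V) (by positivity))

variable (C) in
-- The point is the shape of the bound: quadratic only in the spinor, whose norm is conserved, and
-- linear in the movers with the conserved mass density as coefficient. Hence Gronwall applies.
theorem norm_waveSource_le : ∃ c : ℝ, 0 < c ∧ ∀ h : Lift N, ‖waveSource C h h‖ ≤
    c * (‖liftSpinor h‖ ^ 2 + ‖liftMass h‖ * (‖liftLeft h‖ + ‖liftRight h‖)) := by
  have key : ∀ c1 c2 c3 a b l r n : ℝ, 0 ≤ c1 → 0 ≤ c2 → 0 ≤ c3 → 0 ≤ b → 0 ≤ n → n ≤ l + r →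
      c1 * a * a + c2 * b * (c3 * n) ≤ (c1 + c2 * c3 + 1) * (a ^ 2 + b * (l + r)) := by
    intro c1 c2 c3 a b l r n h1 h2 h3 hb hn hlr
    have e1 : c2 * b * (c3 * n) ≤ c2 * b * (c3 * (l + r)) := by gcongr
    have e2 : 0 ≤ b * (l + r) := mul_nonneg hb (hn.trans hlr)
    have e3 : 0 ≤ a ^ 2 := sq_nonneg a
    nlinarith [mul_nonneg (mul_nonneg h2 h3) e3, mul_nonneg h1 e2]
  refine ⟨‖(currentMap C).holderL (volume : Measure ℝ) 2 2 1‖ +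
    ‖(dampMap (N := N)).holderL (volume : Measure ℝ) 1 ⊤ 1‖ * ‖yTop (N := N)‖ + 1, ?_, fun h => ?_⟩
  · positivity
  · rw [waveSource_apply]
    refine (norm_add_le _ _).trans ((add_le_add (norm_current_le (liftSpinor h))
      (norm_damp_le (liftMass h) (liftV h))).trans ?_)
    refine key _ _ _ _ _ _ _ _ (ContinuousLinearMap.opNorm_nonneg _)
      (ContinuousLinearMap.opNorm_nonneg _) (ContinuousLinearMap.opNorm_nonneg _) (norm_nonneg _)
      (norm_nonneg _) ?_
    rw [liftV_apply]
    exact norm_add_le _ _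

/-- Stated for an abstract component f so that left and right movers share one proof. -/
theorem norm_component_le (f : Lift N →L[ℝ] Y N) (hf : ∀ h, ‖f h‖ ≤ ‖h‖)
    (hS : ∀ t h, ‖f ((dkg M B C).S t h)‖ ≤ ‖f h‖)
    (hN : ∀ h, ‖f ((dkg M B C).N h)‖ ≤ ‖yJ (N := N)‖ * ‖waveSource C h h‖)
    {d : Lift N} {u : C(Icc (-T) T, Lift N)} (hu : (dkg M B C).IsMild d u)
    {g : C(Icc (-T) T, ℝ)} (hg : ∀ t, ‖waveSource C (u t) (u t)‖ ≤ g t) (t : Icc (-T) T) :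
    ‖f (u t)‖ ≤ ‖d‖ + ‖yJ (N := N)‖ * |primitive g t| := by
  rw [hu.eq_S t]
  refine (hS _ _).trans ?_
  rw [map_add, ← ContinuousLinearMap.intervalIntegral_comp_comm _
    (intervalIntegrable_extend _ _ _)]
  refine (norm_add_le _ _).trans (add_le_add (hf d) ?_)
  rw [primitive_apply, ← abs_of_nonneg (norm_nonneg (yJ (N := N))), ← abs_mul,
    ← intervalIntegral.integral_const_mul]
  refine intervalIntegral.norm_integral_le_abs_of_norm_le ?_
    ((intervalIntegrable_extend g 0 t).const_mul _)
  refine Eventually.of_forall fun s => ?_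
  rw [TransportSystem.unapplyS_apply, TransportSystem.curveN_apply]
  refine (hS _ _).trans ((hN _).trans ?_)
  gcongr
  exact hg _

set_option maxHeartbeats 1000000 in
-- Charge and mass density are conserved, so the wave source is bounded by an affine function of g =
-- ‖left‖ + ‖right‖. Integrating the equations of both movers gives an affine integral inequality
-- for g.
theorem norm_le_of_isMild (hB : ∀ j, (B j).IsHermitian) (r : ℝ) :
    ∃ R : ℝ, ∀ (d : Lift N) (u : C(Icc (-T) T, Lift N)), ‖d‖ ≤ r → (dkg M B C).IsMild d u →
      ‖u‖ ≤ R := by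
  have hT : 0 ≤ T := (Fact.out (p := 0 < T)).le
  obtain ⟨c, hc, hW⟩ := norm_waveSource_le C
  set j := ‖yJ (N := N)‖ with hj
  set r' := |r| with hr'
  -- The constants a and k result from adding the two mover estimates, hence the factors 2. The + 1
  -- in k only secures positivity for Gronwall.
  set a : ℝ := 2 * r' + 2 * j * (c * r' ^ 2 * T) with ha
  set k : ℝ := 2 * j * (c * r') + 1 with hk
  have ha0 : 0 ≤ a := by positivity
  have hk0 : 0 < k := by positivity
  refine ⟨max r' (2 * a * Real.exp (2 * k * T)), fun d u hd hu => ?_⟩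
  have hdr : ‖d‖ ≤ r' := hd.trans (le_abs_self r)
  have hcomp := (norm_lift_eq d).symm.le.trans hdr
  simp only [max_le_iff] at hcomp
  obtain ⟨hd1, -, -, hd4⟩ := hcomp
  have hcompn (h : Lift N) : ‖liftLeft h‖ ≤ ‖h‖ ∧ ‖liftRight h‖ ≤ ‖h‖ := by
    have := (norm_lift_eq h).symm.le
    simp only [max_le_iff] at this
    exact ⟨this.2.1, this.2.2.1⟩
  have hs (t : Icc (-T) T) : ‖liftSpinor (u t)‖ ≤ r' := (norm_liftSpinor_eq M hB hu t).trans_le hd1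
  have hm (t : Icc (-T) T) : ‖liftMass (u t)‖ ≤ r' := by rw [liftMass_eq M hu]; exact hd4
  set g : C(Icc (-T) T, ℝ) :=
    ⟨fun t => ‖liftLeft (u t)‖ + ‖liftRight (u t)‖, by fun_prop⟩ with hg
  have hgt (t) : g t = ‖liftLeft (u t)‖ + ‖liftRight (u t)‖ := rfl
  set G : C(Icc (-T) T, ℝ) := ContinuousMap.const _ (c * r' ^ 2) + (c * r') • g with hG
  have hGt (t) : G t = c * r' ^ 2 + c * r' * g t := rfl
  have hg0 (t) : 0 ≤ g t := by rw [hgt]; positivity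
  have hWG (t : Icc (-T) T) : ‖waveSource C (u t) (u t)‖ ≤ G t := by
    refine (hW (u t)).trans ?_
    rw [hGt, ← hgt, mul_add, mul_assoc c r']
    have := hg0 t
    gcongr
    · exact hs t
    · exact hm t
  have hGp (t : Icc (-T) T) : |primitive G t| ≤ c * r' ^ 2 * T + c * r' * |primitive g t| := by
    rw [hG, map_add, map_smul, ContinuousMap.add_apply, ContinuousMap.smul_apply, smul_eq_mul]
    refine (abs_add_le _ _).trans ?_
    rw [abs_mul (c * r'), abs_of_nonneg (by positivity : 0 ≤ c * r')]
    gcongr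
    rw [primitive_apply]
    simp only [ContinuousMap.const_apply, intervalIntegral.integral_const, sub_zero, smul_eq_mul]
    rw [abs_mul, abs_of_nonneg (by positivity : 0 ≤ c * r' ^ 2), mul_comm]
    gcongr
    exact abs_le.2 t.2
  have hhalf (h : Lift N) : ‖(1 / 2 : ℝ) • yJ (waveSource C h h)‖ ≤ j * ‖waveSource C h h‖ := by
    rw [norm_smul]
    have h1 := yJ.le_opNorm (waveSource C h h)
    have h2 : ‖(1 / 2 : ℝ)‖ ≤ 1 := by norm_num
    exact (mul_le_of_le_one_left (norm_nonneg _) h2).trans h1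
  have h1 := norm_component_le M (B := B) (C := C) liftLeft (fun h => (hcompn h).1)
    (fun t h => by rw [liftLeft_S]; exact norm_yShift_le _ _)
    (fun h => by rw [liftLeft_N]; exact hhalf h) hu hWG
  have h2 := norm_component_le M (B := B) (C := C) liftRight (fun h => (hcompn h).2)
    (fun t h => by rw [liftRight_S]; exact norm_yShift_le _ _)
    (fun h => by rw [liftRight_N, neg_smul, norm_neg]; exact hhalf h) hu hWG
  have hbound := le_exp_of_le_integral (g := g) ha0 hk0 hg0 (fun t => by
    have e1 := h1 t
    have e2 := h2 t
    have e3 := hGp t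
    have e4 : j * |primitive G t| ≤ j * (c * r' ^ 2 * T + c * r' * |primitive g t|) := by gcongr
    have e5 := abs_nonneg (primitive g t)
    rw [hgt, ha, hk]
    nlinarith)
  refine (ContinuousMap.norm_le _ (by positivity)).2 fun t => ?_
  have hb := hbound t
  rw [hgt] at hb
  have n1 := norm_nonneg (liftLeft (u t))
  have n2 := norm_nonneg (liftRight (u t))
  rw [norm_lift_eq]
  exact max_le (le_max_of_le_left (hs t)) (max_le (le_max_of_le_right (by linarith))
    (max_le (le_max_of_le_right (by linarith)) (le_max_of_le_left (hm t))))

/-- Global existence for the Dirac–Klein–Gordon system. -/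
theorem solvable_dkg (hB : ∀ j, (B j).IsHermitian) : (dkg M B C).Solvable T :=
  (dkg M B C).solvable_of_bound (norm_le_of_isMild M hB)

end Bound

/-! ### Pairing with compactly supported functions -/

section Pairing

variable {E F : Type} [NormedAddCommGroup E] [NormedSpace ℝ E] [CompleteSpace E]
  [NormedAddCommGroup F] [NormedSpace ℝ F] [CompleteSpace F]
  {p : ℝ≥0∞} [Fact (1 ≤ p)]

instance : Fact (1 ≤ ENNReal.conjExponent p) := ⟨by simp [ENNReal.conjExponent]⟩

variable (p) in
/-- The indicator function of `[-ρ, ρ]`. -/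
def boxInd (ρ : ℝ) : Lp ℝ p (volume : Measure ℝ) :=
  indicatorConstLp p (measurableSet_Icc (a := -ρ) (b := ρ)) (by simp) (1 : ℝ)

theorem coeFn_boxInd (ρ : ℝ) : boxInd p ρ =ᵐ[volume] (Icc (-ρ) ρ).indicator fun _ => (1 : ℝ) :=
  indicatorConstLp_coeFn

/-- Restriction to `[-ρ, ρ]`, as an integrable function. -/
def boxCut (ρ : ℝ) : Lp E p (volume : Measure ℝ) →L[ℝ] Lp E 1 (volume : Measure ℝ) :=
  (ContinuousLinearMap.lsmul ℝ ℝ : ℝ →L[ℝ] E →L[ℝ] E).holderL volume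
    (ENNReal.conjExponent p) p 1 (boxInd _ ρ)

theorem coeFn_boxCut (ρ : ℝ) (f : Lp E p (volume : Measure ℝ)) :
    boxCut ρ f =ᵐ[volume] (Icc (-ρ) ρ).indicator f := by
  filter_upwards [(ContinuousLinearMap.lsmul ℝ ℝ : ℝ →L[ℝ] E →L[ℝ] E).coeFn_holder (r := 1)
    (boxInd (ENNReal.conjExponent p) ρ) f, coeFn_boxInd (p := ENNReal.conjExponent p) ρ]
    with x h1 h2
  refine h1.trans ?_
  rw [h2]
  by_cases hx : x ∈ Icc (-ρ) ρ <;> simp [hx]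

/-- The integral of an element of `L¹`. -/
def lpIntegral : Lp E 1 (volume : Measure ℝ) →L[ℝ] E :=
  clmOfBound (fun f => ∫ x, f x)
    (fun f g => by
      rw [← integral_add (integrable_lp_one f) (integrable_lp_one g)]
      exact integral_congr_ae (Lp.coeFn_add f g))
    (fun c f => by
      rw [← integral_smul]
      exact integral_congr_ae (Lp.coeFn_smul c f)) 1
    (fun f => by
      rw [one_mul, L1.norm_eq_integral_norm]
      exact norm_integral_le_integral_norm _)

/-- The pairing of `φ` and `f` over `[-ρ, ρ]`. -/
def pairL (ρ : ℝ) : (ℝ →ᵇ ℝ) →L[ℝ] Lp E p (volume : Measure ℝ) →L[ℝ] E :=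
  (ContinuousLinearMap.compL ℝ _ _ _ lpIntegral) ∘L
    (((ContinuousLinearMap.lsmul ℝ ℝ : ℝ →L[ℝ] E →L[ℝ] E).holderL volume ⊤ 1 1).bilinearComp
      bcfTop (boxCut ρ))

theorem pairL_apply (ρ : ℝ) (φ : ℝ →ᵇ ℝ) (f : Lp E p (volume : Measure ℝ)) :
    pairL ρ φ f = lpIntegral ((ContinuousLinearMap.lsmul ℝ ℝ : ℝ →L[ℝ] E →L[ℝ] E).holder 1
      (bcfTop φ) (boxCut ρ f)) := rfl

/-- Realizes the pairing with test functions of a given support as a continuous bilinear map, with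
the supremum norm on φ. Pairings along curves can then be differentiated by the product rule. -/
theorem pairL_eq (ρ : ℝ) (φ : ℝ →ᵇ ℝ) (f : Lp E p (volume : Measure ℝ))
    (hφ : ∀ x, φ x ≠ 0 → x ∈ Icc (-ρ) ρ) : pairL ρ φ f = ∫ x, φ x • f x := by
  rw [pairL_apply]
  refine integral_congr_ae ?_
  filter_upwards [(ContinuousLinearMap.lsmul ℝ ℝ : ℝ →L[ℝ] E →L[ℝ] E).coeFn_holder (r := 1)
    (bcfTop φ) (boxCut ρ f), coeFn_bcfTop φ, coeFn_boxCut ρ f] with x h1 h2 h3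
  refine h1.trans ?_
  rw [h2, h3]
  by_cases hx : φ x = 0
  · simp [hx]
  · simp [hφ x hx]

theorem integrable_smul_lp (f : Lp E p (volume : Measure ℝ)) {φ : ℝ → ℝ} (hφ : Continuous φ)
    (hc : HasCompactSupport φ) : Integrable (fun x => φ x • f x) volume :=
  ((Lp.memLp f).locallyIntegrable Fact.out).integrable_smul_left_of_hasCompactSupport hφ hc

end Pairing

/-! ### Compactly supported smooth functions of space and time -/

/-- Smooth compactly supported functions on `ℝ × ℝ`. -/
def IsBump (φ : ℝ → ℝ → ℝ) : Prop :=
  ContDiff ℝ ∞ (Function.uncurry φ) ∧ HasCompactSupport (Function.uncurry φ)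

section Bump

variable {φ : ℝ → ℝ → ℝ}

theorem IsTest.isBump {T : ℝ} (h : IsTest T φ) : IsBump φ := ⟨h.1, h.2.1⟩

theorem IsBump.hasFDerivAt (h : IsBump φ) (p : ℝ × ℝ) :
    HasFDerivAt (Function.uncurry φ) (fderiv ℝ (Function.uncurry φ) p) p :=
  ((h.1.differentiable (by simp)) p).hasFDerivAt

theorem IsBump.hasDerivAt_dt (h : IsBump φ) (t x : ℝ) :
    HasDerivAt (fun s => φ s x) (dt φ t x) t := by
  have h1 : HasDerivAt (fun s : ℝ => (s, x)) ((1 : ℝ), (0 : ℝ)) t :=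
    (hasDerivAt_id t).prodMk (hasDerivAt_const t x)
  have h2 := (h.hasFDerivAt (t, x)).comp_hasDerivAt t h1
  exact h2.differentiableAt.hasDerivAt

theorem IsBump.dt_eq (h : IsBump φ) (t x : ℝ) :
    dt φ t x = fderiv ℝ (Function.uncurry φ) (t, x) (1, 0) := by
  have h1 : HasDerivAt (fun s : ℝ => (s, x)) ((1 : ℝ), (0 : ℝ)) t :=
    (hasDerivAt_id t).prodMk (hasDerivAt_const t x)
  exact ((h.hasFDerivAt (t, x)).comp_hasDerivAt t h1).deriv

theorem IsBump.dx_eq (h : IsBump φ) (t x : ℝ) :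
    dx φ t x = fderiv ℝ (Function.uncurry φ) (t, x) (0, 1) := by
  have h1 : HasDerivAt (fun y : ℝ => (t, y)) ((0 : ℝ), (1 : ℝ)) x :=
    (hasDerivAt_const x t).prodMk (hasDerivAt_id x)
  exact ((h.hasFDerivAt (t, x)).comp_hasDerivAt x h1).deriv

theorem IsBump.uncurry_dt (h : IsBump φ) : Function.uncurry (dt φ) =
    fun p => fderiv ℝ (Function.uncurry φ) p (1, 0) := funext fun p => h.dt_eq p.1 p.2

theorem IsBump.uncurry_dx (h : IsBump φ) : Function.uncurry (dx φ) =
    fun p => fderiv ℝ (Function.uncurry φ) p (0, 1) := funext fun p => h.dx_eq p.1 p.2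

theorem IsBump.fderiv_apply (h : IsBump φ) (v : ℝ × ℝ) :
    ContDiff ℝ ∞ (fun p => fderiv ℝ (Function.uncurry φ) p v) :=
  (h.1.fderiv_right (m := ∞) (by simp)).clm_apply contDiff_const

theorem IsBump.dt (h : IsBump φ) : IsBump (dt φ) := by
  rw [IsBump, h.uncurry_dt]
  exact ⟨h.fderiv_apply _, h.2.fderiv_apply ℝ _⟩

theorem IsBump.dx (h : IsBump φ) : IsBump (dx φ) := by
  rw [IsBump, h.uncurry_dx]
  exact ⟨h.fderiv_apply _, h.2.fderiv_apply ℝ _⟩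

theorem IsBump.tsupport_dt (h : IsBump φ) :
    tsupport (Function.uncurry (MDKG.dt φ)) ⊆ tsupport (Function.uncurry φ) := by
  rw [h.uncurry_dt]
  exact closure_minimal (fun p hp => support_fderiv_subset ℝ fun h0 => hp (by simp [h0]))
    (isClosed_tsupport _)

theorem IsBump.tsupport_dx (h : IsBump φ) :
    tsupport (Function.uncurry (MDKG.dx φ)) ⊆ tsupport (Function.uncurry φ) := by
  rw [h.uncurry_dx]
  exact closure_minimal (fun p hp => support_fderiv_subset ℝ fun h0 => hp (by simp [h0]))
    (isClosed_tsupport _)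

theorem IsTest.dt {T : ℝ} (h : IsTest T φ) : IsTest T (dt φ) :=
  ⟨h.isBump.dt.1, h.isBump.dt.2, h.isBump.tsupport_dt.trans h.2.2⟩

theorem IsTest.dx {T : ℝ} (h : IsTest T φ) : IsTest T (dx φ) :=
  ⟨h.isBump.dx.1, h.isBump.dx.2, h.isBump.tsupport_dx.trans h.2.2⟩

theorem IsBump.dt_dx_comm (h : IsBump φ) (t x : ℝ) : MDKG.dt (MDKG.dx φ) t x =
    MDKG.dx (MDKG.dt φ) t x := by
  rw [h.dx.dt_eq, h.dt.dx_eq, h.uncurry_dx, h.uncurry_dt]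
  have hd : DifferentiableAt ℝ (fderiv ℝ (Function.uncurry φ)) (t, x) :=
    (h.1.fderiv_right (m := ∞) (by simp)).differentiable (by simp) _
  have e (v w : ℝ × ℝ) : fderiv ℝ (fun p => fderiv ℝ (Function.uncurry φ) p v) (t, x) w =
      fderiv ℝ (fderiv ℝ (Function.uncurry φ)) (t, x) w v := by
    have := (hd.hasFDerivAt.clm_apply (hasFDerivAt_const v (t, x))).fderiv
    rw [this]
    simp
  rw [e, e]
  have hs : IsSymmSndFDerivAt ℝ (Function.uncurry φ) (t, x) :=
    h.1.contDiffAt.isSymmSndFDerivAt (by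
      simp only [minSmoothness_of_isRCLikeNormedField]; exact ENat.LEInfty.out)
  exact hs _ _

theorem IsBump.exists_bound (h : IsBump φ) : ∃ ρ : ℝ, 0 < ρ ∧ ∀ t x, φ t x ≠ 0 →
    t ∈ Icc (-ρ) ρ ∧ x ∈ Icc (-ρ) ρ := by
  obtain ⟨ρ, hρ⟩ := h.2.isCompact.isBounded.subset_closedBall (0 : ℝ × ℝ)
  refine ⟨max ρ 1, by positivity, fun t x htx => ?_⟩
  have h1 := hρ (subset_tsupport (Function.uncurry φ) (show (t, x) ∈ _ from htx))
  rw [mem_closedBall_zero_iff, Prod.norm_def] at h1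
  have h2 := (max_le_iff.1 h1)
  exact ⟨abs_le.1 (h2.1.trans (le_max_left _ _)), abs_le.1 (h2.2.trans (le_max_left _ _))⟩

theorem IsBump.continuous_right (h : IsBump φ) (t : ℝ) : Continuous (φ t) :=
  h.1.continuous.comp (by fun_prop : Continuous fun x : ℝ => (t, x))

theorem IsBump.hasCompactSupport_right (h : IsBump φ) (t : ℝ) : HasCompactSupport (φ t) := by
  obtain ⟨ρ, -, hρ⟩ := h.exists_bound
  exact HasCompactSupport.intro (isCompact_Icc (a := -ρ) (b := ρ)) fun x hx => by
    by_contra h0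
    exact hx (hρ t x h0).2

theorem IsBump.contDiff_right (h : IsBump φ) (t : ℝ) : ContDiff ℝ ∞ (φ t) :=
  h.1.comp (by fun_prop : ContDiff ℝ ∞ fun x : ℝ => (t, x))

/-- Time slices, as bounded continuous functions. -/
def slice (h : IsBump φ) (t : ℝ) : ℝ →ᵇ ℝ :=
  BoundedContinuousFunction.ofNormedAddCommGroup (φ t) (h.continuous_right t)
    (h.2.exists_bound_of_continuous h.1.continuous).choose
    (fun x => (h.2.exists_bound_of_continuous h.1.continuous).choose_spec (t, x))

theorem slice_apply (h : IsBump φ) (t x : ℝ) : slice h t x = φ t x := rfl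

theorem continuous_slice (h : IsBump φ) : Continuous (slice h) := by
  have hu := h.2.uniformContinuous_of_continuous h.1.continuous
  rw [Metric.continuous_iff]
  intro t ε hε
  obtain ⟨δ, hδ, H⟩ := Metric.uniformContinuous_iff.1 hu (ε / 2) (by positivity)
  refine ⟨δ, hδ, fun s hs => ?_⟩
  refine lt_of_le_of_lt ((BoundedContinuousFunction.dist_le (by positivity)).2 fun x => ?_)
    (half_lt_self hε)
  exact (H (a := (s, x)) (b := (t, x)) (by
    rw [Prod.dist_eq, dist_self]; exact max_lt hs hδ)).le

/-- The derivative exists in the supremum norm because the slices are a primitive of the continuous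
curve of slices of ∂ₜφ; this identity is checked pointwise in x. -/
theorem hasDerivAt_slice (h : IsBump φ) (t : ℝ) : HasDerivAt (slice h) (slice h.dt t) t := by
  have hc := continuous_slice h.dt
  have h1 : HasDerivAt (fun t => slice h 0 + ∫ s in (0 : ℝ)..t, slice h.dt s) (slice h.dt t) t :=
    (intervalIntegral.integral_hasDerivAt_right (hc.intervalIntegrable (μ := volume) _ _)
      hc.stronglyMeasurable.stronglyMeasurableAtFilter hc.continuousAt).const_add _
  refine h1.congr_of_eventuallyEq (Eventually.of_forall fun t => ?_)
  ext x
  have h2 := (BoundedContinuousFunction.evalCLM ℝ x).intervalIntegral_comp_comm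
    (hc.intervalIntegrable (μ := volume) 0 t)
  have h3 : (∫ s in (0 : ℝ)..t, slice h.dt s) x = ∫ s in (0 : ℝ)..t, MDKG.dt φ s x := h2.symm
  have h4 : Continuous fun s => MDKG.dt φ s x :=
    h.dt.1.continuous.comp (by fun_prop : Continuous fun s : ℝ => (s, x))
  rw [BoundedContinuousFunction.add_apply, h3, slice_apply, slice_apply,
    intervalIntegral.integral_eq_sub_of_hasDerivAt (fun s _ => h.hasDerivAt_dt s x)
      (h4.intervalIntegrable (μ := volume) 0 t)]
  ring

end Bump

/-! ### Pairing in space and time -/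

section SpaceTime

variable {E F : Type} [NormedAddCommGroup E] [NormedSpace ℝ E] [CompleteSpace E]
  [NormedAddCommGroup F] [NormedSpace ℝ F] [CompleteSpace F]
  {p q : ℝ≥0∞} [Fact (1 ≤ p)] [Fact (1 ≤ q)] {T : ℝ} {φ : ℝ → ℝ → ℝ}

variable (T) in
/-- The pairing of `φ` and `f` over `(-T, T) × ℝ`. -/
def dbl (φ : ℝ → ℝ → ℝ) (f : ℝ → Lp E p (volume : Measure ℝ)) : E :=
  ∫ t in (-T)..T, ∫ x, φ t x • f t x

theorem IsBump.exists_pairL (h : IsBump φ) : ∃ ρ : ℝ, ∀ t (f : Lp E p (volume : Measure ℝ)),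
    pairL ρ (slice h t) f = ∫ x, φ t x • f x := by
  obtain ⟨ρ, -, hρ⟩ := h.exists_bound
  exact ⟨ρ, fun t f => pairL_eq ρ (slice h t) f fun x hx => (hρ t x hx).2⟩

theorem IsBump.continuous_integral (h : IsBump φ) {f : ℝ → Lp E p (volume : Measure ℝ)}
    (hf : Continuous f) : Continuous fun t => ∫ x, φ t x • f t x := by
  obtain ⟨ρ, hρ⟩ := h.exists_pairL (E := E) (p := p)
  simp only [← hρ]
  exact ((pairL ρ).continuous.comp (continuous_slice h)).clm_apply hf

theorem IsBump.integrable (h : IsBump φ) (f : Lp E p (volume : Measure ℝ)) (t : ℝ) :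
    Integrable (fun x => φ t x • f x) volume :=
  integrable_smul_lp f (h.continuous_right t) (h.hasCompactSupport_right t)

theorem IsBump.intervalIntegrable (h : IsBump φ) {f : ℝ → Lp E p (volume : Measure ℝ)}
    (hf : Continuous f) (a b : ℝ) :
    IntervalIntegrable (fun t => ∫ x, φ t x • f t x) volume a b :=
  (h.continuous_integral hf).intervalIntegrable a b

theorem dbl_add (h : IsBump φ) {f g : ℝ → Lp E p (volume : Measure ℝ)}
    (hf : Continuous f) (hg : Continuous g) :
    dbl T φ (fun t => f t + g t) = dbl T φ f + dbl T φ g := by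
  rw [dbl, dbl, dbl, ← intervalIntegral.integral_add (h.intervalIntegrable hf _ _)
    (h.intervalIntegrable hg _ _)]
  refine intervalIntegral.integral_congr fun t _ => ?_
  rw [← integral_add (h.integrable _ _) (h.integrable _ _)]
  refine integral_congr_ae ?_
  filter_upwards [Lp.coeFn_add (f t) (g t)] with x hx
  rw [hx, Pi.add_apply, smul_add]

theorem dbl_smul (c : ℝ) (f : ℝ → Lp E p (volume : Measure ℝ)) :
    dbl T φ (fun t => c • f t) = c • dbl T φ f := by
  rw [dbl, dbl, ← intervalIntegral.integral_smul]
  refine intervalIntegral.integral_congr fun t _ => ?_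
  change ∫ x, φ t x • (c • f t) x = c • ∫ x, φ t x • f t x
  rw [← integral_smul]
  refine integral_congr_ae ?_
  filter_upwards [Lp.coeFn_smul c (f t)] with x hx
  rw [hx, Pi.smul_apply, smul_comm]

theorem dbl_neg (f : ℝ → Lp E p (volume : Measure ℝ)) :
    dbl T φ (fun t => -f t) = -dbl T φ f := by
  have := dbl_smul (T := T) (φ := φ) (-1) f
  simpa using this

theorem dbl_sub (h : IsBump φ) {f g : ℝ → Lp E p (volume : Measure ℝ)}
    (hf : Continuous f) (hg : Continuous g) :
    dbl T φ (fun t => f t - g t) = dbl T φ f - dbl T φ g := by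
  simp only [sub_eq_add_neg]
  rw [dbl_add h hf (g := fun t => -g t) hg.neg, dbl_neg]

/-- The pairing depends on values only, up to a linear map. -/
theorem dbl_map (h : IsBump φ) (L : E →L[ℝ] F) {f : ℝ → Lp E p (volume : Measure ℝ)}
    (hf : Continuous f) {g : ℝ → Lp F q (volume : Measure ℝ)}
    (hg : ∀ t, g t =ᵐ[volume] fun x => L (f t x)) : dbl T φ g = L (dbl T φ f) := by
  rw [dbl, dbl, ← L.intervalIntegral_comp_comm (h.intervalIntegrable hf _ _)]
  refine intervalIntegral.integral_congr fun t _ => ?_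
  change ∫ x, φ t x • g t x = L (∫ x, φ t x • f t x)
  rw [← L.integral_comp_comm (h.integrable _ _)]
  refine integral_congr_ae ?_
  filter_upwards [hg t] with x hx
  rw [hx, map_smul]

theorem IsTest.eq_zero_of_notMem (h : IsTest T φ) {t : ℝ} (ht : t ∉ Ioo (-T) T) (x : ℝ) :
    φ t x = 0 := by
  by_contra h0
  exact ht (h.2.2 (subset_tsupport (Function.uncurry φ) (show (t, x) ∈ _ from h0))).1

/-- Integration by parts in time. -/
theorem dbl_dt (hT : 0 < T) (h : IsTest T φ) {f f' : ℝ → Lp E p (volume : Measure ℝ)}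
    (hf : Continuous f) (hf' : Continuous f') (hd : ∀ t ∈ Ioo (-T) T, HasDerivAt f (f' t) t) :
    dbl T (dt φ) f = -dbl T φ f' := by
  obtain ⟨ρ, hρ0, hρ⟩ := h.isBump.exists_bound
  obtain ⟨ρ', hρ0', hρ'⟩ := h.isBump.dt.exists_bound
  have e1 (t) (g : Lp E p (volume : Measure ℝ)) :
      pairL (max ρ ρ') (slice h.isBump t) g = ∫ x, φ t x • g x :=
    pairL_eq _ _ _ fun x hx => by
      have := (hρ t x hx).2
      have h1 := le_max_left ρ ρ'
      exact ⟨by linarith [this.1], by linarith [this.2]⟩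
  have e2 (t) (g : Lp E p (volume : Measure ℝ)) :
      pairL (max ρ ρ') (slice h.isBump.dt t) g = ∫ x, dt φ t x • g x :=
    pairL_eq _ _ _ fun x hx => by
      have := (hρ' t x hx).2
      have h1 := le_max_right ρ ρ'
      exact ⟨by linarith [this.1], by linarith [this.2]⟩
  set B := pairL (E := E) (p := p) (max ρ ρ') with hB
  have hg : ∀ t ∈ Ioo (-T) T, HasDerivAt (fun t => B (slice h.isBump t) (f t))
      (B (slice h.isBump t) (f' t) + B (slice h.isBump.dt t) (f t)) t := fun t ht =>
    B.hasDerivAt_of_bilinear (fun _ => hasDerivAt_slice h.isBump t) (fun _ => hd t ht)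
  have c1 : Continuous fun t => B (slice h.isBump t) (f' t) :=
    (B.continuous.comp (continuous_slice h.isBump)).clm_apply hf'
  have c2 : Continuous fun t => B (slice h.isBump.dt t) (f t) :=
    (B.continuous.comp (continuous_slice h.isBump.dt)).clm_apply hf
  have c3 : Continuous fun t => B (slice h.isBump t) (f t) :=
    (B.continuous.comp (continuous_slice h.isBump)).clm_apply hf
  have h1 := intervalIntegral.integral_eq_sub_of_hasDerivAt_of_le (by linarith : -T ≤ T)
    c3.continuousOn hg ((c1.add c2).intervalIntegrable _ _)
  rw [intervalIntegral.integral_add (c1.intervalIntegrable _ _) (c2.intervalIntegrable _ _)] at h1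
  simp only [e1, e2] at h1
  have z1 : ∫ x, φ T x • f T x = 0 := by
    simp [h.eq_zero_of_notMem (t := T) (by simp)]
  have z2 : ∫ x, φ (-T) x • f (-T) x = 0 := by
    simp [h.eq_zero_of_notMem (t := -T) (by simp)]
  rw [z1, z2, sub_zero] at h1
  rw [dbl, dbl]
  exact eq_neg_of_add_eq_zero_right h1

/-- `φ(t, x - ct)`. -/
def skew (c : ℝ) (φ : ℝ → ℝ → ℝ) (t x : ℝ) : ℝ := φ t (x - c * t)

/-- The map `(t, x) ↦ (t, x - ct)`. -/
def skewHomeo (c : ℝ) : ℝ × ℝ ≃ₜ ℝ × ℝ where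
  toFun p := (p.1, p.2 - c * p.1)
  invFun p := (p.1, p.2 + c * p.1)
  left_inv p := by simp
  right_inv p := by simp

theorem IsTest.skew (h : IsTest T φ) (c : ℝ) : IsTest T (skew c φ) := by
  have e : Function.uncurry (MDKG.skew c φ) = Function.uncurry φ ∘ skewHomeo c := rfl
  refine ⟨?_, ?_, ?_⟩
  · rw [e]
    exact h.1.comp (show ContDiff ℝ ∞ (fun p : ℝ × ℝ => (p.1, p.2 - c * p.1)) by fun_prop)
  · rw [e]
    exact h.2.1.comp_homeomorph _
  · rw [e, tsupport_comp_eq_preimage]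
    intro p hp
    exact ⟨(h.2.2 hp).1, trivial⟩

theorem IsTest.dt_skew (h : IsTest T φ) (c t x : ℝ) :
    MDKG.dt (MDKG.skew c φ) t x = MDKG.dt φ t (x - c * t) - c * MDKG.dx φ t (x - c * t) := by
  have h1 : HasDerivAt (fun s : ℝ => (s, x - c * s)) ((1 : ℝ), -c) t := by
    have h2 : HasDerivAt (fun s : ℝ => x - c * s) (-c) t := by
      simpa using ((hasDerivAt_id t).const_mul c).const_sub x
    exact (hasDerivAt_id t).prodMk h2
  have h2 := ((h.isBump.hasFDerivAt (t, x - c * t)).comp_hasDerivAt t h1).deriv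
  have h3 : deriv (Function.uncurry φ ∘ fun s : ℝ => (s, x - c * s)) t =
    MDKG.dt (MDKG.skew c φ) t x := rfl
  rw [← h3, h2, h.isBump.dt_eq, h.isBump.dx_eq]
  have e : ((1 : ℝ), -c) = ((1 : ℝ), (0 : ℝ)) - c • ((0 : ℝ), (1 : ℝ)) := by simp
  rw [e, map_sub, map_smul, smul_eq_mul]

/-- A function transported with velocity `-c` satisfies the transport equation in the sense of
distributions. -/
theorem dbl_transport (hT : 0 < T) (h : IsTest T φ) (c : ℝ)
    {u n a a' : ℝ → Lp E p (volume : Measure ℝ)}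
    (hu : Continuous u) (ha : Continuous a) (ha' : Continuous a')
    (hd : ∀ t ∈ Ioo (-T) T, HasDerivAt a (a' t) t)
    (hu' : ∀ t ∈ Icc (-T) T, u t = lpShift (c * t) (a t))
    (hn : ∀ t ∈ Icc (-T) T, a' t = lpShift (-(c * t)) (n t)) :
    dbl T (dt φ) u - c • dbl T (dx φ) u + dbl T φ n = 0 := by
  -- In the frame moving with the characteristics u becomes a, which is differentiable in time. The
  -- integration by parts happens there, against the skewed test function; the change of variables x
  -- ↦ x + ct undoes the skewing.
  have h1 := dbl_dt hT (h.skew c) ha ha' hd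
  have e1 : dbl T (skew c φ) a' = dbl T φ n := by
    rw [dbl, dbl]
    refine intervalIntegral.integral_congr fun t ht => ?_
    rw [uIcc_of_le (by linarith)] at ht
    change ∫ x, φ t (x - c * t) • a' t x = ∫ x, φ t x • n t x
    rw [← integral_sub_right_eq_self (fun x => φ t x • n t x) (c * t), hn t ht]
    refine integral_congr_ae ?_
    filter_upwards [coeFn_lpShift (-(c * t)) (n t)] with x hx
    rw [hx, ← sub_eq_add_neg]
  have hdx : IntervalIntegrable (fun t => c • ∫ x, dx φ t x • u t x) volume (-T) T :=
    ((h.isBump.dx.continuous_integral hu).const_smul c).intervalIntegrable _ _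
  have e2 : dbl T (dt (skew c φ)) a = dbl T (dt φ) u - c • dbl T (dx φ) u := by
    rw [dbl, dbl, dbl, ← intervalIntegral.integral_smul, ← intervalIntegral.integral_sub
      (h.isBump.dt.intervalIntegrable hu _ _) hdx]
    refine intervalIntegral.integral_congr fun t ht => ?_
    rw [uIcc_of_le (by linarith)] at ht
    have hi : Integrable (fun x => c • dx φ t x • u t x) volume :=
      (h.isBump.dx.integrable _ _).smul c
    rw [← integral_smul, ← integral_sub (h.isBump.dt.integrable _ _) hi, ← integral_add_right_eq_self
      (fun x => dt (MDKG.skew c φ) t x • a t x) (c * t), hu' t ht]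
    refine integral_congr_ae ?_
    filter_upwards [coeFn_lpShift (c * t) (a t)] with x hx
    rw [hx, h.dt_skew, add_sub_cancel_right, sub_smul, mul_smul]
  rw [e1, e2] at h1
  rw [h1, neg_add_cancel]

end SpaceTime

/-! ### Integration by parts in space -/

section Space

variable {N : ℕ}

/-- Both sides are continuous in g with respect to the L¹ norm, so smooth compactly supported g
suffice; for these Jg is classically differentiable. -/
theorem integral_deriv_smul_yJ {χ : ℝ → ℝ} (hχ : ContDiff ℝ ∞ χ) (hc : HasCompactSupport χ)
    (g : Lp (Pot N) 1 (volume : Measure ℝ)) :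
    ∫ x, deriv χ x • yTop (yJ g) x = -∫ x, χ x • g x := by
  set χ0 : ℝ →ᵇ ℝ := BoundedContinuousFunction.ofNormedAddCommGroup χ hχ.continuous
    (hc.exists_bound_of_continuous hχ.continuous).choose
    (hc.exists_bound_of_continuous hχ.continuous).choose_spec with hχ0
  have hχ'c : Continuous (deriv χ) := hχ.continuous_deriv (by simp)
  set χ1 : ℝ →ᵇ ℝ := BoundedContinuousFunction.ofNormedAddCommGroup (deriv χ) hχ'c
    (hc.deriv.exists_bound_of_continuous hχ'c).choose
    (hc.deriv.exists_bound_of_continuous hχ'c).choose_spec with hχ1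
  obtain ⟨ρ, hρ⟩ := hc.isCompact.isBounded.subset_closedBall (0 : ℝ)
  have hs (x : ℝ) (hx : x ∈ tsupport χ) : x ∈ Icc (-ρ) ρ := by
    have := hρ hx
    rw [mem_closedBall_zero_iff] at this
    exact abs_le.1 this
  have e0 (g : Lp (Pot N) 1 (volume : Measure ℝ)) : pairL ρ χ0 g = ∫ x, χ x • g x :=
    pairL_eq ρ χ0 g fun x hx => hs x (subset_tsupport χ hx)
  have e1 (g : Lp (Pot N) ⊤ (volume : Measure ℝ)) : pairL ρ χ1 g = ∫ x, deriv χ x • g x :=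
    pairL_eq ρ χ1 g fun x hx => hs x (support_deriv_subset hx)
  rw [← e0, ← e1]
  have hclosed : IsClosed {g : Lp (Pot N) 1 (volume : Measure ℝ) |
      pairL ρ χ1 (yTop (yJ g)) = -pairL ρ χ0 g} := isClosed_eq (by fun_prop) (by fun_prop)
  have hd := Lp.dense_hasCompactSupport_contDiff (F := Pot N) (μ := (volume : Measure ℝ))
    (p := 1) (by simp)
  have key := hclosed.closure_subset_iff.2 (?_ : {g : Lp (Pot N) 1 (volume : Measure ℝ) |
    ∃ h : ℝ → Pot N, g =ᵐ[volume] h ∧ HasCompactSupport h ∧ ContDiff ℝ ∞ h} ⊆ _)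
  · exact key (hd g)
  · rintro g ⟨h, hgh, hhc, hh⟩
    change pairL ρ χ1 (yTop (yJ g)) = -pairL ρ χ0 g
    rw [e0, e1]
    have hint : Integrable h volume := hh.continuous.integrable_of_hasCompactSupport hhc
    have hv (x : ℝ) : yFun (yJ g) x = ∫ s in Iic x, h s := by
      rw [yFun_yJ]
      exact integral_congr_ae (ae_restrict_of_ae hgh)
    have hv' (x : ℝ) : HasDerivAt (fun x => yFun (yJ g) x) (h x) x := by
      have h1 : HasDerivAt (fun x => yFun (yJ g) 0 + ∫ s in (0 : ℝ)..x, h s) (h x) x :=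
        (intervalIntegral.integral_hasDerivAt_right (hh.continuous.intervalIntegrable
          (μ := volume) _ _)
          hh.continuous.stronglyMeasurable.stronglyMeasurableAtFilter
          hh.continuous.continuousAt).const_add _
      refine h1.congr_of_eventuallyEq (Eventually.of_forall fun y => ?_)
      have h2 := intervalIntegral.integral_Iic_sub_Iic hint.integrableOn hint.integrableOn
        (a := 0) (b := y)
      change yFun (yJ g) y = _
      simp only [hv]
      rw [← h2]
      abel
    have hvc : Continuous fun x => yFun (yJ g) x := (yFun (yJ g)).continuous
    have h3 := integral_bilinear_hasDerivAt_right_eq_neg_left_of_integrable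
      (L := (ContinuousLinearMap.lsmul ℝ ℝ : ℝ →L[ℝ] Pot N →L[ℝ] Pot N))
      (u := χ) (u' := deriv χ) (v := fun x => yFun (yJ g) x) (v' := h)
      (fun x _ => (hχ.differentiable (by simp) x).hasDerivAt) (fun x _ => hv' x)
      ((hχ.continuous.smul hh.continuous).integrable_of_hasCompactSupport hc.smul_right)
      ((hχ'c.smul hvc).integrable_of_hasCompactSupport hc.deriv.smul_right)
      ((hχ.continuous.smul hvc).integrable_of_hasCompactSupport hc.smul_right)
    simp only [ContinuousLinearMap.lsmul_apply] at h3
    have i1 : ∫ x, deriv χ x • yTop (yJ g) x = ∫ x, deriv χ x • yFun (yJ g) x := by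
      refine integral_congr_ae ?_
      filter_upwards [coeFn_yTop (yJ g)] with x hx
      rw [hx]
    have i2 : ∫ x, χ x • g x = ∫ x, χ x • h x := by
      refine integral_congr_ae ?_
      filter_upwards [hgh] with x hx
      rw [hx]
    rw [i1, i2, h3, neg_neg]

/-- Integration by parts against an element of `Y`. -/
theorem integral_deriv_smul_yTop {χ : ℝ → ℝ} (hχ : ContDiff ℝ ∞ χ) (hc : HasCompactSupport χ)
    (v : Y N) : ∫ x, deriv χ x • yTop v x = -∫ x, χ x • yDer v x := by
  have hχ'c : Continuous (deriv χ) := hχ.continuous_deriv (by simp)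
  rw [Y.eq_const_add v 0]
  set c := yFun v 0 - yFun (yJ (yDer v)) 0
  rw [map_add, map_add, yDer_yConst, zero_add, yDer_yJ, ← integral_deriv_smul_yJ hχ hc]
  have hi (w : Y N) : Integrable (fun x => deriv χ x • yTop w x) volume :=
    integrable_smul_lp _ hχ'c hc.deriv
  have h0 : ∫ x, deriv χ x • yTop (yConst c) x = 0 := by
    have h1 : ∫ x, deriv χ x • yTop (yConst c) x = ∫ x, deriv χ x • c := by
      refine integral_congr_ae ?_
      filter_upwards [coeFn_yTop (yConst c)] with x hx
      rw [hx, yFun_yConst]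
    rw [h1, integral_smul_const, integral_eq_zero_of_hasDerivAt_of_integrable
      (fun x => (hχ.differentiable (by simp) x).hasDerivAt)
      (hχ'c.integrable_of_hasCompactSupport hc.deriv)
      (hχ.continuous.integrable_of_hasCompactSupport hc), zero_smul]
  have h2 : ∫ x, deriv χ x • (yTop (yConst c) + yTop (yJ (yDer v))) x =
      (∫ x, deriv χ x • yTop (yConst c) x) + ∫ x, deriv χ x • yTop (yJ (yDer v)) x := by
    rw [← integral_add (hi _) (hi _)]
    refine integral_congr_ae ?_
    filter_upwards [Lp.coeFn_add (yTop (yConst c)) (yTop (yJ (yDer v)))] with x hx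
    rw [hx, Pi.add_apply, smul_add]
  rw [h2, h0, zero_add]

/-- Integration by parts in space, in space and time. -/
theorem dbl_dx_yTop {T : ℝ} {φ : ℝ → ℝ → ℝ} (h : IsBump φ) (v : ℝ → Y N) :
    dbl T (dx φ) (fun t => yTop (v t)) = -dbl T φ (fun t => yDer (v t)) := by
  rw [dbl, dbl, ← intervalIntegral.integral_neg]
  exact intervalIntegral.integral_congr fun t _ =>
    integral_deriv_smul_yTop (h.contDiff_right t) (h.hasCompactSupport_right t) (v t)

end Space

/-! ### The data space and the lifted space -/

section Proj

variable {N : ℕ}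

scoped instance : NormedAddCommGroup (X0 N) := inferInstance
scoped instance : NormedSpace ℝ (X0 N) := inferInstance
scoped instance : SeminormedAddCommGroup (X0 N) := NormedAddCommGroup.toSeminormedAddCommGroup
scoped instance : TopologicalSpace (X0 N) := UniformSpace.toTopologicalSpace
scoped instance : AddCommGroup (X0 N) := SeminormedAddCommGroup.toAddCommGroup
scoped instance : AddCommMonoid (X0 N) := AddCommGroup.toAddCommMonoid
scoped instance : Module ℝ (X0 N) := NormedSpace.toModule
scoped instance : SMul ℝ (X0 N) := SMulZeroClass.toSMul

/-- The spinor component. -/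
def x0Spinor : X0 N →L[ℝ] Lp Spinor 2 (volume : Measure ℝ) := ContinuousLinearMap.fst ℝ _ _

/-- The potential. -/
def x0V : X0 N →L[ℝ] Y N :=
  (ContinuousLinearMap.fst ℝ (Y N) (Lp (Pot N) 1 (volume : Measure ℝ))).comp
    (ContinuousLinearMap.snd ℝ _ _)

/-- The velocity. -/
def x0W : X0 N →L[ℝ] Lp (Pot N) 1 (volume : Measure ℝ) :=
  (ContinuousLinearMap.snd ℝ (Y N) (Lp (Pot N) 1 (volume : Measure ℝ))).comp
    (ContinuousLinearMap.snd ℝ _ _)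

/-- The element of `X₀` with components given by linear maps. -/
def x0Prod {E : Type} [NormedAddCommGroup E] [NormedSpace ℝ E]
    (a : E →L[ℝ] Lp Spinor 2 (volume : Measure ℝ)) (b : E →L[ℝ] Y N)
    (c : E →L[ℝ] Lp (Pot N) 1 (volume : Measure ℝ)) : E →L[ℝ] X0 N :=
  a.prod (b.prod c)

section Prod

variable {E : Type} [NormedAddCommGroup E] [NormedSpace ℝ E]
    (a : E →L[ℝ] Lp Spinor 2 (volume : Measure ℝ)) (b : E →L[ℝ] Y N)
    (c : E →L[ℝ] Lp (Pot N) 1 (volume : Measure ℝ)) (x : E)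

@[simp] theorem x0Spinor_x0Prod : x0Spinor (N := N) (x0Prod a b c x) = a x := rfl
@[simp] theorem x0V_x0Prod : x0V (N := N) (x0Prod a b c x) = b x := rfl
@[simp] theorem x0W_x0Prod : x0W (N := N) (x0Prod a b c x) = c x := rfl

end Prod

theorem x0_ext {d e : X0 N} (h1 : x0Spinor d = x0Spinor e) (h2 : x0V d = x0V e)
    (h3 : x0W d = x0W e) : d = e := Prod.ext h1 (Prod.ext h2 h3)

theorem x0_rep (d : X0 N) (x : ℝ) : X0.rep d x = (x0Spinor d x, yFun (x0V d) x, x0W d x) := rfl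

attribute [irreducible] x0Spinor x0V x0W x0Prod

/-- Recombination of the left and right moving parts. -/
def projX : Lift N →L[ℝ] X0 N :=
  x0Prod liftSpinor liftV (yDer.comp liftLeft - yDer.comp liftRight)

/-- Decomposition in left and right moving parts. -/
def embX : X0 N →L[ℝ] Lift N :=
  liftProd x0Spinor (N := N) ((1 / 2 : ℝ) • (x0V (N := N) + yJ.comp x0W))
    ((1 / 2 : ℝ) • (x0V (N := N) - yJ.comp x0W)) 0

/-- Insertion of the mass density. -/
def massX : Lp ℝ 1 (volume : Measure ℝ) →L[ℝ] Lift N :=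
  liftProd 0 0 0 (ContinuousLinearMap.id ℝ _)

section Components

variable (h : Lift N) (d : X0 N) (μ : Lp ℝ 1 (volume : Measure ℝ))

@[simp] theorem x0Spinor_projX : x0Spinor (N := N) (projX h) = liftSpinor h := by
  rw [projX, x0Spinor_x0Prod]
@[simp] theorem x0V_projX : x0V (N := N) (projX h) = liftLeft h + liftRight h := by
  rw [projX, x0V_x0Prod, liftV_apply]
@[simp] theorem x0W_projX : x0W (N := N) (projX h) = yDer (liftLeft h) - yDer (liftRight h) := by
  rw [projX, x0W_x0Prod]; rfl

@[simp] theorem liftSpinor_embX : liftSpinor (embX d) = x0Spinor d := by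
  rw [embX, liftSpinor_liftProd]
@[simp] theorem liftLeft_embX : liftLeft (embX d) = (1 / 2 : ℝ) • (x0V d + yJ (x0W d)) := by
  rw [embX, liftLeft_liftProd]; rfl
@[simp] theorem liftRight_embX : liftRight (embX d) = (1 / 2 : ℝ) • (x0V d - yJ (x0W d)) := by
  rw [embX, liftRight_liftProd]; rfl
@[simp] theorem liftMass_embX : liftMass (embX d) = 0 := by
  rw [embX, liftMass_liftProd]; rfl

@[simp] theorem liftSpinor_massX : liftSpinor (massX (N := N) μ) = 0 := by
  rw [massX, liftSpinor_liftProd]; rfl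
@[simp] theorem liftLeft_massX : liftLeft (massX (N := N) μ) = 0 := by
  rw [massX, liftLeft_liftProd]; rfl
@[simp] theorem liftRight_massX : liftRight (massX (N := N) μ) = 0 := by
  rw [massX, liftRight_liftProd]; rfl
@[simp] theorem liftMass_massX : liftMass (massX (N := N) μ) = μ := by
  rw [massX, liftMass_liftProd]; rfl

theorem projX_embX : projX (N := N) (embX d) = d := by
  apply x0_ext
  · simp
  · rw [x0V_projX, liftLeft_embX, liftRight_embX]
    module
  · rw [x0W_projX, liftLeft_embX, liftRight_embX, map_smul, map_smul, map_add, map_sub, yDer_yJ]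
    module

theorem projX_massX : projX (N := N) (massX (N := N) μ) = 0 := by
  apply x0_ext <;> simp

end Components

/-- Translations of the data. -/
def x0Shift (t : ℝ) : X0 N →L[ℝ] X0 N :=
  x0Prod ((lpShift t).comp x0Spinor) ((yShift t).comp x0V) ((lpShift t).comp x0W)

section Shift

variable (t : ℝ) (d : X0 N)

@[simp] theorem x0Spinor_x0Shift : x0Spinor (N := N) (x0Shift t d) = lpShift t (x0Spinor d) := by
  rw [x0Shift, x0Spinor_x0Prod]; rfl
@[simp] theorem x0V_x0Shift : x0V (N := N) (x0Shift t d) = yShift t (x0V d) := by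
  rw [x0Shift, x0V_x0Prod]; rfl
@[simp] theorem x0W_x0Shift : x0W (N := N) (x0Shift t d) = lpShift t (x0W d) := by
  rw [x0Shift, x0W_x0Prod]; rfl

end Shift

attribute [irreducible] projX embX massX x0Shift

theorem projX_liftShift (t : ℝ) (h : Lift N) : projX (N := N) (liftShift t h) = x0Shift t (projX h) := by
  apply x0_ext <;> simp [yDer_yShift]

theorem embX_x0Shift (t : ℝ) (d : X0 N) : embX (x0Shift t d) = liftShift t (embX d) := by
  apply lift_ext <;> simp [yShift_yJ]

theorem massX_lpShift (t : ℝ) (μ : Lp ℝ 1 (volume : Measure ℝ)) :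
    massX (N := N) (lpShift t μ) = liftShift t (massX μ) := by
  apply lift_ext <;> simp

end Proj

/-! ### Mild solutions are weak solutions -/

section Weak

variable {N : ℕ} {M : ℝ} {B C : Fin N → Matrix (Fin 2) (Fin 2) ℂ} {T : ℝ} [hT : Fact (0 < T)]
  {φ : ℝ → ℝ → ℝ} {d : Lift N} {Φ n : C(Icc (-T) T, Lift N)}

/-- Any component R which the free evolution merely translates satisfies its transport equation in
the sense of distributions. It serves both spinor components, both movers and the derivatives of the
movers. -/
theorem dbl_component {E : Type} [NormedAddCommGroup E] [NormedSpace ℝ E] [CompleteSpace E]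
    {p : ℝ≥0∞} [Fact (1 ≤ p)] (R : Lift N →L[ℝ] Lp E p (volume : Measure ℝ)) (c : ℝ)
    (hR : ∀ t h, R ((dkg M B C).S t h) = lpShift (c * t) (R h))
    (hΦ : Φ = (dkg M B C).free d + (dkg M B C).duhamel n) (h : IsTest T φ) :
    dbl T (dt φ) (fun t => R (Φ (clamp T t))) - c • dbl T (dx φ) (fun t => R (Φ (clamp T t))) +
      dbl T φ (fun t => R (n (clamp T t))) = 0 := by
  set P := dkg M B C with hP
  set w := P.unapplyS n with hw
  have hd (t : ℝ) : HasDerivAt (fun t => R (d + ∫ s in (0 : ℝ)..t, w (clamp T s)))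
      (R (w (clamp T t))) t :=
    R.hasFDerivAt.comp_hasDerivAt t ((hasDerivAt_primitive w t).const_add d)
  refine dbl_transport hT.out h c (a := fun t => R (d + ∫ s in (0 : ℝ)..t, w (clamp T s)))
    (a' := fun t => R (w (clamp T t)))
    (R.continuous.comp (continuous_extend Φ)) (continuous_iff_continuousAt.2 fun t =>
      (hd t).continuousAt) (R.continuous.comp (continuous_extend w)) (fun t _ => hd t) ?_ ?_
  · intro t ht
    rw [clamp_of_mem ht, ← hR, hΦ, ContinuousMap.add_apply, P.free_apply, P.duhamel_apply,
      ← map_add, primitive_apply]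
  · intro t ht
    rw [clamp_of_mem ht, hw, P.unapplyS_apply, hR, mul_neg]

theorem yTop_liftLeft_S (t : ℝ) (h : Lift N) : (yTop.comp liftLeft) ((dkg M B C).S t h) =
    lpShift (1 * t) ((yTop.comp liftLeft) h) := by
  rw [one_mul, ContinuousLinearMap.comp_apply, liftLeft_S, yTop_yShift]; rfl

theorem yTop_liftRight_S (t : ℝ) (h : Lift N) : (yTop.comp liftRight) ((dkg M B C).S t h) =
    lpShift (-1 * t) ((yTop.comp liftRight) h) := by
  rw [neg_one_mul, ContinuousLinearMap.comp_apply, liftRight_S, yTop_yShift]; rfl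

theorem yDer_liftLeft_S (t : ℝ) (h : Lift N) : (yDer.comp liftLeft) ((dkg M B C).S t h) =
    lpShift (1 * t) ((yDer.comp liftLeft) h) := by
  rw [one_mul, ContinuousLinearMap.comp_apply, liftLeft_S, yDer_yShift]; rfl

theorem yDer_liftRight_S (t : ℝ) (h : Lift N) : (yDer.comp liftRight) ((dkg M B C).S t h) =
    lpShift (-1 * t) ((yDer.comp liftRight) h) := by
  rw [neg_one_mul, ContinuousLinearMap.comp_apply, liftRight_S, yDer_yShift]; rfl

theorem spinSnd_liftSpinor_S (t : ℝ) (h : Lift N) :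
    ((spinSnd.compLpL 2 volume).comp liftSpinor) ((dkg M B C).S t h) =
      lpShift (1 * t) (((spinSnd.compLpL 2 volume).comp liftSpinor) h) := by
  have h2 := compLpL_comp_zero spinSnd spinFst spinSnd_spinFst (lpShift (-t) (liftSpinor h))
  have h1 := compLpL_comp_eq spinSnd spinSnd spinSnd spinSnd_spinSnd (lpShift t (liftSpinor h))
  rw [one_mul, ContinuousLinearMap.comp_apply, liftSpinor_S, spinEvol_apply, map_add, h1, h2,
    add_zero, compLpL_lpShift]; rfl

theorem spinFst_liftSpinor_S (t : ℝ) (h : Lift N) :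
    ((spinFst.compLpL 2 volume).comp liftSpinor) ((dkg M B C).S t h) =
      lpShift (-1 * t) (((spinFst.compLpL 2 volume).comp liftSpinor) h) := by
  have h2 := compLpL_comp_zero spinFst spinSnd spinFst_spinSnd (lpShift t (liftSpinor h))
  have h1 := compLpL_comp_eq spinFst spinFst spinFst spinFst_spinFst (lpShift (-t) (liftSpinor h))
  rw [neg_one_mul, ContinuousLinearMap.comp_apply, liftSpinor_S, spinEvol_apply, map_add, h1, h2,
    zero_add, compLpL_lpShift]; rfl

variable (T) in
/-- The linear equations `∂ₜψ + α∂ₓψ = f`, `(∂ₜ² - ∂ₓ²)V = F`, `∂ₜV = W`, tested against `φ`. -/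
structure LinearEqs (φ : ℝ → ℝ → ℝ) (u : ℝ → X0 N) (f : ℝ → Lp Spinor 2 (volume : Measure ℝ))
    (F : ℝ → Lp (Pot N) 1 (volume : Measure ℝ)) : Prop where
  fst : dbl T (dt φ) (fun t => spinFst.compLpL 2 volume (x0Spinor (N := N) (u t))) +
      dbl T (dx φ) (fun t => spinFst.compLpL 2 volume (x0Spinor (N := N) (u t))) +
      dbl T φ (fun t => spinFst.compLpL 2 volume (f t)) = 0
  snd : dbl T (dt φ) (fun t => spinSnd.compLpL 2 volume (x0Spinor (N := N) (u t))) -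
      dbl T (dx φ) (fun t => spinSnd.compLpL 2 volume (x0Spinor (N := N) (u t))) +
      dbl T φ (fun t => spinSnd.compLpL 2 volume (f t)) = 0
  wave : dbl T (dt (dt φ)) (fun t => yTop (N := N) (x0V (N := N) (u t))) -
      dbl T (dx (dx φ)) (fun t => yTop (N := N) (x0V (N := N) (u t))) = dbl T φ F
  velocity : dbl T (dt φ) (fun t => yTop (N := N) (x0V (N := N) (u t))) = -dbl T φ (fun t => x0W (N := N) (u t))

theorem eq_of_transport_add {G : Type} [AddCommGroup G] {a b p q s t : G}
    (h1 : a - -p + s = 0) (h2 : b - - -q + t = 0) (h3 : s + t = 0) : a + b = -(p - q) := by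
  have e : a + b = -(p - q) + ((a - -p + s) + (b - - -q + t)) - (s + t) := by abel
  rw [e, h1, h2, h3, add_zero, add_zero, sub_zero]

theorem eq_of_transport_sub {G : Type} [AddCommGroup G] [Module ℝ G] {a b c d F : G}
    (h1 : a - c + (1 / 2 : ℝ) • F = 0) (h2 : b - -d + -(1 / 2 : ℝ) • F = 0) :
    -(a - b) - -(c + d) = F := by
  have e : -(a - b) - -(c + d) =
      F - (a - c + (1 / 2 : ℝ) • F) + (b - -d + -(1 / 2 : ℝ) • F) := by module
  rw [e, h1, h2, sub_zero, add_zero]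

/-- Add the transport equations of the two movers: the sources cancel by `hn`, and the space
derivative of left minus right is the velocity component. -/
theorem velocity_of_mild (hΦ : Φ = (dkg M B C).free d + (dkg M B C).duhamel n)
    (hn : ∀ t, liftLeft (n t) + liftRight (n t) = 0) (h : IsTest T φ) :
    dbl T (dt φ) (fun t => yTop (N := N) (x0V (N := N) (projX (N := N) (Φ (clamp T t))))) =
      -dbl T φ (fun t => x0W (N := N) (projX (N := N) (Φ (clamp T t)))) := by
  have hc (R : Lift N →L[ℝ] Lp (Pot N) ⊤ (volume : Measure ℝ)) (f : C(Icc (-T) T, Lift N)) :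
    Continuous fun t => R (f (clamp T t)) := R.continuous.comp (continuous_extend f)
  have hc1 (R : Lift N →L[ℝ] Lp (Pot N) 1 (volume : Measure ℝ)) (f : C(Icc (-T) T, Lift N)) :
    Continuous fun t => R (f (clamp T t)) := R.continuous.comp (continuous_extend f)
  have hL := dbl_component (yTop.comp liftLeft) 1 yTop_liftLeft_S hΦ h
  have hR := dbl_component (yTop.comp liftRight) (-1) yTop_liftRight_S hΦ h
  have hn0 : dbl T φ (fun t => (yTop.comp liftLeft) (n (clamp T t))) +
      dbl T φ (fun t => (yTop.comp liftRight) (n (clamp T t))) = 0 := by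
    rw [← dbl_add h.isBump (hc _ _) (hc _ _)]
    have : ∀ t, (yTop.comp liftLeft) (n (clamp T t)) + (yTop.comp liftRight) (n (clamp T t)) =
        (0 : ℝ) • yTop (N := N) (liftLeft (n (clamp T t))) := fun t => by
      rw [ContinuousLinearMap.comp_apply, ContinuousLinearMap.comp_apply, ← map_add, hn, map_zero,
        zero_smul]
    simp only [this]
    rw [dbl_smul, zero_smul]
  have e1 : dbl T (dt φ) (fun t => yTop (N := N) (x0V (N := N) (projX (N := N) (Φ (clamp T t))))) =
      dbl T (dt φ) (fun t => (yTop.comp liftLeft) (Φ (clamp T t))) +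
        dbl T (dt φ) (fun t => (yTop.comp liftRight) (Φ (clamp T t))) := by
    rw [← dbl_add h.isBump.dt (hc _ _) (hc _ _)]
    simp only [x0V_projX, map_add, ContinuousLinearMap.comp_apply]
  have e2 : dbl T φ (fun t => x0W (N := N) (projX (N := N) (Φ (clamp T t)))) =
      dbl T φ (fun t => (yDer.comp liftLeft) (Φ (clamp T t))) -
        dbl T φ (fun t => (yDer.comp liftRight) (Φ (clamp T t))) := by
    rw [← dbl_sub h.isBump (hc1 _ _) (hc1 _ _)]
    simp only [x0W_projX, ContinuousLinearMap.comp_apply]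
  have e3 := dbl_dx_yTop (T := T) h.isBump (fun t => liftLeft (Φ (clamp T t)))
  have e4 := dbl_dx_yTop (T := T) h.isBump (fun t => liftRight (Φ (clamp T t)))
  simp only [ContinuousLinearMap.comp_apply] at hL hR hn0 e1 e2
  rw [e1, e2]
  rw [e3, one_smul] at hL
  rw [e4, neg_smul, one_smul] at hR
  exact eq_of_transport_add hL hR hn0

/-- Mild solutions of the linear equations are weak solutions. -/
theorem linearEqs_of_mild (hΦ : Φ = (dkg M B C).free d + (dkg M B C).duhamel n)
    {f : ℝ → Lp Spinor 2 (volume : Measure ℝ)} {F : ℝ → Lp (Pot N) 1 (volume : Measure ℝ)}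
    (hf : ∀ t, liftSpinor (n (clamp T t)) = f t)
    (hl : ∀ t, liftLeft (n (clamp T t)) = (1 / 2 : ℝ) • yJ (F t))
    (hr : ∀ t, liftRight (n (clamp T t)) = -(1 / 2 : ℝ) • yJ (F t)) (h : IsTest T φ) :
    LinearEqs T φ (fun t => projX (N := N) (Φ (clamp T t))) f F := by
  have hn (t : Icc (-T) T) : liftLeft (n t) + liftRight (n t) = 0 := by
    have h1 := hl t
    have h2 := hr t
    rw [clamp_coe] at h1 h2
    rw [h1, h2]
    module
  have hc1 (R : Lift N →L[ℝ] Lp (Pot N) 1 (volume : Measure ℝ)) (f : C(Icc (-T) T, Lift N)) :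
    Continuous fun t => R (f (clamp T t)) := R.continuous.comp (continuous_extend f)
  refine ⟨?_, ?_, ?_, velocity_of_mild hΦ hn h⟩
  · have h1 := dbl_component _ (-1) spinFst_liftSpinor_S hΦ h
    simp only [ContinuousLinearMap.comp_apply, hf, neg_smul, one_smul, sub_neg_eq_add] at h1
    simpa only [x0Spinor_projX] using h1
  · have h1 := dbl_component _ 1 spinSnd_liftSpinor_S hΦ h
    simp only [ContinuousLinearMap.comp_apply, hf, one_smul] at h1
    simpa only [x0Spinor_projX] using h1
  -- The derivatives of the movers solve opposite transport equations with sources F/2 and -F/2.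
  -- Subtracting them, and using the velocity identity with test function ∂ₜφ, gives the second
  -- order equation.
  · have hL := dbl_component (yDer.comp liftLeft) 1 yDer_liftLeft_S hΦ h
    have hR := dbl_component (yDer.comp liftRight) (-1) yDer_liftRight_S hΦ h
    have hv := velocity_of_mild hΦ hn h.dt
    have e1 := dbl_dx_yTop (T := T) h.isBump.dx (fun t => x0V (N := N) (projX (N := N) (Φ (clamp T t))))
    have e2 : dbl T (dt φ) (fun t => x0W (N := N) (projX (N := N) (Φ (clamp T t)))) =
        dbl T (dt φ) (fun t => (yDer.comp liftLeft) (Φ (clamp T t))) -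
          dbl T (dt φ) (fun t => (yDer.comp liftRight) (Φ (clamp T t))) := by
      rw [← dbl_sub h.isBump.dt (hc1 _ _) (hc1 _ _)]
      simp only [x0W_projX, ContinuousLinearMap.comp_apply]
    have e3 : dbl T (dx φ) (fun t => yDer (x0V (N := N) (projX (N := N) (Φ (clamp T t))))) =
        dbl T (dx φ) (fun t => (yDer.comp liftLeft) (Φ (clamp T t))) +
          dbl T (dx φ) (fun t => (yDer.comp liftRight) (Φ (clamp T t))) := by
      rw [← dbl_add h.isBump.dx (hc1 _ _) (hc1 _ _)]
      simp only [x0V_projX, map_add, ContinuousLinearMap.comp_apply]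
    have e4 : dbl T φ (fun t => (yDer.comp liftLeft) (n (clamp T t))) = (1 / 2 : ℝ) • dbl T φ F := by
      rw [← dbl_smul]
      simp only [ContinuousLinearMap.comp_apply, hl, map_smul, yDer_yJ]
    have e5 : dbl T φ (fun t => (yDer.comp liftRight) (n (clamp T t))) =
        -(1 / 2 : ℝ) • dbl T φ F := by
      rw [← dbl_smul]
      simp only [ContinuousLinearMap.comp_apply, hr, map_smul, yDer_yJ]
    rw [hv, e1, e2, e3]
    rw [e4, one_smul] at hL
    rw [e5, neg_smul, one_smul] at hR
    exact eq_of_transport_sub hL hR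

end Weak

/-! ### The weak equations -/

section Eqs

variable {N : ℕ} {T : ℝ} (M m : ℝ) (B C : Fin N → Matrix (Fin 2) (Fin 2) ℂ)

/-- The equations of `IsSolution`, tested against `φ`. -/
structure SolEqs (φ : ℝ → ℝ → ℝ) (w : Icc (-T) T → ℝ → State N) : Prop where
  dirac :
    ∫ t, (∫ x : ℝ,
        ((Complex.I * (dt φ t x : ℂ)) • gamma0.mulVec (w t x).1.ofLp
          + (Complex.I * (dx φ t x : ℂ)) • gamma1.mulVec (w t x).1.ofLp
          + ((φ t x : ℂ) * (M : ℂ)) • (w t x).1.ofLp)) ∂timeMeasure T =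
      ∫ t, (∫ x : ℝ,
        (φ t x : ℂ) • ∑ j, ((w t x).2.1 j : ℂ) •
          (gamma0 * B j).mulVec (w t x).1.ofLp) ∂timeMeasure T
  kleinGordon : ∀ j : Fin N,
    ∫ t, (∫ x : ℝ,
        (((dt (dt φ) t x - dx (dx φ) t x + m ^ 2 * φ t x) * (w t x).2.1 j : ℝ) : ℂ)) ∂timeMeasure T =
      ∫ t, (∫ x : ℝ,
        (φ t x : ℂ) *
          (star (w t x).1.ofLp ⬝ᵥ (C j).mulVec (w t x).1.ofLp)) ∂timeMeasure T
  velocity :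
    ∫ t, (∫ x : ℝ, dt φ t x • (w t x).2.1) ∂timeMeasure T =
      -∫ t, (∫ x : ℝ, φ t x • (w t x).2.2) ∂timeMeasure T

variable {M m B C}

theorem isSolution_iff {X : Type} [TopologicalSpace X] {rep : X → ℝ → State N} {d : X}
    {u : C(Icc (-T) T, X)} : IsSolution rep M m B C d u ↔
      (∀ t : Icc (-T) T, (t : ℝ) = 0 → u t = d) ∧
        ∀ φ, IsTest T φ → SolEqs M m B C φ fun t => rep (u t) :=
  ⟨fun h => ⟨h.init, fun φ hφ => ⟨h.dirac φ hφ, h.kleinGordon φ hφ, h.velocity φ hφ⟩⟩,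
    fun h => ⟨h.1, fun φ hφ => (h.2 φ hφ).dirac, fun φ hφ => (h.2 φ hφ).kleinGordon,
      fun φ hφ => (h.2 φ hφ).velocity⟩⟩

/-- The equations only depend on values on the support of the test function. -/
theorem SolEqs.congr {φ : ℝ → ℝ → ℝ} (h : IsBump φ) {w w' : Icc (-T) T → ℝ → State N}
    (hw : ∀ t : Icc (-T) T, ∀ᵐ x, ((t : ℝ), x) ∈ tsupport (Function.uncurry φ) → w t x = w' t x)
    (hs : SolEqs M m B C φ w) : SolEqs M m B C φ w' := by
  have h0 {χ : ℝ → ℝ → ℝ} (hχ : tsupport (Function.uncurry χ) ⊆ tsupport (Function.uncurry φ))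
      {t x : ℝ} (hx : (t, x) ∉ tsupport (Function.uncurry φ)) : χ t x = 0 := by
    by_contra h1
    exact hx (hχ (subset_tsupport (Function.uncurry χ) (show (t, x) ∈ _ from h1)))
  have key {G : Type} [NormedAddCommGroup G] [NormedSpace ℝ G] (f f' : Icc (-T) T → ℝ → G)
      (hf : ∀ t x, w t x = w' t x → f t x = f' t x)
      (hf' : ∀ (t : Icc (-T) T) x, ((t : ℝ), x) ∉ tsupport (Function.uncurry φ) → f t x = f' t x) :
      ∫ t, (∫ x : ℝ, f t x) ∂timeMeasure T = ∫ t, (∫ x : ℝ, f' t x) ∂timeMeasure T := by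
    refine integral_congr_ae (Eventually.of_forall fun t => integral_congr_ae ?_)
    filter_upwards [hw t] with x hx
    by_cases hx' : ((t : ℝ), x) ∈ tsupport (Function.uncurry φ)
    · exact hf t x (hx hx')
    · exact hf' t x hx'
  have hφ := subset_refl (tsupport (Function.uncurry φ))
  have htt := h.dt.tsupport_dt.trans h.tsupport_dt
  have hxx := h.dx.tsupport_dx.trans h.tsupport_dx
  refine ⟨?_, fun j => ?_, ?_⟩
  · refine (key _ _ ?_ ?_).trans (hs.dirac.trans (key _ _ ?_ ?_))
    · intro t x e; rw [e]
    · intro t x hx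
      rw [h0 hφ hx, h0 h.tsupport_dt hx, h0 h.tsupport_dx hx]; simp
    · intro t x e; rw [e]
    · intro t x hx
      rw [h0 hφ hx]; simp
  · refine (key _ _ ?_ ?_).trans ((hs.kleinGordon j).trans (key _ _ ?_ ?_))
    · intro t x e; rw [e]
    · intro t x hx
      rw [h0 hφ hx, h0 htt hx, h0 hxx hx]; simp
    · intro t x e; rw [e]
    · intro t x hx
      rw [h0 hφ hx]; simp
  · refine (key _ _ ?_ ?_).trans (hs.velocity.trans (congrArg Neg.neg (key _ _ ?_ ?_)))
    · intro t x e; rw [e]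
    · intro t x hx
      rw [h0 h.tsupport_dt hx]; simp
    · intro t x e; rw [e]
    · intro t x hx
      rw [h0 hφ hx]; simp

variable [Fact (0 < T)]

theorem integral_timeMeasure {G : Type} [NormedAddCommGroup G] [NormedSpace ℝ G]
    (g : Icc (-T) T → G) : ∫ t, g t ∂timeMeasure T = ∫ t in (-T)..T, g (clamp T t) := by
  have hT : -T ≤ T := by have := Fact.out (p := 0 < T); linarith
  rw [intervalIntegral.integral_of_le hT, ← integral_Icc_eq_integral_Ioc,
    ← integral_subtype_comap measurableSet_Icc, timeMeasure]
  simp only [clamp_coe]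

/-- The nonlinear equations on `X₀`, tested against `φ`. -/
structure X0Eqs (M m : ℝ) (B C : Fin N → Matrix (Fin 2) (Fin 2) ℂ) (φ : ℝ → ℝ → ℝ)
    (u : C(Icc (-T) T, X0 N)) : Prop where
  dirac : dbl T (dt φ) (fun t => x0Spinor (N := N) (u (clamp T t))) +
      dbl T (dx φ) (fun t => (spinFst - spinSnd).compLpL 2 volume (x0Spinor (N := N) (u (clamp T t)))) +
      dbl T φ (fun t => (massMap M).compLpL 2 volume (x0Spinor (N := N) (u (clamp T t)))) +
      dbl T φ (fun t => (diracMap B).holder 2 (yTop (N := N) (x0V (N := N) (u (clamp T t))))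
        (x0Spinor (N := N) (u (clamp T t)))) = 0
  wave : dbl T (dt (dt φ)) (fun t => yTop (N := N) (x0V (N := N) (u (clamp T t)))) -
      dbl T (dx (dx φ)) (fun t => yTop (N := N) (x0V (N := N) (u (clamp T t)))) +
      m ^ 2 • dbl T φ (fun t => yTop (N := N) (x0V (N := N) (u (clamp T t)))) =
      dbl T φ (fun t => (currentMap C).holder 1 (x0Spinor (N := N) (u (clamp T t)))
        (x0Spinor (N := N) (u (clamp T t))))
  velocity : dbl T (dt φ) (fun t => yTop (N := N) (x0V (N := N) (u (clamp T t)))) =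
      -dbl T φ (fun t => x0W (N := N) (u (clamp T t)))

/-- Multiplication by `iγ⁰`. -/
def diracMul : Spinor →L[ℝ] (Fin 2 → ℂ) :=
  (PiLp.continuousLinearEquiv 2 ℝ (fun _ : Fin 2 => ℂ) : Spinor →L[ℝ] (Fin 2 → ℂ)).comp
    (spinorMap (Complex.I • gamma0))

theorem diracMul_apply (z : Spinor) : diracMul z = (Complex.I • gamma0).mulVec z.ofLp := by
  rw [← spinorMap_ofLp]; rfl

theorem diracMul_injective : Function.Injective diracMul := by
  intro y z h
  rw [diracMul_apply, diracMul_apply] at h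
  have h0 := congrFun h 0
  have h1 := congrFun h 1
  simp [gamma0, Matrix.vecHead, Matrix.vecTail] at h0 h1
  exact spinor_ext h1 h0

/-- Factoring out iγ⁰ and using (γ⁰)² = 1 and γ⁰γ¹ = diag(1, -1) turns the Dirac operator into two
transport operators and a mass term. Nothing is lost, since iγ⁰ is injective. -/
theorem diracMul_lhs (a b c : ℝ) (z : Spinor) :
    (Complex.I * (a : ℂ)) • gamma0.mulVec z.ofLp + (Complex.I * (b : ℂ)) • gamma1.mulVec z.ofLp +
      ((c : ℂ) * (M : ℂ)) • z.ofLp =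
    diracMul (a • z + b • (spinFst - spinSnd) z + c • massMap M z) := by
  rw [diracMul_apply]
  ext i
  fin_cases i <;>
    simp [gamma0, gamma1, massMap, spinorMap_ofLp, Matrix.vecHead,
      Matrix.vecTail, spinFst, spinSnd, Complex.ext_iff] <;> constructor <;> ring

theorem diracMul_rhs (c : ℝ) (V : Pot N) (z : Spinor) :
    (c : ℂ) • ∑ j, (V j : ℂ) • (gamma0 * B j).mulVec z.ofLp = diracMul (-(c • diracMap B V z)) := by
  rw [diracMul_apply, diracMap_apply]
  have h : ∀ j, ((V j • spinorMap (Complex.I • B j) z : Spinor)).ofLp =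
      (V j : ℂ) • (Complex.I • B j).mulVec z.ofLp := fun j => by
    rw [WithLp.ofLp_smul, spinorMap_ofLp]
    ext i; simp
  have h2 : ((-(c • ∑ j, V j • spinorMap (Complex.I • B j) z) : Spinor)).ofLp =
      -((c : ℂ) • ∑ j, (V j : ℂ) • (Complex.I • B j).mulVec z.ofLp) := by
    rw [WithLp.ofLp_neg, WithLp.ofLp_smul, WithLp.ofLp_sum, Finset.sum_congr rfl fun j _ => h j]
    ext i; simp
  rw [h2, Matrix.mulVec_neg, Matrix.mulVec_smul, Matrix.mulVec_sum, ← smul_neg,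
    ← Finset.sum_neg_distrib]
  congr 1
  refine Finset.sum_congr rfl fun j _ => ?_
  rw [Matrix.mulVec_smul, ← smul_neg, Matrix.smul_mulVec, Matrix.smul_mulVec, Matrix.mulVec_smul,
    smul_smul, Complex.I_mul_I, neg_one_smul, neg_neg, Matrix.mulVec_mulVec]

/-- A coordinate, as a complex number. -/
def potCoord (j : Fin N) : Pot N →L[ℝ] ℂ :=
  Complex.ofRealCLM.comp (EuclideanSpace.proj j : Pot N →L[ℝ] ℝ)

theorem potCoord_apply (j : Fin N) (V : Pot N) : potCoord j V = (V j : ℂ) := rfl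

/-- For hermitian C the form z^*Cz is real, so the real part taken in `currentMap` loses nothing and
the complex weak equation is equivalent to a real one. -/
theorem current_eq (hC : ∀ j, (C j).IsHermitian) (j : Fin N) (z : Spinor) :
    star z.ofLp ⬝ᵥ (C j).mulVec z.ofLp = potCoord j (currentMap C z z) := by
  rw [potCoord_apply, currentMap_apply]
  refine Complex.ext (by simp) ?_
  rw [Complex.ofReal_im]
  have h := (hC j).im_star_dotProduct_mulVec_self z.ofLp
  exact h

variable {φ : ℝ → ℝ → ℝ} {u : C(Icc (-T) T, X0 N)}

theorem continuous_x0Spinor_extend (u : C(Icc (-T) T, X0 N)) :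
    Continuous fun t => x0Spinor (N := N) (u (clamp T t)) :=
  (x0Spinor (N := N)).continuous.comp (continuous_extend u)

theorem continuous_yTop_extend (u : C(Icc (-T) T, X0 N)) :
    Continuous fun t => yTop (N := N) (x0V (N := N) (u (clamp T t))) :=
  (yTop (N := N)).continuous.comp ((x0V (N := N)).continuous.comp (continuous_extend u))

theorem continuous_x0W_extend (u : C(Icc (-T) T, X0 N)) :
    Continuous fun t => x0W (N := N) (u (clamp T t)) :=
  (x0W (N := N)).continuous.comp (continuous_extend u)

set_option maxHeartbeats 800000 in
theorem x0_dirac_lhs (h : IsTest T φ) :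
    ∫ t, (∫ x : ℝ,
        ((Complex.I * (dt φ t x : ℂ)) • gamma0.mulVec (X0.rep (u t) x).1.ofLp
          + (Complex.I * (dx φ t x : ℂ)) • gamma1.mulVec (X0.rep (u t) x).1.ofLp
          + ((φ t x : ℂ) * (M : ℂ)) • (X0.rep (u t) x).1.ofLp)) ∂timeMeasure T =
    diracMul (dbl T (dt φ) (fun t => x0Spinor (N := N) (u (clamp T t))) +
      dbl T (dx φ) (fun t => (spinFst - spinSnd).compLpL 2 volume (x0Spinor (N := N) (u (clamp T t)))) +
      dbl T φ (fun t => (massMap M).compLpL 2 volume (x0Spinor (N := N) (u (clamp T t))))) := by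
  have c1 : Continuous fun t => x0Spinor (N := N) (u (clamp T t)) := continuous_x0Spinor_extend u
  have c2 : Continuous fun t => (spinFst - spinSnd).compLpL 2 volume (x0Spinor (N := N) (u (clamp T t))) :=
    ((spinFst - spinSnd).compLpL 2 volume).continuous.comp c1
  have c3 : Continuous fun t => (massMap M).compLpL 2 volume (x0Spinor (N := N) (u (clamp T t))) :=
    ((massMap M).compLpL 2 volume).continuous.comp c1
  have i1 := h.isBump.dt.intervalIntegrable c1 (-T) T
  have i2 := h.isBump.dx.intervalIntegrable c2 (-T) T
  have i3 := h.isBump.intervalIntegrable c3 (-T) T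
  rw [dbl, dbl, dbl, ← intervalIntegral.integral_add i1 i2,
    ← intervalIntegral.integral_add (i1.add i2) i3,
    ← diracMul.intervalIntegral_comp_comm ((i1.add i2).add i3), integral_timeMeasure]
  refine intervalIntegral.integral_congr fun t ht => ?_
  rw [uIcc_of_le (by have := Fact.out (p := 0 < T); linarith)] at ht
  have ht' : ((clamp T t : Icc (-T) T) : ℝ) = t := by rw [clamp_of_mem ht]
  simp only [ht']
  have j1 := h.isBump.dt.integrable (x0Spinor (N := N) (u (clamp T t))) t
  have j2 := h.isBump.dx.integrable
    ((spinFst - spinSnd).compLpL 2 volume (x0Spinor (N := N) (u (clamp T t)))) t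
  have j3 := h.isBump.integrable ((massMap M).compLpL 2 volume (x0Spinor (N := N) (u (clamp T t)))) t
  have j12 : Integrable (fun x => dt φ t x • x0Spinor (N := N) (u (clamp T t)) x + dx φ t x •
    (spinFst - spinSnd).compLpL 2 volume (x0Spinor (N := N) (u (clamp T t))) x) volume := j1.add j2
  have j123 : Integrable (fun x => dt φ t x • x0Spinor (N := N) (u (clamp T t)) x + dx φ t x •
    (spinFst - spinSnd).compLpL 2 volume (x0Spinor (N := N) (u (clamp T t))) x +
    φ t x • (massMap M).compLpL 2 volume (x0Spinor (N := N) (u (clamp T t))) x) volume := j12.add j3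
  rw [← integral_add j1 j2, ← integral_add j12 j3, ← diracMul.integral_comp_comm j123]
  refine integral_congr_ae ?_
  filter_upwards [(spinFst - spinSnd).coeFn_compLpL (x0Spinor (N := N) (u (clamp T t))),
    (massMap M).coeFn_compLpL (x0Spinor (N := N) (u (clamp T t)))] with x h2 h3
  rw [x0_rep, h2, h3]
  exact diracMul_lhs _ _ _ _

theorem continuous_diracHolder : Continuous fun t => (diracMap B).holder 2
    (yTop (N := N) (x0V (N := N) (u (clamp T t)))) (x0Spinor (N := N) (u (clamp T t))) := by
  have c1 : Continuous fun t => x0Spinor (N := N) (u (clamp T t)) := continuous_x0Spinor_extend u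
  have c2 : Continuous fun t => yTop (N := N) (x0V (N := N) (u (clamp T t))) :=
    continuous_yTop_extend u
  exact ((((diracMap B).holderL volume ⊤ 2 2).continuous.comp c2).clm_apply c1 :)

theorem continuous_currentHolder : Continuous fun t => (currentMap C).holder 1
    (x0Spinor (N := N) (u (clamp T t))) (x0Spinor (N := N) (u (clamp T t))) := by
  have c1 : Continuous fun t => x0Spinor (N := N) (u (clamp T t)) := continuous_x0Spinor_extend u
  exact ((((currentMap C).holderL volume 2 2 1).continuous.comp c1).clm_apply c1 :)

theorem x0_dirac_rhs (h : IsTest T φ) :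
    ∫ t, (∫ x : ℝ, (φ t x : ℂ) • ∑ j, ((X0.rep (u t) x).2.1 j : ℂ) •
          (gamma0 * B j).mulVec (X0.rep (u t) x).1.ofLp) ∂timeMeasure T =
    diracMul (-dbl T φ (fun t => (diracMap B).holder 2 (yTop (N := N) (x0V (N := N) (u (clamp T t))))
        (x0Spinor (N := N) (u (clamp T t))))) := by
  have i1 := h.isBump.intervalIntegrable (continuous_diracHolder (B := B) (u := u)) (-T) T
  rw [map_neg, dbl, ← diracMul.intervalIntegral_comp_comm i1, ← intervalIntegral.integral_neg,
    integral_timeMeasure]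
  refine intervalIntegral.integral_congr fun t ht => ?_
  rw [uIcc_of_le (by have := Fact.out (p := 0 < T); linarith)] at ht
  have ht' : ((clamp T t : Icc (-T) T) : ℝ) = t := by rw [clamp_of_mem ht]
  simp only [ht']
  have j1 := h.isBump.integrable ((diracMap B).holder 2 (yTop (N := N) (x0V (N := N) (u (clamp T t))))
        (x0Spinor (N := N) (u (clamp T t)))) t
  rw [← diracMul.integral_comp_comm j1, ← integral_neg]
  refine integral_congr_ae ?_
  filter_upwards [(diracMap B).coeFn_holder (r := 2) (yTop (N := N) (x0V (N := N) (u (clamp T t))))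
    (x0Spinor (N := N) (u (clamp T t))), coeFn_yTop (x0V (N := N) (u (clamp T t)))] with x h1 h2
  rw [x0_rep, h1, h2, ← map_neg]
  exact diracMul_rhs _ _ _

theorem dbl_potCoord {p : ℝ≥0∞} [Fact (1 ≤ p)] {φ : ℝ → ℝ → ℝ} (h : IsBump φ) (j : Fin N)
    {f : ℝ → Lp (Pot N) p (volume : Measure ℝ)} (hf : Continuous f) :
    potCoord j (dbl T φ f) = ∫ t in (-T)..T, ∫ x, (φ t x : ℂ) * potCoord j (f t x) := by
  rw [dbl, ← (potCoord j).intervalIntegral_comp_comm (h.intervalIntegrable hf _ _)]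
  refine intervalIntegral.integral_congr fun t _ => ?_
  rw [← (potCoord j).integral_comp_comm (h.integrable _ _)]
  refine integral_congr_ae (Eventually.of_forall fun x => ?_)
  simp only [map_smul, Complex.real_smul]

set_option maxHeartbeats 800000 in
theorem x0_wave_lhs (h : IsTest T φ) (j : Fin N) :
    ∫ t, (∫ x : ℝ, (((dt (dt φ) t x - dx (dx φ) t x + m ^ 2 * φ t x) *
      (X0.rep (u t) x).2.1 j : ℝ) : ℂ)) ∂timeMeasure T =
    potCoord j (dbl T (dt (dt φ)) (fun t => yTop (N := N) (x0V (N := N) (u (clamp T t)))) -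
      dbl T (dx (dx φ)) (fun t => yTop (N := N) (x0V (N := N) (u (clamp T t)))) +
      m ^ 2 • dbl T φ (fun t => yTop (N := N) (x0V (N := N) (u (clamp T t))))) := by
  have c1 : Continuous fun t => yTop (N := N) (x0V (N := N) (u (clamp T t))) :=
    continuous_yTop_extend u
  have i1 := h.isBump.dt.dt.intervalIntegrable c1 (-T) T
  have i2 := h.isBump.dx.dx.intervalIntegrable c1 (-T) T
  have c2 : Continuous fun t => m ^ 2 • ∫ x, φ t x • yTop (N := N) (x0V (N := N) (u (clamp T t))) x :=
    (h.isBump.continuous_integral c1).const_smul (m ^ 2)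
  have i3 := c2.intervalIntegrable (μ := volume) (-T) T
  rw [dbl, dbl, dbl, ← intervalIntegral.integral_smul, ← intervalIntegral.integral_sub i1 i2,
    ← intervalIntegral.integral_add (i1.sub i2) i3,
    ← (potCoord j).intervalIntegral_comp_comm ((i1.sub i2).add i3), integral_timeMeasure]
  refine intervalIntegral.integral_congr fun t ht => ?_
  rw [uIcc_of_le (by have := Fact.out (p := 0 < T); linarith)] at ht
  have ht' : ((clamp T t : Icc (-T) T) : ℝ) = t := by rw [clamp_of_mem ht]
  simp only [ht']
  have j1 := h.isBump.dt.dt.integrable (yTop (N := N) (x0V (N := N) (u (clamp T t)))) t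
  have j2 := h.isBump.dx.dx.integrable (yTop (N := N) (x0V (N := N) (u (clamp T t)))) t
  have j3 : Integrable (fun x => m ^ 2 • φ t x • yTop (N := N) (x0V (N := N) (u (clamp T t))) x) volume :=
    (h.isBump.integrable (yTop (N := N) (x0V (N := N) (u (clamp T t)))) t).smul (m ^ 2)
  have j12 : Integrable (fun x => dt (dt φ) t x • yTop (N := N) (x0V (N := N) (u (clamp T t))) x -
    dx (dx φ) t x • yTop (N := N) (x0V (N := N) (u (clamp T t))) x) volume := j1.sub j2
  have j123 : Integrable (fun x => dt (dt φ) t x • yTop (N := N) (x0V (N := N) (u (clamp T t))) x -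
    dx (dx φ) t x • yTop (N := N) (x0V (N := N) (u (clamp T t))) x +
    m ^ 2 • φ t x • yTop (N := N) (x0V (N := N) (u (clamp T t))) x) volume := j12.add j3
  rw [← integral_smul, ← integral_sub j1 j2, ← integral_add j12 j3,
    ← (potCoord j).integral_comp_comm j123]
  refine integral_congr_ae ?_
  filter_upwards [coeFn_yTop (x0V (N := N) (u (clamp T t)))] with x h1
  rw [x0_rep, h1, ← sub_smul, smul_smul, ← add_smul, map_smul, potCoord_apply, Complex.real_smul,
    Complex.ofReal_mul]

theorem x0_wave_rhs (hC : ∀ j, (C j).IsHermitian) (h : IsTest T φ) (j : Fin N) :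
    ∫ t, (∫ x : ℝ, (φ t x : ℂ) * (star (X0.rep (u t) x).1.ofLp ⬝ᵥ
      (C j).mulVec (X0.rep (u t) x).1.ofLp)) ∂timeMeasure T =
    potCoord j (dbl T φ (fun t => (currentMap C).holder 1 (x0Spinor (N := N) (u (clamp T t)))
        (x0Spinor (N := N) (u (clamp T t))))) := by
  rw [dbl_potCoord h.isBump j (continuous_currentHolder (C := C) (u := u)), integral_timeMeasure]
  refine intervalIntegral.integral_congr fun t ht => ?_
  rw [uIcc_of_le (by have := Fact.out (p := 0 < T); linarith)] at ht
  have ht' : ((clamp T t : Icc (-T) T) : ℝ) = t := by rw [clamp_of_mem ht]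
  simp only [ht']
  refine integral_congr_ae ?_
  filter_upwards [(currentMap C).coeFn_holder (r := 1) (x0Spinor (N := N) (u (clamp T t)))
    (x0Spinor (N := N) (u (clamp T t)))] with x h1
  rw [x0_rep, h1, current_eq hC]

theorem x0_velocity_lhs {φ : ℝ → ℝ → ℝ} :
    ∫ t, (∫ x : ℝ, φ t x • (X0.rep (u t) x).2.1) ∂timeMeasure T =
      dbl T φ (fun t => yTop (N := N) (x0V (N := N) (u (clamp T t)))) := by
  rw [dbl, integral_timeMeasure]
  refine intervalIntegral.integral_congr fun t ht => ?_
  rw [uIcc_of_le (by have := Fact.out (p := 0 < T); linarith)] at ht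
  have ht' : ((clamp T t : Icc (-T) T) : ℝ) = t := by rw [clamp_of_mem ht]
  simp only [ht']
  refine integral_congr_ae ?_
  filter_upwards [coeFn_yTop (x0V (N := N) (u (clamp T t)))] with x h1
  rw [x0_rep, h1]

theorem x0_velocity_rhs {φ : ℝ → ℝ → ℝ} :
    ∫ t, (∫ x : ℝ, φ t x • (X0.rep (u t) x).2.2) ∂timeMeasure T =
      dbl T φ (fun t => x0W (N := N) (u (clamp T t))) := by
  rw [dbl, integral_timeMeasure]
  refine intervalIntegral.integral_congr fun t ht => ?_
  rw [uIcc_of_le (by have := Fact.out (p := 0 < T); linarith)] at ht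
  have ht' : ((clamp T t : Icc (-T) T) : ℝ) = t := by rw [clamp_of_mem ht]
  simp only [ht', x0_rep]

/-- On `X₀` the weak equations can be written with the pairings in space and time. -/
theorem solEqs_iff (hC : ∀ j, (C j).IsHermitian) (h : IsTest T φ) :
    SolEqs M m B C φ (fun t => X0.rep (u t)) ↔ X0Eqs M m B C φ u := by
  constructor
  · intro hs
    refine ⟨?_, ?_, ?_⟩
    · have h1 := hs.dirac
      rw [x0_dirac_lhs h, x0_dirac_rhs h] at h1
      rw [diracMul_injective h1, neg_add_cancel]
    · ext j
      have h1 := hs.kleinGordon j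
      rw [x0_wave_lhs h, x0_wave_rhs hC h] at h1
      exact Complex.ofReal_injective h1
    · rw [← x0_velocity_lhs, ← x0_velocity_rhs, hs.velocity]
  · intro hs
    refine ⟨?_, fun j => ?_, ?_⟩
    · rw [x0_dirac_lhs h, x0_dirac_rhs h, eq_neg_of_add_eq_zero_left hs.dirac]
    · rw [x0_wave_lhs h, x0_wave_rhs hC h, hs.wave]
    · rw [x0_velocity_lhs, x0_velocity_rhs, hs.velocity]

end Eqs

/-! ### Forces -/

section Forces

variable {N : ℕ} {T : ℝ} [Fact (0 < T)] (M m : ℝ) (B C : Fin N → Matrix (Fin 2) (Fin 2) ℂ)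

theorem dbl_congr {E : Type} [NormedAddCommGroup E] [NormedSpace ℝ E] {p q : ℝ≥0∞}
    {φ : ℝ → ℝ → ℝ} {f : ℝ → Lp E p (volume : Measure ℝ)} {g : ℝ → Lp E q (volume : Measure ℝ)}
    (h : ∀ t, ∀ᵐ x, φ t x ≠ 0 → f t x = g t x) : dbl T φ f = dbl T φ g := by
  rw [dbl, dbl]
  refine intervalIntegral.integral_congr fun t _ => integral_congr_ae ?_
  filter_upwards [h t] with x hx
  by_cases h0 : φ t x = 0
  · rw [h0, zero_smul, zero_smul]
  · rw [hx h0]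

theorem continuous_holder {A E F G : Type} [TopologicalSpace A] [NormedAddCommGroup E]
    [NormedSpace ℝ E] [NormedAddCommGroup F] [NormedSpace ℝ F] [NormedAddCommGroup G]
    [NormedSpace ℝ G] {p q r : ℝ≥0∞} [Fact (1 ≤ p)] [Fact (1 ≤ q)] [Fact (1 ≤ r)]
    [ENNReal.HolderTriple p q r] (b : E →L[ℝ] F →L[ℝ] G) {f : A → Lp E p (volume : Measure ℝ)}
    {g : A → Lp F q (volume : Measure ℝ)} (hf : Continuous f) (hg : Continuous g) :
    Continuous fun a => b.holder r (f a) (g a) :=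
  ((b.holderL volume p q r).continuous.comp hf).clm_apply hg

theorem eq_zero_of_spin {z : Spinor} (h1 : spinFst z = 0) (h2 : spinSnd z = 0) : z = 0 := by
  rw [← spinSnd_add_spinFst z, h1, h2, add_zero]

theorem add_four_eq {G : Type} [AddCommGroup G] {a b c d a' b' e : G} (h1 : a = a') (h2 : b = b')
    (h3 : c + d = e) : a + b + c + d = a' + b' + e := by rw [h1, h2, ← h3, add_assoc (a' + b')]

/-- The lower order terms of the Dirac equation. -/
def diracForce (d : X0 N) : Lp Spinor 2 (volume : Measure ℝ) :=
  (massMap M).compLpL 2 volume (x0Spinor d) +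
    (diracMap B).holder 2 (yTop (N := N) (x0V d)) (x0Spinor d)

/-- The right hand side of the wave equation, with a mass density. -/
def waveForce (μ : Lp ℝ 1 (volume : Measure ℝ)) (d : X0 N) : Lp (Pot N) 1 (volume : Measure ℝ) :=
  (currentMap C).holder 1 (x0Spinor d) (x0Spinor d) + dampMap.holder 1 μ (yTop (N := N) (x0V d))

theorem continuous_diracForce : Continuous (diracForce (N := N) M B) := by
  have c1 : Continuous fun d : X0 N => x0Spinor d := (x0Spinor (N := N)).continuous
  have c2 : Continuous fun d : X0 N => yTop (N := N) (x0V d) :=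
    (yTop (N := N)).continuous.comp (x0V (N := N)).continuous
  have c3 : Continuous fun d : X0 N => (diracMap B).holder 2 (yTop (N := N) (x0V d)) (x0Spinor d) :=
    continuous_holder _ c2 c1
  have c4 : Continuous fun d : X0 N => (massMap M).compLpL 2 volume (x0Spinor d) :=
    ((massMap M).compLpL 2 volume).continuous.comp c1
  exact c4.add c3

/-- The nonlinearity sees a lifted state only through the physical state and the mass density, not
through the splitting into movers. Thus sources can be computed from a weak solution on `X0`. -/
theorem dkg_N_eq (h : Lift N) : (dkg M B C).N h =
    diracInsert (diracForce M B (projX h)) + waveInsert (waveForce C (liftMass h) (projX h)) := by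
  apply lift_ext
  · rw [liftSpinor_N, diracSource_apply, liftV_apply]; simp [diracForce]
  · rw [liftLeft_N, waveSource_apply, liftV_apply]; simp [waveForce]
  · rw [liftRight_N, waveSource_apply, liftV_apply]; simp [waveForce]
  · rw [liftMass_N]; simp

theorem diracForce_eq (d : X0 N) : diracForce M B d = (massMap M).compLpL 2 volume (x0Spinor d) +
    (diracMap B).holder 2 (yTop (N := N) (x0V d)) (x0Spinor d) := rfl

theorem waveForce_eq (μ : Lp ℝ 1 (volume : Measure ℝ)) (d : X0 N) : waveForce C μ d =
    (currentMap C).holder 1 (x0Spinor d) (x0Spinor d) + dampMap.holder 1 μ (yTop (N := N) (x0V d)) := rfl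

attribute [irreducible] diracForce waveForce

variable {M m B C} {φ : ℝ → ℝ → ℝ} {u : C(Icc (-T) T, X0 N)}

/-- A projection R that diagonalizes γ⁰γ¹ with eigenvalue c turns the weak Dirac equation into a
transport equation with velocity c. -/
theorem dbl_spin_dirac (h : IsBump φ) (R : Spinor →L[ℝ] Spinor) (c : ℝ)
    (hR : ∀ z, R ((spinFst - spinSnd) z) = c • R z) :
    R (dbl T (dt φ) (fun t => x0Spinor (N := N) (u (clamp T t))) +
      dbl T (dx φ) (fun t => (spinFst - spinSnd).compLpL 2 volume (x0Spinor (N := N) (u (clamp T t)))) +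
      dbl T φ (fun t => (massMap M).compLpL 2 volume (x0Spinor (N := N) (u (clamp T t)))) +
      dbl T φ (fun t => (diracMap B).holder 2 (yTop (N := N) (x0V (N := N) (u (clamp T t))))
        (x0Spinor (N := N) (u (clamp T t))))) =
    dbl T (dt φ) (fun t => R.compLpL 2 volume (x0Spinor (N := N) (u (clamp T t)))) +
      c • dbl T (dx φ) (fun t => R.compLpL 2 volume (x0Spinor (N := N) (u (clamp T t)))) +
      dbl T φ (fun t => R.compLpL 2 volume (diracForce M B (u (clamp T t)))) := by
  have c1 : Continuous fun t => x0Spinor (N := N) (u (clamp T t)) := continuous_x0Spinor_extend u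
  have c2 : Continuous fun t => (massMap M).compLpL 2 volume (x0Spinor (N := N) (u (clamp T t))) :=
    ((massMap M).compLpL 2 volume).continuous.comp c1
  have c3 : Continuous fun t => (diracMap B).holder 2 (yTop (N := N) (x0V (N := N) (u (clamp T t))))
        (x0Spinor (N := N) (u (clamp T t))) := continuous_diracHolder
  have c4 : Continuous fun t => (spinFst - spinSnd).compLpL 2 volume (x0Spinor (N := N) (u (clamp T t))) :=
    ((spinFst - spinSnd).compLpL 2 volume).continuous.comp c1
  have e1 := dbl_map (T := T) h.dt R c1 (fun t => R.coeFn_compLpL (x0Spinor (N := N) (u (clamp T t))))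
  have e2 : R (dbl T (dx φ) (fun t => (spinFst - spinSnd).compLpL 2 volume
      (x0Spinor (N := N) (u (clamp T t))))) = c • dbl T (dx φ) (fun t => R.compLpL 2 volume
      (x0Spinor (N := N) (u (clamp T t)))) := by
    rw [← dbl_smul, ← dbl_map (T := T) h.dx R c4
      (fun t => R.coeFn_compLpL ((spinFst - spinSnd).compLpL 2 volume (x0Spinor (N := N) (u (clamp T t)))))]
    refine dbl_congr fun t => ?_
    filter_upwards [R.coeFn_compLpL ((spinFst - spinSnd).compLpL 2 volume (x0Spinor (N := N) (u (clamp T t)))),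
      (spinFst - spinSnd).coeFn_compLpL (x0Spinor (N := N) (u (clamp T t))),
      R.coeFn_compLpL (x0Spinor (N := N) (u (clamp T t))),
      Lp.coeFn_smul c (R.compLpL 2 volume (x0Spinor (N := N) (u (clamp T t))))] with x h1 h2 h3 h4 _
    rw [h1, h2, hR, h4, Pi.smul_apply, h3]
  have e3 : R (dbl T φ (fun t => (massMap M).compLpL 2 volume (x0Spinor (N := N) (u (clamp T t))))) +
      R (dbl T φ (fun t => (diracMap B).holder 2 (yTop (N := N) (x0V (N := N) (u (clamp T t))))
        (x0Spinor (N := N) (u (clamp T t))))) =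
      dbl T φ (fun t => R.compLpL 2 volume (diracForce M B (u (clamp T t)))) := by
    rw [← map_add, ← dbl_add h c2 c3]
    have c5 : Continuous fun t => diracForce M B (u (clamp T t)) :=
      (continuous_diracForce M B).comp (continuous_extend u)
    simp only [← diracForce_eq]
    exact (dbl_map (T := T) h R c5 (fun t => R.coeFn_compLpL _)).symm
  rw [R.map_add, R.map_add, R.map_add]
  exact add_four_eq e1.symm e2 e3

/-- Only values of μ on the support of φ enter, and there the bilinear term -μV is -m²V. -/
theorem wave_iff (h : IsBump φ) {μ : Lp ℝ 1 (volume : Measure ℝ)}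
    (hμ : ∀ t, ∀ᵐ x, φ t x ≠ 0 → μ x = m ^ 2) :
    dbl T φ (fun t => waveForce C μ (u (clamp T t))) =
      dbl T φ (fun t => (currentMap C).holder 1 (x0Spinor (N := N) (u (clamp T t)))
        (x0Spinor (N := N) (u (clamp T t)))) - m ^ 2 • dbl T φ (fun t => yTop (N := N) (x0V (N := N) (u (clamp T t)))) := by
  have c1 : Continuous fun t => (currentMap C).holder 1 (x0Spinor (N := N) (u (clamp T t)))
      (x0Spinor (N := N) (u (clamp T t))) := continuous_currentHolder
  have c2 : Continuous fun t => yTop (N := N) (x0V (N := N) (u (clamp T t))) := continuous_yTop_extend u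
  have c3 : Continuous fun t => (dampMap (N := N)).holder 1 μ (yTop (N := N) (x0V (N := N) (u (clamp T t)))) :=
    continuous_holder _ continuous_const c2
  have e1 : dbl T φ (fun t => waveForce C μ (u (clamp T t))) =
      dbl T φ (fun t => (currentMap C).holder 1 (x0Spinor (N := N) (u (clamp T t)))
        (x0Spinor (N := N) (u (clamp T t)))) +
      dbl T φ (fun t => (dampMap (N := N)).holder 1 μ (yTop (N := N) (x0V (N := N) (u (clamp T t))))) := by
    simp only [waveForce_eq]
    exact dbl_add h c1 c3
  have e2 : dbl T φ (fun t => (dampMap (N := N)).holder 1 μ (yTop (N := N) (x0V (N := N) (u (clamp T t))))) =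
      dbl T φ (fun t => (-(m ^ 2)) • yTop (N := N) (x0V (N := N) (u (clamp T t)))) := by
    refine dbl_congr fun t => ?_
    filter_upwards [(dampMap (N := N)).coeFn_holder (r := 1) μ (yTop (N := N) (x0V (N := N) (u (clamp T t)))),
      Lp.coeFn_smul (-(m ^ 2)) (yTop (N := N) (x0V (N := N) (u (clamp T t)))), hμ t] with x h1 h2 h3 h4
    rw [h1, h2, Pi.smul_apply, dampMap_apply, h3 h4, neg_smul]
  rw [e1, e2, dbl_smul, neg_smul, sub_eq_add_neg]

/-- The nonlinear equations are read as linear ones whose forces are computed from the solution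
itself. Thus linear existence and uniqueness results apply to nonlinear weak solutions. -/
theorem x0Eqs_iff_linearEqs (h : IsTest T φ) {μ : Lp ℝ 1 (volume : Measure ℝ)}
    (hμ : ∀ t, ∀ᵐ x, φ t x ≠ 0 → μ x = m ^ 2) :
    X0Eqs M m B C φ u ↔ LinearEqs T φ (fun t => u (clamp T t))
      (fun t => diracForce M B (u (clamp T t))) (fun t => waveForce C μ (u (clamp T t))) := by
  have h1 := dbl_spin_dirac (M := M) (B := B) (u := u) h.isBump spinFst 1 (fun z => by
    rw [_root_.sub_apply, map_sub, spinFst_spinFst, spinFst_spinSnd, sub_zero,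
      one_smul])
  have h2 := dbl_spin_dirac (M := M) (B := B) (u := u) h.isBump spinSnd (-1) (fun z => by
    rw [_root_.sub_apply, map_sub, spinSnd_spinFst, spinSnd_spinSnd, zero_sub,
      neg_one_smul])
  rw [one_smul] at h1
  rw [neg_one_smul, ← sub_eq_add_neg] at h2
  have h3 := wave_iff (C := C) (u := u) h.isBump hμ
  constructor
  · intro hs
    refine ⟨?_, ?_, ?_, hs.velocity⟩
    · rw [← h1, hs.dirac, map_zero]
    · rw [← h2, hs.dirac, map_zero]
    · rw [h3, ← hs.wave, add_sub_cancel_right]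
  · intro hs
    refine ⟨?_, ?_, hs.velocity⟩
    · exact eq_zero_of_spin (h1.trans hs.fst) (h2.trans hs.snd)
    · rw [hs.wave, h3, sub_add_cancel]

/-- Mild solutions solve the equations where the mass density is `m²`. -/
theorem x0Eqs_of_isMild {d : Lift N} {U : C(Icc (-T) T, Lift N)} (hU : (dkg M B C).IsMild d U)
    (h : IsTest T φ) (hμ : ∀ t, ∀ᵐ x, φ t x ≠ 0 → liftMass d x = m ^ 2) :
    X0Eqs M m B C φ (mapCurve T (projX (N := N)) U) := by
  rw [x0Eqs_iff_linearEqs h hμ]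
  refine linearEqs_of_mild hU (fun t => ?_) (fun t => ?_) (fun t => ?_) h
  · rw [TransportSystem.curveN_apply, dkg_N_eq]; simp
  · rw [TransportSystem.curveN_apply, dkg_N_eq, liftMass_eq M hU]; simp
  · rw [TransportSystem.curveN_apply, dkg_N_eq, liftMass_eq M hU]; simp

end Forces

/-! ### Uniqueness for the transport equation on a cone -/

section Constant

variable {E : Type} [NormedAddCommGroup E] [NormedSpace ℝ E] [CompleteSpace E]

theorem contDiff_primitive {θ : ℝ → ℝ} (hθ : ContDiff ℝ ∞ θ) (a : ℝ) :
    ContDiff ℝ ∞ (fun t => ∫ s in a..t, θ s) ∧ ∀ t, deriv (fun t => ∫ s in a..t, θ s) t = θ t := by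
  have hd (t : ℝ) : HasDerivAt (fun t => ∫ s in a..t, θ s) (θ t) t :=
    intervalIntegral.integral_hasDerivAt_right (hθ.continuous.intervalIntegrable _ _)
      hθ.continuous.stronglyMeasurable.stronglyMeasurableAtFilter hθ.continuous.continuousAt
  refine ⟨contDiff_infty_iff_deriv.2 ⟨fun t => (hd t).differentiableAt, ?_⟩, fun t => (hd t).deriv⟩
  rw [funext fun t => (hd t).deriv]
  exact hθ

theorem integral_eq_of_support {θ : ℝ → ℝ} {δ : ℝ} (hδ : 0 < δ)
    (hθ : ∀ x, θ x ≠ 0 → x ∈ Ioo (-δ) δ) {x : ℝ} (hx : x ∉ Ioo (-δ) δ) :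
    ∫ s in (-δ)..x, θ s = if x ≤ -δ then 0 else ∫ s in (-δ)..δ, θ s := by
  have h0 (y : ℝ) (hy : y ∉ Ioo (-δ) δ) : θ y = 0 := by_contra fun h => hy (hθ y h)
  split_ifs with h
  · refine (intervalIntegral.integral_congr (g := fun _ => (0 : ℝ)) fun y hy => ?_).trans (by simp)
    rw [uIcc_of_ge h] at hy
    exact h0 y fun h1 => by linarith [h1.1, hy.2]
  · have hx' : δ ≤ x := by
      by_contra h1
      exact hx ⟨not_le.1 h, not_le.1 h1⟩
    have h2 : EqOn θ (fun _ => (0 : ℝ)) (uIcc δ x) := fun y hy => by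
      rw [uIcc_of_le hx'] at hy
      exact h0 y fun h1 => by linarith [h1.2, hy.1]
    have h3 : EqOn (fun s => θ s) (Ioc (-δ) δ |>.indicator θ) univ := fun y _ => by
      by_cases hy : y ∈ Ioc (-δ) δ
      · rw [indicator_of_mem hy]
      · rw [indicator_of_notMem hy]; exact h0 y fun h1 => hy ⟨h1.1, h1.2.le⟩
    rw [intervalIntegral.integral_of_le (by linarith), intervalIntegral.integral_of_le (by linarith)]
    refine setIntegral_eq_of_subset_of_forall_sdiff_eq_zero measurableSet_Ioc
      (Ioc_subset_Ioc_right hx') fun y hy => h0 y fun h1 => hy.2 ⟨h1.1, h1.2.le⟩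

/-- A continuous function with vanishing weak derivative on an interval is constant there. -/
theorem eq_of_integral_deriv_smul_eq_zero {h : ℝ → E} (hc : Continuous h) {a b : ℝ}
    (H : ∀ η : ℝ → ℝ, ContDiff ℝ ∞ η → HasCompactSupport η → tsupport η ⊆ Ioo a b →
      ∫ t, deriv η t • h t = 0) {s t : ℝ} (hs : s ∈ Ioo a b) (ht : t ∈ Ioo a b) : h s = h t := by
  obtain ⟨δ, hδ, h1, h2, h3, h4⟩ : ∃ δ : ℝ, 0 < δ ∧ a < s - δ ∧ a < t - δ ∧ s + δ < b ∧ t + δ < b := by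
    have e1 := sub_pos.2 hs.1
    have e2 := sub_pos.2 hs.2
    have e3 := sub_pos.2 ht.1
    have e4 := sub_pos.2 ht.2
    refine ⟨min (min (s - a) (b - s)) (min (t - a) (b - t)) / 2, by positivity, ?_⟩
    have f1 := min_le_left (min (s - a) (b - s)) (min (t - a) (b - t))
    have f2 := min_le_right (min (s - a) (b - s)) (min (t - a) (b - t))
    have f3 := min_le_left (s - a) (b - s)
    have f4 := min_le_right (s - a) (b - s)
    have f5 := min_le_left (t - a) (b - t)
    have f6 := min_le_right (t - a) (b - t)
    refine ⟨?_, ?_, ?_, ?_⟩ <;> linarith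
  have hcont : Continuous fun x => h (x + s) - h (x + t) :=
    (hc.comp (continuous_add_const s)).sub (hc.comp (continuous_add_const t))
  -- Given a test function θ near 0 with primitive Θ, the function Θ(x - s) - Θ(x - t) is an
  -- admissible η: far to the right both terms equal the total integral of θ and cancel. Its
  -- derivative pairs h with θ(x - s) - θ(x - t).
  have key : ∀ᵐ x, x ∈ Ioo (-δ) δ → h (x + s) - h (x + t) = 0 := by
    refine isOpen_Ioo.ae_eq_zero_of_integral_contDiff_smul_eq_zero
      (hcont.locallyIntegrable.locallyIntegrableOn _) fun θ hθ hθc hθs => ?_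
    have hθ0 : ∀ x, θ x ≠ 0 → x ∈ Ioo (-δ) δ := fun x hx => hθs (subset_tsupport θ hx)
    obtain ⟨c1, d1⟩ := contDiff_primitive hθ (-δ)
    set Θ : ℝ → ℝ := fun t => ∫ s in (-δ)..t, θ s with hΘ
    have hη : ContDiff ℝ ∞ fun x => Θ (x - s) - Θ (x - t) :=
      (c1.comp (contDiff_id.sub contDiff_const)).sub (c1.comp (contDiff_id.sub contDiff_const))
    have hsupp : tsupport (fun x => Θ (x - s) - Θ (x - t)) ⊆
        Icc (min (s - δ) (t - δ)) (max (s + δ) (t + δ)) := by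
      refine closure_minimal (fun x hx => ?_) isClosed_Icc
      by_contra hx'
      refine hx ?_
      rw [mem_Icc, not_and_or, not_le, not_le, lt_min_iff, max_lt_iff] at hx'
      change Θ (x - s) - Θ (x - t) = 0
      rcases hx' with hx' | hx'
      · rw [hΘ]
        simp only
        rw [integral_eq_of_support hδ hθ0 (fun h => by linarith [h.1, hx'.1]), if_pos (by linarith),
          integral_eq_of_support hδ hθ0 (fun h => by linarith [h.1, hx'.2]), if_pos (by linarith),
          sub_zero]
      · rw [hΘ]
        simp only
        rw [integral_eq_of_support hδ hθ0 (fun h => by linarith [h.2, hx'.1]), if_neg (by linarith [hx'.1]),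
          integral_eq_of_support (x := x - t) hδ hθ0 (fun h => by linarith [h.2, hx'.2]),
          if_neg (by linarith [hx'.2]), sub_self]
    have h5 := H _ hη (isCompact_Icc.of_isClosed_subset (isClosed_tsupport _) hsupp)
      (hsupp.trans fun x hx => ⟨(lt_min h1 h2).trans_le hx.1, hx.2.trans_lt (max_lt h3 h4)⟩)
    have hdΘ (x : ℝ) : HasDerivAt Θ (θ x) x := by
      rw [← d1 x]; exact ((c1.differentiable (by simp)) x).hasDerivAt
    have hd (x : ℝ) : deriv (fun x => Θ (x - s) - Θ (x - t)) x = θ (x - s) - θ (x - t) :=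
      (((hdΘ (x - s)).comp_sub_const x s).sub ((hdΘ (x - t)).comp_sub_const x t)).deriv
    have hi (s : ℝ) : Integrable (fun x => θ x • h (x + s)) volume :=
      (hθ.continuous.smul (hc.comp (continuous_add_const s))).integrable_of_hasCompactSupport
        hθc.smul_right
    have hi' (s : ℝ) : Integrable (fun x => θ (x - s) • h x) volume := by
      have := (hi s).comp_sub_right s
      simpa using this
    have e (s : ℝ) : ∫ x, θ (x - s) • h x = ∫ x, θ x • h (x + s) := by
      have := integral_sub_right_eq_self (fun x => θ x • h (x + s)) (μ := volume) s
      simpa using this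
    simp only [hd, sub_smul] at h5
    rw [integral_sub (hi' s) (hi' t), e, e, ← integral_sub (hi s) (hi t)] at h5
    simpa only [smul_sub] using h5
  have h6 : EqOn (fun x => h (x + s) - h (x + t)) (fun _ => 0) (Ioo (-δ) δ) := by
    refine Measure.eqOn_open_of_ae_eq (μ := volume) ?_ isOpen_Ioo hcont.continuousOn
      continuousOn_const
    exact (ae_restrict_iff' measurableSet_Ioo).2 key
  have h7 := h6 (x := 0) ⟨by linarith, hδ⟩
  simpa [sub_eq_zero] using h7

end Constant

/-- Test functions supported in the cone `|t| + |x| < r`. -/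
def IsConeTest (T r : ℝ) (φ : ℝ → ℝ → ℝ) : Prop :=
  IsTest T φ ∧ ∀ p ∈ tsupport (Function.uncurry φ), |p.1| + |p.2| < r

theorem IsConeTest.dt {T r : ℝ} {φ : ℝ → ℝ → ℝ} (h : IsConeTest T r φ) : IsConeTest T r (dt φ) :=
  ⟨h.1.dt, fun p hp => h.2 p (h.1.isBump.tsupport_dt hp)⟩

theorem IsConeTest.dx {T r : ℝ} {φ : ℝ → ℝ → ℝ} (h : IsConeTest T r φ) : IsConeTest T r (dx φ) :=
  ⟨h.1.dx, fun p hp => h.2 p (h.1.isBump.tsupport_dx hp)⟩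

section Transport

variable {E : Type} [NormedAddCommGroup E] [NormedSpace ℝ E] [CompleteSpace E]
  {p : ℝ≥0∞} [Fact (1 ≤ p)] {T r : ℝ}

/-- Product of a function of time and a travelling wave. -/
theorem isConeTest_travelling {c t₁ ε : ℝ} (hc : |c| ≤ 1) {η g : ℝ → ℝ}
    (hη : ContDiff ℝ ∞ η) (hηc : HasCompactSupport η)
    (hη1 : tsupport η ⊆ Ioo (-T) T) (hη2 : ∀ t ∈ tsupport η, |t| + |t - t₁| < |t₁| + ε)
    (hg : ContDiff ℝ ∞ g)
    (hg1 : ∀ x ∈ tsupport g, |x| ≤ r - |t₁| - ε) :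
    IsConeTest T r (fun t x => η t * g (x - c * (t - t₁))) := by
  have hsupp : tsupport (Function.uncurry fun t x => η t * g (x - c * (t - t₁))) ⊆
      {q : ℝ × ℝ | q.1 ∈ tsupport η ∧ q.2 - c * (q.1 - t₁) ∈ tsupport g} := by
    refine closure_minimal (fun q hq => ?_) ?_
    · have hq' : η q.1 * g (q.2 - c * (q.1 - t₁)) ≠ 0 := hq
      exact ⟨subset_tsupport η (left_ne_zero_of_mul hq'),
        subset_tsupport g (right_ne_zero_of_mul hq')⟩
    · exact ((isClosed_tsupport η).preimage continuous_fst).inter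
        ((isClosed_tsupport g).preimage (by fun_prop))
  have hcone : ∀ q ∈ tsupport (Function.uncurry fun t x => η t * g (x - c * (t - t₁))),
      |q.1| + |q.2| < r := fun q hq => by
    obtain ⟨h1, h2⟩ := hsupp hq
    have h3 := hη2 _ h1
    have h4 := hg1 _ h2
    have h5 : |q.2| ≤ |q.2 - c * (q.1 - t₁)| + |q.1 - t₁| := by
      have h6 : |c * (q.1 - t₁)| ≤ |q.1 - t₁| := by
        rw [abs_mul]; exact mul_le_of_le_one_left (abs_nonneg _) hc
      have h7 := abs_add_le (q.2 - c * (q.1 - t₁)) (c * (q.1 - t₁))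
      rw [sub_add_cancel] at h7
      linarith
    linarith
  refine ⟨⟨?_, ?_, fun q hq => ⟨hη1 (hsupp hq).1, mem_univ _⟩⟩, hcone⟩
  · simp only [Function.uncurry_def]
    fun_prop
  · refine IsCompact.of_isClosed_subset (hηc.isCompact.prod (isCompact_Icc (a := -r) (b := r)))
      (isClosed_tsupport _) fun q hq => ⟨(hsupp hq).1, abs_le.1 ?_⟩
    have := hcone q hq
    linarith [abs_nonneg q.1]

/-- The lemma on cones is applied with time interval and radius so large that its support conditions
hold automatically. -/
theorem isBump_travelling {c t₁ : ℝ} (hc : |c| ≤ 1) {η g : ℝ → ℝ}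
    (hη : ContDiff ℝ ∞ η) (hηc : HasCompactSupport η) (hg : ContDiff ℝ ∞ g)
    (hgc : HasCompactSupport g) : IsBump (fun t x => η t * g (x - c * (t - t₁))) := by
  obtain ⟨a, ha⟩ := hηc.isCompact.exists_bound_of_continuousOn continuousOn_id
  obtain ⟨b, hb⟩ := hgc.isCompact.exists_bound_of_continuousOn continuousOn_id
  simp only [id_eq, Real.norm_eq_abs] at ha hb
  refine (isConeTest_travelling (T := a + 1) (r := b + |t₁| + (2 * a + |t₁| + 1)) (t₁ := t₁)
    (ε := 2 * a + |t₁| + 1) hc hη hηc (fun t ht => abs_lt.1 (by linarith [ha t ht]))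
    (fun t ht => ?_) hg (fun x hx => by linarith [hb x hx])).1.isBump
  have h1 := abs_sub t t₁
  linarith [ha t ht, abs_nonneg t₁]

theorem exists_abs_le_of_tsupport {g : ℝ → ℝ} {ρ : ℝ} (hgc : HasCompactSupport g)
    (hg : tsupport g ⊆ Ioo (-ρ) ρ) : ∃ ε, 0 < ε ∧ ∀ x ∈ tsupport g, |x| ≤ ρ - ε := by
  rcases (tsupport g).eq_empty_or_nonempty with h | h
  · exact ⟨1, one_pos, by simp [h]⟩
  · obtain ⟨x, hx, hm⟩ := hgc.isCompact.exists_isMaxOn h continuous_abs.continuousOn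
    refine ⟨ρ - |x|, sub_pos.2 (abs_lt.2 (hg hx)), fun y hy => ?_⟩
    rw [sub_sub_cancel]
    exact hm hy

/-- Pair f with g travelling along the characteristics and reaching its given position at t₁. The
pairing is continuous in time and has zero weak derivative while g stays in the cone, so its value
at t₁ equals its value at 0, where only f(0) on |x| < r enters. -/
theorem eq_zero_of_transport {f : ℝ → Lp E p (volume : Measure ℝ)} (hf : Continuous f)
    {c : ℝ} (hc : |c| ≤ 1)
    (H : ∀ φ, IsConeTest T r φ → dbl T (dt φ) f + c • dbl T (dx φ) f = 0)
    (h0 : ∀ᵐ x, |x| < r → f 0 x = 0) {t₁ : ℝ} (ht₁ : |t₁| < T) :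
    ∀ᵐ x, |x| < r - |t₁| → f t₁ x = 0 := by
  have key : ∀ᵐ x, x ∈ Ioo (-(r - |t₁|)) (r - |t₁|) → f t₁ x = 0 := by
    refine isOpen_Ioo.ae_eq_zero_of_integral_contDiff_smul_eq_zero
      (((Lp.memLp (f t₁)).locallyIntegrable Fact.out).locallyIntegrableOn _) fun g hg hgc hgs => ?_
    obtain ⟨ε, hε, hgε⟩ := exists_abs_le_of_tsupport hgc hgs
    have hT := (abs_nonneg t₁).trans_lt ht₁
    have hcont : Continuous fun t => ∫ x, g (x - c * (t - t₁)) • f t x := by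
      refine continuous_iff_continuousAt.2 fun t => ?_
      -- The travelling profile is not compactly supported in time. Multiplying by a bump that is 1
      -- near t makes it a test function without changing the pairing near t.
      let θ : ContDiffBump t := default
      have hb := isBump_travelling (t₁ := t₁) hc θ.contDiff θ.hasCompactSupport hg hgc
      refine ((hb.continuous_integral hf).continuousAt).congr ?_
      filter_upwards [θ.eventuallyEq_one] with s hs
      rw [Pi.one_apply] at hs
      simp only [hs, one_mul]
    -- The open interval must contain both 0 and t₁. Overshooting by ε/3 raises |t| + |t - t₁| by
    -- less than ε, the room left between the support of g and the edge of the cone.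
    have hconst : ∀ t ∈ Ioo (max (-T) (min 0 t₁ - ε / 3)) (min T (max 0 t₁ + ε / 3)),
      ∀ s ∈ Ioo (max (-T) (min 0 t₁ - ε / 3)) (min T (max 0 t₁ + ε / 3)),
        ∫ x, g (x - c * (s - t₁)) • f s x = ∫ x, g (x - c * (t - t₁)) • f t x := by
      intro t ht s hs
      refine eq_of_integral_deriv_smul_eq_zero hcont (fun η hη hηc hηs => ?_) hs ht
      have hη1 : tsupport η ⊆ Ioo (-T) T := hηs.trans (Ioo_subset_Ioo (le_max_left _ _) (min_le_left _ _))
      have hη2 : ∀ t ∈ tsupport η, |t| + |t - t₁| < |t₁| + ε := by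
        intro t ht
        have h1 := (le_max_right _ _).trans_lt (hηs ht).1
        have h2 := (hηs ht).2.trans_le (min_le_right _ _)
        rcases le_total 0 t₁ with h3 | h3
        · rw [min_eq_left h3] at h1
          rw [max_eq_right h3] at h2
          rw [abs_of_nonneg h3]
          rcases abs_cases t with h4 | h4 <;> rcases abs_cases (t - t₁) with h5 | h5 <;> linarith
        · rw [min_eq_right h3] at h1
          rw [max_eq_left h3] at h2
          rw [abs_of_nonpos h3]
          rcases abs_cases t with h4 | h4 <;> rcases abs_cases (t - t₁) with h5 | h5 <;> linarith
      have hφ := isConeTest_travelling (T := T) (r := r) hc hη hηc hη1 hη2 hg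
        (fun x hx => hgε x hx)
      have h1 := H _ hφ
      have hdt (t x : ℝ) : dt (fun t x => η t * g (x - c * (t - t₁))) t x =
          deriv η t * g (x - c * (t - t₁)) - c * dx (fun t x => η t * g (x - c * (t - t₁))) t x := by
        have hgd := (hg.differentiable (by simp) (x - c * (t - t₁))).hasDerivAt
        have e1 : HasDerivAt (fun s => x - c * (s - t₁)) (-c) t := by
          have := (((hasDerivAt_id t).sub_const t₁).const_mul c).const_sub x
          simpa using this
        have e2 : HasDerivAt (fun y => y - c * (t - t₁)) 1 x := (hasDerivAt_id x).sub_const _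
        have e3 := ((hη.differentiable (by simp) t).hasDerivAt.mul (hgd.comp t e1)).deriv
        have e4 := ((hgd.comp x e2).const_mul (η t)).deriv
        rw [dt, dx]
        refine e3.trans ?_
        refine Eq.trans ?_ (congrArg (fun z => deriv η t * g (x - c * (t - t₁)) - c * z) e4.symm)
        simp only [Function.comp_apply]
        ring
      have e1 : dbl T (dt fun t x => η t * g (x - c * (t - t₁))) f +
          c • dbl T (dx fun t x => η t * g (x - c * (t - t₁))) f =
          ∫ t in (-T)..T, deriv η t • ∫ x, g (x - c * (t - t₁)) • f t x := by
        have i1 := hφ.1.isBump.dt.intervalIntegrable hf (-T) T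
        have i2 := hφ.1.isBump.dx.intervalIntegrable hf (-T) T
        have i3 : IntervalIntegrable (fun t => c • ∫ x,
          dx (fun t x => η t * g (x - c * (t - t₁))) t x • f t x) volume (-T) T := i2.smul c
        rw [dbl, dbl, ← intervalIntegral.integral_smul, ← intervalIntegral.integral_add i1 i3]
        refine intervalIntegral.integral_congr fun t _ => ?_
        have j1 := hφ.1.isBump.dt.integrable (f t) t
        have j2 : Integrable (fun x => c • dx (fun t x => η t * g (x - c * (t - t₁))) t x • f t x)
          volume := (hφ.1.isBump.dx.integrable (f t) t).smul c
        change (∫ x, _) + c • (∫ x, _) = _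
        rw [← integral_smul, ← integral_add j1 j2, ← integral_smul]
        refine integral_congr_ae (Eventually.of_forall fun x => ?_)
        simp only [hdt]
        module
      rw [h1] at e1
      rw [e1, intervalIntegral.integral_of_le (by linarith)]
      refine (setIntegral_eq_integral_of_forall_compl_eq_zero fun t ht => ?_).symm
      have : deriv η t = 0 := by
        by_contra h
        exact ht (Ioo_subset_Ioc_self (hη1 (tsupport_deriv_subset (subset_tsupport _ h))))
      rw [this, zero_smul]
    have m1 : t₁ ∈ Ioo (max (-T) (min 0 t₁ - ε / 3)) (min T (max 0 t₁ + ε / 3)) := by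
      have := abs_lt.1 ht₁
      exact ⟨max_lt this.1 (by linarith [min_le_right 0 t₁]),
        lt_min this.2 (by linarith [le_max_right 0 t₁])⟩
    have m0 : (0 : ℝ) ∈ Ioo (max (-T) (min 0 t₁ - ε / 3)) (min T (max 0 t₁ + ε / 3)) :=
      ⟨max_lt (by linarith) (by linarith [min_le_left 0 t₁]),
        lt_min hT (by linarith [le_max_left 0 t₁])⟩
    have h2 := hconst _ m0 _ m1
    simp only [sub_self, mul_zero, sub_zero] at h2
    rw [h2]
    refine integral_eq_zero_of_ae ?_
    filter_upwards [h0] with x hx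
    by_cases hx' : g (x - c * (0 - t₁)) = 0
    · rw [hx', zero_smul, Pi.zero_apply]
    · have h3 := hgε _ (subset_tsupport g hx')
      have h6 : |c * (0 - t₁)| ≤ |t₁| := by
        rw [abs_mul, zero_sub, abs_neg]; exact mul_le_of_le_one_left (abs_nonneg _) hc
      have h7 := abs_add_le (x - c * (0 - t₁)) (c * (0 - t₁))
      rw [sub_add_cancel] at h7
      rw [hx (by linarith), smul_zero, Pi.zero_apply]
  filter_upwards [key] with x hx h
  exact hx (abs_lt.1 h)

end Transport

/-! ### Sharp restrictions -/

section Restrict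

variable {E : Type} [NormedAddCommGroup E] [NormedSpace ℝ E] {p : ℝ≥0∞} [Fact (1 ≤ p)]

/-- Multiplication by an indicator function. -/
def lpInd (s : Set ℝ) (hs : MeasurableSet s) :
    Lp E p (volume : Measure ℝ) →L[ℝ] Lp E p (volume : Measure ℝ) :=
  clmOfBound (fun f => ((Lp.memLp f).indicator hs).toLp (s.indicator f))
    (fun f g => by
      rw [← MemLp.toLp_add]
      refine MemLp.toLp_congr _ _ ?_
      filter_upwards [Lp.coeFn_add f g] with x hx
      rw [Pi.add_apply]
      by_cases h : x ∈ s
      · rw [indicator_of_mem h, indicator_of_mem h, indicator_of_mem h, hx, Pi.add_apply]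
      · rw [indicator_of_notMem h, indicator_of_notMem h, indicator_of_notMem h, add_zero])
    (fun c f => by
      rw [← MemLp.toLp_const_smul]
      refine MemLp.toLp_congr _ _ ?_
      filter_upwards [Lp.coeFn_smul c f] with x hx
      rw [Pi.smul_apply]
      by_cases h : x ∈ s
      · rw [indicator_of_mem h, indicator_of_mem h, hx, Pi.smul_apply]
      · rw [indicator_of_notMem h, indicator_of_notMem h, smul_zero])
    1 (fun f => by
      rw [one_mul, Lp.norm_toLp, Lp.norm_def]
      exact ENNReal.toReal_mono (Lp.eLpNorm_ne_top f) (eLpNorm_indicator_le f))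

theorem lpInd_apply (s : Set ℝ) (hs : MeasurableSet s) (f : Lp E p (volume : Measure ℝ)) :
    lpInd s hs f = ((Lp.memLp f).indicator hs).toLp (s.indicator f) := rfl

theorem coeFn_lpInd (s : Set ℝ) (hs : MeasurableSet s) (f : Lp E p (volume : Measure ℝ)) :
    lpInd s hs f =ᵐ[volume] s.indicator f := by
  have h : MemLp (s.indicator f) p (volume : Measure ℝ) := (Lp.memLp f).indicator hs
  have h2 : h.toLp (s.indicator f) =ᵐ[volume] s.indicator f := h.coeFn_toLp
  rw [lpInd_apply]
  exact h2

theorem norm_lpInd_le (s : Set ℝ) (hs : MeasurableSet s) (f : Lp E p (volume : Measure ℝ)) :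
    ‖lpInd s hs f‖ ≤ ‖f‖ := by
  rw [lpInd_apply, Lp.norm_toLp, Lp.norm_def]
  exact ENNReal.toReal_mono (Lp.eLpNorm_ne_top f) (eLpNorm_indicator_le f)

theorem measurableSet_abs_lt (ρ : ℝ) : MeasurableSet {x : ℝ | |x| < ρ} :=
  measurableSet_lt measurable_norm measurable_const

/-- Restriction to `(-ρ, ρ)`. -/
def lpBox (ρ : ℝ) : Lp E p (volume : Measure ℝ) →L[ℝ] Lp E p (volume : Measure ℝ) :=
  lpInd {x | |x| < ρ} (measurableSet_abs_lt ρ)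

theorem coeFn_lpBox (ρ : ℝ) (f : Lp E p (volume : Measure ℝ)) :
    lpBox ρ f =ᵐ[volume] {x : ℝ | |x| < ρ}.indicator f := coeFn_lpInd _ _ f

theorem norm_lpBox_le (ρ : ℝ) (f : Lp E p (volume : Measure ℝ)) : ‖lpBox ρ f‖ ≤ ‖f‖ :=
  norm_lpInd_le _ _ f

attribute [irreducible] lpInd lpBox

theorem lpBox_eq_iff {ρ : ℝ} {f g : Lp E p (volume : Measure ℝ)} :
    lpBox ρ f = lpBox ρ g ↔ ∀ᵐ x, |x| < ρ → f x = g x := by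
  constructor
  · intro h
    filter_upwards [coeFn_lpBox ρ f, coeFn_lpBox ρ g] with x h1 h2 hx
    rw [indicator_of_mem (show x ∈ {x : ℝ | |x| < ρ} from hx)] at h1 h2
    rw [← h1, h, h2]
  · intro h
    refine Lp.ext ?_
    filter_upwards [coeFn_lpBox ρ f, coeFn_lpBox ρ g, h] with x h1 h2 h3
    rw [h1, h2]
    by_cases hx : x ∈ {x : ℝ | |x| < ρ}
    · rw [indicator_of_mem hx, indicator_of_mem hx, h3 hx]
    · rw [indicator_of_notMem hx, indicator_of_notMem hx]

/-- Two cutoffs differ only on two intervals of length |t - s| each, and the L^p norm of f over sets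
of small measure is small for finite p. The radius δ/2 accounts for the two intervals. -/
theorem continuous_lpBox (hp : p ≠ ⊤) (f : Lp E p (volume : Measure ℝ)) :
    Continuous fun ρ => lpBox ρ f := by
  rw [Metric.continuous_iff]
  intro s ε hε
  obtain ⟨δ, hδ, H⟩ := (Lp.memLp f).eLpNorm_indicator_le Fact.out hp
    (ε := ε / 2) (half_pos hε)
  refine ⟨δ / 2, by positivity, fun t ht => ?_⟩
  set S : Set ℝ := uIcc s t ∪ uIcc (-s) (-t) with hS
  have hSm : MeasurableSet S := measurableSet_uIcc.union measurableSet_uIcc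
  have hvol : volume S ≤ ENNReal.ofReal δ := by
    refine (measure_union_le _ _).trans ?_
    rw [Real.volume_interval, Real.volume_interval, ← ENNReal.ofReal_add (abs_nonneg _) (abs_nonneg _)]
    refine ENNReal.ofReal_le_ofReal ?_
    rw [Real.dist_eq] at ht
    have : |-t - -s| = |t - s| := by rw [← abs_neg]; congr 1; ring
    rw [this]
    linarith
  have h1 := H S hSm hvol
  have h2 : eLpNorm (lpBox t f - lpBox s f : Lp E p (volume : Measure ℝ)) p volume ≤
      eLpNorm (S.indicator f) p volume := by
    refine eLpNorm_mono_ae ?_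
    filter_upwards [Lp.coeFn_sub (lpBox t f) (lpBox s f), coeFn_lpBox t f, coeFn_lpBox s f]
      with x h3 h4 h5
    rw [h3, Pi.sub_apply, h4, h5]
    by_cases hx : x ∈ S
    · rw [indicator_of_mem hx]
      by_cases h6 : x ∈ {x : ℝ | |x| < t} <;> by_cases h7 : x ∈ {x : ℝ | |x| < s} <;> simp [h6, h7]
    · have h8 : |x| < t ↔ |x| < s := by
        rw [hS, mem_union, not_or, uIcc, mem_Icc, uIcc, mem_Icc] at hx
        obtain ⟨ha, hb⟩ := hx
        have : ¬ (s ⊓ t ≤ |x| ∧ |x| ≤ s ⊔ t) := by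
          rcases abs_cases x with ⟨h, -⟩ | ⟨h, -⟩
          · rwa [h]
          · rw [h]
            contrapose! hb
            refine ⟨?_, ?_⟩
            · rw [inf_le_iff]; rcases le_sup_iff.1 hb.2 with h | h
              · left; linarith
              · right; linarith
            · rw [le_sup_iff]; rcases inf_le_iff.1 hb.1 with h | h
              · left; linarith
              · right; linarith
        constructor
        · intro h; by_contra h'
          exact this ⟨inf_le_left.trans (not_lt.1 h'), h.le.trans le_sup_right⟩
        · intro h; by_contra h'
          exact this ⟨inf_le_right.trans (not_lt.1 h'), h.le.trans le_sup_left⟩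
      by_cases h6 : |x| < t
      · have h7 := h8.1 h6
        simp [h6, h7]
      · have h7 : ¬ |x| < s := fun h => h6 (h8.2 h)
        simp [h6, h7]
  rw [dist_eq_norm, Lp.norm_def]
  refine (ENNReal.toReal_le_of_le_ofReal (half_pos hε).le (h2.trans h1)).trans_lt (by linarith)

end Restrict

/-! ### Agreement on intervals -/

section Agree

variable {N : ℕ}

/-- The data `d` and `e` agree on `(-r, r)`. -/
def Agree (r : ℝ) (d e : X0 N) : Prop := ∀ᵐ x, |x| < r → X0.rep d x = X0.rep e x

theorem Agree.symm {r : ℝ} {d e : X0 N} (h : Agree r d e) : Agree r e d :=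
  h.mono fun _ hx h => (hx h).symm

theorem Agree.trans {r : ℝ} {d e f : X0 N} (h : Agree r d e) (h' : Agree r e f) : Agree r d f := by
  filter_upwards [h, h'] with x h1 h2 hx
  exact (h1 hx).trans (h2 hx)

theorem Agree.refl (r : ℝ) (d : X0 N) : Agree r d d := Eventually.of_forall fun _ _ => rfl

theorem Agree.mono {r s : ℝ} (hs : s ≤ r) {d e : X0 N} (h : Agree r d e) : Agree s d e :=
  Eventually.mono h fun _ hx h => hx (h.trans_le hs)

theorem agree_iff_ae {r : ℝ} {d e : X0 N} : Agree r d e ↔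
    (∀ᵐ x, |x| < r → x0Spinor d x = x0Spinor e x) ∧
    (∀ᵐ x, |x| < r → yTop (x0V d) x = yTop (x0V e) x) ∧
    (∀ᵐ x, |x| < r → x0W d x = x0W e x) := by
  constructor
  · intro h
    refine ⟨?_, ?_, ?_⟩
    · filter_upwards [h] with x hx h
      have := hx h
      rw [x0_rep, x0_rep] at this
      exact (Prod.ext_iff.1 this).1
    · filter_upwards [h, coeFn_yTop (x0V d), coeFn_yTop (x0V e)] with x hx h1 h2 h
      have := hx h
      rw [x0_rep, x0_rep] at this
      rw [h1, h2]
      exact (Prod.ext_iff.1 (Prod.ext_iff.1 this).2).1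
    · filter_upwards [h] with x hx h
      have := hx h
      rw [x0_rep, x0_rep] at this
      exact (Prod.ext_iff.1 (Prod.ext_iff.1 this).2).2
  · rintro ⟨h1, h2, h3⟩
    filter_upwards [h1, h2, h3, coeFn_yTop (x0V d), coeFn_yTop (x0V e)] with x h1 h2 h3 h4 h5 h
    rw [x0_rep, x0_rep, h1 h, h3 h, ← h4, h2 h, h5]

/-- Agreement becomes equality after applying continuous linear maps. Hence it is a closed condition
and survives differentiation in parameters. -/
theorem agree_iff {r : ℝ} {d e : X0 N} : Agree r d e ↔
    lpBox r (x0Spinor d) = lpBox r (x0Spinor e) ∧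
    lpBox r (yTop (x0V d)) = lpBox r (yTop (x0V e)) ∧ lpBox r (x0W d) = lpBox r (x0W e) := by
  rw [agree_iff_ae, lpBox_eq_iff, lpBox_eq_iff, lpBox_eq_iff]

theorem isClosed_agree {A : Type} [TopologicalSpace A] (r : ℝ) {f g : A → X0 N}
    (hf : Continuous f) (hg : Continuous g) : IsClosed {a | Agree r (f a) (g a)} := by
  have c1 {f : A → X0 N} (hf : Continuous f) : Continuous fun a => lpBox r (x0Spinor (f a)) :=
    (lpBox r).continuous.comp ((x0Spinor (N := N)).continuous.comp hf)
  have c2 {f : A → X0 N} (hf : Continuous f) : Continuous fun a => lpBox r (yTop (x0V (f a))) :=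
    (lpBox r).continuous.comp
      ((yTop (N := N)).continuous.comp ((x0V (N := N)).continuous.comp hf))
  have c3 {f : A → X0 N} (hf : Continuous f) : Continuous fun a => lpBox r (x0W (f a)) :=
    (lpBox r).continuous.comp ((x0W (N := N)).continuous.comp hf)
  simp only [agree_iff]
  exact (isClosed_eq (c1 hf) (c1 hg)).inter
    ((isClosed_eq (c2 hf) (c2 hg)).inter (isClosed_eq (c3 hf) (c3 hg)))

/-- Functions which agree almost everywhere on an interval have the same derivative there. -/
theorem yDer_ae_eq {r : ℝ} {v w : Y N} (h : ∀ᵐ x, |x| < r → yTop v x = yTop w x) :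
    ∀ᵐ x, |x| < r → yDer v x = yDer w x := by
  have h1 : EqOn (yFun v) (yFun w) {x | |x| < r} := by
    refine Measure.eqOn_open_of_ae_eq (μ := volume) ?_ (isOpen_lt continuous_abs continuous_const)
      (yFun v).continuous.continuousOn (yFun w).continuous.continuousOn
    refine (ae_restrict_iff' (measurableSet_abs_lt r)).2 ?_
    filter_upwards [h, coeFn_yTop v, coeFn_yTop w] with x h1 h2 h3 hx
    rw [← h2, ← h3, h1 hx]
  filter_upwards [LocallyIntegrable.ae_hasDerivAt_integral (integrable_lp_one (yDer v)).locallyIntegrable,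
    LocallyIntegrable.ae_hasDerivAt_integral (integrable_lp_one (yDer w)).locallyIntegrable]
    with x h2 h3 hx
  have e : (fun y => ∫ s in (0 : ℝ)..y, yDer v s) =ᶠ[𝓝 x]
      fun y => (∫ s in (0 : ℝ)..y, yDer w s) + (yFun w 0 - yFun v 0) := by
    filter_upwards [(isOpen_lt continuous_abs continuous_const).mem_nhds hx] with y hy
    rw [← yFun_sub, ← yFun_sub, h1 hy]
    abel
  exact (h2 0).unique (((h3 0).add_const _).congr_of_eventuallyEq e)

end Agree

/-! ### Uniqueness on cones: the linear equations -/

section Linear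

variable {N : ℕ} {T r : ℝ}

theorem IsConeTest.eq_zero {φ : ℝ → ℝ → ℝ} (h : IsConeTest T r φ) {t x : ℝ} (hx : φ t x ≠ 0) :
    |t| < T ∧ |x| < r - |t| := by
  have h1 := subset_tsupport (Function.uncurry φ) (show (t, x) ∈ _ from hx)
  have h2 := h.2 _ h1
  exact ⟨abs_lt.2 (h.1.2.2 h1).1, by simp only at h2; linarith⟩

theorem dbl_zero_of_cone {E : Type} [NormedAddCommGroup E] [NormedSpace ℝ E] {p : ℝ≥0∞}
    {φ : ℝ → ℝ → ℝ} (h : IsConeTest T r φ) {f : ℝ → Lp E p (volume : Measure ℝ)}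
    (hf : ∀ t, |t| < T → ∀ᵐ x, |x| < r - |t| → f t x = 0) : dbl T φ f = 0 := by
  rw [dbl]
  refine (intervalIntegral.integral_congr (g := fun _ => (0 : E)) fun t _ => ?_).trans (by simp)
  refine integral_eq_zero_of_ae ?_
  by_cases ht : |t| < T
  · filter_upwards [hf t ht] with x hx
    by_cases h0 : φ t x = 0
    · rw [h0, zero_smul, Pi.zero_apply]
    · rw [hx (h.eq_zero h0).2, smul_zero, Pi.zero_apply]
  · refine Eventually.of_forall fun x => ?_
    have : φ t x = 0 := by_contra fun h0 => ht (h.eq_zero h0).1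
    simp only [this, zero_smul, Pi.zero_apply]

/-- Two solutions of a transport equation which agree initially agree on the cone. -/
theorem eq_of_transport {E : Type} [NormedAddCommGroup E] [NormedSpace ℝ E] [CompleteSpace E]
    {p : ℝ≥0∞} [Fact (1 ≤ p)] {f g : ℝ → Lp E p (volume : Measure ℝ)} (hf : Continuous f)
    (hg : Continuous g) {c : ℝ} (hc : |c| ≤ 1)
    (H : ∀ φ, IsConeTest T r φ → dbl T (dt φ) f + c • dbl T (dx φ) f =
      dbl T (dt φ) g + c • dbl T (dx φ) g)
    (h0 : ∀ᵐ x, |x| < r → f 0 x = g 0 x) {t : ℝ} (ht : |t| < T) :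
    ∀ᵐ x, |x| < r - |t| → f t x = g t x := by
  have h1 := eq_zero_of_transport (T := T) (r := r) (f := fun t => f t - g t) (hf.sub hg) hc
    (fun φ hφ => by
      rw [dbl_sub hφ.1.isBump.dt hf hg, dbl_sub hφ.1.isBump.dx hf hg, smul_sub, sub_add_sub_comm,
        H φ hφ, sub_self])
    (by
      filter_upwards [h0, Lp.coeFn_sub (f 0) (g 0)] with x h1 h2 hx
      rw [h2, Pi.sub_apply, h1 hx, sub_self]) ht
  filter_upwards [h1, Lp.coeFn_sub (f t) (g t)] with x h1 h2 hx
  have := h1 hx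
  rwa [h2, Pi.sub_apply, sub_eq_zero] at this

/-- The algebra of the Riemann invariants ∂ₜV + ∂ₓV and ∂ₜV - ∂ₓV: their transport equations are the
sum and the difference of the first order equations. -/
theorem wave_transport {G : Type} [AddCommGroup G] {a b c d a' b' c' d' F : G}
    (h1 : a - b = F) (h1' : a' - b' = F) (h2 : c = d) (h2' : c' = d') :
    (a + c) - (b + d) = (a' + c') - (b' + d') ∧ (a - c) + (d - b) = (a' - c') + (d' - b') := by
  subst h2 h2'
  constructor
  · rw [add_sub_add_right_eq_sub, add_sub_add_right_eq_sub, h1, h1']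
  · have e : (a - c) + (c - b) = a - b := by abel
    have e' : (a' - c') + (c' - b') = a' - b' := by abel
    rw [e, e', h1, h1']

variable {u v : ℝ → X0 N} {f : ℝ → Lp Spinor 2 (volume : Measure ℝ)}
  {F : ℝ → Lp (Pot N) 1 (volume : Measure ℝ)}

theorem continuous_yTop_x0V (hu : Continuous u) : Continuous fun t => yTop (x0V (u t)) :=
  (yTop (N := N)).continuous.comp ((x0V (N := N)).continuous.comp hu)

theorem continuous_yDer_x0V (hu : Continuous u) : Continuous fun t => yDer (x0V (u t)) :=
  (yDer (N := N)).continuous.comp ((x0V (N := N)).continuous.comp hu)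

theorem continuous_x0W_comp (hu : Continuous u) : Continuous fun t => x0W (u t) :=
  (x0W (N := N)).continuous.comp hu

/-- The first order form of the wave equation. -/
theorem wave_first_order {φ : ℝ → ℝ → ℝ} (h : IsTest T φ) (h1 : LinearEqs T φ u f F)
    (h2 : LinearEqs T (dt φ) u f F) (h3 : LinearEqs T (dx φ) u f F) :
    dbl T (dt φ) (fun t => x0W (u t)) - dbl T (dx φ) (fun t => yDer (x0V (u t))) = -dbl T φ F ∧
      dbl T (dt φ) (fun t => yDer (x0V (u t))) = dbl T (dx φ) (fun t => x0W (u t)) := by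
  have e1 := h1.wave
  rw [h2.velocity, dbl_dx_yTop h.isBump.dx (fun t => x0V (u t))] at e1
  refine ⟨by rw [← e1]; abel, ?_⟩
  have e2 := h3.velocity
  have e3 : dt (dx φ) = dx (dt φ) := funext fun t => funext fun x => h.isBump.dt_dx_comm t x
  rw [e3, dbl_dx_yTop h.isBump.dt (fun t => x0V (u t))] at e2
  exact neg_injective e2

set_option maxHeartbeats 1600000 in
-- Both solutions have the same sources, so each characteristic quantity of the difference solves a
-- source free transport equation with velocity at most 1: the two spinor components and the two
-- Riemann invariants of the wave equation.
theorem agree_of_linearEqs (hu : Continuous u) (hv : Continuous v)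
    (H : ∀ φ, IsConeTest T r φ → LinearEqs T φ u f F)
    (H' : ∀ φ, IsConeTest T r φ → LinearEqs T φ v f F) (h0 : Agree r (u 0) (v 0)) {t : ℝ}
    (ht : |t| < T) : Agree (r - |t|) (u t) (v t) := by
  have ci : ∀ {u : ℝ → X0 N}, Continuous u → Continuous fun t => x0Spinor (u t) := fun hu =>
    (x0Spinor (N := N)).continuous.comp hu
  have one : |(1 : ℝ)| ≤ 1 := by simp
  have mone : |(-1 : ℝ)| ≤ 1 := by simp
  rw [agree_iff_ae] at h0
  obtain ⟨i1, i2, i3⟩ := h0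
  have i4 := yDer_ae_eq i2
  have cp (R : Spinor →L[ℝ] Spinor) {d e : Lp Spinor 2 (volume : Measure ℝ)}
      (h : ∀ᵐ x, |x| < r → d x = e x) :
      ∀ᵐ x, |x| < r → R.compLpL 2 volume d x = R.compLpL 2 volume e x := by
    filter_upwards [h, R.coeFn_compLpL d, R.coeFn_compLpL e] with x h1 h2 h3 hx
    rw [h2, h3, h1 hx]
  have s1 := eq_of_transport (T := T) (r := r)
    (f := fun t => spinFst.compLpL 2 volume (x0Spinor (u t)))
    (g := fun t => spinFst.compLpL 2 volume (x0Spinor (v t)))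
    ((spinFst.compLpL 2 volume).continuous.comp (ci hu))
    ((spinFst.compLpL 2 volume).continuous.comp (ci hv)) one
    (fun φ hφ => by
      rw [one_smul, one_smul]
      exact add_right_cancel ((H φ hφ).fst.trans (H' φ hφ).fst.symm)) (cp _ i1) ht
  have s2 := eq_of_transport (T := T) (r := r)
    (f := fun t => spinSnd.compLpL 2 volume (x0Spinor (u t)))
    (g := fun t => spinSnd.compLpL 2 volume (x0Spinor (v t)))
    ((spinSnd.compLpL 2 volume).continuous.comp (ci hu))
    ((spinSnd.compLpL 2 volume).continuous.comp (ci hv)) mone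
    (fun φ hφ => by
      rw [neg_one_smul, neg_one_smul, ← sub_eq_add_neg, ← sub_eq_add_neg]
      exact add_right_cancel ((H φ hφ).snd.trans (H' φ hφ).snd.symm)) (cp _ i1) ht
  have cW := continuous_x0W_comp hu
  have cW' := continuous_x0W_comp hv
  have cZ := continuous_yDer_x0V hu
  have cZ' := continuous_yDer_x0V hv
  have fo (φ : ℝ → ℝ → ℝ) (hφ : IsConeTest T r φ) :=
    wave_first_order hφ.1 (H φ hφ) (H _ hφ.dt) (H _ hφ.dx)
  have fo' (φ : ℝ → ℝ → ℝ) (hφ : IsConeTest T r φ) :=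
    wave_first_order hφ.1 (H' φ hφ) (H' _ hφ.dt) (H' _ hφ.dx)
  have w1 (s : ℝ) (hs : |s| < T) := eq_of_transport (T := T) (r := r)
    (f := fun t => x0W (u t) + yDer (x0V (u t))) (g := fun t => x0W (v t) + yDer (x0V (v t)))
    (cW.add cZ) (cW'.add cZ') mone
    (fun φ hφ => by
      have hb := hφ.1.isBump
      rw [dbl_add hb.dt cW cZ, dbl_add hb.dx cW cZ, dbl_add hb.dt cW' cZ', dbl_add hb.dx cW' cZ',
        neg_one_smul, neg_one_smul, ← sub_eq_add_neg, ← sub_eq_add_neg,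
        add_comm (dbl T (dx φ) fun t => x0W (u t)), add_comm (dbl T (dx φ) fun t => x0W (v t))]
      exact (wave_transport (fo φ hφ).1 (fo' φ hφ).1 (fo φ hφ).2 (fo' φ hφ).2).1)
    (by
      filter_upwards [i3, i4, Lp.coeFn_add (x0W (u 0)) (yDer (x0V (u 0))),
        Lp.coeFn_add (x0W (v 0)) (yDer (x0V (v 0)))] with x h1 h2 h3 h4 hx
      rw [h3, h4, Pi.add_apply, Pi.add_apply, h1 hx, h2 hx]) hs
  have w2 (s : ℝ) (hs : |s| < T) := eq_of_transport (T := T) (r := r)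
    (f := fun t => x0W (u t) - yDer (x0V (u t))) (g := fun t => x0W (v t) - yDer (x0V (v t)))
    (cW.sub cZ) (cW'.sub cZ') one
    (fun φ hφ => by
      have hb := hφ.1.isBump
      rw [dbl_sub hb.dt cW cZ, dbl_sub hb.dx cW cZ, dbl_sub hb.dt cW' cZ', dbl_sub hb.dx cW' cZ',
        one_smul, one_smul]
      exact (wave_transport (fo φ hφ).1 (fo' φ hφ).1 (fo φ hφ).2 (fo' φ hφ).2).2)
    (by
      filter_upwards [i3, i4, Lp.coeFn_sub (x0W (u 0)) (yDer (x0V (u 0))),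
        Lp.coeFn_sub (x0W (v 0)) (yDer (x0V (v 0)))] with x h1 h2 h3 h4 hx
      rw [h3, h4, Pi.sub_apply, Pi.sub_apply, h1 hx, h2 hx]) hs
  have w (s : ℝ) (hs : |s| < T) : ∀ᵐ x, |x| < r - |s| → x0W (u s) x = x0W (v s) x := by
    filter_upwards [w1 s hs, w2 s hs, Lp.coeFn_add (x0W (u s)) (yDer (x0V (u s))),
      Lp.coeFn_add (x0W (v s)) (yDer (x0V (v s))), Lp.coeFn_sub (x0W (u s)) (yDer (x0V (u s))),
      Lp.coeFn_sub (x0W (v s)) (yDer (x0V (v s)))] with x h1 h2 h3 h4 h5 h6 hx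
    have h1 := h1 hx
    have h2 := h2 hx
    rw [h3, h4, Pi.add_apply, Pi.add_apply] at h1
    rw [h5, h6, Pi.sub_apply, Pi.sub_apply] at h2
    have e : (2 : ℝ) • x0W (u s) x = (2 : ℝ) • x0W (v s) x := by
      have e1 : (2 : ℝ) • x0W (u s) x =
        (x0W (u s) x + yDer (x0V (u s)) x) + (x0W (u s) x - yDer (x0V (u s)) x) := by module
      rw [e1, h1, h2]
      module
    exact smul_right_injective _ (two_ne_zero (α := ℝ)) e
  rw [agree_iff_ae]
  refine ⟨?_, ?_, w t ht⟩
  · filter_upwards [s1, s2, spinFst.coeFn_compLpL (x0Spinor (u t)),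
      spinFst.coeFn_compLpL (x0Spinor (v t)), spinSnd.coeFn_compLpL (x0Spinor (u t)),
      spinSnd.coeFn_compLpL (x0Spinor (v t))] with x h1 h2 h3 h4 h5 h6 hx
    have h1 := h1 hx
    have h2 := h2 hx
    rw [h3, h4] at h1
    rw [h5, h6] at h2
    rw [← spinSnd_add_spinFst (x0Spinor (u t) x), h1, h2, spinSnd_add_spinFst]
  -- V itself is recovered from ∂ₜV = W, a transport equation with velocity 0 whose source is
  -- already known to agree on the cone.
  · refine eq_of_transport (T := T) (r := r) (c := 0) (continuous_yTop_x0V hu)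
      (continuous_yTop_x0V hv) (by simp) (fun φ hφ => ?_) i2 ht
    rw [zero_smul, zero_smul, add_zero, add_zero, (H φ hφ).velocity, (H' φ hφ).velocity]
    have := dbl_zero_of_cone hφ (f := fun t => x0W (u t) - x0W (v t)) (fun s hs => by
      filter_upwards [w s hs, Lp.coeFn_sub (x0W (u s)) (x0W (v s))] with x h1 h2 hx
      rw [h2, Pi.sub_apply, h1 hx, sub_self])
    rw [dbl_sub hφ.1.isBump cW cW', sub_eq_zero] at this
    rw [this]

end Linear

/-! ### Uniqueness on cones: the nonlinear equations -/

section Nonlinear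

variable {N : ℕ} {T r : ℝ} [hT : Fact (0 < T)] {M m : ℝ} {B C : Fin N → Matrix (Fin 2) (Fin 2) ℂ}

/-- Restriction of the sources. -/
def liftBox (ρ : ℝ) : Lift N →L[ℝ] Lift N :=
  (diracInsert (N := N)).comp ((lpBox ρ).comp liftSpinor) +
    -- The wave source F is recovered from the left source ½JF, whence the factor 2, then cut off
    -- and inserted again. Cutting JF itself would create jumps and leave Y.
    (waveInsert (N := N)).comp ((lpBox ρ).comp ((2 : ℝ) • (yDer (N := N)).comp liftLeft))

theorem liftBox_apply (ρ : ℝ) (h : Lift N) : liftBox ρ h = diracInsert (lpBox ρ (liftSpinor h)) +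
    waveInsert (lpBox ρ ((2 : ℝ) • yDer (liftLeft h))) := rfl

theorem norm_liftBox_le : ∃ K : ℝ, 0 ≤ K ∧ ∀ ρ (h : Lift N), ‖liftBox ρ h‖ ≤ K * ‖h‖ := by
  refine ⟨‖diracInsert (N := N)‖ * ‖liftSpinor (N := N)‖ +
    ‖waveInsert (N := N)‖ * ‖(2 : ℝ) • (yDer (N := N)).comp liftLeft‖, by positivity, fun ρ h => ?_⟩
  rw [liftBox_apply, add_mul, mul_assoc, mul_assoc]
  refine (norm_add_le _ _).trans (add_le_add ?_ ?_)
  · refine ((diracInsert (N := N)).le_opNorm _).trans ?_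
    gcongr
    exact (norm_lpBox_le _ _).trans (liftSpinor.le_opNorm h)
  · refine ((waveInsert (N := N)).le_opNorm _).trans ?_
    gcongr
    exact (norm_lpBox_le _ _).trans (((2 : ℝ) • (yDer (N := N)).comp liftLeft).le_opNorm h)

/-- The radius of the cone shrinks with time, so continuity in ρ is what makes the truncated source
a continuous curve. -/
theorem continuous_liftBox (h : Lift N) : Continuous fun ρ => liftBox ρ h := by
  simp only [liftBox_apply]
  exact ((diracInsert (N := N)).continuous.comp (continuous_lpBox (by simp) _)).add
    ((waveInsert (N := N)).continuous.comp (continuous_lpBox (by simp) _))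

theorem liftBox_N (ρ : ℝ) (h : Lift N) : liftBox ρ ((dkg M B C).N h) =
    diracInsert (lpBox ρ (diracForce M B (projX h))) +
      waveInsert (lpBox ρ (waveForce C (liftMass h) (projX h))) := by
  have e : (2 : ℝ) • yDer (liftLeft ((dkg M B C).N h)) = waveForce C (liftMass h) (projX h) := by
    rw [dkg_N_eq]
    simp [yDer_yJ]
  have e' : liftSpinor ((dkg M B C).N h) = diracForce M B (projX h) := by
    rw [dkg_N_eq]
    simp
  rw [liftBox_apply, e, e']

theorem diracForce_ae (d : X0 N) : diracForce M B d =ᵐ[volume] fun x =>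
    massMap M (X0.rep d x).1 + diracMap B (X0.rep d x).2.1 (X0.rep d x).1 := by
  rw [diracForce_eq]
  filter_upwards [Lp.coeFn_add ((massMap M).compLpL 2 volume (x0Spinor d))
    ((diracMap B).holder 2 (yTop (x0V d)) (x0Spinor d)), (massMap M).coeFn_compLpL (x0Spinor d),
    (diracMap B).coeFn_holder (r := 2) (yTop (x0V d)) (x0Spinor d), coeFn_yTop (x0V d)]
    with x h1 h2 h3 h4
  rw [h1, Pi.add_apply, h2, h3, h4, x0_rep]

theorem waveForce_ae (μ : Lp ℝ 1 (volume : Measure ℝ)) (d : X0 N) :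
    waveForce C μ d =ᵐ[volume] fun x =>
      currentMap C (X0.rep d x).1 (X0.rep d x).1 + dampMap (μ x) (X0.rep d x).2.1 := by
  rw [waveForce_eq]
  filter_upwards [Lp.coeFn_add ((currentMap C).holder 1 (x0Spinor d) (x0Spinor d))
    ((dampMap (N := N)).holder 1 μ (yTop (x0V d))),
    (currentMap C).coeFn_holder (r := 1) (x0Spinor d) (x0Spinor d),
    (dampMap (N := N)).coeFn_holder (r := 1) μ (yTop (x0V d)), coeFn_yTop (x0V d)]
    with x h1 h2 h3 h4
  rw [h1, Pi.add_apply, h2, h3, h4, x0_rep]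

/-- The forces act pointwise in x. The nonlocal operator J is applied only after the cutoff. -/
theorem liftBox_congr {ρ : ℝ} {h k : Lift N} (hm : liftMass h = liftMass k)
    (ha : Agree ρ (projX h) (projX k)) :
    liftBox ρ ((dkg M B C).N h) = liftBox ρ ((dkg M B C).N k) := by
  rw [liftBox_N, liftBox_N, hm]
  have e1 : lpBox ρ (diracForce M B (projX h)) = lpBox ρ (diracForce M B (projX k)) := by
    rw [lpBox_eq_iff]
    filter_upwards [ha, diracForce_ae (M := M) (B := B) (projX h),
      diracForce_ae (M := M) (B := B) (projX k)] with x h1 h2 h3 hx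
    rw [h2, h3, h1 hx]
  have e2 : lpBox ρ (waveForce C (liftMass k) (projX h)) =
      lpBox ρ (waveForce C (liftMass k) (projX k)) := by
    rw [lpBox_eq_iff]
    filter_upwards [ha, waveForce_ae (C := C) (liftMass k) (projX h),
      waveForce_ae (C := C) (liftMass k) (projX k)] with x h1 h2 h3 hx
    rw [h2, h3, h1 hx]
  rw [e1, e2]

theorem continuous_comp_family {A X F : Type} [TopologicalSpace A] [NormedAddCommGroup X]
    [NormedSpace ℝ X] [NormedAddCommGroup F] [NormedSpace ℝ F]
    (S : ℝ → X →L[ℝ] F) (K : ℝ) (hK : ∀ t x, ‖S t x‖ ≤ K * ‖x‖)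
    (hS : ∀ x, Continuous fun t => S t x) {f : A → ℝ} {g : A → X} (hf : Continuous f)
    (hg : Continuous g) : Continuous fun a => S (f a) (g a) :=
  (continuous_family S K hK hS).comp (hf.prodMk hg)

theorem continuous_curveN {X : Type} [NormedAddCommGroup X] [NormedSpace ℝ X]
    (P : TransportSystem X) (U : C(Icc (-T) T, X)) : Continuous fun t => P.N (U t) :=
  (P.curveN U).continuous

variable (M B C r) in
theorem continuous_coneSource (U : C(Icc (-T) T, Lift N)) :
    Continuous fun t : Icc (-T) T => liftBox (r - |(t : ℝ)|) ((dkg M B C).N (U t)) := by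
  obtain ⟨K, -, hK⟩ := norm_liftBox_le (N := N)
  exact continuous_comp_family liftBox K hK continuous_liftBox (by fun_prop)
    (continuous_curveN (dkg M B C) U)

variable (M B C r) in
/-- The sources restricted to the cone. -/
def coneSource (U : C(Icc (-T) T, Lift N)) : C(Icc (-T) T, Lift N) where
  toFun t := liftBox (r - |(t : ℝ)|) ((dkg M B C).N (U t))
  continuous_toFun := continuous_coneSource r M B C U

theorem coneSource_apply (U : C(Icc (-T) T, Lift N)) (t : Icc (-T) T) :
    coneSource r M B C U t = liftBox (r - |(t : ℝ)|) ((dkg M B C).N (U t)) := rfl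

theorem liftMass_S_add_duhamel {d : Lift N} {Φ n : C(Icc (-T) T, Lift N)}
    (hΦ : Φ = (dkg M B C).free d + (dkg M B C).duhamel n) (hn : ∀ t, liftMass (n t) = 0)
    (t : Icc (-T) T) : liftMass (Φ t) = liftMass d := by
  rw [hΦ, ContinuousMap.add_apply, (dkg M B C).free_apply, (dkg M B C).duhamel_apply, map_add,
    liftMass_S, liftMass_S, primitive_apply, ← ContinuousLinearMap.intervalIntegral_comp_comm _
    (intervalIntegrable_extend _ _ _)]
  have : ∀ s, liftMass ((dkg M B C).unapplyS n (clamp T s)) = 0 := fun s => by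
    rw [TransportSystem.unapplyS_apply, liftMass_S, hn]
  simp [this]

/-- Tests supported in (-T, T) say nothing at the end points. There agreement follows by continuity
along ct with c increasing to 1, as agreement is closed and the cones at earlier times are wider. -/
theorem agree_of_lt {a b : C(Icc (-T) T, X0 N)}
    (h : ∀ t : Icc (-T) T, |(t : ℝ)| < T → Agree (r - |(t : ℝ)|) (a t) (b t)) (t : Icc (-T) T) :
    Agree (r - |(t : ℝ)|) (a t) (b t) := by
  have h0 := hT.out
  have hcl := isClosed_agree (r - |(t : ℝ)|) (continuous_extend a) (continuous_extend b)
  have hsub : ∀ᶠ c : ℝ in 𝓝[<] 1, c * t ∈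
      {s : ℝ | Agree (r - |(t : ℝ)|) (a (clamp T s)) (b (clamp T s))} := by
    filter_upwards [Ioo_mem_nhdsLT (show (0 : ℝ) < 1 by norm_num)] with c hc
    have ht := abs_le.2 t.2
    have h1 : |c * t| ≤ |(t : ℝ)| := by
      rw [abs_mul, abs_of_pos hc.1]; exact mul_le_of_le_one_left (abs_nonneg _) hc.2.le
    have h2 : |c * t| < T := by
      rw [abs_mul, abs_of_pos hc.1]
      nlinarith [hc.1, hc.2, abs_nonneg (t : ℝ)]
    have h3 := abs_le.1 h2.le
    change Agree (r - |(t : ℝ)|) (a (clamp T (c * t))) (b (clamp T (c * t)))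
    rw [clamp_of_mem h3]
    exact (h ⟨c * t, h3⟩ h2).mono (by simp only; linarith)
  have hlim : Tendsto (fun c : ℝ => c * t) (𝓝[<] 1) (𝓝 (t : ℝ)) := by
    have h2 : Tendsto (fun c : ℝ => c * t) (𝓝 1) (𝓝 (1 * (t : ℝ))) :=
      (continuous_id.mul continuous_const).tendsto 1
    rw [one_mul] at h2
    exact h2.mono_left nhdsWithin_le_nhds
  have h3 := hcl.mem_of_tendsto hlim hsub
  rwa [mem_ofPred_eq, clamp_coe] at h3

/-- On the cone, a solution is given by the Duhamel formula with sources restricted to the cone. -/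
theorem exists_coneSource {u : C(Icc (-T) T, X0 N)}
    (H : ∀ φ, IsConeTest T r φ → X0Eqs M m B C φ u) {d : X0 N}
    (hd : Agree r (u (zeroTime T)) d) : ∃ Φ : C(Icc (-T) T, Lift N),
      Φ = (dkg M B C).free (embX d + massX (m ^ 2 • boxInd 1 r)) +
        (dkg M B C).duhamel (coneSource r M B C Φ) ∧
      ∀ t : Icc (-T) T, Agree (r - |(t : ℝ)|) (u t) (projX (Φ t)) := by
  set μ : Lp ℝ 1 (volume : Measure ℝ) := m ^ 2 • boxInd 1 r with hμ
  set U : C(Icc (-T) T, Lift N) := mapCurve T (embX (N := N)) u +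
    ContinuousMap.const _ (massX μ) with hU
  have hUt (t : Icc (-T) T) : U t = embX (u t) + massX μ := rfl
  set n := coneSource r M B C U with hn
  -- Φ solves the linear problem with sources computed from u. Linear uniqueness shows that it
  -- projects to u on the cone, so the same sources can be recomputed from Φ and the equation closes
  -- up.
  set Φ := (dkg M B C).free (embX d + massX μ) + (dkg M B C).duhamel n with hΦ
  have hUp (t : Icc (-T) T) : projX (U t) = u t := by
    rw [hUt, map_add, projX_embX, projX_massX, add_zero]
  have hUm (t : Icc (-T) T) : liftMass (U t) = μ := by
    rw [hUt, map_add, liftMass_embX, liftMass_massX, zero_add]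
  have hnt (t : Icc (-T) T) : n t = diracInsert (lpBox (r - |(t : ℝ)|) (diracForce M B (u t))) +
      waveInsert (lpBox (r - |(t : ℝ)|) (waveForce C μ (u t))) := by
    rw [hn, coneSource_apply, liftBox_N, hUp, hUm]
  have hΦm (t : Icc (-T) T) : liftMass (Φ t) = μ := by
    rw [liftMass_S_add_duhamel hΦ (fun t => by rw [hnt]; simp), map_add, liftMass_embX,
      liftMass_massX, zero_add]
  have hag (t : Icc (-T) T) (ht : |(t : ℝ)| < T) :
      Agree (r - |(t : ℝ)|) (u t) (projX (Φ t)) := by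
    have h1 := agree_of_linearEqs (T := T) (r := r) (t := t) (u := fun t => u (clamp T t))
      (v := fun t => projX (Φ (clamp T t)))
      (f := fun t => diracForce M B (u (clamp T t))) (F := fun t => waveForce C μ (u (clamp T t)))
      (continuous_extend u) ((projX (N := N)).continuous.comp (continuous_extend Φ)) ?_ ?_ ?_ ht
    · simpa only [clamp_coe] using h1
    · intro φ hφ
      refine (x0Eqs_iff_linearEqs hφ.1 (μ := μ) fun t => ?_).1 (H φ hφ)
      filter_upwards [Lp.coeFn_smul (m ^ 2) (boxInd 1 r), coeFn_boxInd (p := 1) r] with x h1 h2 h3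
      have h4 := (hφ.eq_zero h3).2
      have h5 : x ∈ Icc (-r) r := abs_le.1 (by linarith [abs_nonneg t])
      rw [hμ, h1, Pi.smul_apply, h2, indicator_of_mem h5, smul_eq_mul, mul_one]
    · intro φ hφ
      have h1 := linearEqs_of_mild hΦ
        (f := fun t => lpBox (r - |(clamp T t : ℝ)|) (diracForce M B (u (clamp T t))))
        (F := fun t => lpBox (r - |(clamp T t : ℝ)|) (waveForce C μ (u (clamp T t))))
        (fun t => by rw [hnt]; simp) (fun t => by rw [hnt]; simp) (fun t => by rw [hnt]; simp) hφ.1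
      have hin {t x : ℝ} (hx : φ t x ≠ 0) : |x| < r - |(clamp T t : ℝ)| := by
        obtain ⟨h2, h3⟩ := hφ.eq_zero hx
        rwa [clamp_of_mem (abs_le.1 h2.le)]
      have hc (R : Spinor →L[ℝ] Spinor) :
          dbl T φ (fun t => R.compLpL 2 volume
            (lpBox (r - |(clamp T t : ℝ)|) (diracForce M B (u (clamp T t))))) =
          dbl T φ (fun t => R.compLpL 2 volume (diracForce M B (u (clamp T t)))) := by
        refine dbl_congr fun t => ?_
        filter_upwards [R.coeFn_compLpL (lpBox (r - |(clamp T t : ℝ)|) (diracForce M B (u (clamp T t)))),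
          R.coeFn_compLpL (diracForce M B (u (clamp T t))),
          coeFn_lpBox (r - |(clamp T t : ℝ)|) (diracForce M B (u (clamp T t)))] with x h2 h3 h4 hx
        rw [h2, h3, h4, indicator_of_mem (show x ∈ {x : ℝ | |x| < _} from hin hx)]
      refine ⟨?_, ?_, ?_, h1.velocity⟩
      · rw [← hc]; exact h1.fst
      · rw [← hc]; exact h1.snd
      · refine h1.wave.trans (dbl_congr fun t => ?_)
        filter_upwards [coeFn_lpBox (r - |(clamp T t : ℝ)|) (waveForce C μ (u (clamp T t)))]
          with x h4 hx
        rw [h4, indicator_of_mem (show x ∈ {x : ℝ | |x| < _} from hin hx)]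
    · have e0 : clamp T 0 = zeroTime T := clamp_of_mem _
      have e1 : Φ (zeroTime T) = embX d + massX μ := by
        rw [hΦ, ContinuousMap.add_apply, (dkg M B C).free_apply, (dkg M B C).duhamel_apply,
          primitive_apply]
        simp only [zeroTime, intervalIntegral.integral_same, add_zero, (dkg M B C).S_zero]
      simp only [e0, e1, map_add, projX_embX, projX_massX, add_zero]
      exact hd
  have hag' := agree_of_lt (a := u) (b := mapCurve T (projX (N := N)) Φ) hag
  refine ⟨Φ, ?_, hag'⟩
  have e : n = coneSource r M B C Φ := by
    ext1 t
    rw [hn, coneSource_apply, coneSource_apply]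
    refine liftBox_congr ((hUm t).trans (hΦm t).symm) ?_
    rw [hUp]
    exact hag' t
  rw [← e]

/-- Finite speed of propagation. -/
theorem agree_of_x0Eqs {u u' : C(Icc (-T) T, X0 N)}
    (H : ∀ φ, IsConeTest T r φ → X0Eqs M m B C φ u)
    (H' : ∀ φ, IsConeTest T r φ → X0Eqs M m B C φ u')
    (h0 : Agree r (u (zeroTime T)) (u' (zeroTime T))) (t : Icc (-T) T) :
    Agree (r - |(t : ℝ)|) (u t) (u' t) := by
  obtain ⟨Φ, hΦ, hu⟩ := exists_coneSource H (Agree.refl r _)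
  obtain ⟨Φ', hΦ', hu'⟩ := exists_coneSource H' h0.symm
  set P := dkg M B C with hP
  obtain ⟨K, hK, hb⟩ := norm_liftBox_le (N := N)
  -- The cutoffs are bounded uniformly in the radius, so the truncated source is Lipschitz pointwise
  -- in time. Both lifts solve the same Volterra equation with the same data, and the bound with r =
  -- 0 forces equality.
  obtain ⟨c, -, hc⟩ := P.exists_bound_of_eq_add_duhamel (T := T)
    (K * (‖P.L‖ + ‖P.B‖ * (‖Φ‖ + ‖Φ'‖)))
    (mul_nonneg hK (add_nonneg (ContinuousLinearMap.opNorm_nonneg _)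
      (mul_nonneg (ContinuousLinearMap.opNorm_nonneg _) (by positivity))))
  have e : Φ - Φ' = 0 + P.duhamel (coneSource r M B C Φ - coneSource r M B C Φ') := by
    rw [map_sub, zero_add]
    nth_rewrite 1 [hΦ, hΦ']
    exact add_sub_add_left_eq_sub _ _ _
  have h1 := hc _ _ _ e fun t => by
    rw [ContinuousMap.sub_apply, coneSource_apply, coneSource_apply, ← map_sub, mul_assoc]
    refine (hb _ _).trans (mul_le_mul_of_nonneg_left ?_ hK)
    have e2 : (dkg M B C).N (Φ t) - (dkg M B C).N (Φ' t) = P.lin Φ Φ' (Φ - Φ') t := by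
      rw [← P.curveN_sub]; rfl
    rw [e2]
    exact P.norm_lin_le Φ Φ' _ t
  rw [norm_zero, mul_zero, norm_le_zero_iff, sub_eq_zero] at h1
  rw [h1] at hu
  exact (hu t).trans (hu' t).symm

end Nonlinear

/-! ### Local Lebesgue spaces -/

section LpLoc

variable {E : Type} [NormedAddCommGroup E] [NormedSpace ℝ E] {p : ℝ≥0∞}

theorem LpLoc.ext {f g : LpLoc E p} (h : f.rep =ᵐ[volume] g.rep) : f = g :=
  Subtype.ext (AEEqFun.ext h)

/-- The class of a function. -/
def lpLocMk (g : ℝ → E) (hm : AEStronglyMeasurable g volume)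
    (h : ∀ R : ℕ, MemLp g p ((volume : Measure ℝ).restrict (Icc (-(R : ℝ)) R))) : LpLoc E p :=
  ⟨AEEqFun.mk g hm, fun R => (h R).ae_eq (ae_restrict_of_ae (AEEqFun.coeFn_mk g hm).symm)⟩

theorem rep_lpLocMk (g : ℝ → E) (hm : AEStronglyMeasurable g volume)
    (h : ∀ R : ℕ, MemLp g p ((volume : Measure ℝ).restrict (Icc (-(R : ℝ)) R))) :
    (lpLocMk g hm h).rep =ᵐ[volume] g := AEEqFun.coeFn_mk g hm

variable [Fact (1 ≤ p)]

theorem coeFn_restrict (R : ℕ) (f : LpLoc E p) :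
    LpLoc.restrict R f =ᵐ[(volume : Measure ℝ).restrict (Icc (-(R : ℝ)) R)] f.rep :=
  (f.memLp_rep R).coeFn_toLp

theorem continuous_restrict (R : ℕ) :
    Continuous (LpLoc.restrict R : LpLoc E p → Lp E p ((volume : Measure ℝ).restrict _)) :=
  continuous_iInf_dom continuous_induced_dom

theorem continuous_lpLoc {A : Type} [TopologicalSpace A] {f : A → LpLoc E p}
    (h : ∀ R : ℕ, Continuous fun a => LpLoc.restrict R (f a)) : Continuous f :=
  continuous_iInf_rng.2 fun R => continuous_induced_rng.2 (h R)

/-- Extension by zero. -/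
def extZero (s : Set ℝ) (hs : MeasurableSet s) :
    Lp E p ((volume : Measure ℝ).restrict s) →L[ℝ] Lp E p (volume : Measure ℝ) :=
  clmOfBound (fun f => ((memLp_indicator_iff_restrict hs).2 (Lp.memLp f)).toLp (s.indicator f))
    (fun f g => by
      rw [← MemLp.toLp_add]
      refine MemLp.toLp_congr _ _ ?_
      filter_upwards [(ae_restrict_iff' hs).1 (Lp.coeFn_add f g)] with x hx
      rw [Pi.add_apply]
      by_cases h : x ∈ s
      · rw [indicator_of_mem h, indicator_of_mem h, indicator_of_mem h, hx h, Pi.add_apply]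
      · rw [indicator_of_notMem h, indicator_of_notMem h, indicator_of_notMem h, add_zero])
    (fun c f => by
      rw [← MemLp.toLp_const_smul]
      refine MemLp.toLp_congr _ _ ?_
      filter_upwards [(ae_restrict_iff' hs).1 (Lp.coeFn_smul c f)] with x hx
      rw [Pi.smul_apply]
      by_cases h : x ∈ s
      · rw [indicator_of_mem h, indicator_of_mem h, hx h, Pi.smul_apply]
      · rw [indicator_of_notMem h, indicator_of_notMem h, smul_zero])
    1 (fun f => by
      rw [one_mul, Lp.norm_toLp, Lp.norm_def, eLpNorm_indicator_eq_eLpNorm_restrict hs])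

theorem extZero_apply (s : Set ℝ) (hs : MeasurableSet s)
    (f : Lp E p ((volume : Measure ℝ).restrict s)) :
    extZero s hs f = ((memLp_indicator_iff_restrict hs).2 (Lp.memLp f)).toLp (s.indicator f) := rfl

theorem coeFn_extZero (s : Set ℝ) (hs : MeasurableSet s)
    (f : Lp E p ((volume : Measure ℝ).restrict s)) : extZero s hs f =ᵐ[volume] s.indicator f := by
  have h : MemLp (s.indicator f) p (volume : Measure ℝ) :=
    (memLp_indicator_iff_restrict hs).2 (Lp.memLp f)
  have h2 : h.toLp (s.indicator f) =ᵐ[volume] s.indicator f := h.coeFn_toLp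
  rw [extZero_apply]
  exact h2

/-- Sharp restriction to `[-R, R]`. -/
def lpExt (R : ℕ) : LpLoc E p →L[ℝ] Lp E p (volume : Measure ℝ) where
  toLinearMap := (extZero (Icc (-(R : ℝ)) R) measurableSet_Icc).toLinearMap ∘ₗ LpLoc.restrict R
  cont := (extZero (Icc (-(R : ℝ)) R) measurableSet_Icc).continuous.comp (continuous_restrict R)

theorem coeFn_lpExt (R : ℕ) (f : LpLoc E p) :
    lpExt R f =ᵐ[volume] (Icc (-(R : ℝ)) R).indicator f.rep := by
  have h1 : lpExt R f = extZero (Icc (-(R : ℝ)) R) measurableSet_Icc (LpLoc.restrict R f) := rfl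
  rw [h1]
  filter_upwards [coeFn_extZero (Icc (-(R : ℝ)) R) measurableSet_Icc (LpLoc.restrict R f),
    (ae_restrict_iff' measurableSet_Icc).1 (coeFn_restrict R f)] with x h2 h3
  rw [h2]
  by_cases h : x ∈ Icc (-(R : ℝ)) R
  · rw [indicator_of_mem h, indicator_of_mem h, h3 h]
  · rw [indicator_of_notMem h, indicator_of_notMem h]

theorem LpLoc.locallyIntegrable_rep (f : LpLoc E p) : LocallyIntegrable f.rep volume := by
  intro x
  obtain ⟨R, hR⟩ := exists_nat_gt |x|
  refine ⟨Icc (-(R : ℝ)) R, Icc_mem_nhds (abs_lt.1 hR).1 (abs_lt.1 hR).2, ?_⟩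
  exact (f.memLp_rep R).integrable Fact.out

/-- Functions in `L^p` are locally in `L^p`. -/
def lpToLoc : Lp E p (volume : Measure ℝ) →L[ℝ] LpLoc E p where
  toFun f := lpLocMk f (Lp.aestronglyMeasurable f) fun _ => (Lp.memLp f).restrict _
  map_add' f g := LpLoc.ext (by
    filter_upwards [rep_lpLocMk (f + g : Lp E p (volume : Measure ℝ)) (Lp.aestronglyMeasurable _)
        (fun _ => (Lp.memLp (f + g)).restrict _),
      rep_lpLocMk f (Lp.aestronglyMeasurable f) (fun _ => (Lp.memLp f).restrict _),
      rep_lpLocMk g (Lp.aestronglyMeasurable g) (fun _ => (Lp.memLp g).restrict _),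
      LpLoc.rep_add (lpLocMk f (Lp.aestronglyMeasurable f) fun _ => (Lp.memLp f).restrict _)
        (lpLocMk g (Lp.aestronglyMeasurable g) fun _ => (Lp.memLp g).restrict _), Lp.coeFn_add f g]
      with x h1 h2 h3 h4 h5
    rw [h1, h4, Pi.add_apply, h2, h3, h5, Pi.add_apply])
  map_smul' c f := LpLoc.ext (by
    filter_upwards [rep_lpLocMk (c • f : Lp E p (volume : Measure ℝ)) (Lp.aestronglyMeasurable _)
        (fun _ => (Lp.memLp (c • f)).restrict _),
      rep_lpLocMk f (Lp.aestronglyMeasurable f) (fun _ => (Lp.memLp f).restrict _),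
      LpLoc.rep_smul c (lpLocMk f (Lp.aestronglyMeasurable f) fun _ => (Lp.memLp f).restrict _),
      Lp.coeFn_smul c f]
      with x h1 h2 h4 h5
    rw [h1, RingHom.id_apply, h4, Pi.smul_apply, h2, h5, Pi.smul_apply])
  cont := continuous_lpLoc fun R => by
    have h : ∀ f : Lp E p (volume : Measure ℝ), LpLoc.restrict R (lpLocMk f
        (Lp.aestronglyMeasurable f) fun _ => (Lp.memLp f).restrict _) =
        LpToLpRestrictCLM ℝ E ℝ volume p (Icc (-(R : ℝ)) R) f := fun f => by
      refine Lp.ext ?_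
      filter_upwards [coeFn_restrict R (lpLocMk f (Lp.aestronglyMeasurable f)
        fun _ => (Lp.memLp f).restrict _), LpToLpRestrictCLM_coeFn ℝ (Icc (-(R : ℝ)) R) f,
        ae_restrict_of_ae (rep_lpLocMk f (Lp.aestronglyMeasurable f)
          (fun _ => (Lp.memLp f).restrict _))] with x h1 h2 h3
      rw [h1, h2, h3]
    exact (LpToLpRestrictCLM ℝ E ℝ volume p (Icc (-(R : ℝ)) R)).continuous.congr fun f => (h f).symm

theorem rep_lpToLoc (f : Lp E p (volume : Measure ℝ)) : (lpToLoc f).rep =ᵐ[volume] f :=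
  rep_lpLocMk f (Lp.aestronglyMeasurable f) fun _ => (Lp.memLp f).restrict _

theorem measurableSet_floor (n : ℕ) : MeasurableSet {x : ℝ | ⌊|x|⌋₊ = n} :=
  (Nat.measurable_floor.comp measurable_norm) (measurableSet_singleton n)

/-- Gluing on annuli, up to a finite radius. -/
def glueTrunc (R : ℕ) : (ℕ → Lp E p (volume : Measure ℝ)) →L[ℝ] Lp E p (volume : Measure ℝ) :=
  ∑ n ∈ Finset.range (R + 1), (lpInd {x : ℝ | ⌊|x|⌋₊ = n} (measurableSet_floor n)).comp
    (ContinuousLinearMap.proj n)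

theorem coeFn_glueTrunc (R : ℕ) (f : ℕ → Lp E p (volume : Measure ℝ)) :
    glueTrunc R f =ᵐ[volume] {x : ℝ | ⌊|x|⌋₊ ≤ R}.indicator fun x => f ⌊|x|⌋₊ x := by
  have hs (R : ℕ) : glueTrunc R f = ∑ n ∈ Finset.range (R + 1),
      lpInd {x : ℝ | ⌊|x|⌋₊ = n} (measurableSet_floor n) (f n) := by
    rw [glueTrunc, _root_.sum_apply]; rfl
  induction R with
  | zero =>
    rw [hs, Finset.sum_range_one]
    filter_upwards [coeFn_lpInd {x : ℝ | ⌊|x|⌋₊ = 0} (measurableSet_floor 0) (f 0)] with x hx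
    rw [hx]
    by_cases h : ⌊|x|⌋₊ = 0
    · rw [indicator_of_mem (show x ∈ {x : ℝ | ⌊|x|⌋₊ = 0} from h),
        indicator_of_mem (show x ∈ {x : ℝ | ⌊|x|⌋₊ ≤ 0} from h.le), h]
    · rw [indicator_of_notMem (show x ∉ {x : ℝ | ⌊|x|⌋₊ = 0} from h),
        indicator_of_notMem (show x ∉ {x : ℝ | ⌊|x|⌋₊ ≤ 0} from fun h' => h (Nat.le_zero.1 h'))]
  | succ R ih =>
    rw [hs, Finset.sum_range_succ, ← hs]
    filter_upwards [ih, coeFn_lpInd {x : ℝ | ⌊|x|⌋₊ = R + 1} (measurableSet_floor (R + 1)) (f (R + 1)),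
      Lp.coeFn_add (glueTrunc R f) (lpInd {x : ℝ | ⌊|x|⌋₊ = R + 1} (measurableSet_floor (R + 1))
        (f (R + 1)))] with x h1 h2 h3
    rw [h3, Pi.add_apply, h1, h2]
    simp only [indicator_apply, mem_ofPred_eq]
    rcases lt_trichotomy ⌊|x|⌋₊ (R + 1) with h | h | h
    · rw [if_pos (by omega), if_neg (by omega), if_pos (by omega), add_zero]
    · rw [if_neg (by omega), if_pos (by omega), if_pos (by omega), zero_add, h]
    · rw [if_neg (by omega), if_neg (by omega), if_neg (by omega), add_zero]

theorem aestronglyMeasurable_glue (f : ℕ → Lp E p (volume : Measure ℝ)) :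
    AEStronglyMeasurable (fun x => f ⌊|x|⌋₊ x) (volume : Measure ℝ) := by
  refine aestronglyMeasurable_of_tendsto_ae atTop (f := fun R => glueTrunc R f)
    (fun R => Lp.aestronglyMeasurable _) ?_
  filter_upwards [ae_all_iff.2 fun R => coeFn_glueTrunc R f] with x hx
  refine tendsto_const_nhds.congr' ?_
  filter_upwards [eventually_ge_atTop ⌊|x|⌋₊] with R hR
  rw [hx R, indicator_of_mem (show x ∈ {x : ℝ | ⌊|x|⌋₊ ≤ R} from hR)]

theorem glue_ae_eq (R : ℕ) (f : ℕ → Lp E p (volume : Measure ℝ)) :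
    glueTrunc R f =ᵐ[(volume : Measure ℝ).restrict (Icc (-(R : ℝ)) R)] fun x => f ⌊|x|⌋₊ x := by
  refine (ae_restrict_iff' measurableSet_Icc).2 ?_
  filter_upwards [coeFn_glueTrunc R f] with x hx h
  have : ⌊|x|⌋₊ ≤ R := Nat.floor_le_of_le (abs_le.2 h)
  rw [hx, indicator_of_mem (show x ∈ {x : ℝ | ⌊|x|⌋₊ ≤ R} from this)]

theorem memLp_glue (f : ℕ → Lp E p (volume : Measure ℝ)) (R : ℕ) :
    MemLp (fun x => f ⌊|x|⌋₊ x) p ((volume : Measure ℝ).restrict (Icc (-(R : ℝ)) R)) :=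
  ((Lp.memLp (glueTrunc R f)).restrict _).ae_eq (glue_ae_eq R f)

/-- Gluing on annuli, as a function. -/
def lpGlueFun (f : ℕ → Lp E p (volume : Measure ℝ)) : LpLoc E p :=
  lpLocMk (fun x => f ⌊|x|⌋₊ x) (aestronglyMeasurable_glue f) (memLp_glue f)

theorem rep_lpGlueFun (f : ℕ → Lp E p (volume : Measure ℝ)) :
    (lpGlueFun f).rep =ᵐ[volume] fun x => f ⌊|x|⌋₊ x := rep_lpLocMk _ _ _

/-- Up to a null set only the indices n ≤ R matter on [-R, R]. This finite sum is the reason why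
gluing is continuous for the product topology. -/
theorem restrict_lpGlueFun (R : ℕ) (f : ℕ → Lp E p (volume : Measure ℝ)) :
    LpLoc.restrict R (lpGlueFun f) =
      LpToLpRestrictCLM ℝ E ℝ volume p (Icc (-(R : ℝ)) R) (glueTrunc R f) := by
  refine Lp.ext ?_
  filter_upwards [coeFn_restrict R (lpGlueFun f),
    LpToLpRestrictCLM_coeFn ℝ (Icc (-(R : ℝ)) R) (glueTrunc R f),
    ae_restrict_of_ae (rep_lpGlueFun f), glue_ae_eq R f] with x h1 h2 h3 h4
  rw [h1, h2, h3, h4]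

/-- Gluing on annuli: the result is given by `f n` for `n ≤ |x| < n + 1`. -/
def lpGlue : (ℕ → Lp E p (volume : Measure ℝ)) →L[ℝ] LpLoc E p where
  toFun := lpGlueFun
  map_add' f g := LpLoc.ext (by
    filter_upwards [rep_lpGlueFun (f + g), rep_lpGlueFun f, rep_lpGlueFun g,
      LpLoc.rep_add (lpGlueFun f) (lpGlueFun g), ae_all_iff.2 fun n => Lp.coeFn_add (f n) (g n)]
      with x h1 h2 h3 h4 h5
    rw [h1, h4, Pi.add_apply, Pi.add_apply, h2, h3, h5, Pi.add_apply])
  map_smul' c f := LpLoc.ext (by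
    filter_upwards [rep_lpGlueFun (c • f), rep_lpGlueFun f,
      LpLoc.rep_smul c (lpGlueFun f), ae_all_iff.2 fun n => Lp.coeFn_smul c (f n)]
      with x h1 h2 h4 h5
    rw [RingHom.id_apply, h1, h4, Pi.smul_apply, Pi.smul_apply, h2, h5, Pi.smul_apply])
  cont := continuous_lpLoc fun R => by
    refine Continuous.congr (f := fun f => LpToLpRestrictCLM ℝ E ℝ volume p (Icc (-(R : ℝ)) R)
      (glueTrunc R f)) ?_ fun f => (restrict_lpGlueFun R f).symm
    exact (LpToLpRestrictCLM ℝ E ℝ volume p (Icc (-(R : ℝ)) R)).continuous.comp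
      (glueTrunc R).continuous

theorem rep_lpGlue (f : ℕ → Lp E p (volume : Measure ℝ)) :
    (lpGlue f).rep =ᵐ[volume] fun x => f ⌊|x|⌋₊ x := rep_lpGlueFun f

/-- A smooth function which is `1` for `|x| ≤ n + 1` and `0` for `|x| ≥ n + 2`. -/
def cutoffBump (n : ℕ) : ContDiffBump (0 : ℝ) :=
  ⟨n + 1, n + 2, by positivity, by linarith⟩

/-- `cutoffBump` as a function. -/
def cutoff (n : ℕ) (x : ℝ) : ℝ := cutoffBump n x

theorem contDiff_cutoff (n : ℕ) : ContDiff ℝ ∞ (cutoff n) := (cutoffBump n).contDiff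

theorem cutoff_eq_one {n : ℕ} {x : ℝ} (hx : |x| ≤ n + 1) : cutoff n x = 1 :=
  (cutoffBump n).one_of_mem_closedBall (by rwa [mem_closedBall_zero_iff])

theorem cutoff_support {n : ℕ} {x : ℝ} (hx : cutoff n x ≠ 0) :
    x ∈ Icc (-((n + 2 : ℕ) : ℝ)) ((n + 2 : ℕ) : ℝ) := by
  have h : x ∈ Function.support (cutoffBump n) := hx
  rw [(cutoffBump n).support_eq, mem_ball_zero_iff] at h
  push_cast
  exact abs_le.1 h.le

theorem hasCompactSupport_cutoff (n : ℕ) : HasCompactSupport (cutoff n) :=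
  (cutoffBump n).hasCompactSupport

/-- Multiplication by a compactly supported function. -/
def lpMul (χ : ℝ →ᵇ ℝ) (R : ℕ) : LpLoc E p →L[ℝ] Lp E p (volume : Measure ℝ) :=
  ((ContinuousLinearMap.lsmul ℝ ℝ : ℝ →L[ℝ] E →L[ℝ] E).holderL volume ⊤ p p (bcfTop χ)).comp
    (lpExt R)

theorem coeFn_lpMul {χ : ℝ →ᵇ ℝ} {R : ℕ} (hχ : ∀ x, χ x ≠ 0 → x ∈ Icc (-(R : ℝ)) R)
    (f : LpLoc E p) : lpMul χ R f =ᵐ[volume] fun x => χ x • f.rep x := by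
  filter_upwards [(ContinuousLinearMap.lsmul ℝ ℝ : ℝ →L[ℝ] E →L[ℝ] E).coeFn_holder (r := p)
    (bcfTop χ) (lpExt R f), coeFn_bcfTop χ, coeFn_lpExt R f] with x h1 h2 h3
  refine h1.trans ?_
  rw [h2, h3, ContinuousLinearMap.lsmul_apply]
  by_cases h : χ x = 0
  · rw [h, zero_smul, zero_smul]
  · rw [indicator_of_mem (hχ x h)]

/-- A compactly supported continuous function as a bounded continuous function. -/
def bcfOf {χ : ℝ → ℝ} (h : Continuous χ) (hc : HasCompactSupport χ) : ℝ →ᵇ ℝ :=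
  BoundedContinuousFunction.ofNormedAddCommGroup χ h (hc.exists_bound_of_continuous h).choose
    (hc.exists_bound_of_continuous h).choose_spec

theorem bcfOf_apply {χ : ℝ → ℝ} (h : Continuous χ) (hc : HasCompactSupport χ) (x : ℝ) :
    bcfOf h hc x = χ x := rfl

/-- Multiplication by the cutoff function. -/
def lpCutoff (n : ℕ) : LpLoc E p →L[ℝ] Lp E p (volume : Measure ℝ) :=
  lpMul (bcfOf (contDiff_cutoff n).continuous (hasCompactSupport_cutoff n)) (n + 2)

theorem coeFn_lpCutoff (n : ℕ) (f : LpLoc E p) :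
    lpCutoff n f =ᵐ[volume] fun x => cutoff n x • f.rep x :=
  coeFn_lpMul (fun _ hx => cutoff_support hx) f

attribute [irreducible] lpExt lpToLoc lpGlue lpMul lpCutoff glueTrunc extZero

end LpLoc

/-! ### Local data spaces -/

section YLoc

variable {N : ℕ}

/-- The value of an element of `Y` at `0`. -/
def yZero : Y N →L[ℝ] Pot N := (BoundedContinuousFunction.evalCLM ℝ (0 : ℝ)).comp yFun

theorem yZero_apply (v : Y N) : yZero v = yFun v 0 := rfl

/-- The element of `Y` with value `c` at `0` and derivative `g`. -/
def yOf : Pot N × Lp (Pot N) 1 (volume : Measure ℝ) →L[ℝ] Y N :=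
  yConst.comp (ContinuousLinearMap.fst ℝ _ _ -
    (yZero.comp yJ).comp (ContinuousLinearMap.snd ℝ (Pot N) _)) +
    yJ.comp (ContinuousLinearMap.snd ℝ (Pot N) _)

theorem yOf_apply (c : Pot N) (g : Lp (Pot N) 1 (volume : Measure ℝ)) :
    yOf (c, g) = yConst (c - yZero (yJ g)) + yJ g := rfl

theorem yDer_yOf (c : Pot N) (g : Lp (Pot N) 1 (volume : Measure ℝ)) : yDer (yOf (c, g)) = g := by
  rw [yOf_apply, map_add, yDer_yConst, yDer_yJ, zero_add]

theorem yZero_yOf (c : Pot N) (g : Lp (Pot N) 1 (volume : Measure ℝ)) : yZero (yOf (c, g)) = c := by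
  rw [yOf_apply, map_add, yZero_apply (yConst _), yFun_yConst, sub_add_cancel]

theorem yFun_yOf (c : Pot N) (g : Lp (Pot N) 1 (volume : Measure ℝ)) (x : ℝ) :
    yFun (yOf (c, g)) x = c + ∫ s in (0 : ℝ)..x, g s := by
  have h := yFun_sub (yOf (c, g)) 0 x
  rw [yDer_yOf, ← yZero_apply, yZero_yOf] at h
  rw [← h, add_sub_cancel]

theorem Y.eq_yOf (v : Y N) : v = yOf (yZero v, yDer v) := by
  refine Y.ext (BoundedContinuousFunction.ext fun x => ?_) (yDer_yOf _ _).symm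
  rw [yFun_yOf, ← yFun_sub, yZero_apply, add_sub_cancel]

attribute [irreducible] yOf yZero

/-- The function underlying an element of `Y_loc`. -/
def locFun : YLoc N →L[ℝ] C(ℝ, Pot N) :=
  (ContinuousLinearMap.fst ℝ (C(ℝ, Pot N)) (LpLoc (Pot N) 1)).comp (YLoc N).subtypeL

/-- The derivative of an element of `Y_loc`. -/
def locDer : YLoc N →L[ℝ] LpLoc (Pot N) 1 :=
  (ContinuousLinearMap.snd ℝ (C(ℝ, Pot N)) (LpLoc (Pot N) 1)).comp (YLoc N).subtypeL

theorem locFun_sub (v : YLoc N) (a b : ℝ) :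
    locFun v b - locFun v a = ∫ x in a..b, (locDer v).rep x := v.2 a b

theorem YLoc.ext {v w : YLoc N} (h : ∀ x, locFun v x = locFun w x) : v = w := by
  refine Subtype.ext (Prod.ext (ContinuousMap.ext h) (LpLoc.ext ?_))
  refine ae_eq_of_intervalIntegral_eq (locDer v).locallyIntegrable_rep
    (locDer w).locallyIntegrable_rep fun x => ?_
  have h1 := locFun_sub v 0 x
  have h2 := locFun_sub w 0 x
  rw [h, h] at h1
  exact h1.symm.trans h2

/-- The primitive vanishing at `0`. -/
def locPrim (g : LpLoc (Pot N) 1) : C(ℝ, Pot N) :=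
  ⟨fun x => ∫ s in (0 : ℝ)..x, g.rep s,
    intervalIntegral.continuous_primitive g.intervalIntegrable_rep 0⟩

theorem locPrim_apply (g : LpLoc (Pot N) 1) (x : ℝ) : locPrim g x = ∫ s in (0 : ℝ)..x, g.rep s := rfl

theorem locPrim_eq (g : LpLoc (Pot N) 1) {R : ℕ} {x : ℝ} (hx : |x| ≤ R) :
    locPrim g x = yFun (yOf (0, lpExt R g)) x := by
  rw [locPrim_apply, yFun_yOf, zero_add]
  refine intervalIntegral.integral_congr_ae ?_
  filter_upwards [coeFn_lpExt R g] with y hy hy'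
  have h1 : y ∈ Icc (-(R : ℝ)) R :=
    ordConnected_Icc.uIcc_subset (by simp) (abs_le.1 hx) (uIoc_subset_uIcc hy')
  rw [hy, indicator_of_mem h1]

/-- Joint continuity in the derivative and the point is local in x. For |x| < R the primitive
depends only on the derivative truncated to [-R, R], which reduces the claim to the space Y. -/
theorem continuous_locPrim : Continuous (locPrim (N := N)) := by
  refine ContinuousMap.continuous_of_continuous_uncurry _ ?_
  rw [continuous_iff_continuousAt]
  rintro ⟨g, x⟩
  obtain ⟨R, hR⟩ := exists_nat_gt |x|
  have h1 : Continuous fun q : LpLoc (Pot N) 1 × ℝ => yFun (yOf (0, lpExt R q.1)) q.2 := by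
    have h2 : Continuous fun g : LpLoc (Pot N) 1 => yFun (yOf ((0 : Pot N), lpExt R g)) :=
      yFun.continuous.comp (yOf.continuous.comp (continuous_const.prodMk (lpExt R).continuous))
    exact (h2.comp continuous_fst).eval continuous_snd
  refine h1.continuousAt.congr ?_
  have h3 : {q : LpLoc (Pot N) 1 × ℝ | |q.2| < R} ∈ 𝓝 (g, x) :=
    (isOpen_lt (continuous_snd.abs) continuous_const).mem_nhds hR
  filter_upwards [h3] with q hq
  exact (locPrim_eq q.1 (le_of_lt hq)).symm

/-- The element of `Y_loc` with value `c` at `0` and derivative `g`. -/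
def yLocOf : Pot N × LpLoc (Pot N) 1 →L[ℝ] YLoc N where
  toFun q := ⟨(ContinuousMap.const ℝ q.1 + locPrim q.2, q.2), fun a b => by
    simp only [ContinuousMap.add_apply, ContinuousMap.const_apply, locPrim_apply,
      add_sub_add_left_eq_sub]
    exact intervalIntegral.integral_interval_sub_left (q.2.intervalIntegrable_rep _ _)
      (q.2.intervalIntegrable_rep _ _)⟩
  map_add' q q' := YLoc.ext fun x => by
    change (q.1 + q'.1) + locPrim (q.2 + q'.2) x = (q.1 + locPrim q.2 x) + (q'.1 + locPrim q'.2 x)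
    have : locPrim (q.2 + q'.2) x = locPrim q.2 x + locPrim q'.2 x := by
      rw [locPrim_apply, locPrim_apply, locPrim_apply,
        ← intervalIntegral.integral_add (q.2.intervalIntegrable_rep _ _)
        (q'.2.intervalIntegrable_rep _ _)]
      refine intervalIntegral.integral_congr_ae ?_
      filter_upwards [LpLoc.rep_add q.2 q'.2] with x hx _ using hx
    rw [this]
    abel
  map_smul' c q := YLoc.ext fun x => by
    change c • q.1 + locPrim (c • q.2) x = c • (q.1 + locPrim q.2 x)
    have : locPrim (c • q.2) x = c • locPrim q.2 x := by
      rw [locPrim_apply, locPrim_apply, ← intervalIntegral.integral_smul]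
      refine intervalIntegral.integral_congr_ae ?_
      filter_upwards [LpLoc.rep_smul c q.2] with x hx _ using hx
    rw [this, smul_add]
  cont := Continuous.subtype_mk (((ContinuousMap.continuous_const'.comp continuous_fst).add
    (continuous_locPrim.comp continuous_snd)).prodMk continuous_snd) _

theorem locFun_yLocOf (c : Pot N) (g : LpLoc (Pot N) 1) (x : ℝ) :
    locFun (yLocOf (c, g)) x = c + ∫ s in (0 : ℝ)..x, g.rep s := rfl

end YLoc

/-! ### Cutting off, gluing and embedding data -/

section X0Loc

variable {N : ℕ}

/-- The spinor component. -/
def locSpinor : X0Loc N →L[ℝ] LpLoc Spinor 2 := ContinuousLinearMap.fst ℝ _ _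

/-- The potential. -/
def locV : X0Loc N →L[ℝ] YLoc N :=
  (ContinuousLinearMap.fst ℝ (YLoc N) (LpLoc (Pot N) 1)).comp (ContinuousLinearMap.snd ℝ _ _)

/-- The velocity. -/
def locW : X0Loc N →L[ℝ] LpLoc (Pot N) 1 :=
  (ContinuousLinearMap.snd ℝ (YLoc N) (LpLoc (Pot N) 1)).comp (ContinuousLinearMap.snd ℝ _ _)

theorem x0Loc_rep (d : X0Loc N) (x : ℝ) :
    X0Loc.rep d x = ((locSpinor d).rep x, locFun (locV d) x, (locW d).rep x) := rfl

theorem X0Loc.ext {d e : X0Loc N} (h : X0Loc.rep d =ᵐ[volume] X0Loc.rep e) : d = e := by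
  have h1 : (locSpinor d).rep =ᵐ[volume] (locSpinor e).rep :=
    h.mono fun x hx => (Prod.ext_iff.1 hx).1
  have h2 : (locW d).rep =ᵐ[volume] (locW e).rep :=
    h.mono fun x hx => (Prod.ext_iff.1 (Prod.ext_iff.1 hx).2).2
  have h3 : (locFun (locV d) : ℝ → Pot N) = locFun (locV e) :=
    Measure.eq_of_ae_eq (μ := volume) (h.mono fun x hx => (Prod.ext_iff.1 (Prod.ext_iff.1 hx).2).1)
      (locFun (locV d)).continuous (locFun (locV e)).continuous
  exact Prod.ext (LpLoc.ext h1) (Prod.ext (YLoc.ext (congrFun h3)) (LpLoc.ext h2))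

theorem X0.ext_rep {d e : X0 N} (h : X0.rep d =ᵐ[volume] X0.rep e) : d = e := by
  have h1 : x0Spinor d = x0Spinor e := Lp.ext (h.mono fun x hx => by
    rw [x0_rep, x0_rep] at hx; exact (Prod.ext_iff.1 hx).1)
  have h2 : x0W d = x0W e := Lp.ext (h.mono fun x hx => by
    rw [x0_rep, x0_rep] at hx; exact (Prod.ext_iff.1 (Prod.ext_iff.1 hx).2).2)
  have h3 : (yFun (x0V d) : ℝ → Pot N) = yFun (x0V e) :=
    Measure.eq_of_ae_eq (μ := volume) (h.mono fun x hx => by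
      rw [x0_rep, x0_rep] at hx; exact (Prod.ext_iff.1 (Prod.ext_iff.1 hx).2).1)
      (yFun (x0V d)).continuous (yFun (x0V e)).continuous
  refine x0_ext h1 ?_ h2
  rw [Y.eq_yOf (x0V d), Y.eq_yOf (x0V e), yZero_apply, yZero_apply, h3]
  congr 2
  refine Lp.ext (ae_eq_of_intervalIntegral_eq (integrable_lp_one _).locallyIntegrable
    (integrable_lp_one _).locallyIntegrable fun x => ?_)
  rw [← yFun_sub, ← yFun_sub, h3]

/-- Smooth cutoff of the data. -/
def cutX (n : ℕ) : X0Loc N →L[ℝ] X0 N :=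
  ((lpCutoff n).comp locSpinor).prod
    -- For the potential it is the derivative that is cut off; the function is rebuilt from its
    -- value at 0. It lies in Y and keeps its values wherever the cutoff equals 1 back to the
    -- origin.
    ((yOf.comp (((ContinuousMap.evalCLM ℝ (0 : ℝ)).comp (locFun.comp locV)).prod
      ((lpCutoff n).comp (locDer.comp locV)))).prod ((lpCutoff n).comp locW))

theorem cutX_apply (n : ℕ) (d : X0Loc N) : cutX n d = (lpCutoff n (locSpinor d),
    yOf (locFun (locV d) 0, lpCutoff n (locDer (locV d))), lpCutoff n (locW d)) := rfl

/-- Postcomposition of sequences with a continuous linear map. -/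
def seqMap {E F : Type} [NormedAddCommGroup E] [NormedSpace ℝ E] [NormedAddCommGroup F]
    [NormedSpace ℝ F] (L : E →L[ℝ] F) : (ℕ → E) →L[ℝ] (ℕ → F) :=
  ContinuousLinearMap.pi fun n => L.comp (ContinuousLinearMap.proj (R := ℝ) (φ := fun _ : ℕ => E) n)

/-- Gluing of a sequence of data. -/
def glueX : (ℕ → X0 N) →L[ℝ] X0Loc N :=
  (lpGlue.comp (seqMap (x0Spinor (N := N)))).prod
    ((yLocOf.comp (((yZero.comp (x0V (N := N))).comp
      (ContinuousLinearMap.proj (R := ℝ) (φ := fun _ : ℕ => X0 N) 0)).prod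
      (lpGlue.comp (seqMap ((yDer (N := N)).comp x0V))))).prod
      (lpGlue.comp (seqMap (x0W (N := N)))))

theorem glueX_apply (f : ℕ → X0 N) : glueX f = (lpGlue (fun n => x0Spinor (f n)),
    yLocOf (yZero (x0V (f 0)), lpGlue fun n => yDer (x0V (f n))), lpGlue fun n => x0W (f n)) := rfl

/-- The inclusion of the global data in the local data. -/
def toLoc : X0 N →L[ℝ] X0Loc N :=
  (lpToLoc.comp x0Spinor).prod ((yLocOf.comp ((yZero.comp x0V).prod
    (lpToLoc.comp (yDer.comp x0V)))).prod (lpToLoc.comp x0W))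

theorem toLoc_apply (d : X0 N) : toLoc d = (lpToLoc (x0Spinor d),
    yLocOf (yZero (x0V d), lpToLoc (yDer (x0V d))), lpToLoc (x0W d)) := rfl

theorem rep_toLoc (d : X0 N) : X0Loc.rep (toLoc d) =ᵐ[volume] X0.rep d := by
  filter_upwards [rep_lpToLoc (x0Spinor d), rep_lpToLoc (x0W d)] with x h1 h2
  rw [toLoc_apply, x0Loc_rep, x0_rep]
  refine Prod.ext h1 (Prod.ext ?_ h2)
  change locFun (yLocOf _) x = _
  rw [locFun_yLocOf]
  have : ∫ s in (0 : ℝ)..x, (lpToLoc (yDer (x0V d))).rep s = ∫ s in (0 : ℝ)..x, yDer (x0V d) s :=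
    intervalIntegral.integral_congr_ae ((rep_lpToLoc (yDer (x0V d))).mono fun y hy _ => hy)
  rw [this, ← yFun_yOf, ← Y.eq_yOf]

/-- The global data `d` and the local data `e` agree on `(-r, r)`. -/
def AgreeLoc (r : ℝ) (d : X0 N) (e : X0Loc N) : Prop :=
  ∀ᵐ x, |x| < r → X0.rep d x = X0Loc.rep e x

theorem agreeLoc_cutX (n : ℕ) (d : X0Loc N) : AgreeLoc (n + 1) (cutX n d) d := by
  have key {E : Type} [NormedAddCommGroup E] [NormedSpace ℝ E] {p : ℝ≥0∞} [Fact (1 ≤ p)]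
      (f : LpLoc E p) : ∀ᵐ x : ℝ, |x| < (n : ℝ) + 1 → lpCutoff n f x = f.rep x := by
    filter_upwards [coeFn_lpCutoff n f] with x hx h
    rw [hx, cutoff_eq_one h.le, one_smul]
  filter_upwards [key (locSpinor d), key (locW d)] with x h1 h2 hx
  rw [x0_rep, x0Loc_rep, cutX_apply]
  refine Prod.ext ?_ (Prod.ext ?_ ?_)
  · rw [← h1 hx]; unfold x0Spinor; rfl
  · have : x0V ((lpCutoff n (locSpinor d), yOf (locFun (locV d) 0, lpCutoff n (locDer (locV d))),
        lpCutoff n (locW d)) : X0 N) = yOf (locFun (locV d) 0, lpCutoff n (locDer (locV d))) := by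
      unfold x0V; rfl
    change yFun (x0V _) x = _
    rw [this, yFun_yOf]
    have h3 : ∫ s in (0 : ℝ)..x, lpCutoff n (locDer (locV d)) s =
        ∫ s in (0 : ℝ)..x, (locDer (locV d)).rep s := by
      refine intervalIntegral.integral_congr_ae ?_
      filter_upwards [key (locDer (locV d))] with y hy hy'
      refine hy (abs_lt.2 ?_)
      have h4 := abs_lt.1 hx
      exact ordConnected_Ioo.uIcc_subset (by constructor <;> linarith [abs_nonneg x]) h4
        (uIoc_subset_uIcc hy')
    rw [h3, ← locFun_sub, add_sub_cancel]
  · rw [← h2 hx]; unfold x0W; rfl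

theorem agree_of_le {f : ℕ → X0 N} (hf : ∀ n : ℕ, Agree (n + 1) (f n) (f (n + 1))) {k n : ℕ}
    (h : k ≤ n) : Agree (k + 1) (f k) (f n) := by
  induction n, h using Nat.le_induction with
  | base => exact Agree.refl _ _
  | succ n hn ih =>
    exact ih.trans ((hf n).mono (by have : (k : ℝ) ≤ n := by exact_mod_cast hn
                                    linarith))

/-- At x the glued function uses index k = ⌊|x|⌋. For |x| < n + 1 this satisfies k ≤ n and |x| < k +
1, so consistency up to radius k + 1 identifies f k with f n there. The potential is handled through
its derivative and its value at 0. -/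
theorem agreeLoc_glueX {f : ℕ → X0 N} (hf : ∀ n : ℕ, Agree (n + 1) (f n) (f (n + 1))) (n : ℕ) :
    AgreeLoc (n + 1) (f n) (glueX f) := by
  have hk : ∀ᵐ x : ℝ, ∀ k : ℕ, k ≤ n → |x| < (k : ℝ) + 1 → X0.rep (f k) x = X0.rep (f n) x :=
    ae_all_iff.2 fun k => by
      by_cases h : k ≤ n
      · filter_upwards [agree_of_le hf h] with x hx _ using hx
      · exact Eventually.of_forall fun x h' => absurd h' h
  have hder : ∀ᵐ x : ℝ, ∀ k : ℕ, k ≤ n → |x| < (k : ℝ) + 1 → yDer (x0V (f k)) x = yDer (x0V (f n)) x :=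
    ae_all_iff.2 fun k => by
      by_cases h : k ≤ n
      · filter_upwards [yDer_ae_eq (agree_iff_ae.1 (agree_of_le hf h)).2.1] with x hx _ using hx
      · exact Eventually.of_forall fun x h' => absurd h' h
  have hfl {x : ℝ} (hx : |x| < n + 1) : ⌊|x|⌋₊ ≤ n ∧ |x| < (⌊|x|⌋₊ : ℝ) + 1 := by
    refine ⟨?_, Nat.lt_floor_add_one _⟩
    have : ⌊|x|⌋₊ < n + 1 := (Nat.floor_lt (abs_nonneg x)).2 (by push_cast; exact hx)
    omega
  have h0 : yFun (x0V (f 0)) 0 = yFun (x0V (f n)) 0 := by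
    have h1 : EqOn (yFun (x0V (f 0))) (yFun (x0V (f n))) {x | |x| < 1} := by
      refine Measure.eqOn_open_of_ae_eq (μ := volume) ?_ (isOpen_lt continuous_abs continuous_const)
        (yFun (x0V (f 0))).continuous.continuousOn (yFun (x0V (f n))).continuous.continuousOn
      refine (ae_restrict_iff' (measurableSet_abs_lt 1)).2 ?_
      filter_upwards [hk] with x hx h
      have := hx 0 (Nat.zero_le n) (by simpa using h)
      rw [x0_rep, x0_rep] at this
      exact (Prod.ext_iff.1 (Prod.ext_iff.1 this).2).1
    exact h1 (by simp)
  filter_upwards [hk, rep_lpGlue fun n => x0Spinor (f n), rep_lpGlue fun n => x0W (f n)]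
    with x h1 h2 h3 hx
  have h4 := h1 _ (hfl hx).1 (hfl hx).2
  rw [x0_rep, x0_rep, Prod.mk.injEq, Prod.mk.injEq] at h4
  rw [x0_rep, x0Loc_rep, glueX_apply]
  refine Prod.ext ?_ (Prod.ext ?_ ?_)
  · exact (h4.1.symm.trans h2.symm :)
  · change _ = locFun (yLocOf _) x
    rw [locFun_yLocOf]
    have h5 : ∫ s in (0 : ℝ)..x, (lpGlue fun n => yDer (x0V (f n))).rep s =
        ∫ s in (0 : ℝ)..x, yDer (x0V (f n)) s := by
      refine intervalIntegral.integral_congr_ae ?_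
      filter_upwards [rep_lpGlue fun n => yDer (x0V (f n)), hder] with y hy hy2 hy'
      have h6 : |y| < n + 1 := by
        refine abs_lt.2 ?_
        have h4 := abs_lt.1 hx
        exact ordConnected_Ioo.uIcc_subset (by constructor <;> linarith [abs_nonneg x]) h4
          (uIoc_subset_uIcc hy')
      rw [hy, hy2 _ (hfl h6).1 (hfl h6).2]
    rw [h5, ← yFun_sub, yZero_apply, h0, add_sub_cancel]
  · exact (h4.2.2.symm.trans h3.symm :)

attribute [irreducible] cutX glueX toLoc locSpinor locV locW

end X0Loc

/-! ### Vector space structures on data and curves -/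

section Instances

variable {N : ℕ} {T : ℝ}

scoped instance : IsTopologicalAddGroup (X0 N) := SeminormedAddCommGroup.toIsTopologicalAddGroup
scoped instance : ContinuousAdd (X0 N) := IsTopologicalAddGroup.toContinuousAdd
scoped instance : ContinuousSMul ℝ (X0 N) := IsBoundedSMul.continuousSMul
scoped instance : ContinuousConstSMul ℝ (X0 N) := ContinuousSMul.continuousConstSMul
scoped instance : IsTopologicalAddGroup (X0Loc N) := inferInstance

theorem continuousAdd_of_isTopologicalAddGroup (G : Type) [AddGroup G] [TopologicalSpace G]
    [h : IsTopologicalAddGroup G] : ContinuousAdd G :=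
  h.toContinuousAdd

scoped instance : ContinuousAdd (X0Loc N) := continuousAdd_of_isTopologicalAddGroup (X0Loc N)
scoped instance : ContinuousSMul ℝ (X0Loc N) := inferInstance
scoped instance : ContinuousConstSMul ℝ (X0Loc N) := ContinuousSMul.continuousConstSMul
scoped instance : AddCommMonoid C(Icc (-T) T, X0 N) := ContinuousMap.instAddCommMonoidOfContinuousAdd
scoped instance : Module ℝ C(Icc (-T) T, X0 N) := ContinuousMap.module
scoped instance : AddCommMonoid C(Icc (-T) T, X0Loc N) := ContinuousMap.instAddCommMonoidOfContinuousAdd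
scoped instance : Module ℝ C(Icc (-T) T, X0Loc N) := ContinuousMap.module

end Instances

/-! ### Existence and uniqueness -/

section Sol

variable {N : ℕ} {T : ℝ} [hT : Fact (0 < T)] {m : ℝ}
  (M : ℝ) {B : Fin N → Matrix (Fin 2) (Fin 2) ℂ} (C : Fin N → Matrix (Fin 2) (Fin 2) ℂ)
  (hB : ∀ j, (B j).IsHermitian) {φ : ℝ → ℝ → ℝ}

variable (T) in
/-- The solution with mass density `μ`. -/
def x0Sol (μ : Lp ℝ 1 (volume : Measure ℝ)) (d : X0 N) : C(Icc (-T) T, X0 N) :=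
  mapCurve T (projX (N := N)) ((solvable_dkg (C := C) M hB).sol (embX d + massX μ))

variable {M C hB}

theorem isMild_x0Sol (μ : Lp ℝ 1 (volume : Measure ℝ)) (d : X0 N) :
    (dkg M B C).IsMild (embX d + massX μ)
      ((solvable_dkg (T := T) (C := C) M hB).sol (embX d + massX μ)) :=
  (solvable_dkg (T := T) (C := C) M hB).isMild_sol _

theorem x0Sol_zero (μ : Lp ℝ 1 (volume : Measure ℝ)) (d : X0 N) :
    x0Sol T M C hB μ d (zeroTime T) = d := by
  have h := (isMild_x0Sol (T := T) (M := M) (C := C) (hB := hB) μ d).apply_zero (t := zeroTime T) rfl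
  refine (congrArg (projX (N := N)) h).trans ?_
  rw [map_add, projX_embX, projX_massX, add_zero]

theorem contDiff_clm_comp_affine {X H G F : Type} [NormedAddCommGroup X] [NormedSpace ℝ X]
    [NormedAddCommGroup H] [NormedSpace ℝ H] [NormedAddCommGroup G] [NormedSpace ℝ G]
    [NormedAddCommGroup F] [NormedSpace ℝ F] (L : G →L[ℝ] F) {g : H → G} (hg : ContDiff ℝ ∞ g)
    (A : X →L[ℝ] H) (c : H) : ContDiff ℝ ∞ fun x => L (g (A x + c)) :=
  L.contDiff.comp (hg.comp (A.contDiff.add contDiff_const))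

theorem contDiff_x0Sol (μ : Lp ℝ 1 (volume : Measure ℝ)) :
    ContDiff ℝ ∞ (x0Sol T M C hB μ) :=
  contDiff_clm_comp_affine (X := X0 N) (H := Lift N) (G := C(Icc (-T) T, Lift N))
    (F := C(Icc (-T) T, X0 N)) (mapCurve T (projX (N := N)))
    (solvable_dkg (C := C) M hB).contDiff_sol embX (massX μ)

theorem x0Eqs_x0Sol {μ : Lp ℝ 1 (volume : Measure ℝ)} (h : IsTest T φ)
    (hμ : ∀ t, ∀ᵐ x, φ t x ≠ 0 → μ x = m ^ 2) (d : X0 N) :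
    X0Eqs M m B C φ (x0Sol T M C hB μ d) := by
  refine x0Eqs_of_isMild (isMild_x0Sol (hB := hB) μ d) h fun t => ?_
  rw [map_add, liftMass_embX, liftMass_massX, zero_add]
  exact hμ t

theorem eq_of_zero {t : Icc (-T) T} (ht : (t : ℝ) = 0) : t = zeroTime T := Subtype.ext ht

/-- This is where m = 0 enters: the mass density must be integrable and equal to m² on the whole
line. -/
theorem isSolution_x0Sol (hC : ∀ j, (C j).IsHermitian) (hm : m = 0) (d : X0 N) :
    IsSolution X0.rep M m B C d (x0Sol T M C hB 0 d) := by
  refine isSolution_iff.2 ⟨fun t ht => ?_, fun φ hφ => (solEqs_iff hC hφ).2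
    (x0Eqs_x0Sol hφ (fun t => ?_) d)⟩
  · rw [eq_of_zero ht, x0Sol_zero]
  · filter_upwards [Lp.coeFn_zero ℝ 1 (volume : Measure ℝ)] with x hx _
    rw [hx, hm]
    simp

/-- Uniqueness on the cones of all integer radii n yields agreement for |x| < n - |t|, and these
intervals exhaust the line. -/
theorem eq_x0Sol (hC : ∀ j, (C j).IsHermitian) (hm : m = 0) {d : X0 N} {u : C(Icc (-T) T, X0 N)}
    (hu : IsSolution X0.rep M m B C d u) : u = x0Sol T M C hB 0 d := by
  have hv := isSolution_iff.1 (isSolution_x0Sol (T := T) (M := M) (hB := hB) hC hm d)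
  have hu := isSolution_iff.1 hu
  refine ContinuousMap.ext fun t => X0.ext_rep ?_
  have key (n : ℕ) : Agree (n - |(t : ℝ)|) (u t) (x0Sol T M C hB 0 d t) :=
    agree_of_x0Eqs (m := m) (fun φ hφ => (solEqs_iff hC hφ.1).1 (hu.2 φ hφ.1))
      (fun φ hφ => (solEqs_iff hC hφ.1).1 (hv.2 φ hφ.1))
      (by rw [hu.1 _ rfl, hv.1 _ rfl]; exact Agree.refl _ _) t
  filter_upwards [ae_all_iff.2 key] with x hx
  obtain ⟨n, hn⟩ := exists_nat_gt (|x| + |(t : ℝ)|)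
  exact hx n (by linarith)

/-! ### Local solutions -/

variable (m) in
/-- A smooth mass density equal to `m²` on a large interval. -/
def massCut (n : ℕ) : Lp ℝ 1 (volume : Measure ℝ) :=
  m ^ 2 • (((contDiff_cutoff n).continuous.memLp_of_hasCompactSupport
    (hasCompactSupport_cutoff n) : MemLp (cutoff n) 1 volume)).toLp (cutoff n)

theorem coeFn_massCut (n : ℕ) : massCut m n =ᵐ[volume] fun x => m ^ 2 * cutoff n x := by
  have h : MemLp (cutoff n) 1 (volume : Measure ℝ) :=
    (contDiff_cutoff n).continuous.memLp_of_hasCompactSupport (hasCompactSupport_cutoff n)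
  filter_upwards [Lp.coeFn_smul (m ^ 2) (h.toLp (cutoff n)), h.coeFn_toLp] with x h1 h2
  rw [massCut, h1, Pi.smul_apply, h2, smul_eq_mul]

variable (T) in
/-- An index shift accounting for the finite speed of propagation. -/
def coneShift : ℕ := ⌈T⌉₊

theorem abs_le_coneShift (t : Icc (-T) T) : |(t : ℝ)| ≤ coneShift T :=
  (abs_le.2 t.2).trans (Nat.le_ceil T)

variable (T M m C hB) in
/-- The solution with data cut off at level `n`. -/
def locLevel (n : ℕ) (d : X0Loc N) : C(Icc (-T) T, X0 N) :=
  x0Sol T M C hB (massCut m (n + coneShift T)) (cutX (n + coneShift T) d)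

theorem x0Eqs_locLevel {n : ℕ} (h : IsTest T φ)
    (hφ : ∀ t x, φ t x ≠ 0 → |x| ≤ n + coneShift T + 1) (d : X0Loc N) :
    X0Eqs M m B C φ (locLevel T m M C hB n d) := by
  refine x0Eqs_x0Sol h (fun t => ?_) _
  filter_upwards [coeFn_massCut (m := m) (n + coneShift T)] with x hx h
  rw [hx, cutoff_eq_one (by push_cast; exact hφ t x h), mul_one]

theorem IsConeTest.abs_le {r : ℝ} (h : IsConeTest T r φ) {t x : ℝ} (hx : φ t x ≠ 0) : |x| ≤ r := by
  have := (h.eq_zero hx).2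
  linarith [abs_nonneg t]

/-- Data and mass densities of consecutive levels agree up to radius n + ⌈T⌉ + 1. The cone loses |t|
≤ ⌈T⌉, which leaves n + 1. -/
theorem agree_locLevel (d : X0Loc N) (n : ℕ) (t : Icc (-T) T) :
    Agree (n + 1) (locLevel T m M C hB n d t) (locLevel T m M C hB (n + 1) d t) := by
  refine (agree_of_x0Eqs (r := n + coneShift T + 1) (m := m) (M := M) (B := B) (C := C)
    (fun φ h => x0Eqs_locLevel h.1 (fun t x hx => h.abs_le hx) d)
    (fun φ h => x0Eqs_locLevel h.1 (fun t x hx => (h.abs_le hx).trans (by push_cast; linarith)) d)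
    ?_ t).mono (by have := abs_le_coneShift t; linarith)
  rw [locLevel, locLevel, x0Sol_zero, x0Sol_zero]
  filter_upwards [agreeLoc_cutX (n + coneShift T) d, agreeLoc_cutX (n + 1 + coneShift T) d]
    with x h1 h2 hx
  push_cast at h1 h2
  rw [h1 (by linarith), h2 (by linarith)]

theorem X0Loc.ext_of_agree {f : ℕ → X0 N} {d e : X0Loc N} (h : ∀ n : ℕ, AgreeLoc (n + 1) (f n) d)
    (h' : ∀ n : ℕ, AgreeLoc (n + 1) (f n) e) : d = e := by
  refine X0Loc.ext ?_
  filter_upwards [ae_all_iff.2 h, ae_all_iff.2 h'] with x h1 h2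
  obtain ⟨n, hn⟩ := exists_nat_gt |x|
  rw [← h1 n (by linarith), h2 n (by linarith)]

variable (T) in
/-- Gluing of curves. -/
def glueCurve : (ℕ → C(Icc (-T) T, X0 N)) →L[ℝ] C(Icc (-T) T, X0Loc N) where
  toFun f := ⟨fun t => glueX fun n => f n t, glueX.continuous.comp
    (continuous_pi fun n => (f n).continuous)⟩
  map_add' _ _ := ContinuousMap.ext fun _ => glueX.map_add _ _
  map_smul' _ _ := ContinuousMap.ext fun _ => glueX.map_smul _ _
  cont := ContinuousMap.continuous_of_continuous_uncurry _
    (glueX.continuous.comp (continuous_pi fun n =>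
      ((continuous_apply n).comp continuous_fst).eval continuous_snd))

theorem glueCurve_apply (f : ℕ → C(Icc (-T) T, X0 N)) (t : Icc (-T) T) :
    glueCurve (N := N) T f t = glueX fun n => f n t := rfl

variable (T M m C hB) in
/-- The solution map for local data. -/
def locSol (d : X0Loc N) : C(Icc (-T) T, X0Loc N) :=
  glueCurve (N := N) T fun n => locLevel T m M C hB n d

theorem agreeLoc_locSol (d : X0Loc N) (n : ℕ) (t : Icc (-T) T) :
    AgreeLoc (n + 1) (locLevel T m M C hB n d t) (locSol T m M C hB d t) :=
  agreeLoc_glueX (fun n => agree_locLevel d n t) n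

/-- A test function is compactly supported, so it sees a single level, where the glued curve
coincides with a solution of the cut off problem and the mass density equals m². -/
theorem isSolution_locSol (hC : ∀ j, (C j).IsHermitian) (d : X0Loc N) :
    IsSolution X0Loc.rep M m B C d (locSol T m M C hB d) := by
  refine isSolution_iff.2 ⟨fun t ht => ?_, fun φ hφ => ?_⟩
  · refine X0Loc.ext_of_agree (fun n => agreeLoc_locSol d n t) fun n => ?_
    rw [eq_of_zero ht, locLevel, x0Sol_zero]
    filter_upwards [agreeLoc_cutX (n + coneShift T) d] with x h1 hx
    refine h1 (hx.trans_le ?_)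
    push_cast
    linarith [(Nat.cast_nonneg (coneShift T) : (0 : ℝ) ≤ _)]
  · obtain ⟨ρ, hρ⟩ := hφ.2.1.isCompact.isBounded.subset_closedBall 0
    obtain ⟨n, hn⟩ := exists_nat_gt ρ
    have hx {t x : ℝ} (h : (t, x) ∈ tsupport (Function.uncurry φ)) : |x| < n + 1 := by
      have h1 := hρ h
      rw [mem_closedBall_zero_iff] at h1
      have h2 : |x| ≤ ‖(t, x)‖ := norm_snd_le (t, x)
      linarith
    refine SolEqs.congr hφ.isBump (fun t => ?_) ((solEqs_iff hC hφ).2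
      (x0Eqs_locLevel (m := m) (M := M) (hB := hB) (n := n) hφ (fun t x h => ?_) d))
    · filter_upwards [agreeLoc_locSol (m := m) (M := M) (C := C) (hB := hB) d n t] with x h1 h
      exact h1 (hx h)
    · have := hx (subset_tsupport (Function.uncurry φ) (show (t, x) ∈ _ from h))
      linarith [(Nat.cast_nonneg (coneShift T) : (0 : ℝ) ≤ _)]

/-- Cutting off u at each time, at level k = n + ⌈T⌉, gives a curve in `X0` that still satisfies the
equations for tests in the cone of radius k + 1. Uniqueness on that cone compares it with the level
n solution. -/
theorem eq_locSol (hC : ∀ j, (C j).IsHermitian) {d : X0Loc N} {u : C(Icc (-T) T, X0Loc N)}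
    (hu : IsSolution X0Loc.rep M m B C d u) : u = locSol T m M C hB d := by
  have hu := isSolution_iff.1 hu
  refine ContinuousMap.ext fun t => X0Loc.ext_of_agree (f := fun n => locLevel T m M C hB n d t)
    (fun n => ?_) (fun n => agreeLoc_locSol d n t)
  set k := n + coneShift T with hk
  have hk' : (k : ℝ) = n + coneShift T := by rw [hk]; push_cast; rfl
  set v : C(Icc (-T) T, X0 N) := ⟨fun t => cutX k (u t), (cutX k).continuous.comp u.continuous⟩
    with hv
  have h1 : Agree (k + 1 - |(t : ℝ)|) (locLevel T m M C hB n d t) (v t) := by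
    refine agree_of_x0Eqs (r := k + 1) (m := m) (M := M) (B := B) (C := C)
      (fun φ h => x0Eqs_locLevel h.1 (fun t x hx => (h.abs_le hx).trans_eq (by rw [hk'])) d)
      (fun φ h => (solEqs_iff hC h.1).1 (SolEqs.congr h.1.isBump (fun t => ?_) (hu.2 φ h.1)))
      ?_ t
    · filter_upwards [agreeLoc_cutX k (u t)] with x h2 h3
      have := h.2 _ h3
      exact (h2 (by dsimp only at this; linarith [abs_nonneg (t : ℝ)])).symm
    · rw [locLevel, x0Sol_zero]
      change Agree _ _ (cutX k (u (zeroTime T)))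
      rw [hu.1 _ rfl]
      exact Agree.refl _ _
  filter_upwards [h1, agreeLoc_cutX k (u t)] with x h2 h3 hx
  have := abs_le_coneShift t
  have := Nat.cast_nonneg (α := ℝ) (coneShift T)
  exact (h2 (by linarith)).trans (h3 (by linarith))

end Sol

/-! ### Smoothness of the solution map -/

section Bastiani

/-- Maps of the form L ∘ (product of gₐ) ∘ (lₐ), with L and lₐ continuous linear and gₐ smooth
between normed spaces, are closed under directional derivatives: the derivative has the same form
with H a replaced by H a × H a. The product topology allows limits to be taken in each factor. -/
theorem isBastianiC_of_contDiff_comp {A F : Type} [AddCommGroup F] [Module ℝ F] [TopologicalSpace F]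
    [IsTopologicalAddGroup F] [ContinuousSMul ℝ F]
    {H G : A → Type} [∀ a, NormedAddCommGroup (H a)] [∀ a, NormedSpace ℝ (H a)]
    [∀ a, NormedAddCommGroup (G a)] [∀ a, NormedSpace ℝ (G a)] (L : (∀ a, G a) →L[ℝ] F) (k : ℕ)
    {E : Type} [AddCommGroup E] [Module ℝ E] [TopologicalSpace E] [IsTopologicalAddGroup E]
    [ContinuousSMul ℝ E] (l : ∀ a, E →L[ℝ] H a) (g : ∀ a, H a → G a)
    (hg : ∀ a, ContDiff ℝ ∞ (g a)) : IsBastianiC k fun x => L fun a => g a (l a x) := by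
  induction k generalizing E H with
  | zero => exact L.continuous.comp (continuous_pi fun a => (hg a).continuous.comp (l a).continuous)
  | succ k ih =>
    refine ⟨L.continuous.comp (continuous_pi fun a => (hg a).continuous.comp (l a).continuous),
      fun p => L fun a => fderiv ℝ (g a) (l a p.1) (l a p.2), fun x v => ?_, ?_⟩
    · have h1 (a : A) : Tendsto (fun h : ℝ => h⁻¹ • (g a (l a (x + h • v)) - g a (l a x))) (𝓝[≠] 0)
          (𝓝 (fderiv ℝ (g a) (l a x) (l a v))) := by
        have h2 : HasDerivAt (fun h : ℝ => g a (l a x + h • l a v))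
            (fderiv ℝ (g a) (l a x) (l a v)) 0 := by
          have h3 : HasDerivAt (fun h : ℝ => l a x + h • l a v) (l a v) 0 := by
            simpa using ((hasDerivAt_id (0 : ℝ)).smul_const (l a v)).const_add (l a x)
          have h4 : HasFDerivAt (g a) (fderiv ℝ (g a) (l a x)) (l a x + (0 : ℝ) • l a v) := by
            rw [zero_smul, add_zero]
            exact ((hg a).differentiable (by simp) _).hasFDerivAt
          exact h4.comp_hasDerivAt 0 h3
        have h5 := h2.tendsto_slope_zero
        simpa only [zero_add, zero_smul, add_zero, map_add, map_smul] using h5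
      have h6 := (L.continuous.tendsto _).comp (tendsto_pi_nhds.2 h1)
      refine h6.congr fun h => ?_
      change L _ = _
      rw [← map_sub, ← map_smul]
      rfl
    · have := ih (H := fun a => H a × H a)
        (fun a => ((l a).comp (ContinuousLinearMap.fst ℝ E E)).prod
          ((l a).comp (ContinuousLinearMap.snd ℝ E E)))
        (fun a q => fderiv ℝ (g a) q.1 q.2) (fun a => by
          have := (hg a).fderiv_right (m := ∞) (by simp)
          exact (this.comp contDiff_fst).clm_apply contDiff_snd)
      exact this

variable {N : ℕ} {T : ℝ} [hT : Fact (0 < T)] {m M : ℝ}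
  {B C : Fin N → Matrix (Fin 2) (Fin 2) ℂ} {hB : ∀ j, (B j).IsHermitian}

theorem isBastianiC_x0Sol (k : ℕ) (μ : Lp ℝ 1 (volume : Measure ℝ)) :
    IsBastianiC k (x0Sol T M C hB μ) :=
  isBastianiC_of_contDiff_comp (A := Unit) (H := fun _ => X0 N)
    (G := fun _ => C(Icc (-T) T, X0 N))
    (ContinuousLinearMap.proj (R := ℝ) (φ := fun _ : Unit => C(Icc (-T) T, X0 N)) ()) k
    (fun _ => ContinuousLinearMap.id ℝ _) (fun _ => x0Sol T M C hB μ) fun _ => contDiff_x0Sol μ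

theorem isBastianiC_locSol (k : ℕ) : IsBastianiC k (locSol T m M C hB) :=
  isBastianiC_of_contDiff_comp (A := ℕ) (H := fun _ => X0 N)
    (G := fun _ => C(Icc (-T) T, X0 N)) (F := C(Icc (-T) T, X0Loc N)) (E := X0Loc N)
    (glueCurve (N := N) T) k (fun n => cutX (n + coneShift T))
    (fun n => x0Sol T M C hB (massCut m (n + coneShift T))) fun _ => contDiff_x0Sol _

end Bastiani

/-! ### Weak derivatives and translations -/

section Weak

variable {E : Type} [NormedAddCommGroup E] [NormedSpace ℝ E] [CompleteSpace E] {p : ℝ≥0∞}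
  [Fact (1 ≤ p)]

/-- The integral is the convolution of f with the reflected test function, and the derivative falls
on the smooth factor. -/
theorem hasDerivAt_integral_smul {φ : ℝ → ℝ} (hφ : ContDiff ℝ ∞ φ) (hc : HasCompactSupport φ)
    {f : ℝ → E} (hf : LocallyIntegrable f) (a : ℝ) :
    HasDerivAt (fun a => ∫ x, φ (x - a) • f x) (-∫ x, deriv φ (x - a) • f x) a := by
  have h1 : HasCompactSupport fun x => φ (-x) := hc.comp_homeomorph (Homeomorph.neg ℝ)
  have h2 : ContDiff ℝ 1 fun x => φ (-x) := (hφ.comp contDiff_neg).of_le (by simp)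
  have h3 := h1.hasDerivAt_convolution_right (μ := volume)
    ((ContinuousLinearMap.lsmul ℝ ℝ : ℝ →L[ℝ] E →L[ℝ] E).flip) hf h2 a
  have h4 : deriv (fun x => φ (-x)) = fun x => -deriv φ (-x) :=
    funext fun x => deriv_comp_neg φ x
  rw [h4] at h3
  convert h3 using 1
  · funext b
    refine integral_congr_ae (Eventually.of_forall fun x => ?_)
    simp
  · rw [← integral_neg]
    refine integral_congr_ae (Eventually.of_forall fun x => ?_)
    simp

theorem exists_pair {φ : ℝ → ℝ} (hφ : Continuous φ) (hc : HasCompactSupport φ) :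
    ∃ L : Lp E p (volume : Measure ℝ) →L[ℝ] E, ∀ f, L f = ∫ x, φ x • f x := by
  obtain ⟨ρ, hρ⟩ := hc.isCompact.isBounded.subset_closedBall 0
  refine ⟨pairL ρ (bcfOf hφ hc), fun f => (pairL_eq ρ _ f fun x hx => ?_).trans ?_⟩
  · rw [bcfOf_apply] at hx
    have := hρ (subset_tsupport φ hx)
    rw [mem_closedBall_zero_iff] at this
    exact abs_le.1 this
  · simp only [bcfOf_apply]

theorem locallyIntegrable_lp (f : Lp E p (volume : Measure ℝ)) : LocallyIntegrable f volume :=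
  (Lp.memLp f).locallyIntegrable Fact.out

theorem lp_eq_of_pair {f g : Lp E p (volume : Measure ℝ)}
    (h : ∀ φ : ℝ → ℝ, ContDiff ℝ ∞ φ → HasCompactSupport φ → ∫ x, φ x • f x = ∫ x, φ x • g x) :
    f = g := by
  rw [← sub_eq_zero]
  refine Lp.ext (EventuallyEq.trans ?_ (Lp.coeFn_zero _ _ _).symm)
  refine ae_eq_zero_of_integral_contDiff_smul_eq_zero (locallyIntegrable_lp _) fun φ hφ hc => ?_
  obtain ⟨L, hL⟩ := exists_pair (E := E) (p := p) hφ.continuous hc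
  rw [← hL, map_sub, hL, hL, h φ hφ hc, sub_self]

theorem integral_smul_lpShift (φ : ℝ → ℝ) (f : Lp E p (volume : Measure ℝ)) (a : ℝ) :
    ∫ x, φ x • lpShift a f x = ∫ x, φ (x - a) • f x := by
  rw [← integral_add_right_eq_self (fun x => φ (x - a) • f x) a]
  refine integral_congr_ae ?_
  filter_upwards [coeFn_lpShift a f] with x hx
  rw [hx, add_sub_cancel_right]

/-- Test both sides against φ: the pairing with the translates of f has derivative the pairing with
the translates of g, by definition of the weak derivative. For finite p translations are strongly
continuous, so the integral exists in L^p and weak derivatives become derivatives in norm. -/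
theorem lpShift_sub_eq_integral (hp : p ≠ ⊤) {f g : Lp E p (volume : Measure ℝ)}
    (h : IsWeakDeriv f g) (a : ℝ) : lpShift a f - f = ∫ s in (0 : ℝ)..a, lpShift s g := by
  have hcont := continuous_lpShift hp g
  refine lp_eq_of_pair fun φ hφ hc => ?_
  obtain ⟨L, hL⟩ := exists_pair (E := E) (p := p) hφ.continuous hc
  rw [← hL, ← hL, ← L.intervalIntegral_comp_comm (hcont.intervalIntegrable _ _)]
  have hd (b : ℝ) : HasDerivAt (fun b => L (lpShift b f)) (L (lpShift b g)) b := by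
    have h1 := hasDerivAt_integral_smul hφ hc (locallyIntegrable_lp f) b
    have h2 : ContDiff ℝ ∞ fun x => φ (x - b) := hφ.comp (contDiff_id.sub contDiff_const)
    have h3 : HasCompactSupport fun x => φ (x - b) := by
      have h := hc.comp_homeomorph (Homeomorph.addRight (-b))
      simpa only [Function.comp_def, Homeomorph.coe_addRight, ← sub_eq_add_neg] using h
    have h4 := h _ h2 h3
    have h5 : deriv (fun x => φ (x - b)) = fun x => deriv φ (x - b) :=
      funext fun x => deriv_comp_sub_const φ b x
    rw [h5] at h4
    rw [hL, integral_smul_lpShift, ← neg_neg (∫ x, φ (x - b) • g x), ← h4]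
    refine h1.congr_of_eventuallyEq (Eventually.of_forall fun b => ?_)
    exact (hL _).trans (integral_smul_lpShift _ _ _)
  rw [intervalIntegral.integral_eq_sub_of_hasDerivAt (fun b _ => hd b)
    ((L.continuous.comp hcont).intervalIntegrable _ _), lpShift_zero, map_sub]

theorem hasDerivAt_lpShift (hp : p ≠ ⊤) {f g : Lp E p (volume : Measure ℝ)}
    (h : IsWeakDeriv f g) : HasDerivAt (fun a => lpShift a f) g 0 := by
  have hcont := continuous_lpShift hp g
  have h1 := (intervalIntegral.integral_hasDerivAt_right (hcont.intervalIntegrable 0 0)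
    (hcont.stronglyMeasurableAtFilter _ _) hcont.continuousAt).const_add f
  rw [lpShift_zero] at h1
  refine h1.congr_of_eventuallyEq (Eventually.of_forall fun a => ?_)
  change _ = f + ∫ s in (0 : ℝ)..a, lpShift s g
  rw [← lpShift_sub_eq_integral hp h, add_sub_cancel]

theorem isWeakDeriv_of_hasDerivAt {f g : Lp E p (volume : Measure ℝ)}
    (h : HasDerivAt (fun a => lpShift a f) g 0) : IsWeakDeriv f g := by
  intro φ hφ hc
  obtain ⟨L, hL⟩ := exists_pair (E := E) (p := p) hφ.continuous hc
  have h1 := L.hasFDerivAt.comp_hasDerivAt 0 h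
  have h2 := hasDerivAt_integral_smul hφ hc (locallyIntegrable_lp f) 0
  have h3 : (L ∘ fun a => lpShift a f) = fun a => ∫ x, φ (x - a) • f x :=
    funext fun a => (hL _).trans (integral_smul_lpShift _ _ _)
  rw [h3] at h1
  have h4 := h1.unique h2
  rw [hL] at h4
  simp only [sub_zero] at h4
  rw [h4, neg_neg]

theorem IsWeakDeriv.ae_eq {f f' g g' : ℝ → E} (h : IsWeakDeriv f g) (h' : IsWeakDeriv f' g')
    (hf : f =ᵐ[volume] f') (hg : LocallyIntegrable g) (hg' : LocallyIntegrable g') :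
    g =ᵐ[volume] g' := by
  have h0 : g - g' =ᵐ[volume] 0 := by
    refine ae_eq_zero_of_integral_contDiff_smul_eq_zero (hg.sub hg') fun φ hφ hc => ?_
    have hi {k : ℝ → E} (hk : LocallyIntegrable k) : Integrable fun x => φ x • k x :=
      hk.integrable_smul_left_of_hasCompactSupport hφ.continuous hc
    simp only [Pi.sub_apply, smul_sub]
    rw [integral_sub (hi hg) (hi hg'), sub_eq_zero, ← neg_inj, ← h φ hφ hc, ← h' φ hφ hc]
    exact integral_congr_ae (hf.mono fun x hx => by simp only [hx])
  exact h0.mono fun x hx => sub_eq_zero.1 hx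

theorem IsWeakDeriv.congr {f f' g g' : ℝ → E} (h : IsWeakDeriv f g)
    (hf : f =ᵐ[volume] f') (hg : g =ᵐ[volume] g') : IsWeakDeriv f' g' := by
  intro φ hφ hc
  rw [← integral_congr_ae (hf.mono fun x hx => congrArg (deriv φ x • ·) hx),
    ← integral_congr_ae (hg.mono fun x hx => congrArg (φ x • ·) hx)]
  exact h φ hφ hc

theorem isWeakDeriv_of_contDiff {f : ℝ → E} (hf : ContDiff ℝ ∞ f) : IsWeakDeriv f (deriv f) := by
  intro φ hφ hc
  have h1 : Continuous (deriv f) := hf.continuous_deriv (by simp)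
  have hφ' : Continuous (deriv φ) := hφ.continuous_deriv (by simp)
  have h2 := integral_bilinear_hasDerivAt_right_eq_neg_left_of_integrable (u := φ) (v := f)
    (u' := deriv φ) (v' := deriv f) (L := (ContinuousLinearMap.lsmul ℝ ℝ : ℝ →L[ℝ] E →L[ℝ] E))
    (fun x _ => (hφ.differentiable (by simp) x).hasDerivAt)
    (fun x _ => (hf.differentiable (by simp) x).hasDerivAt)
    ((hφ.continuous.smul h1).integrable_of_hasCompactSupport hc.smul_right)
    ((hφ'.smul hf.continuous).integrable_of_hasCompactSupport hc.deriv.smul_right)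
    ((hφ.continuous.smul hf.continuous).integrable_of_hasCompactSupport hc.smul_right)
  simp only [ContinuousLinearMap.lsmul_apply] at h2
  rw [h2, neg_neg]

theorem IsWeakDeriv.smul {χ : ℝ → ℝ} (hχ : ContDiff ℝ ∞ χ) {f g : ℝ → E}
    (hf : LocallyIntegrable f) (hg : LocallyIntegrable g) (h : IsWeakDeriv f g) :
    IsWeakDeriv (fun x => χ x • f x) (fun x => deriv χ x • f x + χ x • g x) := by
  intro φ hφ hc
  have h1 := h (fun x => φ x * χ x) (hφ.mul hχ) hc.mul_right
  have hχ' : Continuous (deriv χ) := hχ.continuous_deriv (by simp)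
  have hφ' : Continuous (deriv φ) := hφ.continuous_deriv (by simp)
  have hi {k : ℝ → E} (hk : LocallyIntegrable k) {θ : ℝ → ℝ} (hθ : Continuous θ)
      (hθc : HasCompactSupport θ) : Integrable fun x => θ x • k x :=
    hk.integrable_smul_left_of_hasCompactSupport hθ hθc
  have h2 : ∫ x, deriv (fun x => φ x * χ x) x • f x =
      (∫ x, deriv φ x • χ x • f x) + ∫ x, φ x • deriv χ x • f x := by
    rw [← integral_add]
    · refine integral_congr_ae (Eventually.of_forall fun x => ?_)
      change deriv (fun x => φ x * χ x) x • f x = _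
      rw [deriv_fun_mul (hφ.differentiable (by simp) x) (hχ.differentiable (by simp) x), add_smul,
        mul_smul, mul_smul]
    · simpa only [smul_smul, Pi.mul_apply] using hi hf (hφ'.mul hχ.continuous) hc.deriv.mul_right
    · simpa only [smul_smul, Pi.mul_apply] using hi hf (hφ.continuous.mul hχ') hc.mul_right
  have h3 : ∫ x, φ x • (deriv χ x • f x + χ x • g x) =
      (∫ x, φ x • deriv χ x • f x) + ∫ x, (φ x * χ x) • g x := by
    rw [← integral_add]
    · simp only [smul_add, mul_smul]
    · simpa only [smul_smul, Pi.mul_apply] using hi hf (hφ.continuous.mul hχ') hc.mul_right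
    · exact hi hg (hφ.continuous.mul hχ.continuous) hc.mul_right
  rw [h3, neg_add, ← h1, h2]
  abel

end Weak

/-! ### Weak derivatives in Y and Y_loc -/

section WeakY

variable {N : ℕ}

theorem isWeakDeriv_yFun (v : Y N) : IsWeakDeriv (yFun v) (yDer v) := by
  intro φ hφ hc
  rw [← integral_deriv_smul_yTop hφ hc]
  exact integral_congr_ae ((coeFn_yTop v).mono fun x hx => by simp only [hx])

/-- A compactly supported test function sees only one of the intervals |x| < n + 1. -/
theorem IsWeakDeriv.of_local {E : Type} [NormedAddCommGroup E] [NormedSpace ℝ E] {f g : ℝ → E}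
    (h : ∀ n : ℕ, ∃ f' g' : ℝ → E, IsWeakDeriv f' g' ∧ (∀ᵐ x : ℝ, |x| < (n : ℝ) + 1 → f' x = f x) ∧
      ∀ᵐ x : ℝ, |x| < (n : ℝ) + 1 → g' x = g x) : IsWeakDeriv f g := by
  intro φ hφ hc
  obtain ⟨ρ, hρ⟩ := hc.isCompact.isBounded.subset_closedBall 0
  obtain ⟨n, hn⟩ := exists_nat_gt ρ
  obtain ⟨f', g', h1, hf, hg⟩ := h n
  have key {θ : ℝ → ℝ} (hθ : tsupport θ ⊆ tsupport φ) {k k' : ℝ → E}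
      (hk : ∀ᵐ x : ℝ, |x| < (n : ℝ) + 1 → k' x = k x) : ∫ x, θ x • k x = ∫ x, θ x • k' x := by
    refine integral_congr_ae ?_
    filter_upwards [hk] with x hx
    by_cases h0 : θ x = 0
    · rw [h0, zero_smul, zero_smul]
    · have h2 := hρ (hθ (subset_tsupport θ h0))
      rw [mem_closedBall_zero_iff, Real.norm_eq_abs] at h2
      rw [hx (by linarith)]
  rw [key tsupport_deriv_subset hf, key subset_rfl hg]
  exact h1 φ hφ hc

theorem isWeakDeriv_locFun (v : YLoc N) : IsWeakDeriv (locFun v) (locDer v).rep := by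
  refine IsWeakDeriv.of_local fun n => ?_
  have hk : ∀ᵐ x : ℝ, |x| < (n : ℝ) + 1 → lpCutoff n (locDer v) x = (locDer v).rep x := by
    filter_upwards [coeFn_lpCutoff n (locDer v)] with x hx h
    rw [hx, cutoff_eq_one h.le, one_smul]
  refine ⟨_, _, isWeakDeriv_yFun (yOf (locFun v 0, lpCutoff n (locDer v))),
    Eventually.of_forall fun x hx => ?_, by rwa [yDer_yOf]⟩
  rw [yFun_yOf]
  have h3 : ∫ s in (0 : ℝ)..x, lpCutoff n (locDer v) s = ∫ s in (0 : ℝ)..x, (locDer v).rep s := by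
    refine intervalIntegral.integral_congr_ae ?_
    filter_upwards [hk] with y hy hy'
    exact hy (abs_lt.2 (ordConnected_Ioo.uIcc_subset (by constructor <;> linarith [abs_nonneg x])
      (abs_lt.1 hx) (uIoc_subset_uIcc hy')))
  rw [h3, ← locFun_sub, add_sub_cancel]

end WeakY

/-! ### Regularity of data -/

section Reg

variable {X Z : Type} [NormedAddCommGroup X] [NormedSpace ℝ X] [NormedAddCommGroup Z]
  [NormedSpace ℝ Z]

/-- `x` has `K` derivatives along the family `τ`. -/
def StrongReg (τ : ℝ → X →L[ℝ] X) : ℕ → X → Prop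
  | 0, _ => True
  | K + 1, x => ∃ y, HasDerivAt (fun a => τ a x) y 0 ∧ StrongReg τ K y

variable {τ : ℝ → X →L[ℝ] X} {σ : ℝ → Z →L[ℝ] Z}

theorem StrongReg.exists_seq {K : ℕ} {x : X} (h : StrongReg τ K x) :
    ∃ D : ℕ → X, D 0 = x ∧ ∀ j < K, HasDerivAt (fun a => τ a (D j)) (D (j + 1)) 0 := by
  induction K generalizing x with
  | zero => exact ⟨fun _ => x, rfl, fun j hj => absurd hj (Nat.not_lt_zero j)⟩
  | succ K ih =>
    obtain ⟨y, hy, hK⟩ := h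
    obtain ⟨D, h0, hD⟩ := ih hK
    refine ⟨fun j => Nat.casesOn j x D, rfl, fun j hj => ?_⟩
    cases j with
    | zero => change HasDerivAt _ (D 0) 0; rw [h0]; exact hy
    | succ j => exact hD j (Nat.lt_of_succ_lt_succ hj)

theorem StrongReg.add {K : ℕ} {x y : X} (hx : StrongReg τ K x) (hy : StrongReg τ K y) :
    StrongReg τ K (x + y) := by
  induction K generalizing x y with
  | zero => trivial
  | succ K ih =>
    obtain ⟨x', hx', h1⟩ := hx
    obtain ⟨y', hy', h2⟩ := hy
    refine ⟨x' + y', ?_, ih h1 h2⟩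
    simp only [map_add]
    exact hx'.add hy'

theorem StrongReg.map (L : X →L[ℝ] Z) (hL : ∀ a x, L (τ a x) = σ a (L x)) {K : ℕ} {x : X}
    (hx : StrongReg τ K x) : StrongReg σ K (L x) := by
  induction K generalizing x with
  | zero => trivial
  | succ K ih =>
    obtain ⟨x', hx', h1⟩ := hx
    refine ⟨L x', ?_, ih h1⟩
    simp only [← hL]
    exact L.hasFDerivAt.comp_hasDerivAt 0 hx'

theorem strongReg_of_fixed {x : X} (hx : ∀ a, τ a x = x) (K : ℕ) : StrongReg τ K x := by
  induction K generalizing x with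
  | zero => trivial
  | succ K ih =>
    refine ⟨0, ?_, ih fun a => map_zero _⟩
    simp only [hx]
    exact hasDerivAt_const _ _

variable {A E F : Type} [NormedAddCommGroup E] [NormedSpace ℝ E] [NormedAddCommGroup F]
  [NormedSpace ℝ F]

/-- `a` has `K` weak derivatives. -/
def WeakReg (rep : A → ℝ → E) : ℕ → A → Prop
  | 0, _ => True
  | K + 1, a => ∃ b, IsWeakDeriv (rep a) (rep b) ∧ WeakReg rep K b

variable {rep : A → ℝ → E}

theorem weakReg_of_seq {K : ℕ} (D : ℕ → A)
    (h : ∀ j < K, IsWeakDeriv (rep (D j)) (rep (D (j + 1)))) : WeakReg rep K (D 0) := by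
  induction K generalizing D with
  | zero => trivial
  | succ K ih =>
    exact ⟨D 1, h 0 (Nat.succ_pos K), ih (fun j => D (j + 1)) fun j hj =>
      h (j + 1) (Nat.succ_lt_succ hj)⟩

theorem WeakReg.of_succ {K : ℕ} {a : A} (h : WeakReg rep (K + 1) a) : WeakReg rep K a := by
  induction K generalizing a with
  | zero => trivial
  | succ K ih =>
    obtain ⟨b, hb, h1⟩ := h
    exact ⟨b, hb, ih h1⟩

end Reg

/-! ### From weak derivatives to derivatives along translations -/

section LpReg

variable {E F : Type} [NormedAddCommGroup E] [NormedSpace ℝ E] [CompleteSpace E]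
  [NormedAddCommGroup F] [NormedSpace ℝ F] [CompleteSpace F] {p : ℝ≥0∞} [Fact (1 ≤ p)]

theorem strongReg_lp (hp : p ≠ ⊤) {K : ℕ} {f : Lp E p (volume : Measure ℝ)}
    (h : WeakReg (fun f : Lp E p (volume : Measure ℝ) => (f : ℝ → E)) K f) :
    StrongReg lpShift K f := by
  induction K generalizing f with
  | zero => trivial
  | succ K ih =>
    obtain ⟨g, hg, h1⟩ := h
    exact ⟨g, hasDerivAt_lpShift hp hg, ih h1⟩

/-- By the product rule the derivative of χf is χ'f + χg. Both terms have the same form with one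
derivative fewer and the same support bound, so the induction must run over all cutoffs χ. -/
theorem strongReg_lpMul (hp : p ≠ ⊤) {K R : ℕ} {f : LpLoc E p} (h : WeakReg LpLoc.rep K f)
    {χ : ℝ → ℝ} (hχ : ContDiff ℝ ∞ χ) (hc : HasCompactSupport χ)
    (hR : tsupport χ ⊆ Icc (-(R : ℝ)) R) :
    StrongReg lpShift K (lpMul (bcfOf hχ.continuous hc) R f) := by
  induction K generalizing f χ with
  | zero => trivial
  | succ K ih =>
    have hm := h.of_succ
    obtain ⟨g, hg, h1⟩ := h
    have hχ' : ContDiff ℝ ∞ (deriv χ) := (contDiff_infty_iff_deriv.1 hχ).2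
    have hR' : tsupport (deriv χ) ⊆ Icc (-(R : ℝ)) R := tsupport_deriv_subset.trans hR
    refine ⟨lpMul (bcfOf hχ'.continuous hc.deriv) R f + lpMul (bcfOf hχ.continuous hc) R g, ?_,
      (ih hm hχ' hc.deriv hR').add (ih h1 hχ hc hR)⟩
    have e1 (k : LpLoc E p) := coeFn_lpMul (χ := bcfOf hχ.continuous hc) (R := R)
      (fun x hx => hR (subset_tsupport χ hx)) k
    have e2 (k : LpLoc E p) := coeFn_lpMul (χ := bcfOf hχ'.continuous hc.deriv) (R := R)
      (fun x hx => hR' (subset_tsupport _ hx)) k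
    refine hasDerivAt_lpShift hp ((IsWeakDeriv.smul hχ f.locallyIntegrable_rep
      g.locallyIntegrable_rep hg).congr (e1 f).symm ?_)
    filter_upwards [Lp.coeFn_add (lpMul (bcfOf hχ'.continuous hc.deriv) R f)
      (lpMul (bcfOf hχ.continuous hc) R g), e2 f, e1 g] with x h1 h2 h3
    rw [h1, Pi.add_apply, h2, h3]
    rfl

theorem strongReg_lpCutoff (hp : p ≠ ⊤) {K : ℕ} {f : LpLoc E p} (h : WeakReg LpLoc.rep K f)
    (n : ℕ) : StrongReg lpShift K (lpCutoff n f) := by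
  unfold lpCutoff
  refine strongReg_lpMul hp h (contDiff_cutoff n) (hasCompactSupport_cutoff n)
    (closure_minimal (fun x hx => ?_) isClosed_Icc)
  exact_mod_cast cutoff_support hx

theorem exists_lpLoc {f : ℝ → E} (hf : Continuous f) : ∃ g : LpLoc E p, g.rep =ᵐ[volume] f := by
  refine ⟨lpLocMk f hf.aestronglyMeasurable fun R => ?_, rep_lpLocMk _ _ _⟩
  obtain ⟨C, hC⟩ := isCompact_Icc.exists_bound_of_continuousOn hf.continuousOn
    (s := Icc (-(R : ℝ)) R)
  exact MemLp.of_bound hf.aestronglyMeasurable C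
    ((ae_restrict_iff' measurableSet_Icc).2 (Eventually.of_forall hC))

theorem weakReg_of_contDiff {f : ℝ → E} (hf : ContDiff ℝ ∞ f) {g : LpLoc E p}
    (hg : g.rep =ᵐ[volume] f) (K : ℕ) : WeakReg LpLoc.rep K g := by
  induction K generalizing f g with
  | zero => trivial
  | succ K ih =>
    have hf' : ContDiff ℝ ∞ (deriv f) := (contDiff_infty_iff_deriv.1 hf).2
    obtain ⟨g', hg'⟩ := exists_lpLoc (p := p) hf'.continuous
    exact ⟨g', (isWeakDeriv_of_contDiff hf).congr hg.symm hg'.symm, ih hf' hg'⟩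

theorem IsWeakDeriv.map (L : E →L[ℝ] F) {f g : ℝ → E} (hf : LocallyIntegrable f)
    (hg : LocallyIntegrable g) (h : IsWeakDeriv f g) :
    IsWeakDeriv (fun x => L (f x)) (fun x => L (g x)) := by
  intro φ hφ hc
  have key {θ : ℝ → ℝ} (hθ : Continuous θ) (hθc : HasCompactSupport θ) {k : ℝ → E}
      (hk : LocallyIntegrable k) : ∫ x, θ x • L (k x) = L (∫ x, θ x • k x) := by
    rw [← L.integral_comp_comm (hk.integrable_smul_left_of_hasCompactSupport hθ hθc)]
    simp only [map_smul]
  rw [key (hφ.continuous_deriv (by simp)) hc.deriv hf, key hφ.continuous hc hg, h φ hφ hc, map_neg]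

theorem locallyIntegrable_prodMk {f : ℝ → E} {g : ℝ → F} (hf : LocallyIntegrable f)
    (hg : LocallyIntegrable g) : LocallyIntegrable fun x => (f x, g x) := by
  refine locallyIntegrable_iff.2 fun k hk => ?_
  exact Integrable.prodMk (locallyIntegrable_iff.1 hf _ hk) (locallyIntegrable_iff.1 hg _ hk)

end LpReg

/-! ### Regularity of data by components -/

section StateReg

variable {N : ℕ}

/-- Projections of states. -/
def stateSpinor : State N →L[ℝ] Spinor := ContinuousLinearMap.fst ℝ Spinor (Pot N × Pot N)

/-- Projections of states. -/
def stateV : State N →L[ℝ] Pot N :=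
  (ContinuousLinearMap.fst ℝ (Pot N) (Pot N)).comp (ContinuousLinearMap.snd ℝ Spinor (Pot N × Pot N))

/-- Projections of states. -/
def stateW : State N →L[ℝ] Pot N :=
  (ContinuousLinearMap.snd ℝ (Pot N) (Pot N)).comp (ContinuousLinearMap.snd ℝ Spinor (Pot N × Pot N))

theorem locallyIntegrable_x0_rep (d : X0 N) : LocallyIntegrable (X0.rep d) :=
  locallyIntegrable_prodMk (locallyIntegrable_lp d.1) (locallyIntegrable_prodMk
    (yFun d.2.1).continuous.locallyIntegrable (locallyIntegrable_lp d.2.2))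

theorem locallyIntegrable_x0Loc_rep (d : X0Loc N) : LocallyIntegrable (X0Loc.rep d) :=
  locallyIntegrable_prodMk d.1.locallyIntegrable_rep (locallyIntegrable_prodMk
    (locFun d.2.1).continuous.locallyIntegrable d.2.2.locallyIntegrable_rep)

variable {d e : X0 N} {K : ℕ}

/-- The spinor and the velocity are read off by projection. For the potential, the weak derivative
of the jth one is both its Y-derivative and the next potential; by uniqueness these coincide, and
hence the Y-derivatives form a chain of weak derivatives too. -/
theorem weakReg_x0 {D : ℕ → X0 N}
    (h : ∀ j < K, IsWeakDeriv (X0.rep (D j)) (X0.rep (D (j + 1)))) :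
    WeakReg (fun f : Lp Spinor 2 (volume : Measure ℝ) => (f : ℝ → Spinor)) K (x0Spinor (D 0)) ∧
    WeakReg (fun f : Lp (Pot N) 1 (volume : Measure ℝ) => (f : ℝ → Pot N)) K (yDer (x0V (D 0))) ∧
    WeakReg (fun f : Lp (Pot N) 1 (volume : Measure ℝ) => (f : ℝ → Pot N)) K (x0W (D 0)) := by
  have hl (d : X0 N) := locallyIntegrable_x0_rep d
  have hr (d : X0 N) (x : ℝ) := x0_rep d x
  have hs (d : X0 N) : (fun x => stateSpinor (X0.rep d x)) = x0Spinor d :=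
    funext fun x => by rw [hr]; rfl
  have hw (d : X0 N) : (fun x => stateW (X0.rep d x)) = x0W d :=
    funext fun x => by rw [hr]; rfl
  have hv (d : X0 N) : (fun x => stateV (X0.rep d x)) = yFun (x0V d) :=
    funext fun x => by rw [hr]; rfl
  refine ⟨weakReg_of_seq (fun j => x0Spinor (D j)) fun j hj => ?_,
    weakReg_of_seq (fun j => yDer (x0V (D j))) fun j hj => ?_,
    weakReg_of_seq (fun j => x0W (D j)) fun j hj => ?_⟩
  · rw [← hs, ← hs]; exact (h j hj).map stateSpinor (hl _) (hl _)
  · have h1 : IsWeakDeriv (yFun (x0V (D j))) (yFun (x0V (D (j + 1)))) := by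
      rw [← hv, ← hv]; exact (h j hj).map stateV (hl _) (hl _)
    exact (isWeakDeriv_yFun _).congr (h1.ae_eq (isWeakDeriv_yFun (x0V (D j))) EventuallyEq.rfl
      (yFun _).continuous.locallyIntegrable (locallyIntegrable_lp _)) EventuallyEq.rfl
  · rw [← hw, ← hw]; exact (h j hj).map stateW (hl _) (hl _)

theorem weakReg_x0Loc {D : ℕ → X0Loc N}
    (h : ∀ j < K, IsWeakDeriv (X0Loc.rep (D j)) (X0Loc.rep (D (j + 1)))) :
    WeakReg LpLoc.rep K (locSpinor (D 0)) ∧ WeakReg LpLoc.rep K (locDer (locV (D 0))) ∧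
    WeakReg LpLoc.rep K (locW (D 0)) := by
  have hl (d : X0Loc N) := locallyIntegrable_x0Loc_rep d
  have hr (d : X0Loc N) (x : ℝ) := x0Loc_rep d x
  have hs (d : X0Loc N) : (fun x => stateSpinor (X0Loc.rep d x)) = (locSpinor d).rep :=
    funext fun x => by rw [hr]; rfl
  have hw (d : X0Loc N) : (fun x => stateW (X0Loc.rep d x)) = (locW d).rep :=
    funext fun x => by rw [hr]; rfl
  have hv (d : X0Loc N) : (fun x => stateV (X0Loc.rep d x)) = locFun (locV d) :=
    funext fun x => by rw [hr]; rfl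
  refine ⟨weakReg_of_seq (fun j => locSpinor (D j)) fun j hj => ?_,
    weakReg_of_seq (fun j => locDer (locV (D j))) fun j hj => ?_,
    weakReg_of_seq (fun j => locW (D j)) fun j hj => ?_⟩
  · rw [← hs, ← hs]; exact (h j hj).map stateSpinor (hl _) (hl _)
  · have h1 : IsWeakDeriv (locFun (locV (D j))) (locFun (locV (D (j + 1)))) := by
      rw [← hv, ← hv]; exact (h j hj).map stateV (hl _) (hl _)
    exact (isWeakDeriv_locFun _).congr (h1.ae_eq (isWeakDeriv_locFun (locV (D j))) EventuallyEq.rfl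
      (locFun _).continuous.locallyIntegrable (LpLoc.locallyIntegrable_rep _)) EventuallyEq.rfl
  · rw [← hw, ← hw]; exact (h j hj).map stateW (hl _) (hl _)

/-- Write v as a constant plus J applied to its derivative: constants are fixed by translations and
J commutes with them. -/
theorem strongReg_y {v : Y N} (h : StrongReg (lpShift (E := Pot N) (p := 1)) K (yDer v)) : StrongReg (yShift (N := N)) K v := by
  have h1 : StrongReg (yShift (N := N)) K (yJ (yDer v)) :=
    StrongReg.map (σ := yShift (N := N)) (yJ (N := N)) (fun a g => (yShift_yJ (N := N) a g).symm) h
  have h2 : StrongReg (yShift (N := N)) K (yConst (yFun v 0 - yFun (yJ (yDer v)) 0)) :=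
    strongReg_of_fixed (τ := yShift (N := N)) (fun a => yShift_yConst (N := N) a _) K
  have h3 := h2.add h1
  rwa [← Y.eq_const_add v 0] at h3

/-- The inclusions of the components. -/
def inSpinor : Lp Spinor 2 (volume : Measure ℝ) →L[ℝ] X0 N :=
  x0Prod (ContinuousLinearMap.id ℝ _) 0 0

/-- The inclusions of the components. -/
def inV : Y N →L[ℝ] X0 N := x0Prod 0 (ContinuousLinearMap.id ℝ _) 0

/-- The inclusions of the components. -/
def inW : Lp (Pot N) 1 (volume : Measure ℝ) →L[ℝ] X0 N :=
  x0Prod 0 0 (ContinuousLinearMap.id ℝ _)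

section

variable (f : Lp Spinor 2 (volume : Measure ℝ)) (v : Y N) (g : Lp (Pot N) 1 (volume : Measure ℝ))

@[simp] theorem x0Spinor_inSpinor : x0Spinor (inSpinor (N := N) f) = f := by
  rw [inSpinor, x0Spinor_x0Prod]; rfl
@[simp] theorem x0V_inSpinor : x0V (inSpinor (N := N) f) = 0 := by
  rw [inSpinor, x0V_x0Prod]; rfl
@[simp] theorem x0W_inSpinor : x0W (inSpinor (N := N) f) = 0 := by
  rw [inSpinor, x0W_x0Prod]; rfl
@[simp] theorem x0Spinor_inV : x0Spinor (inV v) = 0 := by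
  rw [inV, x0Spinor_x0Prod]; rfl
@[simp] theorem x0V_inV : x0V (inV v) = v := by
  rw [inV, x0V_x0Prod]; rfl
@[simp] theorem x0W_inV : x0W (inV v) = 0 := by
  rw [inV, x0W_x0Prod]; rfl
@[simp] theorem x0Spinor_inW : x0Spinor (inW g) = 0 := by
  rw [inW, x0Spinor_x0Prod]; rfl
@[simp] theorem x0V_inW : x0V (inW g) = 0 := by
  rw [inW, x0V_x0Prod]; rfl
@[simp] theorem x0W_inW : x0W (inW g) = g := by
  rw [inW, x0W_x0Prod]; rfl

end

attribute [irreducible] inSpinor inV inW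

theorem x0_eq_add (d : X0 N) : d = inSpinor (x0Spinor d) + (inV (x0V d) + inW (x0W d)) := by
  apply x0_ext
  · rw [(x0Spinor (N := N)).map_add, (x0Spinor (N := N)).map_add]; simp
  · rw [(x0V (N := N)).map_add, (x0V (N := N)).map_add]; simp
  · rw [(x0W (N := N)).map_add, (x0W (N := N)).map_add]; simp

theorem strongReg_x0 (h1 : StrongReg (lpShift (E := Spinor) (p := 2)) K (x0Spinor d))
    (h2 : StrongReg (lpShift (E := Pot N) (p := 1)) K (yDer (x0V d))) (h3 : StrongReg (lpShift (E := Pot N) (p := 1)) K (x0W d)) :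
    StrongReg (x0Shift (N := N)) K d := by
  have e1 : StrongReg (x0Shift (N := N)) K (inSpinor (x0Spinor d)) :=
    StrongReg.map (X := Lp Spinor 2 (volume : Measure ℝ)) (Z := X0 N) (τ := lpShift (E := Spinor) (p := 2)) (σ := x0Shift (N := N))
      (inSpinor (N := N)) (fun a x => by apply x0_ext <;> simp) h1
  have e2 : StrongReg (x0Shift (N := N)) K (inV (x0V d)) :=
    StrongReg.map (X := Y N) (Z := X0 N) (τ := yShift (N := N)) (σ := x0Shift (N := N))
      (inV (N := N)) (fun a x => by apply x0_ext <;> simp) (strongReg_y h2)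
  have e3 : StrongReg (x0Shift (N := N)) K (inW (x0W d)) :=
    StrongReg.map (X := Lp (Pot N) 1 (volume : Measure ℝ)) (Z := X0 N) (τ := lpShift (E := Pot N) (p := 1)) (σ := x0Shift (N := N))
      (inW (N := N)) (fun a x => by apply x0_ext <;> simp) h3
  have e4 := e1.add (e2.add e3)
  rwa [← x0_eq_add d] at e4

end StateReg

/-! ### Iterated partial derivatives -/

section Partial

variable {X Z : Type} [NormedAddCommGroup X] [NormedSpace ℝ X] [NormedAddCommGroup Z]
  [NormedSpace ℝ Z]

/-- The derivative in the direction `e`. -/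
def pd (e : ℝ × ℝ) (F : ℝ × ℝ → X) (p : ℝ × ℝ) : X := fderiv ℝ F p e

/-- `∂ₜ^j ∂ₓ^k F`. -/
def mixed (F : ℝ × ℝ → X) (j k : ℕ) : ℝ × ℝ → X := (pd (1, 0))^[j] ((pd (0, 1))^[k] F)

theorem mixed_zero (F : ℝ × ℝ → X) : mixed F 0 0 = F := rfl

theorem mixed_succ (F : ℝ × ℝ → X) (j k : ℕ) : mixed F (j + 1) k = pd (1, 0) (mixed F j k) :=
  Function.iterate_succ_apply' _ _ _

theorem mixed_zero_succ (F : ℝ × ℝ → X) (k : ℕ) : mixed F 0 (k + 1) = pd (0, 1) (mixed F 0 k) :=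
  Function.iterate_succ_apply' _ _ _

variable {Ω : Set (ℝ × ℝ)} {F F' : ℝ × ℝ → X}

theorem contDiffOn_pd (hΩ : IsOpen Ω) {n : ℕ∞} (h : ContDiffOn ℝ (n + 1) F Ω) (e : ℝ × ℝ) :
    ContDiffOn ℝ n (pd e F) Ω :=
  (h.fderiv_of_isOpen hΩ le_rfl).clm_apply contDiffOn_const

theorem contDiffOn_iterate_pd (hΩ : IsOpen Ω) {n : ℕ} (j : ℕ) {F : ℝ × ℝ → X}
    (h : ContDiffOn ℝ (n + j : ℕ) F Ω) (e : ℝ × ℝ) : ContDiffOn ℝ n ((pd e)^[j] F) Ω := by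
  induction j generalizing F with
  | zero => exact h
  | succ j ih =>
    rw [Function.iterate_succ_apply]
    refine ih ?_
    have h1 : ContDiffOn ℝ (((n + j : ℕ) : ℕ∞) + 1) F Ω := by exact_mod_cast h
    exact_mod_cast contDiffOn_pd hΩ h1 e

theorem contDiffOn_mixed (hΩ : IsOpen Ω) {n j k K : ℕ} (hK : n + j + k ≤ K)
    (h : ContDiffOn ℝ K F Ω) : ContDiffOn ℝ n (mixed F j k) Ω :=
  contDiffOn_iterate_pd hΩ j (contDiffOn_iterate_pd hΩ k (h.of_le (by exact_mod_cast hK)) _) _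

/-- A property of families of functions, stable under derivatives, passes to the mixed
derivatives. -/
theorem mixed_induction {ι : Type} (hΩ : IsOpen Ω) {P : (ι → ℝ × ℝ → X) → Prop} {K : ℕ}
    (hP : ∀ F e, (∀ i, ∀ p ∈ Ω, DifferentiableAt ℝ (F i) p) → P F → P fun i => pd e (F i))
    {F : ι → ℝ × ℝ → X} (h : ∀ i, ContDiffOn ℝ K (F i) Ω) (h0 : P F) {j k : ℕ} (hjk : j + k ≤ K) :
    P fun i => mixed (F i) j k := by
  have hd (j k : ℕ) (hjk : j + k < K) (i : ι) : ∀ p ∈ Ω, DifferentiableAt ℝ (mixed (F i) j k) p :=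
    fun p hp => ((contDiffOn_mixed hΩ (n := 1) (by omega) (h i)).contDiffAt
      (hΩ.mem_nhds hp)).differentiableAt (by simp)
  induction j with
  | zero =>
    induction k with
    | zero => exact h0
    | succ k ih =>
      simp only [mixed_zero_succ]
      exact hP _ _ (hd 0 k (by omega)) (ih (by omega))
  | succ j ih =>
    simp only [mixed_succ]
    exact hP _ _ (hd j k (by omega)) (ih (by omega))

theorem map_pd_eq (R : X →L[ℝ] Z) {p : ℝ × ℝ} (h : DifferentiableAt ℝ F p)
    (h' : DifferentiableAt ℝ F' p) (hR : ∀ᶠ q in 𝓝 p, R (F q) = R (F' q)) (e : ℝ × ℝ) :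
    R (pd e F p) = R (pd e F' p) := by
  have h1 := R.hasFDerivAt.comp p h.hasFDerivAt
  have h2 := R.hasFDerivAt.comp p h'.hasFDerivAt
  exact congrArg (fun L : ℝ × ℝ →L[ℝ] Z => L e) (h1.unique (h2.congr_of_eventuallyEq hR))

theorem pd_add_eq (R : X →L[ℝ] X) {p : ℝ × ℝ} (a : ℝ × ℝ) (h : DifferentiableAt ℝ F p)
    (hR : ∀ᶠ q in 𝓝 p, F (q + a) = R (F q)) (e : ℝ × ℝ) : pd e F (p + a) = R (pd e F p) := by
  have h1 := R.hasFDerivAt.comp p h.hasFDerivAt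
  have h2 : fderiv ℝ (fun q => F (q + a)) p = R ∘L fderiv ℝ F p :=
    (h1.congr_of_eventuallyEq hR).fderiv
  rw [fderiv_comp_add_right] at h2
  exact congrArg (fun L : ℝ × ℝ →L[ℝ] X => L e) h2

theorem hasDerivAt_left {p : ℝ × ℝ} (h : DifferentiableAt ℝ F p) :
    HasDerivAt (fun s => F (s, p.2)) (pd (1, 0) F p) p.1 :=
  h.hasFDerivAt.comp_hasDerivAt p.1 ((hasDerivAt_id p.1).prodMk (hasDerivAt_const p.1 p.2))

theorem hasDerivAt_right {p : ℝ × ℝ} (h : DifferentiableAt ℝ F p) :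
    HasDerivAt (fun s => F (p.1, s)) (pd (0, 1) F p) p.2 :=
  h.hasFDerivAt.comp_hasDerivAt p.2 ((hasDerivAt_const p.2 p.1).prodMk (hasDerivAt_id p.2))

end Partial

/-! ### Weak and strong derivatives of curves -/

section Curves

variable {N : ℕ} {T : ℝ}

/-- Equality of integrals of `α w` and `-β w'` over space and time. -/
def PairEq (α β : ℝ → ℝ → ℝ) (w w' : Icc (-T) T → ℝ → State N) : Prop :=
  ∫ t, (∫ x : ℝ, α t x • w t x) ∂timeMeasure T = -∫ t, (∫ x : ℝ, β t x • w' t x) ∂timeMeasure T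

theorem PairEq.congr {α β : ℝ → ℝ → ℝ} {w w' z z' : Icc (-T) T → ℝ → State N}
    (h : PairEq α β w w') (hw : ∀ t : Icc (-T) T, ∀ᵐ x : ℝ, α t x ≠ 0 → w t x = z t x)
    (hw' : ∀ t : Icc (-T) T, ∀ᵐ x : ℝ, β t x ≠ 0 → w' t x = z' t x) : PairEq α β z z' := by
  have key {α : ℝ → ℝ → ℝ} {w z : Icc (-T) T → ℝ → State N}
      (hw : ∀ t : Icc (-T) T, ∀ᵐ x : ℝ, α t x ≠ 0 → w t x = z t x) (t : Icc (-T) T) :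
      ∫ x : ℝ, α t x • w t x = ∫ x : ℝ, α t x • z t x := by
    refine integral_congr_ae ?_
    filter_upwards [hw t] with x hx
    by_cases h0 : α t x = 0
    · rw [h0, zero_smul, zero_smul]
    · rw [hx h0]
  have h1 : ∫ t, (∫ x : ℝ, α t x • w t x) ∂timeMeasure T =
      -∫ t, (∫ x : ℝ, β t x • w' t x) ∂timeMeasure T := h
  simp only [key hw, key hw'] at h1
  exact h1

/-- Spatial derivatives of time derivatives. -/
theorem IsWeakDx.of_isWeakDt {X : Type} [TopologicalSpace X] {rep : X → ℝ → State N}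
    {u u' v v' : C(Icc (-T) T, X)} (h : IsWeakDt rep u u') (h' : IsWeakDx rep u v)
    (h'' : IsWeakDt rep v v') : IsWeakDx rep u' v' := by
  intro φ hφ
  have e1 := h _ hφ.dx
  have e2 := h' _ hφ.dt
  have e3 := h'' _ hφ
  simp only [hφ.isBump.dt_dx_comm] at e1
  rw [← neg_inj, ← e1, e2, e3]

variable [hT : Fact (0 < T)] {φ : ℝ → ℝ → ℝ}

theorem intervalIntegral_triple {E F G : Type} [NormedAddCommGroup E] [NormedSpace ℝ E]
    [CompleteSpace E] [NormedAddCommGroup F] [NormedSpace ℝ F] [CompleteSpace F]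
    [NormedAddCommGroup G] [NormedSpace ℝ G] [CompleteSpace G] {a : ℝ → E} {b : ℝ → F} {c : ℝ → G}
    {s t : ℝ} (hst : s ≤ t) (ha : IntervalIntegrable a volume s t)
    (hb : IntervalIntegrable b volume s t) (hc : IntervalIntegrable c volume s t) :
    ∫ x in s..t, (a x, b x, c x) = (∫ x in s..t, a x, ∫ x in s..t, b x, ∫ x in s..t, c x) := by
  rw [intervalIntegrable_iff_integrableOn_Ioc_of_le hst] at ha hb hc
  simp only [intervalIntegral.integral_of_le hst]
  rw [integral_pair ha (hb.prodMk hc), integral_pair hb hc]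

theorem integral_smul_x0_rep {χ : ℝ → ℝ} (hχ : Continuous χ) (hc : HasCompactSupport χ) (d : X0 N) :
    ∫ x : ℝ, χ x • X0.rep d x = (∫ x, χ x • x0Spinor d x, ∫ x, χ x • yTop (x0V d) x,
      ∫ x, χ x • x0W d x) := by
  have hs := integrable_smul_lp (x0Spinor d) hχ hc
  have hv := integrable_smul_lp (yTop (x0V d)) hχ hc
  have hw := integrable_smul_lp (x0W d) hχ hc
  have e2 := integral_pair hs (hv.prodMk hw)
  rw [integral_pair hv hw] at e2
  refine Eq.trans (integral_congr_ae ?_) e2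
  filter_upwards [coeFn_yTop (x0V d)] with x hx
  rw [hx, x0_rep]
  rfl

theorem integral_pair_x0 (h : IsBump φ) (u : C(Icc (-T) T, X0 N)) :
    ∫ t, (∫ x : ℝ, φ t x • X0.rep (u t) x) ∂timeMeasure T =
      (dbl T φ (fun t => x0Spinor (u (clamp T t))), dbl T φ (fun t => yTop (x0V (u (clamp T t)))),
        dbl T φ (fun t => x0W (u (clamp T t)))) := by
  have hT' : -T ≤ T := by have := hT.out; linarith
  refine Eq.trans ?_ (intervalIntegral_triple hT'
    (h.intervalIntegrable (continuous_x0Spinor_extend u) (-T) T)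
    (h.intervalIntegrable (continuous_yTop_extend u) (-T) T)
    (h.intervalIntegrable (continuous_x0W_extend u) (-T) T))
  rw [integral_timeMeasure]
  refine intervalIntegral.integral_congr fun t ht => ?_
  rw [uIcc_of_le hT'] at ht
  have ht' : ((clamp T t : Icc (-T) T) : ℝ) = t := by rw [clamp_of_mem ht]
  simp only [ht']
  exact integral_smul_x0_rep (h.continuous_right t) (h.hasCompactSupport_right t) _

theorem isWeakDt_of_hasDerivAt {u v : C(Icc (-T) T, X0 N)}
    (h : ∀ t ∈ Ioo (-T) T, HasDerivAt (fun s => u (clamp T s)) (v (clamp T t)) t) :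
    IsWeakDt X0.rep u v := by
  intro φ hφ
  rw [integral_pair_x0 hφ.isBump.dt, integral_pair_x0 hφ.isBump]
  have key {E : Type} [NormedAddCommGroup E] [NormedSpace ℝ E] [CompleteSpace E] {p : ℝ≥0∞}
      [Fact (1 ≤ p)] (R : X0 N →L[ℝ] Lp E p (volume : Measure ℝ)) :
      dbl T (dt φ) (fun t => R (u (clamp T t))) = -dbl T φ (fun t => R (v (clamp T t))) :=
    dbl_dt hT.out hφ (R.continuous.comp (continuous_extend u))
      (R.continuous.comp (continuous_extend v)) fun t ht =>
        R.hasFDerivAt.comp_hasDerivAt t (h t ht)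
  exact Prod.ext (key x0Spinor) (Prod.ext (key ((yTop (N := N)).comp x0V)) (key x0W))

theorem isWeakDx_of_hasDerivAt {u v : C(Icc (-T) T, X0 N)}
    (h : ∀ t, HasDerivAt (fun a => x0Shift a (u t)) (v t) 0) : IsWeakDx X0.rep u v := by
  intro φ hφ
  rw [integral_pair_x0 hφ.isBump.dx, integral_pair_x0 hφ.isBump]
  have key {E : Type} [NormedAddCommGroup E] [NormedSpace ℝ E] [CompleteSpace E] {p : ℝ≥0∞}
      [Fact (1 ≤ p)] (R : X0 N →L[ℝ] Lp E p (volume : Measure ℝ))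
      (hR : ∀ a d, R (x0Shift a d) = lpShift a (R d)) :
      dbl T (dx φ) (fun t => R (u (clamp T t))) = -dbl T φ (fun t => R (v (clamp T t))) := by
    rw [dbl, dbl, ← intervalIntegral.integral_neg]
    refine intervalIntegral.integral_congr fun t _ => ?_
    have h1 := R.hasFDerivAt.comp_hasDerivAt 0 (h (clamp T t))
    have h2 : (R ∘ fun a => x0Shift a (u (clamp T t))) = fun a => lpShift a (R (u (clamp T t))) :=
      funext fun a => hR a _
    rw [h2] at h1
    exact isWeakDeriv_of_hasDerivAt h1 (φ t) (hφ.isBump.contDiff_right t)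
      (hφ.isBump.hasCompactSupport_right t)
  exact Prod.ext (key x0Spinor fun a d => x0Spinor_x0Shift a d)
    (Prod.ext (key ((yTop (N := N)).comp x0V) fun a d => by
      rw [ContinuousLinearMap.comp_apply, x0V_x0Shift, yTop_yShift]; rfl)
      (key x0W fun a d => x0W_x0Shift a d))

end Curves

/-! ### Restriction to a shorter time interval -/

section Restrict

variable {N : ℕ} {T T' : ℝ} {X : Type} [TopologicalSpace X]

/-- Restriction of curves. -/
def restrictCurve (h : T ≤ T') (u : C(Icc (-T') T', X)) : C(Icc (-T) T, X) :=
  u.comp ⟨fun t => ⟨t, (neg_le_neg h).trans t.2.1, t.2.2.trans h⟩, by fun_prop⟩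

theorem restrictCurve_apply (h : T ≤ T') (u : C(Icc (-T') T', X)) (t : Icc (-T) T) :
    restrictCurve h u t = u ⟨t, (neg_le_neg h).trans t.2.1, t.2.2.trans h⟩ := rfl

theorem restrictCurve_eq_clamp [Fact (0 < T')] (h : T ≤ T') (u : C(Icc (-T') T', X))
    (t : Icc (-T) T) : restrictCurve h u t = u (clamp T' t) := by
  rw [restrictCurve_apply, clamp_of_mem ⟨(neg_le_neg h).trans t.2.1, t.2.2.trans h⟩]

theorem IsTest.mono (h : T ≤ T') {φ : ℝ → ℝ → ℝ} (hφ : IsTest T φ) : IsTest T' φ :=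
  ⟨hφ.1, hφ.2.1, hφ.2.2.trans (prod_mono (Ioo_subset_Ioo (neg_le_neg h) h) subset_rfl)⟩

theorem integral_timeMeasure_restrict [hT : Fact (0 < T)] [hT' : Fact (0 < T')] (h : T ≤ T')
    {G : Type} [NormedAddCommGroup G] [NormedSpace ℝ G] {g : Icc (-T') T' → G}
    (hg : ∀ t : Icc (-T') T', (t : ℝ) ∉ Ioo (-T) T → g t = 0) :
    ∫ t, g t ∂timeMeasure T' =
      ∫ t : Icc (-T) T, g ⟨t, (neg_le_neg h).trans t.2.1, t.2.2.trans h⟩ ∂timeMeasure T := by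
  have h1 := hT.out
  have h2 := hT'.out
  rw [integral_timeMeasure, integral_timeMeasure, intervalIntegral.integral_of_le (by linarith),
    intervalIntegral.integral_of_le (by linarith)]
  refine (setIntegral_eq_of_subset_of_forall_sdiff_eq_zero (μ := volume)
    (f := fun t => g (clamp T' t)) measurableSet_Ioc
    (Ioc_subset_Ioc (neg_le_neg h) h) fun t ht => ?_).trans
    (setIntegral_congr_fun measurableSet_Ioc fun t ht => ?_)
  · rw [clamp_of_mem (Ioc_subset_Icc_self ht.1)]
    exact hg _ fun h5 => ht.2 ⟨h5.1, h5.2.le⟩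
  · have h3 : t ∈ Icc (-T) T := Ioc_subset_Icc_self ht
    have h4 : t ∈ Icc (-T') T' := Icc_subset_Icc (neg_le_neg h) h h3
    simp only [clamp_of_mem h3, clamp_of_mem h4]

/-- With uniqueness this identifies the solution on [-T, T] as part of one on a longer interval, so
statements proved for open time intervals reach the end points ±T. -/
theorem IsSolution.restrict [hT : Fact (0 < T)] [hT' : Fact (0 < T')] (h : T ≤ T')
    {rep : X → ℝ → State N} {M m : ℝ} {B C : Fin N → Matrix (Fin 2) (Fin 2) ℂ} {d : X}
    {u : C(Icc (-T') T', X)} (hu : IsSolution rep M m B C d u) :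
    IsSolution rep M m B C d (restrictCurve h u) := by
  have h0 {χ : ℝ → ℝ → ℝ} (hχ : IsTest T χ) {t : ℝ} (ht : t ∉ Ioo (-T) T) (x : ℝ) : χ t x = 0 :=
    hχ.eq_zero_of_notMem ht x
  have key {G : Type} [NormedAddCommGroup G] [NormedSpace ℝ G] {g : Icc (-T') T' → G}
      (hg : ∀ t : Icc (-T') T', (t : ℝ) ∉ Ioo (-T) T → g t = 0) :=
    integral_timeMeasure_restrict h hg
  refine ⟨fun t ht => hu.init _ ht, fun φ hφ => ?_, fun φ hφ j => ?_, fun φ hφ => ?_⟩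
  · have h1 := hu.dirac φ (hφ.mono h)
    rw [key fun t ht => ?_, key fun t ht => ?_] at h1
    · exact h1
    · simp [h0 hφ ht]
    · simp [h0 hφ ht, h0 hφ.dt ht, h0 hφ.dx ht]
  · have h1 := hu.kleinGordon φ (hφ.mono h) j
    rw [key fun t ht => ?_, key fun t ht => ?_] at h1
    · exact h1
    · simp [h0 hφ ht]
    · simp [h0 hφ ht, h0 hφ.dt.dt ht, h0 hφ.dx.dx ht]
  · have h1 := hu.velocity φ (hφ.mono h)
    rw [key fun t ht => ?_, key fun t ht => ?_] at h1
    · exact h1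
    · simp [h0 hφ ht]
    · simp [h0 hφ.dt ht]

end Restrict

/-! ### Orbits of solutions under translations -/

section Orbit

variable {N : ℕ} {T : ℝ} [hT : Fact (0 < T)] {m M : ℝ}
  {B C : Fin N → Matrix (Fin 2) (Fin 2) ℂ} {hB : ∀ j, (B j).IsHermitian}

theorem x0Shift_add (s t : ℝ) (d : X0 N) : x0Shift (s + t) d = x0Shift s (x0Shift t d) := by
  apply x0_ext
  · rw [x0Spinor_x0Shift, x0Spinor_x0Shift, x0Spinor_x0Shift, lpShift_add]
  · rw [x0V_x0Shift, x0V_x0Shift, x0V_x0Shift, yShift_add]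
  · rw [x0W_x0Shift, x0W_x0Shift, x0W_x0Shift, lpShift_add]

theorem x0Shift_zero (d : X0 N) : x0Shift 0 d = d := by
  apply x0_ext
  · rw [x0Spinor_x0Shift, lpShift_zero]
  · rw [x0V_x0Shift, yShift_zero]
  · rw [x0W_x0Shift, lpShift_zero]

theorem rep_x0Shift (h : ℝ) (d : X0 N) :
    X0.rep (x0Shift h d) =ᵐ[volume] fun x => X0.rep d (x + h) := by
  filter_upwards [coeFn_lpShift h (x0Spinor d), coeFn_lpShift h (x0W d)] with x h1 h2
  rw [x0_rep, x0_rep, x0Spinor_x0Shift, x0V_x0Shift, x0W_x0Shift, h1, h2, yFun_yShift]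

theorem Agree.shift {r : ℝ} {d e : X0 N} (hr : Agree r d e) (h : ℝ) :
    Agree (r - |h|) (x0Shift h d) (x0Shift h e) := by
  filter_upwards [rep_x0Shift h d, rep_x0Shift h e, ae_shift hr h] with x h1 h2 h3 hx
  rw [h1, h2, h3]
  linarith [abs_add_le x h]

variable (T) in
/-- The region covered by the solutions. -/
def strip : Set (ℝ × ℝ) := Ioo (-T) T ×ˢ univ

theorem isOpen_strip : IsOpen (strip T) := isOpen_Ioo.prod isOpen_univ

variable (T M C hB) in
/-- The translates of a solution. -/
def orbitX (μ : Lp ℝ 1 (volume : Measure ℝ)) (d : X0 N) (p : ℝ × ℝ) : X0 N :=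
  x0Shift p.2 (x0Sol T M C hB μ d (clamp T p.1))

theorem contDiffOn_orbitX {K : ℕ} {μ : Lp ℝ 1 (volume : Measure ℝ)} {d : X0 N}
    (hd : StrongReg (x0Shift (N := N)) K d) (hμ : StrongReg (lpShift (E := ℝ) (p := 1)) K μ) :
    ContDiffOn ℝ K (orbitX T M C hB μ d) (strip T) := by
  have h1 : StrongReg (liftShift (N := N)) K (embX d + massX μ) :=
    (StrongReg.map (X := X0 N) (Z := Lift N) (τ := x0Shift (N := N)) (σ := liftShift (N := N))
      (embX (N := N)) (fun a x => embX_x0Shift a x) hd).add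
    (StrongReg.map (X := Lp ℝ 1 (volume : Measure ℝ)) (Z := Lift N) (τ := lpShift (E := ℝ) (p := 1))
      (σ := liftShift (N := N)) (massX (N := N)) (fun a x => massX_lpShift a x) hμ)
  obtain ⟨D, h0, hD⟩ := h1.exists_seq
  have h2 := (solvable_dkg (T := T) (C := C) M hB).contDiffOn_orbit K D hD
  have h3 := (projX (N := N)).contDiff.comp_contDiffOn (n := K) h2
  refine h3.congr fun p _ => ?_
  rw [h0]
  exact (projX_liftShift _ _).symm

theorem orbitX_add (μ : Lp ℝ 1 (volume : Measure ℝ)) (d : X0 N) (p : ℝ × ℝ) (a : ℝ) :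
    orbitX T M C hB μ d (p + (0, a)) = x0Shift a (orbitX T M C hB μ d p) := by
  rw [orbitX, orbitX, Prod.fst_add, Prod.snd_add, add_zero, add_comm, x0Shift_add]

theorem agree_of_forall_lt {r : ℝ} {d e : X0 N} (h : ∀ ρ < r, Agree ρ d e) : Agree r d e := by
  have h1 : ∀ᵐ x : ℝ, ∀ n : ℕ, |x| < r - 1 / (n + 1) → X0.rep d x = X0.rep e x :=
    ae_all_iff.2 fun n => h _ (sub_lt_self _ Nat.one_div_pos_of_nat)
  filter_upwards [h1] with x hx hr
  obtain ⟨n, hn⟩ := exists_nat_one_div_lt (sub_pos.2 hr)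
  exact hx n (by linarith)

theorem agree_pd {ρ : ℝ} {F F' : ℝ × ℝ → X0 N} {p : ℝ × ℝ} (h : DifferentiableAt ℝ F p)
    (h' : DifferentiableAt ℝ F' p) (hA : ∀ᶠ q in 𝓝 p, Agree ρ (F q) (F' q)) (e : ℝ × ℝ) :
    Agree ρ (pd e F p) (pd e F' p) := by
  have key {Z : Type} [NormedAddCommGroup Z] [NormedSpace ℝ Z] (R : X0 N →L[ℝ] Z)
      (hR : ∀ᶠ q in 𝓝 p, R (F q) = R (F' q)) : R (pd e F p) = R (pd e F' p) :=
    map_pd_eq R h h' hR e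
  exact agree_iff.2 ⟨key ((lpBox ρ).comp x0Spinor) (hA.mono fun q hq => (agree_iff.1 hq).1),
    key ((lpBox ρ).comp ((yTop (N := N)).comp x0V)) (hA.mono fun q hq => (agree_iff.1 hq).2.1),
    key ((lpBox ρ).comp x0W) (hA.mono fun q hq => (agree_iff.1 hq).2.2)⟩

/-- Derivatives inherit agreement on a fixed interval, but here the radius varies with the point.
For each smaller ρ agreement holds in a neighbourhood and can be differentiated; then ρ increases to
the full radius. -/
theorem agree_mixed {K : ℕ} {Q : ℕ → ℝ × ℝ → X0 N} (hQ : ∀ n, ContDiffOn ℝ K (Q n) (strip T))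
    (hA : ∀ n : ℕ, ∀ p ∈ strip T, Agree (n + 1 - |p.2|) (Q n p) (Q (n + 1) p)) {j k : ℕ}
    (hjk : j + k ≤ K) (n : ℕ) {p : ℝ × ℝ} (hp : p ∈ strip T) :
    Agree (n + 1 - |p.2|) (mixed (Q n) j k p) (mixed (Q (n + 1)) j k p) := by
  refine mixed_induction (X := X0 N) isOpen_strip (P := fun G : ℕ → ℝ × ℝ → X0 N => ∀ n : ℕ, ∀ p ∈ strip T,
    Agree (n + 1 - |p.2|) (G n p) (G (n + 1) p)) (fun F e hd hF n p hp => ?_) hQ hA hjk n p hp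
  refine agree_of_forall_lt fun ρ hρ => agree_pd (hd _ p hp) (hd _ p hp) ?_ e
  have h1 : ∀ᶠ q : ℝ × ℝ in 𝓝 p, ρ < n + 1 - |q.2| :=
    (continuous_const.sub continuous_snd.abs).continuousAt.eventually_const_lt hρ
  filter_upwards [h1, isOpen_strip.mem_nhds hp] with q hq hq'
  exact (hF n q hq').mono hq.le

theorem mixed_add {K : ℕ} {Q : ℝ × ℝ → X0 N} (hQ : ContDiffOn ℝ K Q (strip T))
    (hE : ∀ p ∈ strip T, ∀ a, Q (p + (0, a)) = x0Shift a (Q p)) {j k : ℕ} (hjk : j + k ≤ K)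
    {p : ℝ × ℝ} (hp : p ∈ strip T) (a : ℝ) :
    mixed Q j k (p + (0, a)) = x0Shift a (mixed Q j k p) := by
  refine mixed_induction (X := X0 N) (ι := Unit) isOpen_strip (P := fun G : Unit → ℝ × ℝ → X0 N =>
    ∀ p ∈ strip T, ∀ a, G () (p + (0, a)) = x0Shift (N := N) a (G () p)) (fun F e hd hF p hp a => ?_) (fun _ => hQ) hE hjk p hp a
  refine pd_add_eq (x0Shift (N := N) a) (0, a) (hd () p hp) ?_ e
  filter_upwards [isOpen_strip.mem_nhds hp] with q hq using hF q hq a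

end Orbit

/-! ### Weak derivatives of curves obtained from orbits on a longer time interval -/

section CurveAt

variable {N : ℕ} {T T' : ℝ}

open Classical in
variable (T) in
/-- The restriction of `F` to the time axis. -/
def curveAt (F : ℝ × ℝ → X0 N) : C(Icc (-T) T, X0 N) :=
  -- The default only fills in derivatives of order above K, about which `CurveHasRegularity`
  -- asserts nothing.
  if h : Continuous fun t : Icc (-T) T => F (t, 0) then ⟨_, h⟩ else 0

theorem mem_strip (h : T < T') (t : Icc (-T) T) (x : ℝ) : ((t : ℝ), x) ∈ strip T' :=
  ⟨⟨(neg_lt_neg h).trans_le t.2.1, t.2.2.trans_lt h⟩, mem_univ _⟩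

theorem curveAt_apply (h : T < T') {F : ℝ × ℝ → X0 N} (hF : ContinuousOn F (strip T'))
    (t : Icc (-T) T) : curveAt T F t = F (t, 0) := by
  have h1 : Continuous fun t : Icc (-T) T => F (t, 0) :=
    hF.comp_continuous (by fun_prop) fun t => mem_strip h t 0
  rw [curveAt, dif_pos h1]
  rfl

variable [hT : Fact (0 < T)] [hT' : Fact (0 < T')] {K : ℕ} {Q : ℝ × ℝ → X0 N}

theorem isWeakDt_curveAt (h : T < T') (hQ : ContDiffOn ℝ K Q (strip T')) {j k : ℕ}
    (hjk : j + k < K) :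
    IsWeakDt X0.rep (curveAt T (mixed Q j k)) (curveAt T (mixed Q (j + 1) k)) := by
  have h1 := contDiffOn_mixed isOpen_strip (n := 1) (j := j) (k := k) (by omega) hQ
  have h2 := (contDiffOn_mixed isOpen_strip (n := 0) (j := j + 1) (k := k) (by omega) hQ).continuousOn
  refine isWeakDt_of_hasDerivAt fun t ht => ?_
  have hm := mem_strip h ⟨t, Ioo_subset_Icc_self ht⟩ 0
  rw [clamp_of_mem (Ioo_subset_Icc_self ht), curveAt_apply h h2]
  have h3 := hasDerivAt_left (p := (t, 0))
    ((h1.contDiffAt (isOpen_strip.mem_nhds hm)).differentiableAt (by simp))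
  rw [mixed_succ]
  refine h3.congr_of_eventuallyEq ?_
  filter_upwards [Ioo_mem_nhds ht.1 ht.2] with s hs
  rw [clamp_of_mem (Ioo_subset_Icc_self hs), curveAt_apply h h1.continuousOn]

/-- Without time derivatives, the derivative along the second variable is the derivative along
translations. Since `mixed` takes space derivatives first, time derivatives are added by commuting
∂ₜ and ∂ₓ on the test function; symmetry of the derivatives of Q is not used. -/
theorem isWeakDx_curveAt (h : T < T') (hQ : ContDiffOn ℝ K Q (strip T'))
    (hE : ∀ p ∈ strip T', ∀ a, Q (p + (0, a)) = x0Shift a (Q p)) {j k : ℕ} (hjk : j + k < K) :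
    IsWeakDx X0.rep (curveAt T (mixed Q j k)) (curveAt T (mixed Q j (k + 1))) := by
  induction j with
  | zero =>
    have h1 := contDiffOn_mixed isOpen_strip (n := 1) (j := 0) (k := k) (by omega) hQ
    have h2 := (contDiffOn_mixed isOpen_strip (n := 0) (j := 0) (k := k + 1) (by omega) hQ).continuousOn
    refine isWeakDx_of_hasDerivAt fun t => ?_
    have hm := mem_strip h t 0
    rw [curveAt_apply h h2, curveAt_apply h h1.continuousOn, mixed_zero_succ]
    have h3 := hasDerivAt_right (p := ((t : ℝ), (0 : ℝ)))
      ((h1.contDiffAt (isOpen_strip.mem_nhds hm)).differentiableAt (by simp))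
    refine h3.congr_of_eventuallyEq (Eventually.of_forall fun a => ?_)
    have h4 := mixed_add hQ hE (j := 0) (k := k) (by omega) hm a
    rw [Prod.mk_add_mk, add_zero, zero_add] at h4
    exact h4.symm
  | succ j ih =>
    exact IsWeakDx.of_isWeakDt (isWeakDt_curveAt h hQ (by omega)) (ih (by omega))
      (isWeakDt_curveAt h hQ (by omega))

theorem curveHasRegularity_of_orbit (h : T < T') (hQ : ContDiffOn ℝ K Q (strip T'))
    (hE : ∀ p ∈ strip T', ∀ a, Q (p + (0, a)) = x0Shift a (Q p)) {u : C(Icc (-T) T, X0 N)}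
    (hu : ∀ t, u t = Q (t, 0)) : CurveHasRegularity X0.rep K u :=
  ⟨fun j k => curveAt T (mixed Q j k), ContinuousMap.ext fun t => by
    change curveAt T (mixed Q 0 0) t = u t
    rw [mixed_zero, curveAt_apply h hQ.continuousOn, hu], fun _ _ hjk =>
    ⟨isWeakDt_curveAt h hQ hjk, isWeakDx_curveAt h hQ hE hjk⟩⟩

variable {Q : ℕ → ℝ × ℝ → X0 N}

theorem agreeLoc_curveAt (h : T < T') (hQ : ∀ n, ContDiffOn ℝ K (Q n) (strip T'))
    (hA : ∀ n : ℕ, ∀ p ∈ strip T', Agree (n + 1 - |p.2|) (Q n p) (Q (n + 1) p)) {j k : ℕ}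
    (hjk : j + k ≤ K) (n : ℕ) (t : Icc (-T) T) : AgreeLoc (n + 1) (curveAt T (mixed (Q n) j k) t)
      (glueCurve (N := N) T (fun n => curveAt T (mixed (Q n) j k)) t) := by
  refine agreeLoc_glueX (f := fun n => curveAt T (mixed (Q n) j k) t) (fun n => ?_) n
  have hc (n : ℕ) :=
    (contDiffOn_mixed isOpen_strip (n := 0) (j := j) (k := k) (by omega) (hQ n)).continuousOn
  rw [curveAt_apply h (hc n), curveAt_apply h (hc (n + 1))]
  simpa using agree_mixed hQ hA hjk n (mem_strip h t 0)

theorem IsBump.exists_nat {φ : ℝ → ℝ → ℝ} (h : IsBump φ) :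
    ∃ n : ℕ, ∀ t x, φ t x ≠ 0 → |x| < n + 1 := by
  obtain ⟨ρ, -, hρ⟩ := h.exists_bound
  obtain ⟨n, hn⟩ := exists_nat_gt ρ
  refine ⟨n, fun t x hx => ?_⟩
  have := abs_le.2 (hρ t x hx).2
  linarith

/-- The supports of both test functions lie in |x| < n + 1 for one n, where the glued curves equal
their nth terms. -/
theorem pairEq_glueCurve {φ ψ : ℝ → ℝ → ℝ} (hφ : IsBump φ) (hψ : IsBump ψ)
    {f g : ℕ → C(Icc (-T) T, X0 N)}
    (hf : ∀ (n : ℕ) t, AgreeLoc (n + 1) (f n t) (glueCurve (N := N) T f t))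
    (hg : ∀ (n : ℕ) t, AgreeLoc (n + 1) (g n t) (glueCurve (N := N) T g t))
    (h : ∀ n, PairEq φ ψ (fun t => X0.rep (f n t)) fun t => X0.rep (g n t)) :
    PairEq φ ψ (fun t => X0Loc.rep (glueCurve (N := N) T f t)) fun t => X0Loc.rep (glueCurve (N := N) T g t) := by
  obtain ⟨n, hn⟩ := hφ.exists_nat
  obtain ⟨n', hn'⟩ := hψ.exists_nat
  have e1 : (n : ℝ) ≤ max n n' := by exact_mod_cast le_max_left n n'
  have e2 : (n' : ℝ) ≤ max n n' := by exact_mod_cast le_max_right n n'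
  refine PairEq.congr (h (max n n')) (fun t => ?_) fun t => ?_
  · filter_upwards [hf (max n n') t] with x hx h0
    exact hx ((hn _ _ h0).trans_le (by linarith))
  · filter_upwards [hg (max n n') t] with x hx h0
    exact hx ((hn' _ _ h0).trans_le (by linarith))

theorem curveHasRegularity_of_orbits (h : T < T') (hQ : ∀ n, ContDiffOn ℝ K (Q n) (strip T'))
    (hE : ∀ n, ∀ p ∈ strip T', ∀ a, Q n (p + (0, a)) = x0Shift a (Q n p))
    (hA : ∀ n : ℕ, ∀ p ∈ strip T', Agree (n + 1 - |p.2|) (Q n p) (Q (n + 1) p))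
    {u : C(Icc (-T) T, X0Loc N)} (hu : ∀ t, u t = glueX fun n => Q n (t, 0)) :
    CurveHasRegularity X0Loc.rep K u := by
  refine ⟨fun j k => glueCurve (N := N) T fun n => curveAt T (mixed (Q n) j k), ContinuousMap.ext fun t => ?_,
    fun j k hjk => ⟨fun φ hφ => ?_, fun φ hφ => ?_⟩⟩
  · rw [glueCurve_apply, hu]
    refine congrArg _ (funext fun n => ?_)
    rw [mixed_zero, curveAt_apply h (hQ n).continuousOn]
  · exact pairEq_glueCurve hφ.isBump.dt hφ.isBump
      (agreeLoc_curveAt h hQ hA (j := j) (k := k) (by omega))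
      (agreeLoc_curveAt h hQ hA (j := j + 1) (k := k) (by omega))
      fun n => isWeakDt_curveAt h (hQ n) hjk φ hφ
  · exact pairEq_glueCurve hφ.isBump.dx hφ.isBump
      (agreeLoc_curveAt h hQ hA (j := j) (k := k) (by omega))
      (agreeLoc_curveAt h hQ hA (j := j) (k := k + 1) (by omega))
      fun n => isWeakDx_curveAt h (hQ n) (hE n) hjk φ hφ

end CurveAt

/-! ### Smooth representatives -/

section ExpKernel

variable {E : Type} [NormedAddCommGroup E] [NormedSpace ℝ E] [CompleteSpace E]
  {p q : ℝ≥0∞} [Fact (1 ≤ p)] [Fact (1 ≤ q)]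

/-- The kernel `e⁻ˢ` on `s > 0`. -/
def expKer : ℝ → ℝ := (Ioi (0 : ℝ)).indicator fun s => Real.exp (-s)

theorem measurable_expKer : Measurable expKer :=
  (by fun_prop : Measurable fun s : ℝ => Real.exp (-s)).indicator measurableSet_Ioi

theorem memLp_expKer_top : MemLp expKer ⊤ (volume : Measure ℝ) := by
  refine memLp_top_of_bound measurable_expKer.aestronglyMeasurable 1 (Eventually.of_forall fun s => ?_)
  by_cases hs : s ∈ Ioi (0 : ℝ)
  · rw [expKer, indicator_of_mem hs, Real.norm_eq_abs, Real.abs_exp]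
    exact Real.exp_le_one_iff.2 (neg_nonpos.2 (le_of_lt hs))
  · rw [expKer, indicator_of_notMem hs]
    simp

theorem memLp_expKer_two : MemLp expKer 2 (volume : Measure ℝ) := by
  refine (memLp_two_iff_integrable_sq measurable_expKer.aestronglyMeasurable).2 ?_
  have h : IntegrableOn (fun s : ℝ => Real.exp (-2 * s)) (Ioi 0) :=
    exp_neg_integrableOn_Ioi 0 (by norm_num)
  refine ((integrable_indicator_iff measurableSet_Ioi).2 h).congr (Eventually.of_forall fun s => ?_)
  by_cases hs : s ∈ Ioi (0 : ℝ)
  · rw [expKer]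
    simp only [indicator_of_mem hs]
    rw [← Real.exp_nat_mul]
    congr 1
    push_cast
    ring
  · simp only [expKer, indicator_of_notMem hs]
    norm_num

/-- `L` is integration against `e⁻ˢ` over `s > 0`. -/
def IsExpIntegral (L : Lp E p (volume : Measure ℝ) →L[ℝ] E) : Prop :=
  ∀ f, IntegrableOn (fun s => Real.exp (-s) • f s) (Ioi 0) ∧
    L f = ∫ s in Ioi (0 : ℝ), Real.exp (-s) • f s

theorem exists_isExpIntegral [ENNReal.HolderTriple q p 1] (h : MemLp expKer q (volume : Measure ℝ)) :
    ∃ L : Lp E p (volume : Measure ℝ) →L[ℝ] E, IsExpIntegral L := by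
  set B : Lp ℝ q (volume : Measure ℝ) →L[ℝ] Lp E p (volume : Measure ℝ) →L[ℝ]
      Lp E 1 (volume : Measure ℝ) :=
    (ContinuousLinearMap.lsmul ℝ ℝ : ℝ →L[ℝ] E →L[ℝ] E).holderL volume q p 1 with hB
  have h0 : h.toLp expKer =ᵐ[volume] expKer := h.coeFn_toLp
  have h1 (f : Lp E p (volume : Measure ℝ)) : B (h.toLp expKer) f =ᵐ[volume]
      (Ioi (0 : ℝ)).indicator fun s => Real.exp (-s) • f s := by
    filter_upwards [(ContinuousLinearMap.lsmul ℝ ℝ : ℝ →L[ℝ] E →L[ℝ] E).coeFn_holder (r := 1)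
      (h.toLp expKer) f, h0] with s hs h0
    refine hs.trans ?_
    rw [h0]
    by_cases hs : s ∈ Ioi (0 : ℝ)
    · rw [expKer, indicator_of_mem hs, indicator_of_mem hs]
      rfl
    · rw [expKer, indicator_of_notMem hs, indicator_of_notMem hs, map_zero]
      rfl
  refine ⟨lpIntegral.comp (B (h.toLp expKer)), fun f => ⟨?_, ?_⟩⟩
  · exact (integrable_indicator_iff measurableSet_Ioi).1 ((integrable_lp_one _).congr (h1 f))
  · exact (integral_congr_ae (h1 f)).trans (integral_indicator measurableSet_Ioi)

/-- Applied to the translates of f, the functional L yields P(x) = eˣ∫ₓ^∞ e⁻ˢf(s) ds, which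
satisfies P' = P - f almost everywhere. So f = P - P' recovers point values of a class of functions
from a continuous functional and one derivative of the orbit. -/
theorem IsExpIntegral.ae_eq {L : Lp E p (volume : Measure ℝ) →L[ℝ] E} (hL : IsExpIntegral L)
    {F : ℝ × ℝ → Lp E p (volume : Measure ℝ)} {t : ℝ}
    (hE : ∀ a, F (t, a) = lpShift a (F (t, 0))) (hd : ∀ x, DifferentiableAt ℝ F (t, x)) :
    F (t, 0) =ᵐ[volume] fun x => L (F (t, x)) - L (pd (0, 1) F (t, x)) := by
  set f : ℝ → E := fun s => F (t, 0) s with hf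
  have hloc : LocallyIntegrable fun s => Real.exp (-s) • f s :=
    ((Lp.memLp (F (t, 0))).locallyIntegrable Fact.out).continuous_smul (by fun_prop)
  have hii (a b : ℝ) : IntervalIntegrable (fun s => Real.exp (-s) • f s) volume a b :=
    (LocallyIntegrable.integrableOn_isCompact hloc isCompact_uIcc).intervalIntegrable
  have hP (x : ℝ) : L (F (t, x)) = Real.exp x • ((∫ s in Ioi (0 : ℝ), Real.exp (-s) • f s) -
      ∫ s in (0 : ℝ)..x, Real.exp (-s) • f s) := by
    have h1 : ∫ s in Ioi (0 : ℝ), Real.exp (-s) • F (t, x) s =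
        ∫ s in Ioi (0 : ℝ), Real.exp x • (Real.exp (-(s + x)) • f (s + x)) := by
      refine integral_congr_ae (ae_restrict_of_ae ?_)
      rw [hE x]
      filter_upwards [coeFn_lpShift x (F (t, 0))] with s hs
      rw [hs, smul_smul, ← Real.exp_add]
      congr 2
      ring
    have h2 : ∫ s in Ioi (0 : ℝ), Real.exp (-(s + x)) • f (s + x) =
        ∫ s in Ioi x, Real.exp (-s) • f s := by
      have h3 := (measurePreserving_add_right (volume : Measure ℝ) x).setIntegral_preimage_emb
        (measurableEmbedding_addRight x) (fun s => Real.exp (-s) • f s) (Ioi x)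
      simpa using h3
    have h3 : IntegrableOn (fun s => Real.exp (-s) • f s) (Ioi x) := by
      have h4 : IntegrableOn (fun s => Real.exp (-s) • f s) (uIoc 0 x ∪ Ioi 0) :=
        (intervalIntegrable_iff.1 (hii 0 x)).union (hL _).1
      refine h4.mono_set fun s hs => ?_
      rcases lt_or_ge 0 s with h | h
      · exact Or.inr h
      · exact Or.inl (mem_uIoc.2 (Or.inr ⟨hs, h⟩))
    rw [(hL _).2, h1, integral_smul, h2,
      ← intervalIntegral.integral_interval_add_Ioi (hL (F (t, 0))).1 h3, add_sub_cancel_left]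
  have hD (x : ℝ) : HasDerivAt (fun x => L (F (t, x))) (L (pd (0, 1) F (t, x))) x :=
    L.hasFDerivAt.comp_hasDerivAt x (hasDerivAt_right (p := (t, x)) (hd x))
  filter_upwards [LocallyIntegrable.ae_hasDerivAt_integral hloc] with x hx
  have h1 := (Real.hasDerivAt_exp x).smul
    ((hx 0).const_sub (∫ s in Ioi (0 : ℝ), Real.exp (-s) • f s))
  have h2 := (hD x).unique (h1.congr_of_eventuallyEq (Eventually.of_forall hP))
  rw [h2, hP, smul_neg, smul_smul, ← Real.exp_add, add_neg_cancel, Real.exp_zero, one_smul]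
  abel

end ExpKernel

/-! ### Smooth functions representing smooth orbits -/

section SmoothRep

variable {N : ℕ} {T T' : ℝ} [hT : Fact (0 < T)] {Q : ℝ × ℝ → X0 N}

theorem contDiffOn_pd_infty {X : Type} [NormedAddCommGroup X] [NormedSpace ℝ X] {F : ℝ × ℝ → X}
    (hF : ContDiffOn ℝ ∞ F (strip T)) (e : ℝ × ℝ) : ContDiffOn ℝ ∞ (pd e F) (strip T) :=
  contDiffOn_pd (n := ⊤) isOpen_strip hF e

/-- The potential at (t, x) is the value at 0 of the translate by x, a continuous functional of the
orbit. For the spinor and the velocity point evaluation is not defined and is replaced by the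
exponential kernel formula. Continuous functionals of a smooth orbit are smooth. -/
theorem exists_smooth_rep (hQ : ContDiffOn ℝ ∞ Q (strip T))
    (hE : ∀ p ∈ strip T, ∀ a, Q (p + (0, a)) = x0Shift a (Q p)) :
    ∃ f : ℝ × ℝ → State N, ContDiffOn ℝ ∞ f (strip T) ∧
      ∀ t ∈ Ioo (-T) T, X0.rep (Q (t, 0)) =ᵐ[volume] fun x => f (t, x) := by
  obtain ⟨L₁, h₁⟩ := exists_isExpIntegral (E := Spinor) (p := 2) memLp_expKer_two
  obtain ⟨L₂, h₂⟩ := exists_isExpIntegral (E := Pot N) (p := 1) memLp_expKer_top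
  have hE' (t : ℝ) (ht : t ∈ Ioo (-T) T) (a : ℝ) : Q (t, a) = x0Shift a (Q (t, 0)) := by
    rw [← hE (t, 0) ⟨ht, mem_univ _⟩, Prod.mk_add_mk, add_zero, zero_add]
  set q₁ : ℝ × ℝ → Lp Spinor 2 (volume : Measure ℝ) := fun p => x0Spinor (Q p) with hq₁
  set q₂ : ℝ × ℝ → Lp (Pot N) 1 (volume : Measure ℝ) := fun p => x0W (Q p) with hq₂
  have c₁ : ContDiffOn ℝ ∞ q₁ (strip T) := (x0Spinor (N := N)).contDiff.comp_contDiffOn hQ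
  have c₂ : ContDiffOn ℝ ∞ q₂ (strip T) := (x0W (N := N)).contDiff.comp_contDiffOn hQ
  have d₁ (t : ℝ) (ht : t ∈ Ioo (-T) T) (x : ℝ) : DifferentiableAt ℝ q₁ (t, x) :=
    (c₁.contDiffAt (isOpen_strip.mem_nhds ⟨ht, mem_univ x⟩)).differentiableAt (by simp)
  have d₂ (t : ℝ) (ht : t ∈ Ioo (-T) T) (x : ℝ) : DifferentiableAt ℝ q₂ (t, x) :=
    (c₂.contDiffAt (isOpen_strip.mem_nhds ⟨ht, mem_univ x⟩)).differentiableAt (by simp)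
  have s₁ : ContDiffOn ℝ ∞ (fun p => L₁ (q₁ p) - L₁ (pd (0, 1) q₁ p)) (strip T) :=
    (L₁.contDiff.comp_contDiffOn c₁).sub (L₁.contDiff.comp_contDiffOn (contDiffOn_pd_infty c₁ _))
  have s₂ : ContDiffOn ℝ ∞ (fun p => L₂ (q₂ p) - L₂ (pd (0, 1) q₂ p)) (strip T) :=
    (L₂.contDiff.comp_contDiffOn c₂).sub (L₂.contDiff.comp_contDiffOn (contDiffOn_pd_infty c₂ _))
  have s₃ : ContDiffOn ℝ ∞ (fun p => yZero (x0V (Q p))) (strip T) :=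
    (yZero.comp (x0V (N := N))).contDiff.comp_contDiffOn hQ
  refine ⟨fun p => (L₁ (q₁ p) - L₁ (pd (0, 1) q₁ p), yZero (x0V (Q p)),
    L₂ (q₂ p) - L₂ (pd (0, 1) q₂ p)), s₁.prodMk (s₃.prodMk s₂), fun t ht => ?_⟩
  have i₁ (a : ℝ) : q₁ (t, a) = lpShift a (q₁ (t, 0)) := by
    change x0Spinor (Q (t, a)) = _
    rw [hE' t ht a, x0Spinor_x0Shift]
  have i₂ (a : ℝ) : q₂ (t, a) = lpShift a (q₂ (t, 0)) := by
    change x0W (Q (t, a)) = _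
    rw [hE' t ht a, x0W_x0Shift]
  have i₃ (x : ℝ) : yZero (x0V (Q (t, x))) = yFun (x0V (Q (t, 0))) x := by
    rw [hE' t ht x, x0V_x0Shift, yZero_apply, yFun_yShift, zero_add]
  filter_upwards [h₁.ae_eq i₁ (d₁ t ht), h₂.ae_eq i₂ (d₂ t ht)] with x hx₁ hx₂
  rw [x0_rep]
  exact Prod.ext hx₁ (Prod.ext (i₃ x).symm hx₂)

/-- The smooth representatives of different levels agree almost everywhere on common intervals,
hence everywhere by continuity. Choosing level ⌊|x|⌋ at x gives a function equal, near each point,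
to the representative of one fixed level. -/
theorem isSmoothCurve_of_orbits [hT' : Fact (0 < T')] {Q : ℕ → ℝ × ℝ → X0 N}
    (h : T < T') (hQ : ∀ n, ContDiffOn ℝ ∞ (Q n) (strip T'))
    (hE : ∀ n, ∀ p ∈ strip T', ∀ a, Q n (p + (0, a)) = x0Shift a (Q n p))
    (hA : ∀ n : ℕ, ∀ p ∈ strip T', Agree (n + 1 - |p.2|) (Q n p) (Q (n + 1) p))
    {u : C(Icc (-T) T, X0Loc N)} (hu : ∀ t, u t = glueX fun n => Q n (t, 0)) :
    IsSmoothCurve X0Loc.rep u := by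
  choose f hf hr using fun n => exists_smooth_rep (hQ n) (hE n)
  have hA0 (t : ℝ) (ht : t ∈ Ioo (-T') T') (n : ℕ) : Agree (n + 1) (Q n (t, 0)) (Q (n + 1) (t, 0)) := by
    simpa using hA n (t, 0) ⟨ht, mem_univ _⟩
  have hc (n : ℕ) (t : ℝ) (ht : t ∈ Ioo (-T') T') : Continuous fun x => f n (t, x) :=
    (hf n).continuousOn.comp_continuous (by fun_prop) fun x => ⟨ht, mem_univ x⟩
  have heq (t : ℝ) (ht : t ∈ Ioo (-T') T') {k n : ℕ} (hkn : k ≤ n) {x : ℝ} (hx : |x| < k + 1) :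
      f k (t, x) = f n (t, x) := by
    refine Measure.eqOn_open_of_ae_eq (μ := volume) ?_
      (isOpen_lt continuous_abs continuous_const : IsOpen {x : ℝ | |x| < k + 1})
      (hc k t ht).continuousOn (hc n t ht).continuousOn hx
    refine (ae_restrict_iff' (measurableSet_abs_lt _)).2 ?_
    filter_upwards [agree_of_le (hA0 t ht) hkn, hr k t ht, hr n t ht] with x h1 h2 h3 hx
    rw [← h2, ← h3, h1 hx]
  set g : ℝ × ℝ → State N := fun p => f ⌊|p.2|⌋₊ p with hg
  have hgn (n : ℕ) {p : ℝ × ℝ} (hp : p ∈ strip T') (hx : |p.2| < n + 1) : g p = f n p := by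
    refine heq p.1 hp.1 ?_ (Nat.lt_floor_add_one _)
    have : ⌊|p.2|⌋₊ < n + 1 := (Nat.floor_lt (abs_nonneg _)).2 (by push_cast; exact hx)
    omega
  have hgs : ContDiffOn ℝ ∞ g (strip T') := by
    intro p hp
    obtain ⟨n, hn⟩ := exists_nat_gt |p.2|
    refine (((hf n).contDiffAt (isOpen_strip.mem_nhds hp)).congr_of_eventuallyEq ?_).contDiffWithinAt
    have h1 : ∀ᶠ q : ℝ × ℝ in 𝓝 p, |q.2| < n :=
      continuous_snd.abs.continuousAt.eventually_lt_const hn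
    filter_upwards [h1, isOpen_strip.mem_nhds hp] with q hq hq'
    exact hgn n hq' (by linarith)
  refine ⟨g, hgs.mono fun p hp => mem_strip h ⟨p.1, hp.1⟩ p.2, fun t => ?_⟩
  have ht := (mem_strip h t 0).1
  have hall : ∀ᵐ x : ℝ, ∀ n : ℕ, |x| < n + 1 → X0Loc.rep (u t) x = f n (t, x) :=
    ae_all_iff.2 fun n => by
      filter_upwards [agreeLoc_glueX (f := fun n => Q n (t, 0)) (hA0 t ht) n, hr n t ht]
        with x h1 h2 hx
      rw [hu, ← h1 hx, h2]
  filter_upwards [hall] with x hx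
  exact hx _ (Nat.lt_floor_add_one _)

end SmoothRep

/-! ### Persistence of regularity -/

section Regularity

variable {N : ℕ} {K : ℕ}

theorem weakReg_lp_of_contDiff {p : ℝ≥0∞} [Fact (1 ≤ p)] {χ : ℝ → ℝ} (hχ : ContDiff ℝ ∞ χ)
    (hc : HasCompactSupport χ) {f : Lp ℝ p (volume : Measure ℝ)} (hf : f =ᵐ[volume] χ) (K : ℕ) :
    WeakReg (fun f : Lp ℝ p (volume : Measure ℝ) => (f : ℝ → ℝ)) K f := by
  induction K generalizing χ f with
  | zero => trivial
  | succ K ih =>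
    have hχ' : ContDiff ℝ ∞ (deriv χ) := (contDiff_infty_iff_deriv.1 hχ).2
    have h1 : MemLp (deriv χ) p (volume : Measure ℝ) :=
      hχ'.continuous.memLp_of_hasCompactSupport hc.deriv
    have h2 : h1.toLp (deriv χ) =ᵐ[volume] deriv χ := h1.coeFn_toLp
    exact ⟨h1.toLp (deriv χ), (isWeakDeriv_of_contDiff hχ).congr hf.symm h2.symm,
      ih hχ' hc.deriv h2⟩

theorem strongReg_massCut (m : ℝ) (n : ℕ) :
    StrongReg (lpShift (E := ℝ) (p := 1)) K (massCut m n) :=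
  strongReg_lp (by simp) (weakReg_lp_of_contDiff (contDiff_const.mul (contDiff_cutoff n))
    ((hasCompactSupport_cutoff n).mul_left (f := fun _ => m ^ 2)) (coeFn_massCut n) K)

theorem strongReg_cutX {d : X0Loc N} (h1 : WeakReg LpLoc.rep K (locSpinor d))
    (h2 : WeakReg LpLoc.rep K (locDer (locV d))) (h3 : WeakReg LpLoc.rep K (locW d)) (n : ℕ) :
    StrongReg (x0Shift (N := N)) K (cutX n d) := by
  have e1 : x0Spinor (cutX n d) = lpCutoff n (locSpinor d) := by
    rw [cutX_apply]; unfold x0Spinor; rfl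
  have e2 : x0V (cutX n d) = yOf (locFun (locV d) 0, lpCutoff n (locDer (locV d))) := by
    rw [cutX_apply]; unfold x0V; rfl
  have e3 : x0W (cutX n d) = lpCutoff n (locW d) := by
    rw [cutX_apply]; unfold x0W; rfl
  refine strongReg_x0 ?_ ?_ ?_
  · rw [e1]; exact strongReg_lpCutoff (by simp) h1 n
  · rw [e2, yDer_yOf]; exact strongReg_lpCutoff (by simp) h2 n
  · rw [e3]; exact strongReg_lpCutoff (by simp) h3 n

variable {T T' : ℝ} [hT : Fact (0 < T)] [hT' : Fact (0 < T')] {m M : ℝ}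
  {B C : Fin N → Matrix (Fin 2) (Fin 2) ℂ} {hB : ∀ j, (B j).IsHermitian}

/-- The restriction of the longer solution solves the problem on [-T, T], so uniqueness applies. -/
theorem x0Sol_eq_clamp (hC : ∀ j, (C j).IsHermitian) (h : T ≤ T') (d : X0 N) (t : Icc (-T) T) :
    x0Sol T M C hB 0 d t = x0Sol T' M C hB 0 d (clamp T' t) := by
  rw [← restrictCurve_eq_clamp h]
  exact DFunLike.congr_fun
    (eq_x0Sol hC rfl ((isSolution_x0Sol (T := T') hC rfl d).restrict h)).symm t

theorem locSol_eq_clamp (hC : ∀ j, (C j).IsHermitian) (h : T ≤ T') (d : X0Loc N)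
    (t : Icc (-T) T) : locSol T m M C hB d t = locSol T' m M C hB d (clamp T' t) := by
  rw [← restrictCurve_eq_clamp h]
  exact DFunLike.congr_fun
    (eq_locSol hC ((isSolution_locSol (T := T') (m := m) hC d).restrict h)).symm t

theorem curveHasRegularity_x0Sol (hC : ∀ j, (C j).IsHermitian) {d : X0 N}
    (hd : HasRegularity X0.rep K d) : CurveHasRegularity X0.rep K (x0Sol T M C hB 0 d) := by
  obtain ⟨D, rfl, hD⟩ := hd
  obtain ⟨h1, h2, h3⟩ := weakReg_x0 hD
  have hs : StrongReg (x0Shift (N := N)) K (D 0) := strongReg_x0 (strongReg_lp (by simp) h1)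
    (strongReg_lp (by simp) h2) (strongReg_lp (by simp) h3)
  have h0 : StrongReg (lpShift (E := ℝ) (p := 1)) K (0 : Lp ℝ 1 (volume : Measure ℝ)) :=
    strongReg_of_fixed (fun a => map_zero _) K
  -- Orbits are differentiable only for times in an open interval, so the problem is solved on [-T -
  -- 1, T + 1] to include ±T.
  have : Fact (0 < T + 1) := ⟨by linarith [hT.out]⟩
  refine curveHasRegularity_of_orbit (T' := T + 1) (Q := orbitX (T + 1) M C hB 0 (D 0))
    (by linarith) (contDiffOn_orbitX hs h0) (fun p _ a => orbitX_add _ _ _ _) fun t => ?_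
  rw [orbitX, x0Shift_zero, x0Sol_eq_clamp (T' := T + 1) hC (by linarith)]

/-- The translates of the solution with data cut off at level `n`. -/
def locOrbit (T : ℝ) [hT : Fact (0 < T)] (m M : ℝ) (C : Fin N → Matrix (Fin 2) (Fin 2) ℂ)
    (hB : ∀ j, (B j).IsHermitian) (d : X0Loc N) (n : ℕ) : ℝ × ℝ → X0 N :=
  orbitX T M C hB (massCut m (n + coneShift T)) (cutX (n + coneShift T) d)

theorem agree_locOrbit (d : X0Loc N) (n : ℕ) (p : ℝ × ℝ) : Agree (n + 1 - |p.2|)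
    (locOrbit T m M C hB d n p) (locOrbit T m M C hB d (n + 1) p) :=
  (agree_locLevel d n (clamp T p.1)).shift p.2

theorem locSol_eq_glueX (hC : ∀ j, (C j).IsHermitian) (h : T ≤ T') (d : X0Loc N)
    (t : Icc (-T) T) :
    locSol T m M C hB d t = glueX fun n => locOrbit T' m M C hB d n (t, 0) := by
  rw [locSol_eq_clamp (T' := T') hC h, locSol, glueCurve_apply]
  refine congrArg _ (funext fun n => ?_)
  rw [locOrbit, orbitX, x0Shift_zero, locLevel]

theorem contDiffOn_locOrbit {d : X0Loc N} (h1 : WeakReg LpLoc.rep K (locSpinor d))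
    (h2 : WeakReg LpLoc.rep K (locDer (locV d))) (h3 : WeakReg LpLoc.rep K (locW d)) (n : ℕ) :
    ContDiffOn ℝ K (locOrbit T m M C hB d n) (strip T) :=
  contDiffOn_orbitX (strongReg_cutX h1 h2 h3 _) (strongReg_massCut m _)

theorem curveHasRegularity_locSol (hC : ∀ j, (C j).IsHermitian) {d : X0Loc N}
    (hd : HasRegularity X0Loc.rep K d) :
    CurveHasRegularity X0Loc.rep K (locSol T m M C hB d) := by
  obtain ⟨D, rfl, hD⟩ := hd
  obtain ⟨h1, h2, h3⟩ := weakReg_x0Loc hD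
  have : Fact (0 < T + 1) := ⟨by linarith [hT.out]⟩
  exact curveHasRegularity_of_orbits (T' := T + 1) (Q := locOrbit (T + 1) m M C hB (D 0))
    (by linarith) (contDiffOn_locOrbit h1 h2 h3) (fun n p _ a => orbitX_add _ _ _ _)
    (fun n p _ => agree_locOrbit _ _ _) fun t => locSol_eq_glueX hC (by linarith) _ t

theorem isSmoothCurve_locSol (hC : ∀ j, (C j).IsHermitian) {d : X0Loc N}
    (hd : IsSmoothData X0Loc.rep d) : IsSmoothCurve X0Loc.rep (locSol T m M C hB d) := by
  obtain ⟨f, hf, hfe⟩ := hd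
  have f1 : ContDiff ℝ ∞ fun x => (f x).1 := contDiff_fst.comp hf
  have f2 : ContDiff ℝ ∞ fun x => (f x).2.1 := contDiff_fst.comp (contDiff_snd.comp hf)
  have f3 : ContDiff ℝ ∞ fun x => (f x).2.2 := contDiff_snd.comp (contDiff_snd.comp hf)
  have g1 : (locSpinor d).rep =ᵐ[volume] fun x => (f x).1 := hfe.mono fun x hx => by
    rw [x0Loc_rep] at hx
    exact congrArg Prod.fst hx
  have g2 : (locFun (locV d) : ℝ → Pot N) =ᵐ[volume] fun x => (f x).2.1 := hfe.mono fun x hx => by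
    rw [x0Loc_rep] at hx
    exact congrArg (fun s : State N => s.2.1) hx
  have g3 : (locW d).rep =ᵐ[volume] fun x => (f x).2.2 := hfe.mono fun x hx => by
    rw [x0Loc_rep] at hx
    exact congrArg (fun s : State N => s.2.2) hx
  have f2' := (contDiff_infty_iff_deriv.1 f2).2
  have g2' := (isWeakDeriv_locFun (locV d)).ae_eq (isWeakDeriv_of_contDiff f2) g2
    (locDer (locV d)).locallyIntegrable_rep f2'.continuous.locallyIntegrable
  have : Fact (0 < T + 1) := ⟨by linarith [hT.out]⟩
  exact isSmoothCurve_of_orbits (T' := T + 1) (Q := locOrbit (T + 1) m M C hB d)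
    (by linarith) (fun n => contDiffOn_infty.2 fun K => contDiffOn_locOrbit
      (weakReg_of_contDiff f1 g1 K) (weakReg_of_contDiff f2' g2' K) (weakReg_of_contDiff f3 g3 K) n)
    (fun n p _ a => orbitX_add _ _ _ _)
    (fun n p _ => agree_locOrbit _ _ _) fun t => locSol_eq_glueX hC (by linarith) _ t

/-- For m = 0 a global solution, viewed locally, satisfies the same weak equations, so it is the
local solution. -/
theorem locSol_toLoc (hC : ∀ j, (C j).IsHermitian) (d : X0 N) (t : Icc (-T) T) :
    locSol T 0 M C hB (toLoc d) t = toLoc (x0Sol T M C hB 0 d t) := by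
  set v : C(Icc (-T) T, X0Loc N) := ⟨fun t => toLoc (x0Sol T M C hB 0 d t),
    toLoc.continuous.comp (x0Sol T M C hB 0 d).continuous⟩ with hv
  have h1 := isSolution_iff.1 (isSolution_x0Sol (T := T) (M := M) (hB := hB) hC rfl d)
  have h2 : IsSolution X0Loc.rep M 0 B C (toLoc d) v := by
    refine isSolution_iff.2 ⟨fun t ht => ?_, fun φ hφ => SolEqs.congr hφ.isBump (fun t => ?_)
      (h1.2 φ hφ)⟩
    · change toLoc (x0Sol T M C hB 0 d t) = _
      rw [h1.1 t ht]
    · filter_upwards [rep_toLoc (x0Sol T M C hB 0 d t)] with x hx _ using hx.symm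
  exact (DFunLike.congr_fun (eq_locSol (hB := hB) hC h2) t).symm

/-- Data in X₀ that are smooth functions need not have derivatives in X₀. Smoothness is therefore
taken from the local theory, where only local integrability of the derivatives matters. -/
theorem isSmoothCurve_x0Sol (hC : ∀ j, (C j).IsHermitian) {d : X0 N}
    (hd : IsSmoothData X0.rep d) : IsSmoothCurve X0.rep (x0Sol T M C hB 0 d) := by
  obtain ⟨f, hf, hfe⟩ := hd
  obtain ⟨g, hg, hge⟩ := isSmoothCurve_locSol (T := T) (m := 0) (M := M) (hB := hB) hC
    (d := toLoc d) ⟨f, hf, (rep_toLoc d).trans hfe⟩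
  refine ⟨g, hg, fun t => ?_⟩
  have h1 := hge t
  rw [locSol_toLoc hC] at h1
  exact (rep_toLoc _).symm.trans h1

end Regularity

/-! ### Density of smooth data -/

section Density

variable {N : ℕ}

/-- An element of Y is given by its value at 0 and its derivative in L¹, so X₀ is a continuous image
of a product of ℝ^N and Lebesgue spaces, in which smooth compactly supported functions are dense.
Their primitives are again smooth. -/
theorem dense_isSmoothData : Dense {d : X0 N | IsSmoothData X0.rep d} := by
  set Φ : Lp Spinor 2 (volume : Measure ℝ) × (Pot N × Lp (Pot N) 1 (volume : Measure ℝ)) ×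
      Lp (Pot N) 1 (volume : Measure ℝ) → X0 N := fun q => (q.1, yOf q.2.1, q.2.2) with hΦ
  have hc : Continuous Φ := continuous_fst.prodMk ((yOf.continuous.comp
    (continuous_fst.comp continuous_snd)).prodMk (continuous_snd.comp continuous_snd))
  have hs : Function.Surjective Φ := fun d =>
    ⟨(d.1, (yZero d.2.1, yDer d.2.1), d.2.2), Prod.ext rfl (Prod.ext (Y.eq_yOf _).symm rfl)⟩
  have h1 := Lp.dense_hasCompactSupport_contDiff (F := Spinor) (p := 2) (μ := (volume : Measure ℝ))
    (by simp)
  have h2 := Lp.dense_hasCompactSupport_contDiff (F := Pot N) (p := 1) (μ := (volume : Measure ℝ))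
    (by simp)
  refine (hs.denseRange.dense_image hc (h1.prod ((dense_univ.prod h2).prod h2))).mono ?_
  rintro _ ⟨⟨ψ, ⟨c, v⟩, w⟩, ⟨⟨f, hf, -, hfs⟩, ⟨-, ⟨g, hg, -, hgs⟩⟩, ⟨k, hk, -, hks⟩⟩, rfl⟩
  have hgi : ContDiff ℝ ∞ fun x => c + ∫ s in (0 : ℝ)..x, g s := by
    have hd (x : ℝ) : HasDerivAt (fun x => c + ∫ s in (0 : ℝ)..x, g s) (g x) x :=
      (hgs.continuous.integral_hasStrictDerivAt 0 x).hasDerivAt.const_add c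
    refine contDiff_infty_iff_deriv.2 ⟨fun x => (hd x).differentiableAt, ?_⟩
    rwa [funext fun x => (hd x).deriv]
  refine ⟨fun x => (f x, c + ∫ s in (0 : ℝ)..x, g s, k x), hfs.prodMk (hgi.prodMk hks), ?_⟩
  filter_upwards [hf, hk] with x hx hx'
  refine Prod.ext hx (Prod.ext ?_ hx')
  change yFun (yOf (c, v)) x = _
  rw [yFun_yOf]
  exact congrArg (c + ·) (intervalIntegral.integral_congr_ae (hg.mono fun y hy _ => hy))

theorem exists_seq_isSmoothData (d : X0 N) :
    ∃ e : ℕ → X0 N, (∀ n, IsSmoothData X0.rep (e n)) ∧ Tendsto e atTop (𝓝 d) :=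
  mem_closure_iff_seq_limit.1 (dense_isSmoothData d)

theorem agree_cutX (d : X0Loc N) {k n : ℕ} (h : k ≤ n) : Agree (k + 1) (cutX k d) (cutX n d) := by
  filter_upwards [agreeLoc_cutX k d, agreeLoc_cutX n d] with x h1 h2 hx
  have : (k : ℝ) ≤ n := by exact_mod_cast h
  rw [h1 hx, h2 (by linarith)]

/-- Both sides are glued from cutoffs of d, with levels min(k, n) and k respectively. For each k the
sequence in n is eventually constant, and gluing is continuous for the product topology. -/
theorem tendsto_toLoc_cutX (d : X0Loc N) : Tendsto (fun n => toLoc (cutX n d)) atTop (𝓝 d) := by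
  have h1 : d = glueX fun n => cutX n d :=
    X0Loc.ext_of_agree (fun n => agreeLoc_cutX n d)
      (agreeLoc_glueX fun n => agree_cutX d (Nat.le_succ n))
  have h2 (n : ℕ) : toLoc (cutX n d) = glueX fun k => cutX (min k n) d := by
    refine X0Loc.ext_of_agree (f := fun k => cutX (min k n) d) (fun k => ?_)
      (agreeLoc_glueX fun k => ?_)
    · rcases le_total k n with h | h
      · rw [min_eq_left h]
        filter_upwards [agree_cutX d h, rep_toLoc (cutX n d)] with x hx h3 h4
        rw [h3, hx h4]
      · rw [min_eq_right h]
        filter_upwards [rep_toLoc (cutX n d)] with x hx _ using hx.symm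
    · rcases lt_or_ge k n with h | h
      · rw [min_eq_left h.le, min_eq_left (Nat.succ_le_of_lt h)]
        exact agree_cutX d (Nat.le_succ k)
      · rw [min_eq_right h, min_eq_right (h.trans (Nat.le_succ k))]
        exact Agree.refl _ _
  have h3 : Tendsto (fun n k => cutX (min k n) d) atTop (𝓝 fun k => cutX k d) :=
    tendsto_pi_nhds.2 fun k => tendsto_const_nhds.congr' <| by
      filter_upwards [eventually_ge_atTop k] with n hn
      rw [min_eq_left hn]
  have h4 := (glueX.continuous.tendsto _).comp h3
  rw [← h1] at h4
  exact h4.congr fun n => (h2 n).symm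

/-- Choose smooth data within 1/(n + 1) of the nth cutoff of d. The error tends to 0 in X₀, hence
locally, and the cutoffs converge to d. -/
theorem exists_seq_isSmoothData_loc (d : X0Loc N) :
    ∃ e : ℕ → X0Loc N, (∀ n, IsSmoothData X0Loc.rep (e n)) ∧ Tendsto e atTop (𝓝 d) := by
  have h (n : ℕ) : ∃ e : X0 N, IsSmoothData X0.rep e ∧ ‖e - cutX n d‖ < 1 / ((n : ℝ) + 1) := by
    obtain ⟨e, he, he'⟩ := (dense_isSmoothData (N := N)).exists_dist_lt (cutX n d)
      (Nat.one_div_pos_of_nat (α := ℝ) (n := n))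
    exact ⟨e, he, by rwa [← dist_eq_norm, dist_comm]⟩
  choose e he he' using h
  refine ⟨fun n => toLoc (e n), fun n => ?_, ?_⟩
  · obtain ⟨f, hf, hfe⟩ := he n
    exact ⟨f, hf, (rep_toLoc _).trans hfe⟩
  · have h1 : Tendsto (fun n => e n - cutX n d) atTop (𝓝 0) :=
      squeeze_zero_norm (fun n => (he' n).le) tendsto_one_div_add_atTop_nhds_zero_nat
    have h2 := ((toLoc (N := N)).continuous.tendsto 0).comp h1
    rw [map_zero] at h2
    have h3 := h2.add (tendsto_toLoc_cutX d)
    rw [zero_add] at h3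
    refine h3.congr fun n => ?_
    exact (toLoc.map_add _ _).symm.trans (congrArg toLoc (sub_add_cancel (e n) (cutX n d)))

end Density

/-! ### Global well-posedness -/

section Main

variable {N : ℕ} {M m : ℝ} {B C : Fin N → Matrix (Fin 2) (Fin 2) ℂ}

theorem globallyWellPosed_x0 (hB : ∀ j, (B j).IsHermitian) (hC : ∀ j, (C j).IsHermitian)
    (hm : m = 0) : GloballyWellPosed M m B C (X0.rep (N := N)) := by
  intro T hT
  have : Fact (0 < T) := ⟨hT⟩
  have hc : Continuous (x0Sol T M C hB 0) := isBastianiC_x0Sol 0 0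
  refine ⟨x0Sol T M C hB 0, isSolution_x0Sol hC hm, fun d u hu => eq_x0Sol hC hm hu,
    hc, fun k => isBastianiC_x0Sol k 0,
    fun K d hd => curveHasRegularity_x0Sol hC hd, fun d hd => isSmoothCurve_x0Sol hC hd,
    fun d => ?_⟩
  obtain ⟨e, he, ht⟩ := exists_seq_isSmoothData d
  exact ⟨e, fun n => isSmoothCurve_x0Sol hC (he n), (hc.tendsto d).comp ht⟩

theorem globallyWellPosed_x0Loc (hB : ∀ j, (B j).IsHermitian) (hC : ∀ j, (C j).IsHermitian) :
    GloballyWellPosed M m B C (X0Loc.rep (N := N)) := by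
  intro T hT
  have : Fact (0 < T) := ⟨hT⟩
  have hc : Continuous (locSol T m M C hB) := isBastianiC_locSol 0
  refine ⟨locSol T m M C hB, isSolution_locSol hC, fun d u hu => eq_locSol hC hu,
    hc, isBastianiC_locSol,
    fun K d hd => curveHasRegularity_locSol hC hd, fun d hd => isSmoothCurve_locSol hC hd,
    fun d => ?_⟩
  obtain ⟨e, he, ht⟩ := exists_seq_isSmoothData_loc d
  exact ⟨e, fun n => isSmoothCurve_locSol hC (he n), (hc.tendsto d).comp ht⟩

end Main

end MDKG

end

theorem theorem3 (N : ℕ) (M m : ℝ) (B C : Fin N → Matrix (Fin 2) (Fin 2) ℂ)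
    (hB : ∀ j, (B j).IsHermitian) (hC : ∀ j, (C j).IsHermitian) :
    (m = 0 → MDKG.GloballyWellPosed M m B C (MDKG.X0.rep (N := N))) ∧
      MDKG.GloballyWellPosed M m B C (MDKG.X0Loc.rep (N := N)) :=
  ⟨fun hm => MDKG.globallyWellPosed_x0 hB hC hm, MDKG.globallyWellPosed_x0Loc hB hC⟩
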